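/- Let $n\in\{2,3\}$, let $\Omega\subset\mathbb R^n$ be a bounded domain (nonempty, open, connected) whose closure is a finite union of $n$-simplices, let $k\ge 0$ be an integer and let $\gamma>0$. There is a constant $C>0$, depending only on $n,\Omega,k,\gamma$, such that the following holds for every $\kappa>0$ and every geometrically conforming decomposition $\mathcal T_h$ of $\overline\Omega$ into finitely many nondegenerate closed $n$-simplices which is shape regular with constant $\gamma$ (every $K\in\mathcal T_h$ contains a ball of radius $r_K>0$ with $h_K:=\operatorname{diam}K\le\gamma r_K$). In particular $C$ is independent of $\kappa$ and of the mesh size $h=\max_K h_K$. Let $\mathcal E_h^i$ be the set of interior faces (edges if $n=2$), i.e. the $(n-1)$-dimensional faces $e=K^+\cap K^-$ shared by two elements, with $h_e=\operatorname{diam}e$ and with unit normals $\mathbf n^\pm$ exterior to $K^\pm$. Let $\Sigma_h$ be the space of symmetric $n\times n$ tensor fields $\tau$ that are polynomials of total degree at most $k+1$ on each $K$ and satisfy $\int_\Omega\operatorname{tr}\tau\,dx=0$, and let $V_h$ be the space of $\mathbb R^n$-valued fields that are polynomials of total degree at most $k$ on each $K$; no continuity between elements is required. Write $\tau^d=\tau-\frac1n\operatorname{tr}(\tau)I$,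 let $\mathrm{div}_h$ be the elementwise row-wise divergence, $(\cdot,\cdot)$ and $\|\cdot\|_0$ the $L^2$ inner product and norm (integrals over $\Omega$ being sums of integrals over the elements), and on $e\in\mathcal E_h^i$ put $$[\tau]=\tfrac12(\tau^+\mathbf n^++\tau^-\mathbf n^-),\qquad \{v\}=\tfrac12(v^++v^-).$$ Define $$a_h(\sigma,\tau)=\tfrac12(\sigma^d,\tau^d)+\sum_{e\in\mathcal E_h^i}\frac1{h_e}\int_e[\sigma]\cdot[\tau]\,ds,\qquad b_h(\tau,v)=(\mathrm{div}_h\tau,v)-\sum_{e\in\mathcal E_h^i}\int_e[\tau]\cdot\{v\}\,ds,$$ $$A_h((\sigma,u),(\tau,v))=a_h(\sigma,\tau)+b_h(\tau,u)-b_h(\sigma,v)+\kappa^{-1}(u,v),$$ and, with $\tilde\kappa=\min\{\kappa,1\}$, $$\|\tau\|_{\Sigma_h}^2=\|\tau^d\|_0^2+\tilde\kappa\|\mathrm{div}_h\tau\|_0^2+\sum_{e\in\mathcal E_h^i}h_e^{-1}\|[\tau]\|_{L^2(e)}^2,\qquad \|v\|_V^2=\tilde\kappa^{-1}\|v\|_0^2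 .$$ Then $$\inf_{0\ne(\sigma,u)\in\Sigma_h\times V_h}\ \sup_{0\ne(\tau,v)\in\Sigma_h\times V_h}\frac{A_h((\sigma,u),(\tau,v))}{(\|\sigma\|_{\Sigma_h}+\|u\|_V)(\|\tau\|_{\Sigma_h}+\|v\|_V)}\ \ge\ C .$$ -/

import Mathlib

open MeasureTheory
open scoped Matrix BigOperators

noncomputable section

namespace MDG

/-- Euclidean space `ℝⁿ`. -/
abbrev E (n : ℕ) : Type := EuclideanSpace ℝ (Fin n)

/-! ### Simplicial decompositions -/

/-- A geometrically conforming decomposition of the closure of `Ω` into finitely many closed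
nondegenerate `n`-simplices. A simplex is given by its set of `n + 1` vertices; the closed
simplex is the convex hull of this set. -/
structure Triangulation {n : ℕ} (Ω : Set (E n)) where
  /-- the vertex sets of the elements -/
  cells : Finset (Finset (E n))
  card_cell : ∀ K ∈ cells, K.card = n + 1
  indep : ∀ K ∈ cells, AffineIndependent ℝ ((↑) : K → E n)
  /-- two elements meet in the convex hull of their common vertices, i.e. in a common
  (possibly empty) face -/
  conforming : ∀ K ∈ cells, ∀ L ∈ cells,
    convexHull ℝ (K : Set (E n)) ∩ convexHull ℝ (L : Set (E n)) =
      convexHull ℝ ((K : Set (E n)) ∩ (L : Set (E n)))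
  cover : ⋃ K ∈ cells, convexHull ℝ (K : Set (E n)) = closure Ω

/-- The closed simplex (element or face) with vertex set `s`. -/
abbrev hull {n : ℕ} (s : Finset (E n)) : Set (E n) := convexHull ℝ (s : Set (E n))

/-- The diameter of the simplex with vertex set `s` (`h_K` for an element, `h_e` for a face). -/
def diam {n : ℕ} (s : Finset (E n)) : ℝ := Metric.diam (hull s)

namespace Triangulation

variable {n : ℕ} {Ω : Set (E n)}

/-- Shape regularity with constant `γ`: every element `K` contains a ball of radius `r > 0`
with `h_K ≤ γ r`. -/
def ShapeRegular (T : Triangulation Ω) (γ : ℝ) : Prop :=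
  ∀ K ∈ T.cells, ∃ (c : E n) (r : ℝ), 0 < r ∧ Metric.ball c r ⊆ hull K ∧ diam K ≤ γ * r

open Classical in
/-- The elements having `e` among their faces. -/
def adjacent (T : Triangulation Ω) (e : Finset (E n)) : Finset T.cells :=
  Finset.univ.filter fun K => e ⊆ K.1

open Classical in
/-- The interior faces ("edges"): the `(n - 1)`-dimensional faces shared by two elements
`K⁺` and `K⁻`. -/
def interiorFaces (T : Triangulation Ω) : Finset (Finset (E n)) :=
  (T.cells.biUnion fun K => K.powersetCard n).filter fun e => (T.adjacent e).card = 2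

end Triangulation

/-- The unit normal on the face with vertex set `e`, pointing to the exterior of the simplex with
vertex set `K ⊇ e`: the normalized component, orthogonal to the face, of the vector from the
barycenter of `K` to the barycenter of `e`. -/
def outwardNormal {n : ℕ} (K e : Finset (E n)) : E n :=
  let w : E n := (vectorSpan ℝ (e : Set (E n)))ᗮ.starProjection
    (e.centroid ℝ id - K.centroid ℝ id)
  ‖w‖⁻¹ • w

/-! ### Pointwise algebra of matrices -/

/-- The deviator `M^d = M - (1/n) tr(M) I`. -/
def dev {n : ℕ} (M : Matrix (Fin n) (Fin n) ℝ) : Matrix (Fin n) (Fin n) ℝ :=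
  M - ((1 / (n : ℝ)) * M.trace) • (1 : Matrix (Fin n) (Fin n) ℝ)

/-- The product `M : N = ∑ i j, M i j * N i j`. -/
def ddot {n : ℕ} (M N : Matrix (Fin n) (Fin n) ℝ) : ℝ := ∑ i, ∑ j, M i j * N i j

/-! ### Piecewise polynomial fields

A piecewise polynomial field is given by one polynomial (tuple) per element; its one-sided
trace on a face of `K` is given by the polynomial on `K`. -/

/-- Polynomials in `n` real variables. -/
abbrev Poly (n : ℕ) : Type := MvPolynomial (Fin n) ℝ

/-- The value of a polynomial vector field at a point. -/
def evalV {n : ℕ} (v : Fin n → Poly n) (x : E n) : Fin n → ℝ :=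
  fun i => MvPolynomial.eval x.ofLp (v i)

/-- The value of a polynomial tensor field at a point. -/
def evalM {n : ℕ} (τ : Matrix (Fin n) (Fin n) (Poly n)) (x : E n) : Matrix (Fin n) (Fin n) ℝ :=
  τ.map (MvPolynomial.eval x.ofLp)

/-- The row-wise divergence of a polynomial tensor field. -/
def divM {n : ℕ} (τ : Matrix (Fin n) (Fin n) (Poly n)) : Fin n → Poly n :=
  fun i => ∑ j, MvPolynomial.pderiv j (τ i j)

section Spaces

variable {n : ℕ} {Ω : Set (E n)} (T : Triangulation Ω)

/-- Piecewise polynomial vector fields, of arbitrary degree. -/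
abbrev BrokenVec : Type := T.cells → Fin n → Poly n

/-- Piecewise polynomial tensor fields, of arbitrary degree. -/
abbrev BrokenTensor : Type := T.cells → Matrix (Fin n) (Fin n) (Poly n)

/-- The broken divergence. -/
def divh (τ : BrokenTensor T) : BrokenVec T := fun K => divM (τ K)

/-- The integral over the domain of the trace of a piecewise polynomial tensor field. -/
def integralTrace (τ : BrokenTensor T) : ℝ :=
  ∑ K : T.cells, ∫ x in hull K.1, (evalM (τ K) x).trace

lemma integrableOn_trace (τ : BrokenTensor T) (K : T.cells) :
    IntegrableOn (fun x => (evalM (τ K) x).trace) (hull K.1) := by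
  refine ContinuousOn.integrableOn_compact (K.1.finite_toSet.isCompact_convexHull ℝ) ?_
  apply Continuous.continuousOn
  simp only [Matrix.trace, Matrix.diag, evalM, Matrix.map_apply]
  refine continuous_finsetSum _ fun i _ => ?_
  exact (MvPolynomial.continuous_eval _).comp (PiLp.continuous_ofLp 2 _)

/-- The space `V_h` of piecewise `P_k` vector fields. -/
def Vh (k : ℕ) : Submodule ℝ (BrokenVec T) where
  carrier := {v | ∀ K i, v K i ∈ MvPolynomial.restrictTotalDegree (Fin n) ℝ k}
  add_mem' hv hw K i := Submodule.add_mem _ (hv K i) (hw K i)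
  zero_mem' _ _ := Submodule.zero_mem _
  smul_mem' c _ hv K i := Submodule.smul_mem _ c (hv K i)

/-- The space `Σ_h` of piecewise `P_{k+1}` symmetric tensor fields whose trace has mean value
zero over the domain. -/
def Sigmah (k : ℕ) : Submodule ℝ (BrokenTensor T) where
  carrier := {τ | (∀ K, (τ K).IsSymm) ∧
    (∀ K i j, τ K i j ∈ MvPolynomial.restrictTotalDegree (Fin n) ℝ (k + 1)) ∧
    integralTrace T τ = 0}
  add_mem' := by
    rintro σ τ ⟨hσ1, hσ2, hσ3⟩ ⟨hτ1, hτ2, hτ3⟩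
    refine ⟨fun K => (hσ1 K).add (hτ1 K),
      fun K i j => Submodule.add_mem _ (hσ2 K i j) (hτ2 K i j), ?_⟩
    have h : integralTrace T (σ + τ) = integralTrace T σ + integralTrace T τ := by
      unfold integralTrace
      rw [← Finset.sum_add_distrib]
      refine Finset.sum_congr rfl fun K _ => ?_
      rw [← integral_add (integrableOn_trace T σ K) (integrableOn_trace T τ K)]
      simp [evalM, Matrix.trace, Finset.sum_add_distrib]
    rw [h, hσ3, hτ3, add_zero]
  zero_mem' := by
    refine ⟨fun K => Matrix.isSymm_zero, fun K i j => Submodule.zero_mem _, ?_⟩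
    simp [integralTrace, evalM, Matrix.trace]
  smul_mem' := by
    rintro c τ ⟨hτ1, hτ2, hτ3⟩
    refine ⟨fun K => (hτ1 K).smul c, fun K i j => Submodule.smul_mem _ c (hτ2 K i j), ?_⟩
    have h : integralTrace T (c • τ) = c * integralTrace T τ := by
      unfold integralTrace
      rw [Finset.mul_sum]
      refine Finset.sum_congr rfl fun K _ => ?_
      rw [← integral_const_mul]
      simp [evalM, Matrix.trace, Finset.mul_sum, MvPolynomial.smul_eval]
    rw [h, hτ3, mul_zero]

/-! ### Jumps and averages on interior faces -/

/-- The jump `[τ] = (1/2) (τ⁺ n⁺ + τ⁻ n⁻)` on an interior face `e`. -/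
def jump (τ : BrokenTensor T) (e : Finset (E n)) (x : E n) : Fin n → ℝ :=
  (1 / 2 : ℝ) • ∑ K ∈ T.adjacent e, evalM (τ K) x *ᵥ (outwardNormal K.1 e).ofLp

/-- The average `{v} = (1/2) (v⁺ + v⁻)` on an interior face `e`. -/
def average (v : BrokenVec T) (e : Finset (E n)) (x : E n) : Fin n → ℝ :=
  (1 / 2 : ℝ) • ∑ K ∈ T.adjacent e, evalV (v K) x

/-! ### Inner products and integrals -/

/-- The `L²` inner product of piecewise polynomial vector fields. -/
def innerV (u v : BrokenVec T) : ℝ :=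
  ∑ K : T.cells, ∫ x in hull K.1, evalV (u K) x ⬝ᵥ evalV (v K) x

/-- The `L²` inner product `(σ^d, τ^d)` of the deviators. -/
def innerDev (σ τ : BrokenTensor T) : ℝ :=
  ∑ K : T.cells, ∫ x in hull K.1, ddot (dev (evalM (σ K) x)) (dev (evalM (τ K) x))

/-- `∑_e h_e⁻¹ ∫_e [σ] · [τ] ds` over the interior faces `e`, where `ds` is the
`(n - 1)`-dimensional surface measure. -/
def jumpForm (σ τ : BrokenTensor T) : ℝ :=
  ∑ e ∈ T.interiorFaces, (diam e)⁻¹ * ∫ x in hull e, jump T σ e x ⬝ᵥ jump T τ e x ∂μHE[n - 1]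

/-- `∑_e ∫_e [τ] · {v} ds` over the interior faces `e`. -/
def couplingForm (τ : BrokenTensor T) (v : BrokenVec T) : ℝ :=
  ∑ e ∈ T.interiorFaces, ∫ x in hull e, jump T τ e x ⬝ᵥ average T v e x ∂μHE[n - 1]

/-! ### The bilinear forms of the method -/

/-- `a_h(σ, τ)`. -/
def ah (σ τ : BrokenTensor T) : ℝ := (1 / 2) * innerDev T σ τ + jumpForm T σ τ

/-- `b_h(τ, v)`. -/
def bh (τ : BrokenTensor T) (v : BrokenVec T) : ℝ := innerV T (divh T τ) v - couplingForm T τ v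

/-- `s(u, v) = (κ⁻¹ u, v)`. -/
def sForm (κ : ℝ) (u v : BrokenVec T) : ℝ := κ⁻¹ * innerV T u v

/-- `A_h((σ, u), (τ, v)) = a_h(σ, τ) + b_h(τ, u) - b_h(σ, v) + s(u, v)` on `Σ_h × V_h`. -/
def Ah (κ : ℝ) (k : ℕ) (x y : Sigmah T k × Vh T k) : ℝ :=
  ah T x.1 y.1 + bh T y.1 x.2 - bh T x.1 y.2 + sForm T κ x.2 y.2

/-! ### The parameter-dependent norms -/

/-- `κ̃ = min {κ, 1}`. -/
def kappaTilde (κ : ℝ) : ℝ := min κ 1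

/-- `‖τ‖²_{Σ_h} = ‖τ^d‖₀² + κ̃ ‖div_h τ‖₀² + |τ|_*²`. -/
def normSigma (κ : ℝ) (τ : BrokenTensor T) : ℝ :=
  Real.sqrt (innerDev T τ τ + kappaTilde κ * innerV T (divh T τ) (divh T τ) + jumpForm T τ τ)

/-- `‖v‖²_V = κ̃⁻¹ ‖v‖₀²`. -/
def normV (κ : ℝ) (v : BrokenVec T) : ℝ := Real.sqrt ((kappaTilde κ)⁻¹ * innerV T v v)

/-- The product norm `‖τ‖_{Σ_h} + ‖v‖_V` on `Σ_h × V_h`. -/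
def normProd (κ : ℝ) (k : ℕ) (y : Sigmah T k × Vh T k) : ℝ := normSigma T κ y.1 + normV T κ y.2

end Spaces

/-- The inf-sup constant `inf_{x ≠ 0} sup_{y ≠ 0} B(x, y) / (N(x) N(y))`, in `[-∞, ∞]`. -/
def infSup {X : Type*} [Zero X] (B : X → X → ℝ) (N : X → ℝ) : EReal :=
  ⨅ x : {x : X // x ≠ 0}, ⨆ y : {y : X // y ≠ 0}, ((B x.1 y.1 / (N x.1 * N y.1) : ℝ) : EReal)

end MDG

end

noncomputable section

namespace MDG

/-! ### Simplices as affine images of the corner simplex -/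

/-! The trial pair (σ, u) is tested with the perturbed pair (σ + t τ, u − s κ̃ div_h σ). Testing
with (σ, u) itself gives a_h(σ, σ) + κ⁻¹‖u‖², which misses κ̃‖div_h σ‖² and, when κ is large, ‖u‖².
The perturbation of u supplies the divergence: it adds s κ̃ b_h(σ, div_h σ), whose face terms are
absorbed by the jump seminorm through an inverse trace inequality (`exists_coupling_bound`). The
perturbation of σ supplies ‖u‖², provided that b_h(τ, u) ≥ ¼‖u‖² while the deviator, the divergence
and the jumps of τ are bounded by a constant times ‖u‖ (`exists_stable_tensor`). Since κ̃⁻¹ =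
max{κ⁻¹, 1}, the sum κ⁻¹‖u‖² + ‖u‖² controls ‖u‖²_V uniformly in κ. The weights t and s depend only
on the constants of these two theorems; the bookkeeping is in `coercivity_of_form_bounds` and
`boundedness_of_form_bounds`. The norm sees only the deviator of σ, so no estimate of tr σ is
needed, only definiteness (`eq_zero_of_Sigmah`).

The field τ comes from a smooth one. Extend u by zero to a cube containing all elements, solve Δφ_i
= u_i there and put τ = ∇φ + (∇φ)ᵀ − (div φ) I. This is symmetric and its divergence is Δφ, because
the other two contributions cancel. No boundary condition is imposed, so Fourier series are enough;
shifting the frequencies by half a unit removes the zero mode, and truncation makes τ smooth, with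
its H¹ norm bounded by ‖u‖ and div τ − u small in L² (`exists_symmetric_divergence`).

The smooth field is then interpolated on each simplex (`exists_tensorInterp`). A symmetric matrix is
a combination of the squares z zᵀ of the edge vectors z = w − v, with coefficients built from
gradients of barycentric coordinates. The vector w − v is tangent to all faces except those opposite
v and w, so normal traces and divergence reduce to one scalar problem per edge: find a polynomial of
degree k + 1 with prescribed moments against degree k on those two faces, and prescribed moments of
its derivative along the edge. Integration by parts along the edge turns the latter into interior
moments against derivatives of test polynomials, which have degree k − 1. The linear system is
solvable because every test polynomial times suitable barycentric coordinates is itself an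
admissible solution polynomial (`refForm_compatible`).

Exact face moments make the coupling term of b_h vanish; exact divergence moments give (div_h τ_h,
u) = (div τ, u) for the interpolant τ_h; and since τ has no jumps, the jumps of τ_h are
interpolation errors, of the order needed for the weight h_e⁻¹. All local constants come from the
corner simplex and from shape regularity. Subtracting a multiple of the identity finally makes the
mean trace zero without changing anything else. -/

/-- The corner simplex `{x | 0 ≤ x, ∑ x ≤ 1}` in `ℝᵈ`. -/
def corner (d : ℕ) : Set (Fin d → ℝ) := {x | (∀ i, 0 ≤ x i) ∧ ∑ i, x i ≤ 1}

/-- The linear part of the affine map sending the corner simplex to the simplex with vertices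
`b 0, …, b d`. -/
def edgeLin {n d : ℕ} (b : Fin (d + 1) → E n) : (Fin d → ℝ) →ₗ[ℝ] E n :=
  Fintype.linearCombination ℝ fun i => b i.succ - b 0

/-- The affine map sending the corner simplex to the simplex with vertices `b 0, …, b d`. -/
def simplexMap {n d : ℕ} (b : Fin (d + 1) → E n) (x : Fin d → ℝ) : E n := b 0 + edgeLin b x

lemma edgeLin_apply {n d : ℕ} (b : Fin (d + 1) → E n) (x : Fin d → ℝ) :
    edgeLin b x = ∑ i, x i • (b i.succ - b 0) := rfl

lemma corner_convex (d : ℕ) : Convex ℝ (corner d) := by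
  rintro x ⟨hx, hx'⟩ y ⟨hy, hy'⟩ a c ha hc hac
  refine ⟨fun i => ?_, ?_⟩
  · have := hx i; have := hy i
    simp only [Pi.add_apply, Pi.smul_apply, smul_eq_mul]; positivity
  · simp only [Pi.add_apply, Pi.smul_apply, smul_eq_mul, Finset.sum_add_distrib, ← Finset.mul_sum]
    nlinarith

lemma corner_isClosed (d : ℕ) : IsClosed (corner d) := by
  have : corner d = (⋂ i, {x : Fin d → ℝ | 0 ≤ x i}) ∩ {x | ∑ i, x i ≤ 1} := by
    ext x; simp [corner]
  rw [this]
  refine (isClosed_iInter fun i => isClosed_le continuous_const (continuous_apply i)).inter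
    (isClosed_le (by fun_prop) continuous_const)

lemma corner_subset_Icc (d : ℕ) : corner d ⊆ Set.Icc 0 1 := by
  rintro x ⟨hx, hx'⟩
  refine ⟨fun i => hx i, fun i => ?_⟩
  exact (Finset.single_le_sum (fun j _ => hx j) (Finset.mem_univ i)).trans hx'

lemma corner_isCompact (d : ℕ) : IsCompact (corner d) :=
  isCompact_Icc.of_isClosed_subset (corner_isClosed d) (corner_subset_Icc d)

lemma corner_measurableSet (d : ℕ) : MeasurableSet (corner d) := (corner_isClosed d).measurableSet

/-- The interior of the corner simplex. -/
lemma isOpen_openCorner (d : ℕ) : IsOpen {x : Fin d → ℝ | (∀ i, 0 < x i) ∧ ∑ i, x i < 1} := by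
  have : {x : Fin d → ℝ | (∀ i, 0 < x i) ∧ ∑ i, x i < 1} =
      (⋂ i, {x : Fin d → ℝ | 0 < x i}) ∩ {x | ∑ i, x i < 1} := by
    ext x; simp
  rw [this]
  exact (isOpen_iInter_of_finite fun i => isOpen_lt continuous_const (continuous_apply i)).inter
    (isOpen_lt (by fun_prop) continuous_const)

lemma openCorner_nonempty (d : ℕ) :
    ({x : Fin d → ℝ | (∀ i, 0 < x i) ∧ ∑ i, x i < 1}).Nonempty := by
  refine ⟨fun _ => 1 / ((d : ℝ) + 1), fun i => by positivity, ?_⟩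
  simp only [Finset.sum_const, Finset.card_univ, Fintype.card_fin, nsmul_eq_mul]
  rw [mul_one_div, div_lt_one (by positivity)]
  linarith

lemma openCorner_subset_interior (d : ℕ) :
    {x : Fin d → ℝ | (∀ i, 0 < x i) ∧ ∑ i, x i < 1} ⊆ interior (corner d) :=
  interior_maximal (fun _ hx => ⟨fun i => (hx.1 i).le, hx.2.le⟩) (isOpen_openCorner d)

lemma interior_corner_nonempty (d : ℕ) : (interior (corner d)).Nonempty :=
  (openCorner_nonempty d).mono (openCorner_subset_interior d)

lemma corner_volume_pos (d : ℕ) : 0 < volume (corner d) :=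
  Measure.measure_pos_of_nonempty_interior _ (interior_corner_nonempty d)

lemma corner_volume_lt_top (d : ℕ) : volume (corner d) < ⊤ := (corner_isCompact d).measure_lt_top

lemma corner_volume_toReal_pos (d : ℕ) : 0 < (volume (corner d)).toReal :=
  ENNReal.toReal_pos (corner_volume_pos d).ne' (corner_volume_lt_top d).ne

/-! ### Surface and volume measure of a simplex in corner coordinates -/

section Image

variable {n d : ℕ} {b : Fin (d + 1) → E n}

lemma simplexMap_combination (b : Fin (d + 1) → E n) (x : Fin d → ℝ) :
    simplexMap b x = (1 - ∑ i, x i) • b 0 + ∑ i, x i • b i.succ := by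
  simp only [simplexMap, edgeLin_apply, smul_sub, Finset.sum_sub_distrib, sub_smul, one_smul,
    ← Finset.sum_smul]
  abel

lemma simplexMap_image_corner (b : Fin (d + 1) → E n) :
    simplexMap b '' corner d = convexHull ℝ (Set.range b) := by
  apply Set.Subset.antisymm
  · rintro _ ⟨x, ⟨hx, hx'⟩, rfl⟩
    rw [simplexMap_combination]
    have h := (convex_convexHull ℝ (Set.range b)).sum_mem (t := Finset.univ)
      (w := Fin.cons (1 - ∑ i, x i) x) (z := b) ?_ ?_
      (fun i _ => subset_convexHull ℝ _ ⟨i, rfl⟩)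
    · simpa [Fin.sum_univ_succ] using h
    · intro i _
      refine Fin.cases ?_ (fun j => ?_) i
      · simpa using hx'
      · simpa using hx j
    · simp [Fin.sum_univ_succ]
  · refine convexHull_min ?_ ?_
    · rintro _ ⟨i, rfl⟩
      refine Fin.cases ?_ (fun j => ?_) i
      · refine ⟨0, ⟨by simp, by simp⟩, by simp [simplexMap]⟩
      · refine ⟨Pi.single j 1, ⟨fun i => ?_, by simp⟩, ?_⟩
        · by_cases h : i = j
          · subst h; simp
          · simp [h]
        · simp [simplexMap, edgeLin_apply, Pi.single_apply]
    · have : simplexMap b '' corner d = (fun y => b 0 + y) '' (edgeLin b '' corner d) := by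
        rw [Set.image_image]; rfl
      rw [this]
      exact ((corner_convex d).linear_image (edgeLin b)).translate _

lemma edgeLin_injective (hb : AffineIndependent ℝ b) : Function.Injective (edgeLin b) := by
  rw [affineIndependent_iff_linearIndependent_vsub ℝ b 0] at hb
  have h2 : LinearIndependent ℝ fun i : Fin d => b i.succ - b 0 := by
    have := hb.comp (fun i : Fin d => (⟨i.succ, Fin.succ_ne_zero i⟩ : {x : Fin (d+1) // x ≠ 0}))
      (fun i j h => by simpa using h)
    simpa [Function.comp_def, vsub_eq_sub] using this
  exact linearIndependent_iff_injective_fintypeLinearCombination.1 h2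

lemma continuous_edgeLin (b : Fin (d + 1) → E n) : Continuous (edgeLin b) :=
  (edgeLin b).continuous_of_finiteDimensional

lemma continuous_simplexMap (b : Fin (d + 1) → E n) : Continuous (simplexMap b) :=
  continuous_const.add (continuous_edgeLin b)

lemma simplexMap_injective (hb : AffineIndependent ℝ b) : Function.Injective (simplexMap b) :=
  fun _ _ h => edgeLin_injective hb (add_left_cancel h)

lemma isClosedEmbedding_simplexMap (hb : AffineIndependent ℝ b) :
    Topology.IsClosedEmbedding (simplexMap b) := by
  have h1 := LinearMap.isClosedEmbedding_of_injective (f := edgeLin b)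
    (LinearMap.ker_eq_bot.2 (edgeLin_injective hb))
  exact (Homeomorph.addLeft (b 0)).isClosedEmbedding.comp h1

lemma measurableEmbedding_simplexMap (hb : AffineIndependent ℝ b) :
    MeasurableEmbedding (simplexMap b) := (isClosedEmbedding_simplexMap hb).measurableEmbedding

lemma simplexMap_sub (b : Fin (d + 1) → E n) (x y : Fin d → ℝ) :
    simplexMap b x - simplexMap b y = edgeLin b (x - y) := by
  simp [simplexMap]

/-- The parameter space carries the sup norm, so each of the `d` edge vectors contributes at most
its own length. -/
lemma lipschitzWith_simplexMap {h : NNReal} (hh : ∀ i : Fin d, ‖b i.succ - b 0‖ ≤ h) :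
    LipschitzWith (d * h) (simplexMap b) := by
  refine LipschitzWith.of_dist_le_mul fun x y => ?_
  rw [dist_eq_norm, dist_eq_norm, simplexMap_sub, edgeLin_apply]
  refine (norm_sum_le _ _).trans ?_
  calc ∑ i, ‖(x - y) i • (b i.succ - b 0)‖ ≤ ∑ _i : Fin d, ‖x - y‖ * h := by
        refine Finset.sum_le_sum fun i _ => ?_
        rw [norm_smul]
        exact mul_le_mul (norm_le_pi_norm _ i) (hh i) (norm_nonneg _) (norm_nonneg _)
    _ = _ := by simp; ring

lemma antilipschitz_simplexMap (hb : AffineIndependent ℝ b) :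
    ∃ K : NNReal, AntilipschitzWith K (simplexMap b) := by
  obtain ⟨K, _, hK⟩ := (edgeLin b).exists_antilipschitzWith
    (LinearMap.ker_eq_bot.2 (edgeLin_injective hb))
  refine ⟨K, fun x y => ?_⟩
  have := hK x y
  simpa [simplexMap] using this

/-- The normalizing constant of the Euclidean Hausdorff measure. -/
lemma exists_euclideanHausdorff_eq_smul (d : ℕ) : ∃ c : NNReal, c ≠ 0 ∧
    ∀ {X : Type} [EMetricSpace X] [MeasurableSpace X] [BorelSpace X],
      (μHE[d] : Measure X) = c • μH[d] := by
  refine ⟨Measure.addHaarScalarFactor (volume : Measure (EuclideanSpace ℝ (Fin d))) μH[d], ?_, ?_⟩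
  · exact (Measure.addHaarScalarFactor_volume_hausdorffMeasure_ne_zero (d := d))
  · intro X _ _ _
    exact Measure.euclideanHausdorffMeasure_def d

lemma hausdorffMeasure_fin_real (d : ℕ) : (μH[d] : Measure (Fin d → ℝ)) = volume := by
  simpa using hausdorffMeasure_pi_real (ι := Fin d)

/-- The pullback of the surface measure along `simplexMap` is translation invariant and finite on
compact sets, hence a multiple of Lebesgue measure; no Jacobian has to be computed. The Lipschitz
bound caps the multiple in terms of the edge lengths, and the reverse Lipschitz bound makes it
positive. -/
lemma exists_scale_le (d : ℕ) : ∃ C : ℝ, 0 < C ∧ ∀ {n : ℕ} {b : Fin (d + 1) → E n},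
    AffineIndependent ℝ b → ∃ c : ℝ, 0 < c ∧
      (μHE[d].restrict (Set.range (simplexMap b)) : Measure (E n)) =
        (ENNReal.ofReal c) • (volume.map (simplexMap b)) ∧
      ∀ h : NNReal, (∀ i : Fin d, ‖b i.succ - b 0‖ ≤ h) → c ≤ C * h ^ d := by
  obtain ⟨c₀, hc₀, hdef⟩ := exists_euclideanHausdorff_eq_smul d
  refine ⟨c₀ * d ^ d, ?_, fun {n b} hb => ?_⟩
  · have : (0 : ℝ) < c₀ := by exact_mod_cast pos_iff_ne_zero.2 hc₀
    rcases Nat.eq_zero_or_pos d with rfl | hd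
    · simpa using this
    · positivity
  set Ψ := simplexMap b with hΨ
  have hme : MeasurableEmbedding Ψ := measurableEmbedding_simplexMap hb
  set ν : Measure (Fin d → ℝ) := Measure.comap Ψ μHE[d] with hν
  have hνA : ∀ A, ν A = c₀ * μH[d] (Ψ '' A) := fun A => by
    rw [hν, hme.comap_apply, hdef]; rfl
  have hup : ∀ h : NNReal, (∀ i : Fin d, ‖b i.succ - b 0‖ ≤ h) → ∀ A,
      ν A ≤ c₀ * ((d * h : NNReal) ^ d * volume A) := by
    intro h hh A
    rw [hνA]
    gcongr
    have := (lipschitzWith_simplexMap hh).hausdorffMeasure_image_le (d := (d : ℝ))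
      (Nat.cast_nonneg d) A
    simpa [hausdorffMeasure_fin_real] using this
  obtain ⟨h₀, hh₀⟩ : ∃ h : NNReal, ∀ i : Fin d, ‖b i.succ - b 0‖ ≤ h := by
    refine ⟨∑ i : Fin d, ‖b i.succ - b 0‖₊, fun i => ?_⟩
    have : ‖b i.succ - b 0‖₊ ≤ ∑ i : Fin d, ‖b i.succ - b 0‖₊ :=
      Finset.single_le_sum (f := fun i : Fin d => ‖b i.succ - b 0‖₊) (fun _ _ => zero_le)
        (Finset.mem_univ i)
    exact_mod_cast this
  have : IsFiniteMeasureOnCompacts ν := by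
    refine ⟨fun K hK => (hup h₀ hh₀ K).trans_lt ?_⟩
    exact ENNReal.mul_lt_top ENNReal.coe_lt_top
      (ENNReal.mul_lt_top (ENNReal.pow_lt_top ENNReal.coe_lt_top) hK.measure_lt_top)
  have : ν.IsAddLeftInvariant := by
    refine ⟨fun x => ?_⟩
    ext A hA
    rw [Measure.map_apply (measurable_const_add x) hA, hνA, hνA]
    congr 1
    -- Translating the parameter translates the image by a fixed vector of the ambient space, which
    -- is an isometry and preserves Hausdorff measure.
    have : Ψ '' A = (IsometryEquiv.addLeft (edgeLin b x)) '' (Ψ '' ((x + ·) ⁻¹' A)) := by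
      ext z
      constructor
      · rintro ⟨y, hy, rfl⟩
        refine ⟨Ψ (y - x), ⟨y - x, by simpa using hy, rfl⟩, ?_⟩
        simp [hΨ, simplexMap, map_sub]; abel
      · rintro ⟨_, ⟨y, hy, rfl⟩, rfl⟩
        refine ⟨x + y, hy, ?_⟩
        simp [hΨ, simplexMap, map_add]; abel
    rw [this, IsometryEquiv.hausdorffMeasure_image]
  have hsm := Measure.isAddLeftInvariant_eq_smul ν volume
  set c := Measure.addHaarScalarFactor ν volume with hc
  have hIcc : volume (Set.Icc (0 : Fin d → ℝ) 1) = 1 := by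
    rw [Real.volume_Icc_pi]; simp
  have hcIcc : ν (Set.Icc 0 1) = c := by
    rw [hsm, Measure.smul_apply, hIcc]; simp [ENNReal.smul_def]
  refine ⟨c, ?_, ?_, ?_⟩
  · rcases eq_or_ne c 0 with h0 | h0
    · exfalso
      obtain ⟨K, hK⟩ := antilipschitz_simplexMap hb
      have := hK.le_hausdorffMeasure_image (d := (d : ℝ)) (Nat.cast_nonneg d) (Set.Icc 0 1)
      rw [hausdorffMeasure_fin_real, hIcc] at this
      rw [h0, hνA] at hcIcc
      simp only [ENNReal.coe_zero, mul_eq_zero, ENNReal.coe_eq_zero, hc₀, false_or] at hcIcc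
      rw [← hΨ, hcIcc] at this
      simp at this
    · exact_mod_cast pos_iff_ne_zero.2 h0
  · rw [← hme.map_comap, ← hν, hsm, ENNReal.ofReal_coe_nnreal]
    rw [Measure.map_smul]
    rfl
  · intro h hh
    have := hup h hh (Set.Icc 0 1)
    rw [hcIcc, hIcc, mul_one] at this
    have h2 : c ≤ c₀ * (d * h) ^ d := by exact_mod_cast this
    have h3 : (c : ℝ) ≤ c₀ * (d * h) ^ d := by exact_mod_cast h2
    rw [mul_pow] at h3
    linarith

/-- The ratio of the `d`-dimensional measures of a `d`-simplex and of the corner simplex. -/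
def scale {n : ℕ} (s : Finset (E n)) : ℝ :=
  (μHE[s.card - 1] (hull s)).toReal / (volume (corner (s.card - 1))).toReal

lemma card_of_range (hb : AffineIndependent ℝ b) {s : Finset (E n)} (hs : Set.range b = s) :
    s.card = d + 1 := by
  have : (s : Set (E n)).ncard = d + 1 := by
    rw [← hs, Set.ncard_range_of_injective hb.injective]; simp
  simpa using this

/-- The multiple found in `exists_scale_le` is identified as `scale s` by evaluating both measures
on the whole simplex. Afterwards every integral over an element or a face is `scale` times an
integral over a corner simplex. -/
lemma restrict_hull (hb : AffineIndependent ℝ b) {s : Finset (E n)} (hs : Set.range b = s) :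
    (μHE[d].restrict (hull s) : Measure (E n)) =
      ENNReal.ofReal (scale s) • (volume.restrict (corner d)).map (simplexMap b) := by
  obtain ⟨C, _, hC⟩ := exists_scale_le d
  obtain ⟨c, hc, hres, _⟩ := hC hb
  have hme := measurableEmbedding_simplexMap hb
  have himg : hull s = simplexMap b '' corner d := by rw [simplexMap_image_corner, hs]
  have hms : MeasurableSet (hull s) := by
    rw [himg]; exact hme.measurableSet_image.2 (corner_measurableSet d)
  have key : (μHE[d].restrict (hull s) : Measure (E n)) =
      ENNReal.ofReal c • (volume.restrict (corner d)).map (simplexMap b) := by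
    have h1 : (μHE[d].restrict (hull s) : Measure (E n)) =
        (μHE[d].restrict (Set.range (simplexMap b))).restrict (hull s) := by
      rw [Measure.restrict_restrict hms, Set.inter_eq_left.2]
      rw [himg]; exact Set.image_subset_range _ _
    rw [h1, hres, Measure.restrict_smul, hme.restrict_map, himg,
      Set.preimage_image_eq _ hme.injective]
  have hcs : scale s = c := by
    have h2 := congrArg (fun μ => μ (hull s)) key
    simp only [Measure.restrict_apply_self, Measure.smul_apply, smul_eq_mul] at h2
    rw [hme.map_apply, himg, Set.preimage_image_eq _ hme.injective, Measure.restrict_apply_self,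
      ← himg] at h2
    have hcard := card_of_range hb hs
    rw [scale, hcard, Nat.add_sub_cancel, h2, ENNReal.toReal_mul, ENNReal.toReal_ofReal hc.le]
    field_simp [(corner_volume_toReal_pos d).ne']
  rw [hcs, key]

lemma scale_pos (hb : AffineIndependent ℝ b) {s : Finset (E n)} (hs : Set.range b = s) :
    0 < scale s := by
  obtain ⟨C, _, hC⟩ := exists_scale_le d
  obtain ⟨c, hc, hres, _⟩ := hC hb
  have hme := measurableEmbedding_simplexMap hb
  have himg : hull s = simplexMap b '' corner d := by rw [simplexMap_image_corner, hs]
  have h2 := congrArg (fun μ => μ (hull s)) hres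
  rw [Measure.restrict_eq_self _ (by rw [himg]; exact Set.image_subset_range _ _),
    Measure.smul_apply, smul_eq_mul, hme.map_apply, himg,
    Set.preimage_image_eq _ hme.injective, ← himg] at h2
  have hcard := card_of_range hb hs
  rw [scale, hcard, Nat.add_sub_cancel, h2, ENNReal.toReal_mul, ENNReal.toReal_ofReal hc.le]
  have := corner_volume_toReal_pos d
  positivity

lemma exists_scale_le_pow (d : ℕ) : ∃ C : ℝ, 0 < C ∧ ∀ {n : ℕ} {b : Fin (d + 1) → E n}
    {s : Finset (E n)}, AffineIndependent ℝ b → Set.range b = s → ∀ h : ℝ,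
      (∀ i : Fin d, ‖b i.succ - b 0‖ ≤ h) → 0 ≤ h → scale s ≤ C * h ^ d := by
  obtain ⟨C, hC0, hC⟩ := exists_scale_le d
  refine ⟨C, hC0, fun {n b s} hb hs h hh hnn => ?_⟩
  obtain ⟨c, hc, hres, hle⟩ := hC hb
  have hme := measurableEmbedding_simplexMap hb
  have himg : hull s = simplexMap b '' corner d := by rw [simplexMap_image_corner, hs]
  have h2 := congrArg (fun μ => μ (hull s)) hres
  rw [Measure.restrict_eq_self _ (by rw [himg]; exact Set.image_subset_range _ _),
    Measure.smul_apply, smul_eq_mul, hme.map_apply, himg,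
    Set.preimage_image_eq _ hme.injective, ← himg] at h2
  have hcard := card_of_range hb hs
  have hv := corner_volume_toReal_pos d
  have : scale s = c := by
    rw [scale, hcard, Nat.add_sub_cancel, h2, ENNReal.toReal_mul, ENNReal.toReal_ofReal hc.le]
    field_simp
  rw [this]
  exact hle ⟨h, hnn⟩ hh

lemma integral_hull (hb : AffineIndependent ℝ b) {s : Finset (E n)} (hs : Set.range b = s)
    (f : E n → ℝ) : ∫ x in hull s, f x ∂μHE[d] =
      scale s * ∫ y in corner d, f (simplexMap b y) := by
  rw [restrict_hull hb hs, integral_smul_measure, (measurableEmbedding_simplexMap hb).integral_map,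
    ENNReal.toReal_ofReal (scale_pos hb hs).le, smul_eq_mul]

lemma integrableOn_hull (hb : AffineIndependent ℝ b) {s : Finset (E n)} (hs : Set.range b = s)
    {f : E n → ℝ} (hf : Continuous f) : IntegrableOn f (hull s) μHE[d] := by
  rw [IntegrableOn, restrict_hull hb hs]
  refine Integrable.smul_measure ?_ ENNReal.ofReal_ne_top
  rw [(measurableEmbedding_simplexMap hb).integrable_map_iff]
  exact (hf.comp (continuous_simplexMap b)).continuousOn.integrableOn_compact (corner_isCompact d)

/-- The vertices of a simplex can be listed with two given ones at the beginning. -/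
lemma exists_vertexList {n d : ℕ} {K : Finset (E n)} (hK : K.card = d + 2)
    (hind : AffineIndependent ℝ ((↑) : K → E n)) {v w : E n} (hv : v ∈ K) (hw : w ∈ K)
    (hvw : v ≠ w) : ∃ b : Fin (d + 2) → E n, AffineIndependent ℝ b ∧ Set.range b = K ∧
      b 0 = v ∧ b 1 = w := by
  classical
  have hcard : Fintype.card K = d + 2 := by simpa using hK
  let e₀ : Fin (d + 2) ≃ K := (Fintype.equivFinOfCardEq hcard).symm
  let e₁ := (Equiv.swap 0 (e₀.symm ⟨v, hv⟩)).trans e₀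
  have h1 : e₁ 0 = ⟨v, hv⟩ := by simp [e₁]
  let e := (Equiv.swap 1 (e₁.symm ⟨w, hw⟩)).trans e₁
  have hne : e₁.symm ⟨w, hw⟩ ≠ 0 := by
    intro h
    have := congrArg e₁ h
    rw [Equiv.apply_symm_apply, h1] at this
    exact hvw (Subtype.ext_iff.1 this).symm
  have h2 : e 0 = ⟨v, hv⟩ := by
    simp only [e, Equiv.trans_apply]
    rw [Equiv.swap_apply_of_ne_of_ne (by simp) hne.symm, h1]
  have h3 : e 1 = ⟨w, hw⟩ := by simp [e]
  refine ⟨fun i => (e i : E n), hind.comp_embedding e.toEmbedding, ?_, by simp [h2], by simp [h3]⟩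
  ext x
  constructor
  · rintro ⟨i, rfl⟩; exact (e i).2
  · intro hx; exact ⟨e.symm ⟨x, hx⟩, by simp⟩

/-- The vertices of a simplex can be listed. -/
lemma exists_vertexList' {n d : ℕ} {K : Finset (E n)} (hK : K.card = d + 1)
    (hind : AffineIndependent ℝ ((↑) : K → E n)) :
    ∃ b : Fin (d + 1) → E n, AffineIndependent ℝ b ∧ Set.range b = K := by
  have hcard : Fintype.card K = d + 1 := by simpa using hK
  let e : Fin (d + 1) ≃ K := (Fintype.equivFinOfCardEq hcard).symm
  refine ⟨fun i => (e i : E n), hind.comp_embedding e.toEmbedding, ?_⟩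
  ext x
  constructor
  · rintro ⟨i, rfl⟩; exact (e i).2
  · intro hx; exact ⟨e.symm ⟨x, hx⟩, by simp⟩

end Image

/-! ### Integration by parts along an edge of a simplex -/

section Corner

variable {m : ℕ}

lemma cons_mem_corner {s : ℝ} {y : Fin m → ℝ} :
    (Fin.cons s y : Fin (m + 1) → ℝ) ∈ corner (m + 1) ↔
      y ∈ corner m ∧ s ∈ Set.Icc 0 (1 - ∑ i, y i) := by
  simp only [corner, Set.mem_ofPred_eq, Fin.forall_fin_succ, Fin.cons_zero, Fin.cons_succ,
    Fin.sum_univ_succ, Set.mem_Icc]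
  constructor
  · rintro ⟨⟨h0, h1⟩, h2⟩
    exact ⟨⟨h1, by linarith⟩, h0, by linarith⟩
  · rintro ⟨⟨h1, h2⟩, h3, h4⟩
    exact ⟨⟨h3, h1⟩, by linarith⟩

lemma setIntegral_corner_succ {G : (Fin (m + 1) → ℝ) → ℝ} (hG : Continuous G) :
    ∫ x in corner (m + 1), G x =
      ∫ y in corner m, ∫ s in (0 : ℝ)..(1 - ∑ i, y i), G (Fin.cons s y) := by
  have hmp := (volume_preserving_piFinSuccAbove (fun _ : Fin (m + 1) => ℝ) 0).symm
  set e := (MeasurableEquiv.piFinSuccAbove (fun _ : Fin (m + 1) => ℝ) 0).symm with he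
  have hes : ∀ p : ℝ × (Fin m → ℝ), e p = Fin.cons p.1 p.2 := fun p => by
    rw [he]; simp [MeasurableEquiv.piFinSuccAbove]; rfl
  have hint : Integrable ((corner (m + 1)).indicator G) :=
    (integrable_indicator_iff (corner_measurableSet _)).2
      (hG.continuousOn.integrableOn_compact (corner_isCompact _))
  rw [← integral_indicator (corner_measurableSet _), ← hmp.integral_comp e.measurableEmbedding]
  have hint2 := (hmp.integrable_comp_emb e.measurableEmbedding).2 hint
  rw [Measure.volume_eq_prod] at hint2 ⊢
  simp only [Function.comp_def] at hint2
  rw [integral_prod_symm _ hint2, ← integral_indicator (corner_measurableSet _)]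
  refine integral_congr_ae (Filter.Eventually.of_forall fun y => ?_)
  simp only [hes]
  by_cases hy : y ∈ corner m
  · rw [Set.indicator_of_mem hy, intervalIntegral.integral_of_le (by linarith [hy.2]),
      ← integral_Icc_eq_integral_Ioc, ← integral_indicator measurableSet_Icc]
    refine integral_congr_ae (Filter.Eventually.of_forall fun s => ?_)
    by_cases hs : s ∈ Set.Icc 0 (1 - ∑ i, y i)
    · simp only [Set.indicator_of_mem hs, Set.indicator_of_mem (cons_mem_corner.2 ⟨hy, hs⟩)]
    · rw [Set.indicator_of_notMem hs]
      refine Set.indicator_of_notMem ?_ _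
      exact fun h => hs (cons_mem_corner.1 h).2
  · rw [Set.indicator_of_notMem hy]
    rw [← integral_zero ℝ ℝ]
    refine integral_congr_ae (Filter.Eventually.of_forall fun s => ?_)
    refine Set.indicator_of_notMem ?_ _
    exact fun h => hy (cons_mem_corner.1 h).1

lemma continuous_cons_right (s : (Fin m → ℝ) → ℝ) (hs : Continuous s) :
    Continuous fun y : Fin m → ℝ => (Fin.cons (s y) y : Fin (m + 1) → ℝ) := by
  refine continuous_pi fun i => ?_
  refine Fin.cases ?_ (fun j => ?_) i
  · simpa using hs
  · simpa using continuous_apply j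

/-- The fundamental theorem of calculus on lines parallel to the first axis: they enter the corner
simplex through `x 0 = 0` and leave it through `∑ x = 1`, and both faces are parametrized by the
remaining coordinates. -/
lemma integral_corner_fderiv {g : (Fin (m + 1) → ℝ) → ℝ} (hg : ContDiff ℝ 1 g) :
    ∫ x in corner (m + 1), fderiv ℝ g x (Pi.single 0 1) =
      (∫ y in corner m, g (Fin.cons (1 - ∑ i, y i) y)) - ∫ y in corner m, g (Fin.cons 0 y) := by
  have hc : Continuous fun x => fderiv ℝ g x (Pi.single 0 1) :=
    (hg.continuous_fderiv one_ne_zero).clm_apply continuous_const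
  rw [setIntegral_corner_succ hc, ← integral_sub]
  · refine integral_congr_ae (Filter.Eventually.of_forall fun y => ?_)
    simp only
    have hder : ∀ s : ℝ, HasDerivAt (fun s => g (Fin.cons s y))
        (fderiv ℝ g (Fin.cons s y) (Pi.single 0 1)) s := by
      intro s
      have h1 : HasDerivAt (fun s : ℝ => (Fin.cons s y : Fin (m + 1) → ℝ)) (Pi.single 0 1) s := by
        rw [hasDerivAt_pi]
        intro i
        refine Fin.cases ?_ (fun j => ?_) i
        · simpa using hasDerivAt_id' s
        · simpa using hasDerivAt_const s (y j)
      exact (hg.differentiable one_ne_zero _).hasFDerivAt.comp_hasDerivAt s h1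
    refine intervalIntegral.integral_eq_sub_of_hasDerivAt (fun s _ => hder s) ?_
    refine Continuous.intervalIntegrable (hc.comp ?_) _ _
    refine continuous_pi fun i => ?_
    refine Fin.cases ?_ (fun j => ?_) i
    · simpa using continuous_id'
    · simpa using continuous_const
  · exact (hg.continuous.comp (continuous_cons_right _ (by fun_prop))).continuousOn.integrableOn_compact
      (corner_isCompact _)
  · exact (hg.continuous.comp (continuous_cons_right _ (by fun_prop))).continuousOn.integrableOn_compact
      (corner_isCompact _)

end Corner

/-! ### The two faces opposite to the ends of an edge -/

section Faces

variable {m n : ℕ} {K : Finset (E n)} {v w : E n} {b : Fin (m + 2) → E n}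

lemma simplexMap_succ (b : Fin (m + 2) → E n) (y : Fin m → ℝ) :
    simplexMap (b ∘ Fin.succ) y = simplexMap b (Fin.cons (1 - ∑ i, y i) y) := by
  simp only [simplexMap_combination, Fin.sum_univ_succ, Fin.cons_zero, Fin.cons_succ,
    Function.comp]
  simp

lemma simplexMap_succAbove_one (b : Fin (m + 2) → E n) (y : Fin m → ℝ) :
    simplexMap (b ∘ Fin.succAbove 1) y = simplexMap b (Fin.cons 0 y) := by
  simp only [simplexMap_combination, Fin.sum_univ_succ, Fin.cons_zero, Fin.cons_succ,
    Function.comp]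
  have : ∀ j : Fin m, (1 : Fin (m + 2)).succAbove j.succ = j.succ.succ := fun j => by
    rw [Fin.succAbove_of_le_castSucc]
    simp [Fin.le_def]
  simp [this]

lemma range_succ_eq_erase (hb : AffineIndependent ℝ b) (hs : Set.range b = K) (h0 : b 0 = v)
    [DecidableEq (E n)] : Set.range (b ∘ Fin.succ) = (K.erase v : Finset (E n)) := by
  rw [Finset.coe_erase, ← hs, ← h0]
  ext x
  simp only [Set.mem_range, Function.comp, Set.mem_sdiff, Set.mem_singleton_iff]
  constructor
  · rintro ⟨i, rfl⟩
    exact ⟨⟨_, rfl⟩, fun h => Fin.succ_ne_zero i (hb.injective h)⟩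
  · rintro ⟨⟨i, rfl⟩, h⟩
    obtain ⟨j, rfl⟩ := Fin.exists_succ_eq.2 (fun h' : i = 0 => h (by rw [h']))
    exact ⟨j, rfl⟩

lemma range_succAbove_eq_erase (hb : AffineIndependent ℝ b) (hs : Set.range b = K) (h1 : b 1 = w)
    [DecidableEq (E n)] : Set.range (b ∘ Fin.succAbove 1) = (K.erase w : Finset (E n)) := by
  rw [Finset.coe_erase, ← hs, ← h1]
  ext x
  simp only [Set.mem_range, Function.comp, Set.mem_sdiff, Set.mem_singleton_iff]
  constructor
  · rintro ⟨i, rfl⟩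
    exact ⟨⟨_, rfl⟩, fun h => Fin.succAbove_ne 1 i (hb.injective h)⟩
  · rintro ⟨⟨i, rfl⟩, h⟩
    obtain ⟨j, hj⟩ := Fin.exists_succAbove_eq (x := i) (y := 1) (fun h' : i = 1 => h (by rw [h']))
    exact ⟨j, by rw [hj]⟩

lemma affineIndependent_succ (hb : AffineIndependent ℝ b) :
    AffineIndependent ℝ (b ∘ Fin.succ) := hb.comp_embedding (Fin.succEmb _)

lemma affineIndependent_succAbove (hb : AffineIndependent ℝ b) :
    AffineIndependent ℝ (b ∘ Fin.succAbove 1) := hb.comp_embedding (Fin.succAboveEmb 1)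

lemma hasFDerivAt_simplexMap {d : ℕ} (b : Fin (d + 1) → E n) (x : Fin d → ℝ) :
    HasFDerivAt (simplexMap b) (LinearMap.toContinuousLinearMap (edgeLin b)) x :=
  (LinearMap.toContinuousLinearMap (edgeLin b)).hasFDerivAt.const_add (b 0)

lemma contDiff_simplexMap {d : ℕ} (b : Fin (d + 1) → E n) {k : WithTop ℕ∞} :
    ContDiff ℝ k (simplexMap b) :=
  contDiff_const.add (LinearMap.toContinuousLinearMap (edgeLin b)).contDiff

lemma edgeLin_single (b : Fin (m + 2) → E n) : edgeLin b (Pi.single 0 1) = b 1 - b 0 := by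
  simp [edgeLin_apply, Pi.single_apply]

lemma fderiv_comp_simplexMap {f : E n → ℝ} (hf : ContDiff ℝ 1 f) (b : Fin (m + 2) → E n)
    (x : Fin (m + 1) → ℝ) :
    fderiv ℝ (f ∘ simplexMap b) x (Pi.single 0 1) = fderiv ℝ f (simplexMap b x) (b 1 - b 0) := by
  rw [((hf.differentiable one_ne_zero _).hasFDerivAt.comp x (hasFDerivAt_simplexMap b x)).fderiv]
  simp [edgeLin_single]

/-- Listing `v` first and `w` second turns the edge from `v` to `w` into the first coordinate
direction. The face opposite `v` is then the slanted face of the corner simplex, and the face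
opposite `w` is `x 0 = 0`. -/
lemma exists_faceLists [DecidableEq (E n)] (hK : K.card = m + 2)
    (hind : AffineIndependent ℝ ((↑) : K → E n)) (hv : v ∈ K) (hw : w ∈ K) (hvw : v ≠ w) :
    ∃ b : Fin (m + 2) → E n, AffineIndependent ℝ b ∧ Set.range b = K ∧ b 0 = v ∧ b 1 = w ∧
      (∀ f : E n → ℝ, ∫ x in hull K, f x ∂μHE[m + 1] =
        scale K * ∫ y in corner (m + 1), f (simplexMap b y)) ∧
      (∀ f : E n → ℝ, ∫ x in hull (K.erase v), f x ∂μHE[m] =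
        scale (K.erase v) * ∫ y in corner m, f (simplexMap b (Fin.cons (1 - ∑ i, y i) y))) ∧
      (∀ f : E n → ℝ, ∫ x in hull (K.erase w), f x ∂μHE[m] =
        scale (K.erase w) * ∫ y in corner m, f (simplexMap b (Fin.cons 0 y))) ∧
      0 < scale K ∧ 0 < scale (K.erase v) ∧ 0 < scale (K.erase w) := by
  obtain ⟨b, hb, hs, h0, h1⟩ := exists_vertexList hK hind hv hw hvw
  have hb0 := affineIndependent_succ hb
  have hb1 := affineIndependent_succAbove hb
  have hs0 := range_succ_eq_erase hb hs h0
  have hs1 := range_succAbove_eq_erase hb hs h1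
  refine ⟨b, hb, hs, h0, h1, fun f => integral_hull hb hs f, fun f => ?_, fun f => ?_,
    scale_pos hb hs, scale_pos hb0 hs0, scale_pos hb1 hs1⟩
  · rw [integral_hull hb0 hs0 f]
    simp only [simplexMap_succ]
  · rw [integral_hull hb1 hs1 f]
    simp only [simplexMap_succAbove_one]

lemma measure_top (n : ℕ) : (μHE[n] : Measure (E n)) = volume :=
  EuclideanSpace.euclideanHausdorffMeasure_eq_volume n

/-- Integration by parts along the edge from `v` to `w` of a simplex. -/
theorem integral_edge_deriv [DecidableEq (E (m + 1))] {K : Finset (E (m + 1))} {v w : E (m + 1)}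
    (hK : K.card = m + 2) (hind : AffineIndependent ℝ ((↑) : K → E (m + 1))) (hv : v ∈ K)
    (hw : w ∈ K) (hvw : v ≠ w) {f : E (m + 1) → ℝ} (hf : ContDiff ℝ 1 f) :
    (scale K)⁻¹ * ∫ x in hull K, fderiv ℝ f x (w - v) =
      (scale (K.erase v))⁻¹ * (∫ x in hull (K.erase v), f x ∂μHE[m]) -
      (scale (K.erase w))⁻¹ * ∫ x in hull (K.erase w), f x ∂μHE[m] := by
  obtain ⟨b, hb, hs, h0, h1, hiK, hiv, hiw, hsK, hsv, hsw⟩ := exists_faceLists hK hind hv hw hvw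
  rw [measure_top] at hiK
  rw [hiK, hiv, hiw, inv_mul_cancel_left₀ hsK.ne', inv_mul_cancel_left₀ hsv.ne',
    inv_mul_cancel_left₀ hsw.ne']
  have := integral_corner_fderiv (hf.comp (contDiff_simplexMap b (k := 1)))
  simp only [fderiv_comp_simplexMap hf, h0, h1] at this
  exact this

end Faces

/-! ### The Poincaré inequality on convex sets -/

section Poincare

variable {n : ℕ} {S : Set (E n)}

/-- The homothety with centre `y` and ratio `1 - s` maps the convex set into itself, with Jacobian
`(1 - s) ^ n`. Restricting to `s ≤ 1 / 2` keeps the Jacobian above `2⁻ⁿ`. -/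
lemma setIntegral_homothety_le (hS : Convex ℝ S) (hSm : MeasurableSet S) {G : E n → ℝ}
    (hG : IntegrableOn G S) (hG0 : ∀ x, 0 ≤ G x) {y : E n} (hy : y ∈ S) {s : ℝ} (hs0 : 0 ≤ s)
    (hs : s ≤ 1 / 2) :
    ∫ x in S, G ((1 - s) • x + s • y) ≤ 2 ^ n * ∫ x in S, G x := by
  have hpos : (0 : ℝ) < 1 - s := by linarith
  have hGi : Integrable (S.indicator G) := (integrable_indicator_iff hSm).2 hG
  have hGi0 : ∀ x, 0 ≤ S.indicator G x := fun x => Set.indicator_nonneg (fun x _ => hG0 x) x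
  have h1 : ∫ x in S, G ((1 - s) • x + s • y) =
      ∫ x in S, S.indicator G ((1 - s) • x + s • y) := by
    refine setIntegral_congr_fun hSm fun x hx => ?_
    have : (1 - s) • x + s • y ∈ S := hS hx hy hpos.le hs0 (by ring)
    simp only [Set.indicator_of_mem this]
  have h2 : Integrable fun x => S.indicator G ((1 - s) • x + s • y) :=
    (hGi.comp_add_right (s • y)).comp_smul hpos.ne'
  rw [h1]
  refine (setIntegral_le_integral h2 (Filter.Eventually.of_forall fun x => hGi0 _)).trans ?_
  rw [Measure.integral_comp_smul volume (fun z => S.indicator G (z + s • y)) (1 - s),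
    integral_add_right_eq_self (S.indicator G) (s • y), integral_indicator hSm, smul_eq_mul,
    finrank_euclideanSpace, Fintype.card_fin]
  refine mul_le_mul_of_nonneg_right ?_ (setIntegral_nonneg hSm fun x _ => hG0 x)
  rw [abs_inv, abs_of_pos (pow_pos hpos n), ← inv_pow]
  refine pow_le_pow_left₀ (inv_nonneg.2 hpos.le) ?_ n
  rw [inv_le_comm₀ hpos two_pos]
  linarith

/-- Expand the integral of the squared deviation from the mean `m`, which is nonnegative. -/
lemma sq_intervalIntegral_le {f : ℝ → ℝ} (hf : Continuous f) {a : ℝ} (ha : 0 ≤ a) :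
    (∫ s in (0 : ℝ)..a, f s) ^ 2 ≤ a * ∫ s in (0 : ℝ)..a, f s ^ 2 := by
  rcases ha.eq_or_lt with rfl | ha
  · simp
  set m := (∫ s in (0 : ℝ)..a, f s) / a with hm
  have h0 : 0 ≤ ∫ s in (0 : ℝ)..a, (f s - m) ^ 2 :=
    intervalIntegral.integral_nonneg ha.le fun s _ => sq_nonneg _
  have h1 : ∫ s in (0 : ℝ)..a, (f s - m) ^ 2 =
      (∫ s in (0 : ℝ)..a, f s ^ 2) - 2 * m * (∫ s in (0 : ℝ)..a, f s) + a * m ^ 2 := by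
    have : ∀ s, (f s - m) ^ 2 = f s ^ 2 - 2 * m * f s + m ^ 2 := fun s => by ring
    simp only [this]
    rw [intervalIntegral.integral_add, intervalIntegral.integral_sub,
      intervalIntegral.integral_const_mul]
    · simp
    all_goals exact Continuous.intervalIntegrable (by fun_prop) _ _
  have h2 : (∫ s in (0 : ℝ)..a, f s) = m * a := by rw [hm]; field_simp
  rw [h1, h2] at h0
  rw [h2]
  nlinarith

/-- The segment is cut at its midpoint and each half is parametrized from its own endpoint with `s ≤
1 / 2`. Each half is then in reach of `setIntegral_homothety_le`, with the other endpoint as centre.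
-/
lemma sq_sub_le_segment {g : E n → ℝ} (hg : ContDiff ℝ 1 g) {h : ℝ} {x y : E n}
    (hxy : ‖y - x‖ ≤ h) :
    (g x - g y) ^ 2 ≤ h ^ 2 * ((∫ s in (0 : ℝ)..(1 / 2), ‖fderiv ℝ g ((1 - s) • x + s • y)‖ ^ 2) +
      ∫ s in (0 : ℝ)..(1 / 2), ‖fderiv ℝ g ((1 - s) • y + s • x)‖ ^ 2) := by
  have hcf : Continuous (fderiv ℝ g) := hg.continuous_fderiv one_ne_zero
  have half : ∀ x y : E n, ‖y - x‖ ≤ h → (g ((1 / 2 : ℝ) • x + (1 / 2 : ℝ) • y) - g x) ^ 2 ≤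
      h ^ 2 / 2 * ∫ s in (0 : ℝ)..(1 / 2), ‖fderiv ℝ g ((1 - s) • x + s • y)‖ ^ 2 := by
    intro x y hxy
    have hder : ∀ s : ℝ, HasDerivAt (fun s : ℝ => g ((1 - s) • x + s • y))
        (fderiv ℝ g ((1 - s) • x + s • y) (y - x)) s := by
      intro s
      have h1 : HasDerivAt (fun s : ℝ => (1 - s) • x + s • y) (y - x) s := by
        have := (((hasDerivAt_id' s).const_sub 1).smul_const x).add
          ((hasDerivAt_id' s).smul_const y)
        refine this.congr_deriv ?_
        simp; abel
      exact (hg.differentiable one_ne_zero _).hasFDerivAt.comp_hasDerivAt s h1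
    have hcl : Continuous fun s : ℝ => fderiv ℝ g ((1 - s) • x + s • y) :=
      hcf.comp (by fun_prop)
    have hc1 : Continuous fun s : ℝ => fderiv ℝ g ((1 - s) • x + s • y) (y - x) :=
      hcl.clm_apply continuous_const
    have hftc := intervalIntegral.integral_eq_sub_of_hasDerivAt (a := 0) (b := 1 / 2)
      (fun s _ => hder s) (hc1.intervalIntegrable _ _)
    have e1 : (1 - (1 / 2 : ℝ)) = 1 / 2 := by norm_num
    simp only [e1, sub_zero, one_smul, zero_smul, add_zero] at hftc
    rw [← hftc]
    refine (sq_intervalIntegral_le hc1 (by norm_num : (0 : ℝ) ≤ 1 / 2)).trans ?_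
    suffices hmain : ∫ s in (0 : ℝ)..(1 / 2), (fderiv ℝ g ((1 - s) • x + s • y) (y - x)) ^ 2 ≤
        h ^ 2 * ∫ s in (0 : ℝ)..(1 / 2), ‖fderiv ℝ g ((1 - s) • x + s • y)‖ ^ 2 by
      linarith
    rw [← intervalIntegral.integral_const_mul]
    refine intervalIntegral.integral_mono_on (by norm_num)
      (Continuous.intervalIntegrable (by fun_prop) _ _)
      (Continuous.intervalIntegrable (by fun_prop) _ _) fun s _ => ?_
    rw [← mul_pow, ← sq_abs]
    refine pow_le_pow_left₀ (abs_nonneg _) ?_ 2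
    have := (fderiv ℝ g ((1 - s) • x + s • y)).le_opNorm (y - x)
    rw [Real.norm_eq_abs] at this
    refine this.trans ?_
    rw [mul_comm]
    exact mul_le_mul_of_nonneg_right hxy (norm_nonneg _)
  have h1 := half x y hxy
  have h2 := half y x (by rwa [norm_sub_rev])
  rw [add_comm ((1 / 2 : ℝ) • y)] at h2
  nlinarith [sq_nonneg ((g ((1 / 2 : ℝ) • x + (1 / 2 : ℝ) • y) - g x) +
    (g ((1 / 2 : ℝ) • x + (1 / 2 : ℝ) • y) - g y))]

/-- The Poincaré inequality on a compact convex set. -/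
theorem exists_poincare (hS : Convex ℝ S) (hSc : IsCompact S) (hSv : volume S ≠ 0) {h : ℝ}
    (hh : ∀ x ∈ S, ∀ y ∈ S, ‖y - x‖ ≤ h) {g : E n → ℝ} (hg : ContDiff ℝ 1 g) :
    ∃ c : ℝ, ∫ x in S, (g x - c) ^ 2 ≤ 2 ^ n * h ^ 2 * ∫ x in S, ‖fderiv ℝ g x‖ ^ 2 := by
  have hSm : MeasurableSet S := hSc.measurableSet
  have hSt : volume S ≠ ⊤ := hSc.measure_lt_top.ne
  have hcf : Continuous (fderiv ℝ g) := hg.continuous_fderiv one_ne_zero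
  have hgc : Continuous g := hg.continuous
  set G : E n → ℝ := fun x => ‖fderiv ℝ g x‖ ^ 2 with hGdef
  have hGc : Continuous G := by fun_prop
  have hG0 : ∀ x, 0 ≤ G x := fun x => by positivity
  have hGS : IntegrableOn G S := hGc.continuousOn.integrableOn_compact hSc
  have hIc : ∀ {f : E n → ℝ}, Continuous f → IntegrableOn f S := fun hf =>
    hf.continuousOn.integrableOn_compact hSc
  set I := ∫ x in S, G x
  have hI0 : 0 ≤ I := setIntegral_nonneg hSm fun x _ => hG0 x
  -- `H x y` collects the squared gradient along the half of the segment that is next to `x`. The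
  -- half next to `y` is `H y x`, and both have the same double integral.
  obtain ⟨H, hH⟩ : ∃ H : E n → E n → ℝ, ∀ x y, H x y =
    ∫ s in (0 : ℝ)..(1 / 2), G ((1 - s) • x + s • y) := ⟨_, fun _ _ => rfl⟩
  have hHc : Continuous fun p : E n × E n => H p.1 p.2 := by
    simp only [hH]
    refine intervalIntegral.continuous_parametric_intervalIntegral_of_continuous' ?_ 0 (1 / 2)
    exact hGc.comp (by fun_prop)
  have hprod : ∀ {f : E n × E n → ℝ}, Continuous f →
      Integrable f ((volume.restrict S).prod (volume.restrict S)) := by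
    intro f hf
    rw [Measure.prod_restrict]
    exact hf.continuousOn.integrableOn_compact (hSc.prod hSc)
  have hmarg : ∀ {f : E n → E n → ℝ}, (Continuous fun p : E n × E n => f p.1 p.2) →
      IntegrableOn (fun y => ∫ x in S, f y x) S := fun {f} hf =>
    Integrable.integral_prod_left (f := fun p : E n × E n => f p.1 p.2) (hprod hf)
  have hHc' : Continuous fun p : E n × E n => H p.2 p.1 := hHc.comp continuous_swap
  have hHy : ∀ y ∈ S, ∫ x in S, H x y ≤ 1 / 2 * (2 ^ n * I) := by
    intro y hy
    simp only [hH, intervalIntegral.integral_of_le (show (0 : ℝ) ≤ 1 / 2 by norm_num)]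
    rw [integral_integral_swap]
    · have hle : ∀ s ∈ Set.Ioc (0 : ℝ) (1 / 2), ∫ x in S, G ((1 - s) • x + s • y) ≤ 2 ^ n * I :=
        fun s hs => setIntegral_homothety_le hS hSm hGS hG0 hy hs.1.le hs.2
      have := setIntegral_mono_on (μ := volume) (s := Set.Ioc (0 : ℝ) (1 / 2))
        (f := fun s => ∫ x in S, G ((1 - s) • x + s • y)) (g := fun _ => 2 ^ n * I) ?_ ?_
        measurableSet_Ioc hle
      · simpa using this
      · refine Continuous.integrableOn_Ioc ?_
        refine continuous_parametric_integral_of_continuous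
          (f := fun s x => G ((1 - s) • x + s • y)) ?_ hSc
        exact hGc.comp (by fun_prop : Continuous fun p : ℝ × E n => (1 - p.1) • p.2 + p.1 • y)
      · exact continuous_const.integrableOn_Ioc
    · rw [Measure.prod_restrict]
      refine IntegrableOn.mono_set (t := S ×ˢ Set.Icc (0 : ℝ) (1 / 2)) ?_
        (Set.prod_mono le_rfl Set.Ioc_subset_Icc_self)
      refine ContinuousOn.integrableOn_compact (hSc.prod isCompact_Icc) (Continuous.continuousOn ?_)
      exact hGc.comp (by fun_prop : Continuous fun p : E n × ℝ => (1 - p.2) • p.1 + p.2 • y)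
  have hHH : ∫ y in S, ∫ x in S, H x y ≤ (volume S).toReal * (1 / 2 * (2 ^ n * I)) := by
    have := setIntegral_mono_on (μ := volume) (s := S) (f := fun y => ∫ x in S, H x y)
      (g := fun _ => 1 / 2 * (2 ^ n * I)) ?_ (hIc continuous_const) hSm hHy
    · simpa [Measure.real] using this
    · exact hmarg (f := fun y x => H x y) hHc'
  have hFy : ∀ y ∈ S, ∫ x in S, (g x - g y) ^ 2 ≤
      h ^ 2 * ((∫ x in S, H x y) + ∫ x in S, H y x) := by
    intro y hy
    have hx1 : Continuous fun x => H x y :=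
      hHc.comp (by fun_prop : Continuous fun x : E n => (x, y))
    have hx2 : Continuous fun x => H y x :=
      hHc.comp (by fun_prop : Continuous fun x : E n => (y, x))
    rw [← integral_add (hIc hx1) (hIc hx2), ← integral_const_mul]
    refine setIntegral_mono_on (hIc (by fun_prop)) (hIc ?_) hSm fun x hx => ?_
    · exact continuous_const.mul (hx1.add hx2)
    · rw [hH, hH]
      exact sq_sub_le_segment hg (hh x hx y hy)
  have hint1 : IntegrableOn (fun y => ∫ x in S, H x y) S :=
    hmarg (f := fun y x => H x y) hHc'
  have hint2 : IntegrableOn (fun y => ∫ x in S, H y x) S :=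
    hmarg hHc
  have hswap : ∫ y in S, ∫ x in S, H y x = ∫ y in S, ∫ x in S, H x y :=
    integral_integral_swap (hprod hHc)
  have hintF : IntegrableOn (fun y => ∫ x in S, (g x - g y) ^ 2) S :=
    hmarg (f := fun y x => (g x - g y) ^ 2) (by fun_prop)
  have htot : ∫ y in S, ∫ x in S, (g x - g y) ^ 2 ≤ (volume S).toReal * (2 ^ n * h ^ 2 * I) := by
    refine (setIntegral_mono_on hintF ((hint1.add hint2).const_mul (h ^ 2)) hSm hFy).trans ?_
    simp only [Pi.add_apply]
    rw [integral_const_mul, integral_add hint1 hint2, hswap]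
    nlinarith [sq_nonneg h]
  -- The double integral bounds an average over `y`, so some `y` does at least as well as the
  -- average. The value `g y` plays the role usually given to the mean of `g`.
  obtain ⟨y, -, hy⟩ := exists_le_setAverage hSv hSt hintF
  refine ⟨g y, hy.trans ?_⟩
  rw [setAverage_eq, smul_eq_mul, Measure.real]
  have hp : 0 < (volume S).toReal := ENNReal.toReal_pos hSv hSt
  rw [inv_mul_le_iff₀ hp]
  exact htot

end Poincare

open scoped Classical

/-! ### Barycentric coordinates -/

/-- `K` is the vertex set of a nondegenerate `n`-simplex. -/
structure IsCell {n : ℕ} (K : Finset (E n)) : Prop where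
  card : K.card = n + 1
  indep : AffineIndependent ℝ ((↑) : K → E n)

namespace IsCell

variable {n : ℕ} {K : Finset (E n)} (hK : IsCell K)

/-- The vertices of a nondegenerate simplex as an affine basis. -/
def basis : AffineBasis K ℝ (E n) where
  toFun := (↑)
  ind' := hK.indep
  tot' := by
    rw [hK.indep.affineSpan_eq_top_iff_card_eq_finrank_add_one]
    simp [hK.card]

/-- The barycentric coordinates. -/
def coord (v : K) : E n →ᵃ[ℝ] ℝ := hK.basis.coord v

/-- The gradients of the barycentric coordinates. -/
def grad (v : K) : E n →ₗ[ℝ] ℝ := (hK.coord v).linear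

@[simp] lemma basis_apply (v : K) : hK.basis v = v := rfl

lemma coord_apply (v w : K) : hK.coord v w = if v = w then 1 else 0 := by
  rw [coord, ← hK.basis_apply w, AffineBasis.coord_apply]

lemma sum_coord (x : E n) : ∑ v, hK.coord v x = 1 := hK.basis.sum_coord_apply_eq_one x

lemma sum_coord_smul (x : E n) : ∑ v, hK.coord v x • (v : E n) = x :=
  hK.basis.linear_combination_coord_eq_self x

lemma coord_sub (v : K) (x y : E n) : hK.coord v x - hK.coord v y = hK.grad v (x - y) :=
  ((hK.coord v).linearMap_vsub x y).symm

lemma coord_add (v : K) (x y : E n) : hK.coord v (y + x) = hK.grad v x + hK.coord v y := by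
  rw [← sub_eq_iff_eq_add, coord_sub, add_sub_cancel_left]

lemma grad_sub (u v w : K) : hK.grad u ((w : E n) - v) =
    (if u = w then 1 else 0) - (if u = v then 1 else 0) := by
  rw [← coord_sub, coord_apply, coord_apply]

lemma sum_grad (x : E n) : ∑ v, hK.grad v x = 0 := by
  have : ∀ v, hK.grad v x = hK.coord v x - hK.coord v 0 := fun v => by rw [coord_sub, sub_zero]
  simp only [this, Finset.sum_sub_distrib, sum_coord, sub_self]

lemma sum_grad_smul (x : E n) : ∑ v, hK.grad v x • (v : E n) = x := by
  have : ∀ v, hK.grad v x = hK.coord v x - hK.coord v 0 := fun v => by rw [coord_sub, sub_zero]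
  simp only [this, sub_smul, Finset.sum_sub_distrib, sum_coord_smul, sub_zero]

lemma mem_hull {x : E n} : x ∈ hull K ↔ ∀ v, 0 ≤ hK.coord v x := by
  have h : (K : Set (E n)) = Set.range hK.basis := Subtype.range_coe.symm
  rw [hull, h, AffineBasis.convexHull_eq_nonneg_coord]; rfl

lemma coord_nonneg {x : E n} (hx : x ∈ hull K) (v : K) : 0 ≤ hK.coord v x := hK.mem_hull.1 hx v

lemma coord_le_one {x : E n} (hx : x ∈ hull K) (v : K) : hK.coord v x ≤ 1 := by
  rw [← hK.sum_coord x]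
  exact Finset.single_le_sum (fun u _ => hK.coord_nonneg hx u) (Finset.mem_univ v)

lemma coord_eq_zero {x : E n} {s : Finset (E n)} (hs : s ⊆ K) {v : K} (hv : (v : E n) ∉ s)
    (hx : x ∈ hull s) : hK.coord v x = 0 := by
  have h : hull s ⊆ {x | hK.coord v x = 0} := by
    refine convexHull_min ?_ ?_
    · intro w hw
      have := hK.coord_apply v ⟨w, hs hw⟩
      rw [if_neg] at this
      · exact this
      · rintro rfl; exact hv hw
    · have : {x | hK.coord v x = 0} = hK.coord v ⁻¹' {0} := rfl
      rw [this]
      exact (convex_singleton 0).affine_preimage (hK.coord v)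
  exact h hx

lemma continuous_coord (v : K) : Continuous (hK.coord v) :=
  (hK.coord v).continuous_of_finiteDimensional

lemma hasFDerivAt_coord (v : K) (x : E n) :
    HasFDerivAt (hK.coord v) (LinearMap.toContinuousLinearMap (hK.grad v)) x := by
  have : (hK.coord v : E n → ℝ) = fun x => LinearMap.toContinuousLinearMap (hK.grad v) x +
      hK.coord v 0 := by
    ext x
    have := hK.coord_add v x 0
    simpa using this
  rw [this]
  exact (LinearMap.toContinuousLinearMap (hK.grad v)).hasFDerivAt.add_const _

lemma contDiff_coord (v : K) {k : WithTop ℕ∞} : ContDiff ℝ k (hK.coord v) := by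
  have : (hK.coord v : E n → ℝ) = fun x => LinearMap.toContinuousLinearMap (hK.grad v) x +
      hK.coord v 0 := by
    ext x
    have := hK.coord_add v x 0
    simpa using this
  rw [this]
  exact (LinearMap.toContinuousLinearMap (hK.grad v)).contDiff.add contDiff_const

/-- A barycentric coordinate stays in `[0, 1]` on the inscribed ball, so its increments from the
centre are at most 1. This is how shape regularity enters the interpolation estimate. -/
lemma abs_grad_le {c : E n} {r : ℝ} (hr : 0 < r) (hball : Metric.ball c r ⊆ hull K) (v : K)
    (x : E n) : |hK.grad v x| ≤ r⁻¹ * ‖x‖ := by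
  have key : ∀ y : E n, ‖y‖ < r → |hK.grad v y| ≤ 1 := by
    intro y hy
    have h1 : c + y ∈ hull K := hball (by simpa using hy)
    have h2 : c ∈ hull K := hball (by simpa using hr)
    have h3 := hK.coord_add v y c
    rw [abs_le]
    constructor <;> linarith [hK.coord_nonneg h1 v, hK.coord_le_one h1 v, hK.coord_nonneg h2 v,
      hK.coord_le_one h2 v]
  rcases eq_or_ne x 0 with rfl | hx
  · simp
  have hx' : 0 < ‖x‖ := norm_pos_iff.2 hx
  by_contra! hcon
  have hA : 0 < |hK.grad v x| := lt_trans (by positivity) hcon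
  have hlt : |hK.grad v x|⁻¹ < r * ‖x‖⁻¹ := by
    have := inv_strictAnti₀ (by positivity) hcon
    rwa [mul_inv, inv_inv] at this
  -- With such a `t` the vector `t • x` is shorter than `r`, yet its increment exceeds 1.
  obtain ⟨t, ht1, ht2⟩ := exists_between hlt
  have ht : 0 < t := (inv_pos.2 hA).trans ht1
  have h1 := key (t • x) (by
    rw [norm_smul, Real.norm_of_nonneg ht.le]
    rwa [← div_eq_mul_inv, lt_div_iff₀ hx'] at ht2)
  rw [map_smul, smul_eq_mul, abs_mul, abs_of_pos ht] at h1
  rw [inv_lt_iff_one_lt_mul₀ hA] at ht1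
  linarith

lemma isCompact_hull (s : Finset (E n)) : IsCompact (hull s) := s.finite_toSet.isCompact_convexHull ℝ

lemma norm_sub_le_diam {s : Finset (E n)} {x y : E n} (hx : x ∈ hull s) (hy : y ∈ hull s) :
    ‖y - x‖ ≤ diam s := by
  rw [← dist_eq_norm]
  exact Metric.dist_le_diam_of_mem (isCompact_hull s).isBounded hy hx

lemma mem_hull_of_mem {s : Finset (E n)} {v : E n} (hv : v ∈ s) : v ∈ hull s :=
  subset_convexHull ℝ _ hv

end IsCell

/-! ### From a simplex to one of its faces -/

section Trace

variable {m : ℕ} {K : Finset (E (m + 1))}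

/-- The trace inequality on a face of a simplex. -/
theorem IsCell.trace_inequality (hK : IsCell K) (v : K) {g : E (m + 1) → ℝ} (hg : ContDiff ℝ 1 g) :
    (scale (K.erase v))⁻¹ * ∫ x in hull (K.erase (v : E (m + 1))), g x ^ 2 ∂μHE[m] ≤
      (scale K)⁻¹ * ((m + 1) * (2 * (∫ x in hull K, g x ^ 2) +
        diam K ^ 2 * ∫ x in hull K, ‖fderiv ℝ g x‖ ^ 2)) := by
  have hcf : Continuous (fderiv ℝ g) := hg.continuous_fderiv one_ne_zero
  have hgc := hg.continuous
  have hKcard : K.card = m + 2 := hK.card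
  have hms : ∀ s : Finset (E (m + 1)), MeasurableSet (hull s) := fun s =>
    (IsCell.isCompact_hull s).measurableSet
  have hIK : ∀ {f : E (m + 1) → ℝ}, Continuous f → IntegrableOn f (hull K) := fun hf =>
    hf.continuousOn.integrableOn_compact (IsCell.isCompact_hull K)
  obtain ⟨b, hb, hbs⟩ : ∃ b : Fin (m + 1) → E (m + 1), AffineIndependent ℝ b ∧
      Set.range b = (K.erase v : Finset (E (m + 1))) := by
    refine exists_vertexList' (by rw [Finset.card_erase_of_mem v.2, hKcard]; rfl) ?_
    exact hK.indep.mono (Finset.coe_subset.2 (Finset.erase_subset _ _))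
  have hIF : ∀ {f : E (m + 1) → ℝ}, Continuous f →
      IntegrableOn f (hull (K.erase (v : E (m + 1)))) μHE[m] := fun hf => integrableOn_hull hb hbs hf
  have hsK : 0 < scale K := by
    obtain ⟨b, hb, hbs⟩ := exists_vertexList' hK.card hK.indep
    exact scale_pos hb hbs
  -- The weight `coord w` vanishes on the face opposite `w`, so integrating the derivative of `coord
  -- w * g ^ 2` along the edge from `v` to `w` leaves only the face opposite `v`. Along this edge
  -- the weight has slope 1.
  have hstep : ∀ w : K, w ≠ v → (scale (K.erase v))⁻¹ *
      ∫ x in hull (K.erase (v : E (m + 1))), hK.coord w x * g x ^ 2 ∂μHE[m] ≤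
      (scale K)⁻¹ * (2 * (∫ x in hull K, g x ^ 2) +
        diam K ^ 2 * ∫ x in hull K, ‖fderiv ℝ g x‖ ^ 2) := by
    intro w hwv
    have hwv' : (v : E (m + 1)) ≠ w := fun h => hwv (Subtype.ext h.symm)
    have hf : ContDiff ℝ 1 fun x => hK.coord w x * g x ^ 2 :=
      (hK.contDiff_coord w).mul (hg.pow 2)
    have hibp := integral_edge_deriv hKcard hK.indep v.2 w.2 hwv' hf
    have h0 : ∫ x in hull (K.erase (w : E (m + 1))), hK.coord w x * g x ^ 2 ∂μHE[m] = 0 := by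
      rw [← integral_zero (E (m + 1)) ℝ (μ := μHE[m].restrict (hull (K.erase (w : E (m + 1)))))]
      refine setIntegral_congr_fun (hms _) fun x hx => ?_
      simp only [hK.coord_eq_zero (Finset.erase_subset _ _) (Finset.notMem_erase _ _) hx, zero_mul]
    rw [h0, mul_zero, sub_zero] at hibp
    rw [← hibp]
    refine mul_le_mul_of_nonneg_left ?_ (inv_nonneg.2 hsK.le)
    rw [← integral_const_mul, ← integral_const_mul, ← integral_add (hIK (by fun_prop))
      (hIK (by fun_prop))]
    refine setIntegral_mono_on (hIK ?_) (hIK (by fun_prop)) (hms _) fun x hx => ?_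
    · exact (hf.continuous_fderiv one_ne_zero).clm_apply continuous_const
    have hd : HasFDerivAt (fun x => hK.coord w x * g x ^ 2) _ x :=
      (hK.hasFDerivAt_coord w x).mul ((hg.differentiable one_ne_zero x).hasFDerivAt.pow 2)
    rw [hd.fderiv]
    simp only [add_apply, smul_apply, smul_eq_mul,
      LinearMap.coe_toContinuousLinearMap', hK.grad_sub, if_true, if_neg hwv, nsmul_eq_mul]
    set D := fderiv ℝ g x ((w : E (m + 1)) - v)
    have hD : D ^ 2 ≤ diam K ^ 2 * ‖fderiv ℝ g x‖ ^ 2 := by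
      rw [← mul_pow, ← sq_abs]
      refine pow_le_pow_left₀ (abs_nonneg _) ?_ 2
      have h1 := (fderiv ℝ g x).le_opNorm ((w : E (m + 1)) - v)
      have h2 := IsCell.norm_sub_le_diam (IsCell.mem_hull_of_mem v.2) (IsCell.mem_hull_of_mem w.2)
      rw [Real.norm_eq_abs] at h1
      nlinarith [norm_nonneg (fderiv ℝ g x)]
    have hl0 := hK.coord_nonneg hx w
    have hl1 := hK.coord_le_one hx w
    set l := hK.coord w x
    push_cast
    have h3 : l * (2 * g x ^ (2 - 1) * D) ≤ l * (g x ^ 2 + D ^ 2) := by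
      refine mul_le_mul_of_nonneg_left ?_ hl0
      norm_num
      nlinarith [sq_nonneg (g x - D)]
    have h4 : l * (g x ^ 2 + D ^ 2) ≤ 1 * (g x ^ 2 + D ^ 2) :=
      mul_le_mul_of_nonneg_right hl1 (by positivity)
    norm_num at h3 ⊢
    nlinarith
  -- On the face opposite `v` the other barycentric coordinates sum to 1, so summing the estimates
  -- removes the weights.
  have hsum : ∫ x in hull (K.erase (v : E (m + 1))), g x ^ 2 ∂μHE[m] =
      ∑ w ∈ Finset.univ.erase v,
        ∫ x in hull (K.erase (v : E (m + 1))), hK.coord w x * g x ^ 2 ∂μHE[m] := by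
    rw [← integral_finsetSum]
    · refine setIntegral_congr_fun (hms _) fun x hx => ?_
      rw [← Finset.sum_mul]
      have h1 := hK.sum_coord x
      rw [← Finset.add_sum_erase _ _ (Finset.mem_univ v),
        hK.coord_eq_zero (Finset.erase_subset _ _) (Finset.notMem_erase _ _) hx, zero_add] at h1
      rw [h1, one_mul]
    · intro w _
      exact hIF ((hK.continuous_coord w).mul (hgc.pow 2))
  rw [hsum, Finset.mul_sum]
  refine (Finset.sum_le_sum fun w hw => hstep w (Finset.ne_of_mem_erase hw)).trans ?_
  rw [Finset.sum_const, Finset.card_erase_of_mem (Finset.mem_univ _), Finset.card_univ,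
    Fintype.card_coe, hKcard]
  apply le_of_eq
  rw [nsmul_eq_mul]
  push_cast
  ring

end Trace

/-! ### Polynomials of bounded degree -/

section Degree

variable {n d k : ℕ}

/-- Polynomials of total degree at most `k`. -/
abbrev PolyLE (n k : ℕ) : Submodule ℝ (Poly n) := MvPolynomial.restrictTotalDegree (Fin n) ℝ k

lemma mem_polyLE {p : Poly n} : p ∈ PolyLE n k ↔ p.totalDegree ≤ k :=
  MvPolynomial.mem_restrictTotalDegree _ _ _

lemma polyLE_mono {l : ℕ} (h : k ≤ l) {p : Poly n} (hp : p ∈ PolyLE n k) : p ∈ PolyLE n l :=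
  mem_polyLE.2 ((mem_polyLE.1 hp).trans h)

lemma mul_mem_polyLE {l : ℕ} {p q : Poly n} (hp : p ∈ PolyLE n k) (hq : q ∈ PolyLE n l) :
    p * q ∈ PolyLE n (k + l) :=
  mem_polyLE.2 ((MvPolynomial.totalDegree_mul _ _).trans
    (Nat.add_le_add (mem_polyLE.1 hp) (mem_polyLE.1 hq)))

lemma C_mem_polyLE (c : ℝ) : (MvPolynomial.C c : Poly n) ∈ PolyLE n k :=
  mem_polyLE.2 (by simp)

lemma X_mem_polyLE (i : Fin n) : (MvPolynomial.X i : Poly n) ∈ PolyLE n 1 :=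
  mem_polyLE.2 (by simp)

lemma totalDegree_pderiv_le (i : Fin n) (p : Poly n) :
    (MvPolynomial.pderiv i p).totalDegree ≤ p.totalDegree - 1 := by
  rw [p.as_sum, map_sum]
  refine MvPolynomial.totalDegree_finsetSum_le fun s hs => ?_
  rw [MvPolynomial.pderiv_monomial]
  have hdeg : (s.sum fun _ e => e) ≤ (∑ v ∈ p.support, MvPolynomial.monomial v (p.coeff v)).totalDegree := by
    rw [← p.as_sum]; exact MvPolynomial.le_totalDegree hs
  rcases Nat.eq_zero_or_pos (s i) with h0 | hpos
  · simp [h0]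
  · refine (MvPolynomial.totalDegree_monomial_le _ _).trans ?_
    have h1 : s = (s - Finsupp.single i 1) + Finsupp.single i 1 := by
      rw [tsub_add_cancel_of_le]
      exact Finsupp.single_le_iff.2 hpos
    have h2 : (s.sum fun _ e => e) = ((s - Finsupp.single i 1).sum fun _ e => e) + 1 := by
      conv_lhs => rw [h1]
      rw [Finsupp.sum_add_index' (by simp) (by simp)]
      simp
    have h3 : ((s - Finsupp.single i 1).sum fun _ => id) =
        ((s - Finsupp.single i 1).sum fun _ e => e) := rfl
    omega

lemma pderiv_mem_polyLE (i : Fin n) {p : Poly n} (hp : p ∈ PolyLE n (k + 1)) :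
    MvPolynomial.pderiv i p ∈ PolyLE n k := by
  have := totalDegree_pderiv_le i p
  have := mem_polyLE.1 hp
  exact mem_polyLE.2 (by omega)

lemma pderiv_eq_zero_of_mem_zero (i : Fin n) {p : Poly n} (hp : p ∈ PolyLE n 0) :
    MvPolynomial.pderiv i p = 0 := by
  have h := mem_polyLE.1 hp
  rw [Nat.le_zero, MvPolynomial.totalDegree_eq_zero_iff_eq_C] at h
  rw [h, MvPolynomial.pderiv_C]

lemma bind₁_mem_polyLE {L : Fin d → Poly n} (hL : ∀ i, L i ∈ PolyLE n 1) {p : Poly d}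
    (hp : p ∈ PolyLE d k) : MvPolynomial.bind₁ L p ∈ PolyLE n k := by
  rw [mem_polyLE] at hp ⊢
  rw [p.as_sum, map_sum]
  refine MvPolynomial.totalDegree_finsetSum_le fun s hs => ?_
  rw [MvPolynomial.bind₁_monomial]
  refine (MvPolynomial.totalDegree_mul _ _).trans ?_
  rw [MvPolynomial.totalDegree_C, zero_add]
  refine (MvPolynomial.totalDegree_finsetProd _ _).trans ?_
  refine le_trans ?_ ((MvPolynomial.le_totalDegree hs).trans hp)
  refine Finset.sum_le_sum fun i _ => (MvPolynomial.totalDegree_pow _ _).trans ?_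
  have := mem_polyLE.1 (hL i)
  nlinarith

lemma eval_bind₁ (L : Fin d → Poly n) (p : Poly d) (x : Fin n → ℝ) :
    MvPolynomial.eval x (MvPolynomial.bind₁ L p) =
      MvPolynomial.eval (fun i => MvPolynomial.eval x (L i)) p := by
  simp only [MvPolynomial.eval, MvPolynomial.eval₂Hom_bind₁]

end Degree

/-! ### Quadratic integrals -/

lemma sq_integral_mul_le {X : Type*} [MeasurableSpace X] {μ : Measure X} {f g : X → ℝ}
    (hff : Integrable (fun x => f x ^ 2) μ) (hgg : Integrable (fun x => g x ^ 2) μ)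
    (hfg : Integrable (fun x => f x * g x) μ) :
    (∫ x, f x * g x ∂μ) ^ 2 ≤ (∫ x, f x ^ 2 ∂μ) * ∫ x, g x ^ 2 ∂μ := by
  have key : ∀ t : ℝ, 0 ≤ (∫ x, g x ^ 2 ∂μ) * (t * t) + (-2 * ∫ x, f x * g x ∂μ) * t +
      ∫ x, f x ^ 2 ∂μ := by
    intro t
    have h0 : 0 ≤ ∫ x, (f x - t * g x) ^ 2 ∂μ := integral_nonneg fun x => sq_nonneg _
    have h1 : ∀ x, (f x - t * g x) ^ 2 = f x ^ 2 + (-2 * t) * (f x * g x) + t * t * g x ^ 2 :=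
      fun x => by ring
    simp only [h1] at h0
    have h2 := hfg.const_mul (-2 * t)
    rw [integral_add (f := fun x => f x ^ 2 + -2 * t * (f x * g x)) (hff.add h2) (hgg.const_mul _),
      integral_add hff h2, integral_const_mul, integral_const_mul] at h0
    linarith
  have := discrim_le_zero key
  rw [discrim] at this
  nlinarith

/-- The integrand is continuous and nonnegative, so it vanishes in the interior, where the weight is
positive. The weight may vanish on the boundary; there `F` is recovered by continuity along a
segment from an interior point. -/
lemma eq_zero_of_setIntegral_corner {d : ℕ} {l F : (Fin d → ℝ) → ℝ} (hl : Continuous l)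
    (hF : Continuous F) (hl0 : ∀ x ∈ corner d, 0 ≤ l x)
    (hlpos : ∀ x, (∀ i, 0 < x i) → ∑ i, x i < 1 → 0 < l x)
    (h : ∫ x in corner d, l x * F x ^ 2 = 0) : ∀ x ∈ corner d, F x = 0 := by
  have hc : Continuous fun x => l x * F x ^ 2 := by fun_prop
  have h1 := (setIntegral_eq_zero_iff_of_nonneg_ae (μ := volume) (s := corner d)
    (f := fun x => l x * F x ^ 2) ?_ ?_).1 h
  · have h2 : Set.EqOn (fun x => l x * F x ^ 2) 0 (interior (corner d)) :=
      Measure.eqOn_open_of_ae_eq (μ := volume)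
        (ae_restrict_of_ae_restrict_of_subset interior_subset h1) isOpen_interior
        hc.continuousOn continuousOn_const
    have h3 : ∀ x : Fin d → ℝ, (∀ i, 0 < x i) → ∑ i, x i < 1 → F x = 0 := by
      intro x hx hx'
      have h4 := h2 (openCorner_subset_interior d ⟨hx, hx'⟩)
      have h5 := (hlpos x hx hx').ne'
      simpa [h5] using h4
    intro x hx
    obtain ⟨z, hz, hz'⟩ := openCorner_nonempty d
    have hcont : Continuous fun t : ℝ => F ((1 - t) • x + t • z) := hF.comp (by fun_prop)
    have hzero : Set.EqOn (fun t : ℝ => F ((1 - t) • x + t • z)) (fun _ => 0)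
        (closure (Set.Ioc 0 1)) := by
      refine Set.EqOn.closure (fun t ht => h3 _ (fun i => ?_) ?_) hcont continuous_const
      · simp only [Pi.add_apply, Pi.smul_apply, smul_eq_mul]
        nlinarith [mul_nonneg (sub_nonneg.2 ht.2) (hx.1 i), mul_pos ht.1 (hz i)]
      · simp only [Pi.add_apply, Pi.smul_apply, smul_eq_mul, Finset.sum_add_distrib,
          ← Finset.mul_sum]
        nlinarith [mul_le_mul_of_nonneg_left hx.2 (sub_nonneg.2 ht.2),
          mul_lt_mul_of_pos_left hz' ht.1]
    have := hzero (x := 0) (by rw [closure_Ioc zero_ne_one]; simp)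
    simpa using this
  · filter_upwards [ae_restrict_mem (corner_measurableSet d)] with x hx
    exact mul_nonneg (hl0 x hx) (sq_nonneg _)
  · exact hc.continuousOn.integrableOn_compact (corner_isCompact d)

/-! ### Finite-dimensional systems of equations -/

/-- A linear system on finite-dimensional spaces is solvable for all compatible data, with the
solution depending linearly on finitely many values of the data. -/
lemma exists_finite_solution {P Q : Type*} [AddCommGroup P] [Module ℝ P] [AddCommGroup Q]
    [Module ℝ Q] [FiniteDimensional ℝ Q] (B : P →ₗ[ℝ] Q →ₗ[ℝ] ℝ) :
    ∃ (N : ℕ) (p : Fin N → P) (q : Fin N → Q), ∀ l : Q →ₗ[ℝ] ℝ,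
      (∀ y, (∀ x, B x y = 0) → l y = 0) → ∀ y, B (∑ r, l (q r) • p r) y = l y := by
  have : Module.Free ℝ (LinearMap.range B) := Module.Free.of_divisionRing ℝ (LinearMap.range B)
  have : Module.Projective ℝ (LinearMap.range B) := Module.Projective.of_free
  -- A linear right inverse of `B` on its range, extended to the whole dual of `Q`, makes the
  -- solution linear in the data; expanding the data in a dual basis leaves finitely many fixed
  -- vectors.
  obtain ⟨S, hS⟩ := LinearMap.exists_rightInverse_of_surjective B.rangeRestrict
    (LinearMap.range_eq_top.2 B.surjective_rangeRestrict)
  obtain ⟨R, hR⟩ := LinearMap.exists_extend S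
  let bq := Module.finBasis ℝ Q
  refine ⟨Module.finrank ℝ Q, fun r => R (bq.coord r), fun r => bq r, fun l hl y => ?_⟩
  have hl' : l = ∑ r, l (bq r) • bq.coord r := by
    refine bq.ext fun i => ?_
    simp
  -- In finite dimension the range of `B` is the annihilator of the vectors killed by all `B x`,
  -- which is exactly the compatibility assumed of `l`.
  have hmem : l ∈ LinearMap.range B := by
    have h1 : (Submodule.dualCoannihilator (LinearMap.range B)).dualAnnihilator =
        LinearMap.range B := Subspace.dualCoannihilator_dualAnnihilator_eq
    rw [← h1, Submodule.mem_dualAnnihilator]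
    intro y hy
    refine hl y fun x => ?_
    exact (Submodule.mem_dualCoannihilator _).1 hy (B x) ⟨x, rfl⟩
  have h2 : ∑ r, l (bq r) • R (bq.coord r) = S ⟨l, hmem⟩ := by
    have h3 := congrArg R hl'
    rw [map_sum] at h3
    simp only [map_smul] at h3
    rw [← h3]
    exact congrArg (fun f => f ⟨l, hmem⟩) hR
  rw [h2]
  have h4 := congrArg (fun f => (f ⟨l, hmem⟩ : Q →ₗ[ℝ] ℝ) y) hS
  exact h4

/-! ### Interpolation on the corner simplex -/

section RefInterp

variable {m k : ℕ}

/-- The parametrization of the slanted face of the corner simplex. -/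
def slant (y : Fin m → ℝ) : Fin (m + 1) → ℝ := Fin.cons (1 - ∑ i, y i) y

/-- The parametrization of the face `x 0 = 0` of the corner simplex. -/
def flat (y : Fin m → ℝ) : Fin (m + 1) → ℝ := Fin.cons 0 y

lemma continuous_slant : Continuous (slant (m := m)) := continuous_cons_right _ (by fun_prop)

lemma continuous_flat : Continuous (flat (m := m)) := continuous_cons_right _ (by fun_prop)

/-- The surface measures on the slanted face and on the face `x 0 = 0` of the corner simplex and
the volume measure on the simplex. -/
def refMeasure (m : ℕ) : Fin 3 → Measure (Fin (m + 1) → ℝ) :=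
  ![(volume.restrict (corner m)).map slant, (volume.restrict (corner m)).map flat,
    volume.restrict (corner (m + 1))]

lemma integral_refMeasure_zero {f : (Fin (m + 1) → ℝ) → ℝ} (hf : Continuous f) :
    ∫ x, f x ∂refMeasure m 0 = ∫ y in corner m, f (slant y) :=
  integral_map continuous_slant.aemeasurable hf.aestronglyMeasurable

lemma integral_refMeasure_one {f : (Fin (m + 1) → ℝ) → ℝ} (hf : Continuous f) :
    ∫ x, f x ∂refMeasure m 1 = ∫ y in corner m, f (flat y) :=
  integral_map continuous_flat.aemeasurable hf.aestronglyMeasurable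

lemma integral_refMeasure_two (f : (Fin (m + 1) → ℝ) → ℝ) :
    ∫ x, f x ∂refMeasure m 2 = ∫ x in corner (m + 1), f x := rfl

lemma integrable_refMeasure {f : (Fin (m + 1) → ℝ) → ℝ} (hf : Continuous f) (i : Fin 3) :
    Integrable f (refMeasure m i) := by
  fin_cases i
  · refine (integrable_map_measure hf.aestronglyMeasurable continuous_slant.aemeasurable).2 ?_
    exact (hf.comp continuous_slant).continuousOn.integrableOn_compact (corner_isCompact m)
  · refine (integrable_map_measure hf.aestronglyMeasurable continuous_flat.aemeasurable).2 ?_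
    exact (hf.comp continuous_flat).continuousOn.integrableOn_compact (corner_isCompact m)
  · exact hf.continuousOn.integrableOn_compact (corner_isCompact (m + 1))

/-- The test polynomials on the two faces and on the simplex. -/
def refTest (m : ℕ) : Fin 3 → Poly (m + 1) →ₗ[ℝ] Poly (m + 1) :=
  ![LinearMap.id, LinearMap.id, (MvPolynomial.pderiv 0).toLinearMap]

lemma continuous_eval {d : ℕ} (p : Poly d) : Continuous fun x => MvPolynomial.eval x p :=
  MvPolynomial.continuous_eval p

lemma continuous_mul_fun {X : Type*} [TopologicalSpace X] {f g : X → ℝ} (hf : Continuous f)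
    (hg : Continuous g) : Continuous fun x => f x * g x := hf.mul hg

lemma continuous_sq_fun {X : Type*} [TopologicalSpace X] {f : X → ℝ} (hf : Continuous f) :
    Continuous fun x => f x ^ 2 := hf.pow 2

/-- The left hand side of the interpolation conditions. -/
def refForm (m k : ℕ) : PolyLE (m + 1) (k + 1) →ₗ[ℝ] (Fin 3 → PolyLE (m + 1) k) →ₗ[ℝ] ℝ :=
  LinearMap.mk₂ ℝ (fun p q => ∑ i, ∫ x, MvPolynomial.eval x (p : Poly (m + 1)) *
      MvPolynomial.eval x (refTest m i (q i)) ∂refMeasure m i)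
    (fun p p' q => by
      rw [← Finset.sum_add_distrib]
      refine Finset.sum_congr rfl fun i _ => ?_
      rw [← integral_add (integrable_refMeasure (continuous_mul_fun (continuous_eval _) (continuous_eval _)) i)
        (integrable_refMeasure (continuous_mul_fun (continuous_eval _) (continuous_eval _)) i)]
      simp [add_mul])
    (fun c p q => by
      rw [Finset.smul_sum]
      refine Finset.sum_congr rfl fun i _ => ?_
      rw [smul_eq_mul, ← integral_const_mul]
      simp [mul_assoc])
    (fun p q q' => by
      rw [← Finset.sum_add_distrib]
      refine Finset.sum_congr rfl fun i _ => ?_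
      rw [← integral_add (integrable_refMeasure (continuous_mul_fun (continuous_eval _) (continuous_eval _)) i)
        (integrable_refMeasure (continuous_mul_fun (continuous_eval _) (continuous_eval _)) i)]
      simp [mul_add])
    (fun c p q => by
      rw [Finset.smul_sum]
      refine Finset.sum_congr rfl fun i _ => ?_
      rw [smul_eq_mul, ← integral_const_mul]
      simp [mul_left_comm])

/-- The right hand side of the interpolation conditions. -/
def refData (k : ℕ) {g : (Fin (m + 1) → ℝ) → ℝ} (hg : Continuous g) :
    (Fin 3 → PolyLE (m + 1) k) →ₗ[ℝ] ℝ where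
  toFun q := ∑ i, ∫ x, g x * MvPolynomial.eval x (refTest m i (q i)) ∂refMeasure m i
  map_add' q q' := by
    rw [← Finset.sum_add_distrib]
    refine Finset.sum_congr rfl fun i _ => ?_
    rw [← integral_add (integrable_refMeasure (continuous_mul_fun hg (continuous_eval _)) i)
      (integrable_refMeasure (continuous_mul_fun hg (continuous_eval _)) i)]
    simp [mul_add]
  map_smul' c q := by
    rw [Finset.smul_sum]
    refine Finset.sum_congr rfl fun i _ => ?_
    rw [smul_eq_mul, ← integral_const_mul]
    simp [mul_left_comm]

/-- The first two barycentric coordinates on the corner simplex. -/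
def bary0 (m : ℕ) : Poly (m + 1) := 1 - ∑ i, MvPolynomial.X i

lemma eval_bary0 (x : Fin (m + 1) → ℝ) : MvPolynomial.eval x (bary0 m) = 1 - ∑ i, x i := by
  simp [bary0]

lemma bary0_mem : bary0 m ∈ PolyLE (m + 1) 1 := by
  refine Submodule.sub_mem _ ?_ (Submodule.sum_mem _ fun i _ => X_mem_polyLE i)
  exact C_mem_polyLE 1

lemma eval_bary0_slant (y : Fin m → ℝ) : MvPolynomial.eval (slant y) (bary0 m) = 0 := by
  simp [eval_bary0, slant, Fin.sum_univ_succ]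

lemma eval_bary0_flat (y : Fin m → ℝ) : MvPolynomial.eval (flat y) (bary0 m) = 1 - ∑ i, y i := by
  simp [eval_bary0, flat, Fin.sum_univ_succ]

/-- A triple of tests that annihilates all polynomials of degree `k + 1` has its three parts zero,
each on its own domain. The interior part is tested with itself times two barycentric coordinates,
which vanishes on both faces; then each face part is tested with itself times the coordinate that
vanishes on the other face. Only solvability of the interpolation problem is needed, not uniqueness.
-/
lemma refForm_compatible (q : Fin 3 → PolyLE (m + 1) k) (hq : ∀ p, refForm m k p q = 0)
    {g : (Fin (m + 1) → ℝ) → ℝ} (hg : Continuous g) : refData k hg q = 0 := by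
  set T : Fin 3 → Poly (m + 1) := fun i => refTest m i (q i) with hT
  have hform : ∀ p : Poly (m + 1), p ∈ PolyLE (m + 1) (k + 1) →
      (∫ y in corner m, MvPolynomial.eval (slant y) p * MvPolynomial.eval (slant y) (T 0)) +
      (∫ y in corner m, MvPolynomial.eval (flat y) p * MvPolynomial.eval (flat y) (T 1)) +
      ∫ x in corner (m + 1), MvPolynomial.eval x p * MvPolynomial.eval x (T 2) = 0 := by
    intro p hp
    have h := hq ⟨p, hp⟩
    simp only [refForm, LinearMap.mk₂_apply, Fin.sum_univ_three] at h
    rw [integral_refMeasure_zero (continuous_mul_fun (continuous_eval _) (continuous_eval _)),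
      integral_refMeasure_one (continuous_mul_fun (continuous_eval _) (continuous_eval _)),
      integral_refMeasure_two] at h
    exact h
  have hT0 : T 0 ∈ PolyLE (m + 1) k := (q 0).2
  have hT1 : T 1 ∈ PolyLE (m + 1) k := (q 1).2
  have hX := X_mem_polyLE (n := m + 1) 0
  have hsl : ∀ y : Fin m → ℝ, slant y 0 = 1 - ∑ i, y i := fun y => by simp [slant]
  have hfl : ∀ y : Fin m → ℝ, flat y 0 = 0 := fun y => by simp [flat]
  have h2 : ∀ x ∈ corner (m + 1), MvPolynomial.eval x (T 2) = 0 := by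
    -- The interior test is a derivative, of degree at most `k - 1`, so two more linear factors fit
    -- into degree `k + 1`. For `k = 0` the subtraction is not available, but then the derivative is
    -- zero.
    have hmem : bary0 m * MvPolynomial.X 0 * T 2 ∈ PolyLE (m + 1) (k + 1) := by
      cases k with
      | zero =>
        have : T 2 = 0 := pderiv_eq_zero_of_mem_zero 0 (q 2).2
        rw [this, mul_zero]; exact Submodule.zero_mem _
      | succ k =>
        have : T 2 ∈ PolyLE (m + 1) k := pderiv_mem_polyLE 0 (q 2).2
        exact polyLE_mono (by omega) (mul_mem_polyLE (mul_mem_polyLE bary0_mem hX) this)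
    have h := hform _ hmem
    simp only [map_mul, eval_bary0_slant, MvPolynomial.eval_X, hfl, zero_mul, mul_zero,
      integral_zero, zero_add] at h
    simp only [eval_bary0] at h
    refine eq_zero_of_setIntegral_corner (l := fun x => (1 - ∑ i, x i) * x 0) (by fun_prop)
      (continuous_eval _) (fun x hx => mul_nonneg (by linarith [hx.2]) (hx.1 0))
      (fun x hx hx' => mul_pos (by linarith) (hx 0)) ?_
    rw [← h]
    refine integral_congr_ae (Filter.Eventually.of_forall fun x => ?_)
    simp only
    ring
  have hT2 : ∀ f : (Fin (m + 1) → ℝ) → ℝ,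
      ∫ x in corner (m + 1), f x * MvPolynomial.eval x (T 2) = 0 := by
    intro f
    exact setIntegral_eq_zero_of_forall_eq_zero fun x hx => by rw [h2 x hx, mul_zero]
  have hpos : ∀ y ∈ corner m, 0 ≤ 1 - ∑ i, y i := fun y hy => by linarith [hy.2]
  have h0 : ∀ y ∈ corner m, MvPolynomial.eval (slant y) (T 0) = 0 := by
    have h := hform (MvPolynomial.X 0 * T 0)
      (polyLE_mono (by omega) (mul_mem_polyLE hX hT0))
    simp only [hT2, map_mul, MvPolynomial.eval_X, hfl, hsl, zero_mul, integral_zero,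
      add_zero] at h
    refine eq_zero_of_setIntegral_corner (l := fun y => 1 - ∑ i, y i)
      (F := fun y => MvPolynomial.eval (slant y) (T 0)) (by fun_prop)
      ((continuous_eval _).comp continuous_slant) hpos (fun y _ hy' => by linarith) ?_
    rw [← h]
    refine integral_congr_ae (Filter.Eventually.of_forall fun y => ?_)
    simp only
    ring
  have h1 : ∀ y ∈ corner m, MvPolynomial.eval (flat y) (T 1) = 0 := by
    have h := hform (bary0 m * T 1)
      (polyLE_mono (by omega) (mul_mem_polyLE bary0_mem hT1))
    simp only [hT2, map_mul, eval_bary0_slant, eval_bary0_flat, zero_mul, integral_zero,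
      add_zero, zero_add] at h
    refine eq_zero_of_setIntegral_corner (l := fun y => 1 - ∑ i, y i)
      (F := fun y => MvPolynomial.eval (flat y) (T 1)) (by fun_prop)
      ((continuous_eval _).comp continuous_flat) hpos (fun y _ hy' => by linarith) ?_
    rw [← h]
    refine integral_congr_ae (Filter.Eventually.of_forall fun y => ?_)
    simp only
    ring
  change ∑ i, ∫ x, g x * MvPolynomial.eval x (T i) ∂refMeasure m i = 0
  rw [Fin.sum_univ_three, integral_refMeasure_zero (continuous_mul_fun hg (continuous_eval _)),
    integral_refMeasure_one (continuous_mul_fun hg (continuous_eval _)), integral_refMeasure_two, hT2,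
    setIntegral_eq_zero_of_forall_eq_zero fun y hy => by rw [h0 y hy, mul_zero],
    setIntegral_eq_zero_of_forall_eq_zero fun y hy => by rw [h1 y hy, mul_zero]]
  simp

/-- Interpolation of moments on the corner simplex by polynomials of degree `k + 1`. -/
theorem exists_refInterp (m k : ℕ) : ∃ C : ℝ, 0 ≤ C ∧ ∀ g : (Fin (m + 1) → ℝ) → ℝ, Continuous g →
    ∃ p ∈ PolyLE (m + 1) (k + 1),
      (∀ i, ∀ q ∈ PolyLE (m + 1) k, ∫ x, (MvPolynomial.eval x p - g x) *
        MvPolynomial.eval x (refTest m i q) ∂refMeasure m i = 0) ∧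
      ∑ i, ∫ x, MvPolynomial.eval x p ^ 2 ∂refMeasure m i ≤
        C * ∑ i, ∫ x, g x ^ 2 ∂refMeasure m i := by
  obtain ⟨N, p, q, hpq⟩ := exists_finite_solution (refForm m k)
  have hcs : ∀ g : (Fin (m + 1) → ℝ) → ℝ, ∀ hg : Continuous g, ∀ r,
      refData k hg (q r) ^ 2 ≤ (3 * ∑ i, ∫ x, MvPolynomial.eval x (refTest m i (q r i)) ^ 2
        ∂refMeasure m i) * ∑ i, ∫ x, g x ^ 2 ∂refMeasure m i := by
    intro g hg r
    have h1 : refData k hg (q r) ^ 2 ≤ (Finset.univ : Finset (Fin 3)).card *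
        ∑ i, (∫ x, g x * MvPolynomial.eval x (refTest m i (q r i)) ∂refMeasure m i) ^ 2 :=
      sq_sum_le_card_mul_sum_sq (s := Finset.univ)
        (f := fun i => ∫ x, g x * MvPolynomial.eval x (refTest m i (q r i)) ∂refMeasure m i)
    refine h1.trans ?_
    simp only [Finset.card_univ, Fintype.card_fin, Nat.cast_ofNat]
    rw [mul_assoc]
    refine mul_le_mul_of_nonneg_left ?_ (by norm_num)
    rw [Finset.sum_mul]
    refine Finset.sum_le_sum fun i _ => ?_
    have h2 := sq_integral_mul_le (μ := refMeasure m i) (f := g)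
      (g := fun x => MvPolynomial.eval x (refTest m i (q r i)))
      (integrable_refMeasure (by fun_prop) i)
      (integrable_refMeasure (continuous_sq_fun (continuous_eval _)) i)
      (integrable_refMeasure (continuous_mul_fun hg (continuous_eval _)) i)
    refine h2.trans ?_
    rw [mul_comm]
    refine mul_le_mul_of_nonneg_left ?_ (integral_nonneg fun x => sq_nonneg _)
    exact Finset.single_le_sum (f := fun i => ∫ x, g x ^ 2 ∂refMeasure m i)
      (fun i _ => integral_nonneg fun x => sq_nonneg _) (Finset.mem_univ i)
  -- The constant is built from the finitely many fixed polynomials `p r` and `q r`, hence depends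
  -- on `m` and `k` only. The 3 counts the two faces and the interior.
  refine ⟨∑ i, ∑ r, N * ((3 * ∑ i, ∫ x, MvPolynomial.eval x (refTest m i (q r i)) ^ 2
        ∂refMeasure m i) * ∫ x, MvPolynomial.eval x (p r : Poly (m + 1)) ^ 2 ∂refMeasure m i),
    ?_, fun g hg => ?_⟩
  · have : ∀ (f : (Fin (m + 1) → ℝ) → ℝ) i, 0 ≤ ∫ x, f x ^ 2 ∂refMeasure m i := fun f i =>
      integral_nonneg fun x => sq_nonneg _
    refine Finset.sum_nonneg fun i _ => Finset.sum_nonneg fun r _ => ?_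
    have h1 : 0 ≤ ∑ i, ∫ x, MvPolynomial.eval x (refTest m i (q r i)) ^ 2 ∂refMeasure m i :=
      Finset.sum_nonneg fun i _ => this _ i
    have h2 := this (fun x => MvPolynomial.eval x (p r : Poly (m + 1))) i
    positivity
  have hsol := hpq (refData k hg) (fun y hy => refForm_compatible y hy hg)
  set P : PolyLE (m + 1) (k + 1) := ∑ r, refData k hg (q r) • p r with hP
  refine ⟨P, P.2, fun i s hs => ?_, ?_⟩
  · have h1 := hsol (Pi.single i ⟨s, hs⟩)
    simp only [refForm, LinearMap.mk₂_apply, refData, LinearMap.coe_mk, AddHom.coe_mk] at h1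
    rw [Finset.sum_eq_single i, Finset.sum_eq_single i, Pi.single_eq_same] at h1
    · simp only [sub_mul]
      rw [integral_sub (integrable_refMeasure (continuous_mul_fun (continuous_eval _) (continuous_eval _)) i)
        (integrable_refMeasure (continuous_mul_fun hg (continuous_eval _)) i), sub_eq_zero]
      exact h1
    · intro j _ hj; simp [Pi.single_eq_of_ne hj]
    · simp
    · intro j _ hj; simp [Pi.single_eq_of_ne hj]
    · simp
  · rw [Finset.sum_mul]
    refine Finset.sum_le_sum fun i _ => ?_
    have heval : ∀ x, MvPolynomial.eval x (P : Poly (m + 1)) ^ 2 ≤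
        N * ∑ r, refData k hg (q r) ^ 2 * MvPolynomial.eval x (p r : Poly (m + 1)) ^ 2 := by
      intro x
      have h1 : MvPolynomial.eval x (P : Poly (m + 1)) =
          ∑ r, refData k hg (q r) * MvPolynomial.eval x (p r : Poly (m + 1)) := by
        rw [hP]
        simp [MvPolynomial.smul_eval]
      have h2 : (∑ r, refData k hg (q r) * MvPolynomial.eval x (p r : Poly (m + 1))) ^ 2 ≤
          (Finset.univ : Finset (Fin N)).card * ∑ r, (refData k hg (q r) *
            MvPolynomial.eval x (p r : Poly (m + 1))) ^ 2 := sq_sum_le_card_mul_sum_sq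
      rw [h1]
      simpa [mul_pow] using h2
    have hci : ∀ r, Continuous fun x =>
        refData k hg (q r) ^ 2 * MvPolynomial.eval x (p r : Poly (m + 1)) ^ 2 := fun r =>
      continuous_mul_fun continuous_const (continuous_sq_fun (continuous_eval _))
    refine (integral_mono (integrable_refMeasure (continuous_sq_fun (continuous_eval _)) i)
      (integrable_refMeasure (continuous_mul_fun continuous_const (continuous_finsetSum _ fun r _ => hci r)) i)
      heval).trans ?_
    rw [integral_const_mul, integral_finsetSum _ fun r _ => integrable_refMeasure (hci r) i,
      Finset.mul_sum, Finset.sum_mul]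
    refine Finset.sum_le_sum fun r _ => ?_
    rw [integral_const_mul, mul_assoc]
    refine mul_le_mul_of_nonneg_left ?_ (Nat.cast_nonneg N)
    rw [mul_right_comm]
    exact mul_le_mul_of_nonneg_right (hcs g hg r) (integral_nonneg fun x => sq_nonneg _)

end RefInterp

/-! ### Polynomial functions on Euclidean space -/

section PolyFun

variable {n d k : ℕ}

lemma hasFDerivAt_eval (p : Poly n) (x : E n) :
    HasFDerivAt (fun x : E n => MvPolynomial.eval x.ofLp p)
      (∑ i, MvPolynomial.eval x.ofLp (MvPolynomial.pderiv i p) •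
        (EuclideanSpace.proj i : E n →L[ℝ] ℝ)) x := by
  induction p using MvPolynomial.induction_on with
  | C a => simpa using hasFDerivAt_const a x
  | add p q hp hq =>
    simp only [map_add, add_smul, Finset.sum_add_distrib]
    exact hp.add hq
  | mul_X p i hp =>
    have hX : HasFDerivAt (fun x : E n => x i) (EuclideanSpace.proj i : E n →L[ℝ] ℝ) x :=
      (EuclideanSpace.proj i : E n →L[ℝ] ℝ).hasFDerivAt
    have h := hp.mul hX
    simp only [map_mul, MvPolynomial.eval_X]
    refine h.congr_fderiv ?_
    ext y
    simp only [MvPolynomial.pderiv_mul, MvPolynomial.pderiv_X, map_add, map_mul,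
      MvPolynomial.eval_X, add_apply, smul_apply, sum_apply, smul_eq_mul, Finset.mul_sum,
      PiLp.proj_apply, add_mul, Finset.sum_add_distrib]
    rw [add_comm]
    congr 1
    · exact Finset.sum_congr rfl fun j _ => by ring
    · rw [Finset.sum_eq_single i]
      · simp
      · intro j _ hj
        simp [hj.symm]
      · simp

lemma contDiff_eval (p : Poly n) {l : WithTop ℕ∞} :
    ContDiff ℝ l (fun x : E n => MvPolynomial.eval x.ofLp p) := by
  induction p using MvPolynomial.induction_on with
  | C a => simpa using contDiff_const
  | add p q hp hq => simpa using hp.add hq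
  | mul_X p i hp =>
    simp only [map_mul, MvPolynomial.eval_X]
    exact hp.mul (EuclideanSpace.proj i : E n →L[ℝ] ℝ).contDiff

lemma continuous_evalE (p : Poly n) : Continuous fun x : E n => MvPolynomial.eval x.ofLp p :=
  (contDiff_eval p (l := 0)).continuous

lemma fderiv_eval (p : Poly n) (x t : E n) :
    fderiv ℝ (fun x : E n => MvPolynomial.eval x.ofLp p) x t =
      ∑ i, MvPolynomial.eval x.ofLp (MvPolynomial.pderiv i p) * t i := by
  rw [(hasFDerivAt_eval p x).fderiv]
  simp [sum_apply]

/-- The coordinates of the affine map onto a simplex, as polynomials. -/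
def simplexPoly (b : Fin (d + 1) → E n) (j : Fin n) : Poly d :=
  MvPolynomial.C (b 0 j) + ∑ i, MvPolynomial.C ((b i.succ - b 0) j) * MvPolynomial.X i

lemma simplexPoly_mem (b : Fin (d + 1) → E n) (j : Fin n) : simplexPoly b j ∈ PolyLE d 1 := by
  refine Submodule.add_mem _ (C_mem_polyLE _) (Submodule.sum_mem _ fun i _ => ?_)
  have := mul_mem_polyLE (C_mem_polyLE (n := d) (k := 0) ((b i.succ - b 0) j)) (X_mem_polyLE i)
  rwa [zero_add] at this

lemma eval_simplexPoly (b : Fin (d + 1) → E n) (j : Fin n) (y : Fin d → ℝ) :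
    MvPolynomial.eval y (simplexPoly b j) = simplexMap b y j := by
  simp [simplexPoly, simplexMap, edgeLin_apply, mul_comm]

/-- The pullback of a polynomial to the corner simplex. -/
def pullback (b : Fin (d + 1) → E n) (q : Poly n) : Poly d :=
  MvPolynomial.bind₁ (simplexPoly b) q

lemma eval_pullback (b : Fin (d + 1) → E n) (q : Poly n) (y : Fin d → ℝ) :
    MvPolynomial.eval y (pullback b q) = MvPolynomial.eval (simplexMap b y).ofLp q := by
  rw [pullback, eval_bind₁]
  simp only [eval_simplexPoly]

lemma pullback_mem (b : Fin (d + 1) → E n) {q : Poly n} (hq : q ∈ PolyLE n k) :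
    pullback b q ∈ PolyLE d k := bind₁_mem_polyLE (simplexPoly_mem b) hq

/-- In corner coordinates the derivative along the edge from `b 0` to `b 1` is the partial
derivative in the first variable, which is why `refTest` contains `pderiv 0`. -/
lemma eval_pderiv_pullback {m : ℕ} (b : Fin (m + 2) → E n) (q : Poly n) (y : Fin (m + 1) → ℝ) :
    MvPolynomial.eval y (MvPolynomial.pderiv 0 (pullback b q)) =
      fderiv ℝ (fun x : E n => MvPolynomial.eval x.ofLp q) (simplexMap b y) (b 1 - b 0) := by
  rw [← fderiv_comp_simplexMap (contDiff_eval q)]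
  have h1 : (fun x : E n => MvPolynomial.eval x.ofLp q) ∘ simplexMap b =
      (fun x : E (m + 1) => MvPolynomial.eval x.ofLp (pullback b q)) ∘
        (EuclideanSpace.equiv (Fin (m + 1)) ℝ).symm := by
    ext y
    simp [eval_pullback]
  rw [h1]
  have h2 := (hasFDerivAt_eval (pullback b q) ((EuclideanSpace.equiv (Fin (m + 1)) ℝ).symm y)).comp
    y (EuclideanSpace.equiv (Fin (m + 1)) ℝ).symm.hasFDerivAt
  rw [h2.fderiv]
  simp [sum_apply]

end PolyFun

/-! ### Barycentric coordinates as polynomials -/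

namespace IsCell

variable {n k : ℕ} {K : Finset (E n)} (hK : IsCell K)

/-- The barycentric coordinates as polynomials. -/
def coordPoly (v : K) : Poly n :=
  MvPolynomial.C (hK.coord v 0) +
    ∑ j, MvPolynomial.C (hK.grad v (EuclideanSpace.single j 1)) * MvPolynomial.X j

lemma coordPoly_mem (v : K) : hK.coordPoly v ∈ PolyLE n 1 := by
  refine Submodule.add_mem _ (C_mem_polyLE _) (Submodule.sum_mem _ fun i _ => ?_)
  have := mul_mem_polyLE (C_mem_polyLE (n := n) (k := 0) (hK.grad v (EuclideanSpace.single i 1)))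
    (X_mem_polyLE i)
  rwa [zero_add] at this

lemma grad_apply_eq_sum (v : K) (x : E n) :
    hK.grad v x = ∑ j, hK.grad v (EuclideanSpace.single j 1) * x j := by
  have h : x = ∑ j, x j • EuclideanSpace.single j (1 : ℝ) := by
    ext i
    simp [Finset.sum_apply, Pi.single_apply]
  conv_lhs => rw [h]
  rw [map_sum]
  simp [mul_comm]

lemma eval_coordPoly (v : K) (x : E n) :
    MvPolynomial.eval x.ofLp (hK.coordPoly v) = hK.coord v x := by
  have := hK.coord_add v x 0
  rw [zero_add] at this
  rw [this, grad_apply_eq_sum]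
  simp [coordPoly, add_comm]

lemma coord_simplexMap {b : Fin (n + 1) → E n} (hb : AffineIndependent ℝ b)
    (hs : Set.range b = K) (i : Fin n) (hi : b i.succ ∈ K) (y : Fin n → ℝ) :
    hK.coord ⟨b i.succ, hi⟩ (simplexMap b y) = y i := by
  have hmem : ∀ j, b j ∈ K := fun j => by
    rw [← Finset.mem_coe, ← hs]; exact ⟨j, rfl⟩
  rw [simplexMap, add_comm, add_comm, edgeLin_apply, coord_add, map_sum]
  have h0 := hK.coord_apply ⟨b i.succ, hi⟩ ⟨b 0, hmem 0⟩
  rw [if_neg (fun h => Fin.succ_ne_zero i (hb.injective (Subtype.ext_iff.1 h)))] at h0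
  simp only at h0
  rw [h0, add_zero, Finset.sum_eq_single i]
  · have h1 := hK.grad_sub ⟨b i.succ, hi⟩ ⟨b 0, hmem 0⟩ ⟨b i.succ, hi⟩
    rw [if_pos rfl, if_neg (fun h => Fin.succ_ne_zero i (hb.injective (Subtype.ext_iff.1 h)))] at h1
    simp only at h1
    rw [map_smul, h1]; simp
  · intro j _ hj
    have h1 := hK.grad_sub ⟨b i.succ, hi⟩ ⟨b 0, hmem 0⟩ ⟨b j.succ, hmem _⟩
    rw [if_neg (fun h => hj.symm (Fin.succ_injective _ (hb.injective (Subtype.ext_iff.1 h)))),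
      if_neg (fun h => Fin.succ_ne_zero i (hb.injective (Subtype.ext_iff.1 h)))] at h1
    simp only at h1
    rw [map_smul, h1]; simp
  · simp

/-- Polynomials on the corner simplex are pullbacks. -/
lemma exists_eval_simplexMap (hK : IsCell K) {b : Fin (n + 1) → E n} (hb : AffineIndependent ℝ b)
    (hs : Set.range b = K) {p : Poly n} (hp : p ∈ PolyLE n k) :
    ∃ q ∈ PolyLE n k, ∀ y : Fin n → ℝ,
      MvPolynomial.eval (simplexMap b y).ofLp q = MvPolynomial.eval y p := by
  have hmem : ∀ j, b j ∈ K := fun j => by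
    rw [← Finset.mem_coe, ← hs]; exact ⟨j, rfl⟩
  refine ⟨MvPolynomial.bind₁ (fun i : Fin n => hK.coordPoly ⟨b i.succ, hmem _⟩) p,
    bind₁_mem_polyLE (fun i => hK.coordPoly_mem _) hp, fun y => ?_⟩
  rw [eval_bind₁]
  simp only [eval_coordPoly, hK.coord_simplexMap hb hs]

lemma scale_pos (hK : IsCell K) : 0 < scale K := by
  obtain ⟨b, hb, hbs⟩ := exists_vertexList' hK.card hK.indep
  exact MDG.scale_pos hb hbs

end IsCell

/-! ### The inverse trace inequality and interpolation on a simplex -/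

section Phys

variable {m : ℕ} {K : Finset (E (m + 1))}

lemma slant_mem_corner {y : Fin m → ℝ} (hy : y ∈ corner m) : slant y ∈ corner (m + 1) :=
  cons_mem_corner.2 ⟨hy, by linarith [hy.2], le_rfl⟩

/-- Polynomials of bounded degree are controlled on a face of the corner simplex by their
values inside. -/
lemma exists_refTrace (m k : ℕ) : ∃ C : ℝ, 0 ≤ C ∧ ∀ p ∈ PolyLE (m + 1) k,
    ∫ x, MvPolynomial.eval x p ^ 2 ∂refMeasure m 0 ≤
      C * ∫ x, MvPolynomial.eval x p ^ 2 ∂refMeasure m 2 := by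
  have hI : ∀ (p q : Poly (m + 1)) i, Integrable (fun x => MvPolynomial.eval x p *
      MvPolynomial.eval x q) (refMeasure m i) := fun p q i =>
    integrable_refMeasure (continuous_mul_fun (continuous_eval _) (continuous_eval _)) i
  let B : PolyLE (m + 1) k →ₗ[ℝ] PolyLE (m + 1) k →ₗ[ℝ] ℝ :=
    LinearMap.mk₂ ℝ (fun p q => ∫ x, MvPolynomial.eval x (p : Poly (m + 1)) *
      MvPolynomial.eval x (q : Poly (m + 1)) ∂refMeasure m 2)
    (fun p p' q => by rw [← integral_add (hI _ _ _) (hI _ _ _)]; simp [add_mul])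
    (fun c p q => by rw [smul_eq_mul, ← integral_const_mul]; simp [mul_assoc])
    (fun p q q' => by rw [← integral_add (hI _ _ _) (hI _ _ _)]; simp [mul_add])
    (fun c p q => by rw [smul_eq_mul, ← integral_const_mul]; simp [mul_left_comm])
  have hB : ∀ p q, B p q = ∫ x, MvPolynomial.eval x (p : Poly (m + 1)) *
      MvPolynomial.eval x (q : Poly (m + 1)) ∂refMeasure m 2 := fun _ _ => rfl
  obtain ⟨N, P, Q, hPQ⟩ := exists_finite_solution B
  have hnn : ∀ (p : Poly (m + 1)) i, 0 ≤ ∫ x, MvPolynomial.eval x p ^ 2 ∂refMeasure m i :=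
    fun p i => integral_nonneg fun x => sq_nonneg _
  refine ⟨N * ∑ r, (∫ x, MvPolynomial.eval x (Q r : Poly (m + 1)) ^ 2 ∂refMeasure m 2) *
    ∫ x, MvPolynomial.eval x (P r : Poly (m + 1)) ^ 2 ∂refMeasure m 0, ?_, fun p hp => ?_⟩
  · exact mul_nonneg (Nat.cast_nonneg N)
      (Finset.sum_nonneg fun r _ => mul_nonneg (hnn _ _) (hnn _ _))
  set p' : PolyLE (m + 1) k := ⟨p, hp⟩ with hp'
  -- `s` represents the same functional as `p` under the L² Gram form. It therefore agrees with `p`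
  -- on the corner simplex, closed faces included, and its coefficients are bounded by the L² norm
  -- of `p`.
  set s := ∑ r, B p' (Q r) • P r with hs
  have h1 : ∀ y, B s y = B p' y := hPQ (B p') fun y hy => hy p'
  have h2 : B (p' - s) (p' - s) = 0 := by
    rw [map_sub B, LinearMap.sub_apply, h1, sub_self]
  have h3 : ∀ x ∈ corner (m + 1), MvPolynomial.eval x ((p' - s : PolyLE (m + 1) k) : Poly (m + 1)) = 0 := by
    refine eq_zero_of_setIntegral_corner (l := fun _ => 1) continuous_const (continuous_eval _)
      (fun _ _ => zero_le_one) (fun _ _ _ => zero_lt_one) ?_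
    rw [hB, integral_refMeasure_two] at h2
    rw [← h2]
    refine integral_congr_ae (Filter.Eventually.of_forall fun x => ?_)
    simp only
    ring
  have h4 : ∀ y ∈ corner m, MvPolynomial.eval (slant y) p ^ 2 ≤
      N * ∑ r, B p' (Q r) ^ 2 * MvPolynomial.eval (slant y) (P r : Poly (m + 1)) ^ 2 := by
    intro y hy
    have h5 := h3 _ (slant_mem_corner hy)
    rw [Submodule.coe_sub, map_sub, sub_eq_zero] at h5
    have h6 : MvPolynomial.eval (slant y) p =
        ∑ r, B p' (Q r) * MvPolynomial.eval (slant y) (P r : Poly (m + 1)) := by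
      rw [hp'] at h5
      simp only at h5
      rw [h5, hs]
      simp [MvPolynomial.smul_eval]
    have h7 : (∑ r, B p' (Q r) * MvPolynomial.eval (slant y) (P r : Poly (m + 1))) ^ 2 ≤
        (Finset.univ : Finset (Fin N)).card * ∑ r, (B p' (Q r) *
          MvPolynomial.eval (slant y) (P r : Poly (m + 1))) ^ 2 := sq_sum_le_card_mul_sum_sq
    rw [h6]
    simpa [mul_pow] using h7
  have hci : ∀ r, Continuous fun y : Fin m → ℝ =>
      B p' (Q r) ^ 2 * MvPolynomial.eval (slant y) (P r : Poly (m + 1)) ^ 2 := fun r =>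
    continuous_mul_fun continuous_const
      (continuous_sq_fun ((continuous_eval _).comp continuous_slant))
  have hIc : ∀ {f : (Fin m → ℝ) → ℝ}, Continuous f → IntegrableOn f (corner m) := fun hf =>
    hf.continuousOn.integrableOn_compact (corner_isCompact m)
  rw [integral_refMeasure_zero (continuous_sq_fun (continuous_eval _))]
  refine (setIntegral_mono_on
    (hIc (continuous_sq_fun ((continuous_eval _).comp continuous_slant)))
    (hIc (continuous_mul_fun continuous_const (continuous_finsetSum _ fun r _ => hci r)))
    (corner_measurableSet m) h4).trans ?_
  rw [integral_const_mul, integral_finsetSum _ fun r _ => hIc (hci r), mul_assoc, Finset.sum_mul]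
  refine mul_le_mul_of_nonneg_left (Finset.sum_le_sum fun r _ => ?_) (Nat.cast_nonneg N)
  rw [integral_const_mul, integral_refMeasure_zero (continuous_sq_fun (continuous_eval _)),
    mul_right_comm]
  refine mul_le_mul_of_nonneg_right ?_ (integral_nonneg fun x => sq_nonneg _)
  rw [hB, mul_comm]
  exact sq_integral_mul_le (integrable_refMeasure (continuous_sq_fun (continuous_eval _)) 2)
    (integrable_refMeasure (continuous_sq_fun (continuous_eval _)) 2) (hI _ _ _)

/-- The integrals over a simplex and over two of its faces, in the coordinates of the corner
simplex. -/
lemma IsCell.exists_refCoords (hK : IsCell K) {v w : K} (hvw : v ≠ w) :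
    ∃ b : Fin (m + 2) → E (m + 1), AffineIndependent ℝ b ∧ Set.range b = K ∧ b 0 = v ∧ b 1 = w ∧
      0 < scale (K.erase (v : E (m + 1))) ∧ 0 < scale (K.erase (w : E (m + 1))) ∧
      ∀ f : E (m + 1) → ℝ, Continuous f →
      (∫ x in hull K, f x = scale K * ∫ y, f (simplexMap b y) ∂refMeasure m 2) ∧
      (∫ x in hull (K.erase (v : E (m + 1))), f x ∂μHE[m] =
        scale (K.erase (v : E (m + 1))) * ∫ y, f (simplexMap b y) ∂refMeasure m 0) ∧
      (∫ x in hull (K.erase (w : E (m + 1))), f x ∂μHE[m] =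
        scale (K.erase (w : E (m + 1))) * ∫ y, f (simplexMap b y) ∂refMeasure m 1) := by
  obtain ⟨b, hb, hs, h0, h1, hiK, hiv, hiw, hsK, hsv, hsw⟩ := exists_faceLists
    (m := m) hK.card hK.indep v.2 w.2 (fun h => hvw (Subtype.ext h))
  refine ⟨b, hb, hs, h0, h1, hsv, hsw, fun f hf => ⟨?_, ?_, ?_⟩⟩
  · rw [measure_top] at hiK
    exact hiK f
  · rw [hiv, integral_refMeasure_zero (f := fun y => f (simplexMap b y))
      (hf.comp (continuous_simplexMap b))]; rfl
  · rw [hiw, integral_refMeasure_one (f := fun y => f (simplexMap b y))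
      (hf.comp (continuous_simplexMap b))]; rfl

lemma exists_ne_vertex (hK : IsCell K) (v : K) : ∃ w : K, v ≠ w := by
  have : 1 < Fintype.card K := by rw [Fintype.card_coe, hK.card]; omega
  obtain ⟨w, hw⟩ := Fintype.exists_ne_of_one_lt_card this v
  exact ⟨w, hw.symm⟩

lemma IsCell.scale_erase_pos (hK : IsCell K) (v : K) : 0 < scale (K.erase (v : E (m + 1))) := by
  obtain ⟨w, hw⟩ := exists_ne_vertex hK v
  obtain ⟨b, _, _, _, _, h, _⟩ := hK.exists_refCoords hw
  exact h

/-- The inverse trace inequality for polynomials of bounded degree. -/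
theorem exists_inverseTrace (m k : ℕ) : ∃ C : ℝ, 0 ≤ C ∧ ∀ {K : Finset (E (m + 1))}, IsCell K →
    ∀ v : K, ∀ p ∈ PolyLE (m + 1) k,
      (scale (K.erase (v : E (m + 1))))⁻¹ *
        ∫ x in hull (K.erase (v : E (m + 1))), MvPolynomial.eval x.ofLp p ^ 2 ∂μHE[m] ≤
      C * ((scale K)⁻¹ * ∫ x in hull K, MvPolynomial.eval x.ofLp p ^ 2) := by
  obtain ⟨C, hC0, hC⟩ := exists_refTrace m k
  refine ⟨C, hC0, fun {K} hK v p hp => ?_⟩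
  obtain ⟨w, hvw⟩ := exists_ne_vertex hK v
  obtain ⟨b, hb, hs, h0, h1, hsv, hsw, hint⟩ := hK.exists_refCoords hvw
  obtain ⟨hiK, hiv, _⟩ := hint _ (continuous_sq_fun (continuous_evalE p))
  rw [hiK, hiv, inv_mul_cancel_left₀ hsv.ne', inv_mul_cancel_left₀ hK.scale_pos.ne']
  have := hC _ (pullback_mem b hp)
  simpa only [eval_pullback] using this

/-- Interpolation of a smooth function by polynomials of degree `k + 1`, adapted to the edge
from `v` to `w`. -/
theorem exists_interp (m k : ℕ) : ∃ C : ℝ, 0 ≤ C ∧ ∀ {K : Finset (E (m + 1))}, IsCell K →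
    ∀ v w : K, v ≠ w → ∀ g : E (m + 1) → ℝ, ContDiff ℝ 1 g → ∃ p ∈ PolyLE (m + 1) (k + 1),
      (∀ q ∈ PolyLE (m + 1) k, ∫ x in hull (K.erase (v : E (m + 1))),
        (MvPolynomial.eval x.ofLp p - g x) * MvPolynomial.eval x.ofLp q ∂μHE[m] = 0) ∧
      (∀ q ∈ PolyLE (m + 1) k, ∫ x in hull (K.erase (w : E (m + 1))),
        (MvPolynomial.eval x.ofLp p - g x) * MvPolynomial.eval x.ofLp q ∂μHE[m] = 0) ∧
      (∀ q ∈ PolyLE (m + 1) k, ∫ x in hull K,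
        fderiv ℝ (fun x => MvPolynomial.eval x.ofLp p - g x) x ((w : E (m + 1)) - v) *
          MvPolynomial.eval x.ofLp q = 0) ∧
      (scale K)⁻¹ * (∫ x in hull K, (MvPolynomial.eval x.ofLp p - g x) ^ 2) +
        (scale (K.erase (v : E (m + 1))))⁻¹ * (∫ x in hull (K.erase (v : E (m + 1))),
          (MvPolynomial.eval x.ofLp p - g x) ^ 2 ∂μHE[m]) +
        (scale (K.erase (w : E (m + 1))))⁻¹ * (∫ x in hull (K.erase (w : E (m + 1))),
          (MvPolynomial.eval x.ofLp p - g x) ^ 2 ∂μHE[m]) ≤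
        C * (diam K ^ 2 * ((scale K)⁻¹ * ∫ x in hull K, ‖fderiv ℝ g x‖ ^ 2)) := by
  obtain ⟨C, hC0, hC⟩ := exists_refInterp m k
  -- `2 * C + 2` passes from the interpolant to the error. The other factor adds `2 ^ (m + 1)` from
  -- the Poincaré inequality and, for each of the two faces, `(m + 1) * (2 * 2 ^ (m + 1) + 1)` from
  -- the trace inequality.
  refine ⟨(2 * C + 2) * ((4 * (m + 1) + 1) * 2 ^ (m + 1) + 2 * (m + 1)), by positivity,
    fun {K} hK v w hvw g hg => ?_⟩
  obtain ⟨b, hb, hs, h0, h1, hsv, hsw, hint⟩ := hK.exists_refCoords hvw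
  have hsK := hK.scale_pos
  have hcomp := IsCell.isCompact_hull K
  have hvol : volume (hull K) ≠ 0 := by
    intro h
    have h2 := restrict_hull (d := m + 1) hb hs
    have h3 := congrArg (fun μ => μ (hull K)) h2
    have h4 : scale K = 0 := by
      rw [scale, hK.card, Nat.add_sub_cancel, measure_top, h]; simp
    exact hsK.ne' h4
  -- Adding a constant to both `p` and `g` does not change the error, so `g - c` is interpolated and
  -- `c` is added back; all norms of `g - c` are controlled by the gradient of `g`.
  obtain ⟨c, hc⟩ := exists_poincare (convex_convexHull ℝ _) hcomp hvol (h := diam K)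
    (fun x hx y hy => IsCell.norm_sub_le_diam hx hy) hg
  set g' : E (m + 1) → ℝ := fun x => g x - c with hg'
  have hg'1 : ContDiff ℝ 1 g' := hg.sub contDiff_const
  have hfd : ∀ x, fderiv ℝ g' x = fderiv ℝ g x := fun x => by
    rw [hg', fderiv_sub_const]
  have hgc : Continuous g' := hg'1.continuous
  obtain ⟨p', hp', hmom, hbd⟩ := hC (g' ∘ simplexMap b) (hgc.comp (continuous_simplexMap b))
  obtain ⟨p₀, hp₀, hpe⟩ := hK.exists_eval_simplexMap hb hs hp'
  have hdiff : ∀ x : E (m + 1), MvPolynomial.eval x.ofLp (p₀ + MvPolynomial.C c) - g x =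
      MvPolynomial.eval x.ofLp p₀ - g' x := fun x => by
    simp only [map_add, MvPolynomial.eval_C, hg']; ring
  refine ⟨p₀ + MvPolynomial.C c, Submodule.add_mem _ hp₀ (C_mem_polyLE c), ?_⟩
  simp only [hdiff]
  have hec : Continuous fun x : E (m + 1) => MvPolynomial.eval x.ofLp p₀ - g' x :=
    (continuous_evalE p₀).sub hgc
  have hm0 : ∀ q ∈ PolyLE (m + 1) k, ∫ x in hull (K.erase (v : E (m + 1))),
        (MvPolynomial.eval x.ofLp p₀ - g' x) * MvPolynomial.eval x.ofLp q ∂μHE[m] = 0 := by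
    intro q hq
    rw [(hint _ (continuous_mul_fun hec (continuous_evalE q))).2.1]
    have := hmom 0 _ (pullback_mem b hq)
    simp only [refTest, Matrix.cons_val_zero, LinearMap.id_apply, eval_pullback] at this
    simp only [hpe]
    exact mul_eq_zero_of_right _ this
  have hm1 : ∀ q ∈ PolyLE (m + 1) k, ∫ x in hull (K.erase (w : E (m + 1))),
        (MvPolynomial.eval x.ofLp p₀ - g' x) * MvPolynomial.eval x.ofLp q ∂μHE[m] = 0 := by
    intro q hq
    rw [(hint _ (continuous_mul_fun hec (continuous_evalE q))).2.2]
    have := hmom 1 _ (pullback_mem b hq)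
    simp only [refTest, Matrix.cons_val_one, Matrix.cons_val_zero, LinearMap.id_apply,
      eval_pullback] at this
    simp only [hpe]
    exact mul_eq_zero_of_right _ this
  have hec1 : ContDiff ℝ 1 fun x : E (m + 1) => MvPolynomial.eval x.ofLp p₀ - g' x :=
    (contDiff_eval p₀).sub hg'1
  refine ⟨hm0, hm1, fun q hq => ?_, ?_⟩
  · have hq1 : ContDiff ℝ 1 fun x : E (m + 1) => MvPolynomial.eval x.ofLp q := contDiff_eval q
    -- In the integration by parts of `(p - g) * q` along the edge the boundary terms are face
    -- moments, and the term with the derivative on `q` is the third kind of moment. All vanish,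
    -- hence so does the moment of the derivative of `p - g`.
    have hibp := integral_edge_deriv hK.card hK.indep v.2 w.2 (fun h => hvw (Subtype.ext h))
      (hec1.mul hq1)
    rw [hm0 q hq, hm1 q hq, mul_zero, mul_zero, sub_zero] at hibp
    have hz : ∫ x in hull K, (MvPolynomial.eval x.ofLp p₀ - g' x) *
        fderiv ℝ (fun x : E (m + 1) => MvPolynomial.eval x.ofLp q) x ((w : E (m + 1)) - v) = 0 := by
      rw [(hint _ (continuous_mul_fun hec ((hq1.continuous_fderiv one_ne_zero).clm_apply
        continuous_const))).1]
      have := hmom 2 _ (pullback_mem b hq)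
      simp only [refTest] at this
      simp only [hpe, ← h0, ← h1, ← eval_pderiv_pullback]
      exact mul_eq_zero_of_right _ this
    have hI : ∀ {f : E (m + 1) → ℝ}, Continuous f → IntegrableOn f (hull K) := fun hf =>
      hf.continuousOn.integrableOn_compact hcomp
    have hprod : ∀ x, fderiv ℝ (fun x : E (m + 1) => (MvPolynomial.eval x.ofLp p₀ - g' x) *
        MvPolynomial.eval x.ofLp q) x ((w : E (m + 1)) - v) =
        fderiv ℝ (fun x => MvPolynomial.eval x.ofLp p₀ - g' x) x ((w : E (m + 1)) - v) *
          MvPolynomial.eval x.ofLp q + (MvPolynomial.eval x.ofLp p₀ - g' x) *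
        fderiv ℝ (fun x : E (m + 1) => MvPolynomial.eval x.ofLp q) x ((w : E (m + 1)) - v) := by
      intro x
      rw [fderiv_fun_mul (hec1.differentiable one_ne_zero x) (hq1.differentiable one_ne_zero x)]
      simp only [add_apply, smul_apply, smul_eq_mul]
      ring
    have h5 := (mul_eq_zero.1 hibp).resolve_left (inv_ne_zero hsK.ne')
    simp only [hprod] at h5
    rw [integral_add (hI (continuous_mul_fun ((hec1.continuous_fderiv one_ne_zero).clm_apply
        continuous_const) (continuous_evalE q)))
      (hI (continuous_mul_fun hec ((hq1.continuous_fderiv one_ne_zero).clm_apply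
        continuous_const))), hz, add_zero] at h5
    exact h5
  · obtain ⟨hK2, hv2, hw2⟩ := hint _ (continuous_sq_fun hec)
    rw [hK2, hv2, hw2, inv_mul_cancel_left₀ hsK.ne', inv_mul_cancel_left₀ hsv.ne',
      inv_mul_cancel_left₀ hsw.ne']
    simp only [hpe]
    obtain ⟨gK2, gv2, gw2⟩ := hint _ (continuous_sq_fun hgc)
    set J := (scale K)⁻¹ * ∫ x in hull K, ‖fderiv ℝ g x‖ ^ 2 with hJ
    have hP : (scale K)⁻¹ * (∫ x in hull K, g' x ^ 2) ≤ 2 ^ (m + 1) * (diam K ^ 2 * J) := by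
      have := mul_le_mul_of_nonneg_left hc (inv_nonneg.2 hsK.le)
      refine this.trans (le_of_eq ?_)
      rw [hJ]; ring
    have ht0 := hK.trace_inequality v hg'1
    have ht1 := hK.trace_inequality w hg'1
    simp only [hfd] at ht0 ht1
    rw [gv2, inv_mul_cancel_left₀ hsv.ne'] at ht0
    rw [gw2, inv_mul_cancel_left₀ hsw.ne'] at ht1
    have htr : (scale K)⁻¹ * ((m + 1) * (2 * (∫ x in hull K, g' x ^ 2) +
        diam K ^ 2 * ∫ x in hull K, ‖fderiv ℝ g x‖ ^ 2)) ≤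
        (m + 1) * (2 * (2 ^ (m + 1) * (diam K ^ 2 * J)) + diam K ^ 2 * J) := by
      have : (scale K)⁻¹ * ((m + 1) * (2 * (∫ x in hull K, g' x ^ 2) +
        diam K ^ 2 * ∫ x in hull K, ‖fderiv ℝ g x‖ ^ 2)) =
        (m + 1) * (2 * ((scale K)⁻¹ * ∫ x in hull K, g' x ^ 2) + diam K ^ 2 * J) := by
        rw [hJ]; ring
      rw [this]
      gcongr
    have hg2 : (scale K)⁻¹ * (∫ x in hull K, g' x ^ 2) =
        ∫ y, g' (simplexMap b y) ^ 2 ∂refMeasure m 2 := by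
      rw [gK2, inv_mul_cancel_left₀ hsK.ne']
    rw [hg2] at hP
    rw [Fin.sum_univ_three, Fin.sum_univ_three] at hbd
    simp only [Function.comp_apply] at hbd
    have hsq : ∀ i, ∫ y, (MvPolynomial.eval y p' - g' (simplexMap b y)) ^ 2 ∂refMeasure m i ≤
        2 * (∫ y, MvPolynomial.eval y p' ^ 2 ∂refMeasure m i) +
        2 * ∫ y, g' (simplexMap b y) ^ 2 ∂refMeasure m i := by
      intro i
      have hgb : Continuous fun y => g' (simplexMap b y) := hgc.comp (continuous_simplexMap b)
      have i1 := integrable_refMeasure (continuous_mul_fun (continuous_const (y := (2 : ℝ)))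
        (continuous_sq_fun (continuous_eval p'))) i
      have i2 := integrable_refMeasure (continuous_mul_fun (continuous_const (y := (2 : ℝ)))
        (continuous_sq_fun hgb)) i
      rw [← integral_const_mul, ← integral_const_mul, ← integral_add i1 i2]
      refine integral_mono (integrable_refMeasure
        (continuous_sq_fun ((continuous_eval p').sub hgb)) i) (i1.add i2) fun y => ?_
      simp only
      nlinarith [sq_nonneg (MvPolynomial.eval y p' + g' (simplexMap b y))]
    have s0 := hsq 0
    have s1 := hsq 1
    have s2 := hsq 2
    set A := diam K ^ 2 * J
    set G0 := ∫ y, g' (simplexMap b y) ^ 2 ∂refMeasure m 0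
    set G1 := ∫ y, g' (simplexMap b y) ^ 2 ∂refMeasure m 1
    set G2 := ∫ y, g' (simplexMap b y) ^ 2 ∂refMeasure m 2
    have hG : G0 + G1 + G2 ≤ ((4 * (m + 1) + 1) * 2 ^ (m + 1) + 2 * (m + 1)) * A := by
      have := ht0.trans htr
      have := ht1.trans htr
      nlinarith
    calc _ ≤ (2 * C + 2) * (G0 + G1 + G2) := by linarith
      _ ≤ (2 * C + 2) * (((4 * (m + 1) + 1) * 2 ^ (m + 1) + 2 * (m + 1)) * A) :=
        mul_le_mul_of_nonneg_left hG (by linarith)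
      _ = _ := by ring

end Phys

/-! ### Geometry of triangulations -/

namespace IsCell

variable {n : ℕ} {K L : Finset (E n)}

lemma affine_eq_of_eqOn (hL : IsCell L) {f g : E n →ᵃ[ℝ] ℝ} (h : ∀ u ∈ L, f u = g u) : f = g := by
  refine AffineMap.ext_on (s := (L : Set (E n))) ?_ fun u hu => h u hu
  have := hL.basis.tot
  have hr : Set.range hL.basis = (L : Set (E n)) := Subtype.range_coe
  rwa [hr] at this

/-- The barycentric coordinates opposite to a common face of two simplices are proportional. -/
lemma coord_eq_mul_coord (hK : IsCell K) (hL : IsCell L) {v : K} {w : L}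
    (he : K.erase (v : E n) = L.erase (w : E n)) (x : E n) :
    hK.coord v x = hK.coord v w * hL.coord w x := by
  -- Two affine functions are compared at the vertices of `L`: both vanish on the common face and
  -- agree at the apex `w`.
  have h : hK.coord v = hK.coord v w • hL.coord w := by
    refine hL.affine_eq_of_eqOn fun u hu => ?_
    simp only [AffineMap.coe_smul, Pi.smul_apply, smul_eq_mul]
    by_cases huw : u = w
    · subst huw
      rw [hL.coord_apply w w, if_pos rfl, mul_one]
    · have h1 : u ∈ L.erase (w : E n) := Finset.mem_erase.2 ⟨huw, hu⟩
      have h2 : u ∈ K.erase (v : E n) := by rwa [he]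
      rw [hK.coord_eq_zero (Finset.erase_subset _ _) (Finset.notMem_erase _ _)
        (mem_hull_of_mem h2), hL.coord_eq_zero (Finset.erase_subset _ _) (Finset.notMem_erase _ _)
        (mem_hull_of_mem h1), mul_zero]
  exact congrArg (fun f => f x) h

lemma coord_self (hK : IsCell K) (v : K) : hK.coord v v = 1 := by
  rw [hK.coord_apply, if_pos rfl]

lemma coord_apex_ne_zero (hK : IsCell K) (hL : IsCell L) {v : K} {w : L}
    (he : K.erase (v : E n) = L.erase (w : E n)) : hK.coord v w ≠ 0 := by
  intro h
  have := hK.coord_eq_mul_coord hL he v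
  rw [h, zero_mul, coord_self] at this
  exact one_ne_zero this

/-- Two different conforming simplices with a common face lie on opposite sides of it. -/
lemma coord_apex_neg (hK : IsCell K) (hL : IsCell L) (hKL : K ≠ L)
    (hconf : hull K ∩ hull L = convexHull ℝ ((K : Set (E n)) ∩ (L : Set (E n)))) {v : K} {w : L}
    (he : K.erase (v : E n) = L.erase (w : E n)) : hK.coord v w < 0 := by
  rcases lt_or_gt_of_ne (hK.coord_apex_ne_zero hL he) with h | h
  · exact h
  -- If the apex of `L` lay on the same side as `v`, points slightly moved from the barycentre `x₀`
  -- of the common face towards that apex would lie in both simplices. Conformity puts such points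
  -- in the hull of the common vertices, where the coordinate of `v` is zero.
  exfalso
  have hvL : (v : E n) ∉ L := by
    intro hv
    have hsub : K ⊆ L := by
      intro u hu
      by_cases huv : u = v
      · rwa [huv]
      · have : u ∈ L.erase (w : E n) := he ▸ Finset.mem_erase.2 ⟨huv, hu⟩
        exact Finset.mem_of_mem_erase this
    exact hKL (Finset.eq_of_subset_of_card_le hsub (by rw [hK.card, hL.card]))
  -- An empty face occurs only in dimension 0, where the space has one point and the two simplices
  -- coincide.
  rcases (K.erase (v : E n)).eq_empty_or_nonempty with hem | hne
  · have hn : n = 0 := by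
      have h1 := Finset.card_erase_of_mem v.2
      rw [hem, hK.card] at h1
      simpa using h1.symm
    subst hn
    exact hvL (Subsingleton.elim (w : E 0) v ▸ w.2)
  set e := K.erase (v : E n) with hedef
  set N : ℝ := (e.card : ℝ) with hN
  have hNpos : 0 < N := by rw [hN]; exact_mod_cast hne.card_pos
  set x₀ : E n := ∑ u ∈ e, N⁻¹ • u with hx₀
  have hx₀L : x₀ ∈ hull e := by
    refine (convex_convexHull ℝ _).sum_mem (fun _ _ => inv_nonneg.2 hNpos.le) ?_
      fun u hu => mem_hull_of_mem hu
    rw [Finset.sum_const, nsmul_eq_mul]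
    exact mul_inv_cancel₀ hNpos.ne'
  have hvx₀ : hK.coord v x₀ = 0 :=
    hK.coord_eq_zero (Finset.erase_subset _ _) (Finset.notMem_erase _ _) hx₀L
  have hux₀ : ∀ u : K, u ≠ v → 0 < hK.coord u x₀ := by
    intro u huv
    have hmem : (u : E n) ∈ e := Finset.mem_erase.2 ⟨fun h => huv (Subtype.ext h), u.2⟩
    have hsum : hK.coord u x₀ = ∑ u' ∈ e, N⁻¹ * hK.coord u u' := by
      have hw : ∑ u' ∈ e, N⁻¹ = 1 := by
        rw [Finset.sum_const, nsmul_eq_mul]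
        exact mul_inv_cancel₀ hNpos.ne'
      have hg : hK.coord u x₀ = hK.grad u x₀ + hK.coord u 0 := by
        have := hK.coord_add u x₀ 0
        rwa [zero_add] at this
      have hg' : ∀ y, hK.coord u y = hK.grad u y + hK.coord u 0 := fun y => by
        have := hK.coord_add u y 0
        rwa [zero_add] at this
      rw [hg, hx₀, map_sum]
      have h2 : ∀ u' ∈ e, N⁻¹ * hK.coord u u' = hK.grad u (N⁻¹ • u') + N⁻¹ * hK.coord u 0 := by
        intro u' _
        rw [hg' u', map_smul, smul_eq_mul, mul_add]
      rw [Finset.sum_congr rfl h2, Finset.sum_add_distrib, ← Finset.sum_mul, hw, one_mul]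
    rw [hsum]
    refine Finset.sum_pos' (fun u' hu' => mul_nonneg (inv_nonneg.2 hNpos.le)
      (hK.coord_nonneg (mem_hull_of_mem (Finset.mem_of_mem_erase hu')) u)) ⟨u, hmem, ?_⟩
    rw [coord_self, mul_one]
    exact inv_pos.2 hNpos
  -- a point near `x₀` in the direction of the apex of `L`
  have hev : ∀ᶠ t : ℝ in nhdsWithin 0 (Set.Ioi 0), ∀ u : K, u ≠ v →
      0 < hK.coord u ((1 - t) • x₀ + t • (w : E n)) := by
    rw [Filter.eventually_all]
    intro u
    by_cases huv : u = v
    · exact Filter.Eventually.of_forall fun t h => absurd huv h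
    have hc : Continuous fun t : ℝ => hK.coord u ((1 - t) • x₀ + t • (w : E n)) :=
      (hK.continuous_coord u).comp (by fun_prop)
    have h0 : 0 < hK.coord u ((1 - (0 : ℝ)) • x₀ + (0 : ℝ) • (w : E n)) := by
      simpa using hux₀ u huv
    have := hc.continuousAt.eventually (lt_mem_nhds h0)
    exact (this.filter_mono nhdsWithin_le_nhds).mono fun t ht _ => ht
  have hev2 : ∀ᶠ t : ℝ in nhdsWithin 0 (Set.Ioi 0), t ∈ Set.Ioo (0 : ℝ) 1 :=
    Ioo_mem_nhdsGT zero_lt_one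
  obtain ⟨t, ht, ht0, ht1⟩ := (hev.and hev2).exists
  set x := (1 - t) • x₀ + t • (w : E n) with hx
  have hvx : hK.coord v x = t * hK.coord v w := by
    have : hK.coord v x = (1 - t) • hK.coord v x₀ + t • hK.coord v w :=
      Convex.combo_affine_apply (by ring)
    rw [this, hvx₀]; simp
  have hxK : x ∈ hull K := by
    rw [hK.mem_hull]
    intro u
    by_cases huv : u = v
    · rw [huv, hvx]; positivity
    · exact (ht u huv).le
  have hxL : x ∈ hull L := by
    refine convex_convexHull ℝ _ ?_ (mem_hull_of_mem w.2) (by linarith) ht0.le (by ring)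
    rw [he] at hx₀L
    refine convexHull_mono ?_ hx₀L
    exact Finset.coe_subset.2 (Finset.erase_subset _ _)
  have hxKL : x ∈ convexHull ℝ ((K : Set (E n)) ∩ (L : Set (E n))) := hconf ▸ ⟨hxK, hxL⟩
  rw [← Finset.coe_inter] at hxKL
  have h0 : hK.coord v x = 0 := hK.coord_eq_zero Finset.inter_subset_left
    (fun h => hvL (Finset.mem_inter.1 h).2) hxKL
  rw [hvx] at h0
  have : 0 < t * hK.coord v w := mul_pos ht0 h
  linarith

end IsCell

/-! ### Outward normals and overlaps of simplices -/

namespace IsCell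

variable {m : ℕ} {K L : Finset (E (m + 1))}

lemma coord_centroid_face (hK : IsCell K) (v : K) :
    hK.coord v ((K.erase (v : E (m + 1))).centroid ℝ id) = 0 := by
  refine hK.coord_eq_zero (Finset.erase_subset _ _) (Finset.notMem_erase _ _) ?_
  refine Finset.centroid_mem_convexHull _ ?_
  rw [← Finset.card_pos, Finset.card_erase_of_mem v.2, hK.card]
  omega

lemma coord_centroid_pos (hK : IsCell K) (v : K) : 0 < hK.coord v (K.centroid ℝ id) := by
  have hne : K.Nonempty := ⟨v, v.2⟩
  have hw : ∑ u ∈ K, K.centroidWeights ℝ u = 1 :=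
    K.sum_centroidWeights_eq_one_of_nonempty ℝ hne
  rw [Finset.centroid_def, Finset.map_affineCombination _ _ _ hw,
    Finset.affineCombination_eq_linear_combination _ _ _ hw]
  simp only [Finset.centroidWeights_apply, Function.comp_apply, id, smul_eq_mul]
  have hc : (0 : ℝ) < (K.card : ℝ)⁻¹ := by
    rw [hK.card]; positivity
  refine Finset.sum_pos' (fun u hu => mul_nonneg hc.le (hK.coord_nonneg (mem_hull_of_mem hu) v))
    ⟨v, v.2, ?_⟩
  rw [coord_self, mul_one]
  exact hc

lemma grad_eq_zero_of_mem (hK : IsCell K) (v : K) {x : E (m + 1)}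
    (hx : x ∈ vectorSpan ℝ ((K.erase (v : E (m + 1)) : Finset (E (m + 1))) : Set (E (m + 1)))) :
    hK.grad v x = 0 := by
  have h : vectorSpan ℝ ((K.erase (v : E (m + 1)) : Finset (E (m + 1))) : Set (E (m + 1))) ≤
      LinearMap.ker (hK.grad v) := by
    rw [vectorSpan_def, Submodule.span_le]
    rintro _ ⟨a, ha, b, hb, rfl⟩
    have h1 := hK.coord_eq_zero (Finset.erase_subset _ _) (Finset.notMem_erase _ _)
      (mem_hull_of_mem (Finset.mem_coe.1 ha))
    have h2 := hK.coord_eq_zero (Finset.erase_subset _ _) (Finset.notMem_erase _ _)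
      (mem_hull_of_mem (Finset.mem_coe.1 hb))
    simp only [vsub_eq_sub, SetLike.mem_coe, LinearMap.mem_ker]
    rw [← coord_sub, h1, h2, sub_zero]
  exact h hx

/-- The projection onto the normal line does not change the pairing with the gradient of `coord v`,
which kills the directions of the face. For the vector between the barycentres this pairing is minus
the value of `coord v` at the barycentre of `K`, so it is negative; in particular the projected
vector is not zero and can be normalized. -/
lemma outwardNormal_spec (hK : IsCell K) (v : K) :
    outwardNormal K (K.erase (v : E (m + 1))) ∈
      (vectorSpan ℝ ((K.erase (v : E (m + 1)) : Finset (E (m + 1))) : Set (E (m + 1))))ᗮ ∧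
    ‖outwardNormal K (K.erase (v : E (m + 1)))‖ = 1 ∧
    hK.grad v (outwardNormal K (K.erase (v : E (m + 1)))) < 0 := by
  set V := vectorSpan ℝ ((K.erase (v : E (m + 1)) : Finset (E (m + 1))) : Set (E (m + 1))) with hV
  set x := (K.erase (v : E (m + 1))).centroid ℝ id - K.centroid ℝ id with hx
  have hon : outwardNormal K (K.erase (v : E (m + 1))) =
    ‖Vᗮ.starProjection x‖⁻¹ • Vᗮ.starProjection x := rfl
  have hmem : Vᗮ.starProjection x ∈ Vᗮ := Submodule.starProjection_apply_mem _ _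
  have hg : hK.grad v (Vᗮ.starProjection x) < 0 := by
    have h1 : x - Vᗮ.starProjection x ∈ Vᗮᗮ := Submodule.sub_starProjection_mem_orthogonal x
    rw [Submodule.orthogonal_orthogonal] at h1
    have h2 := hK.grad_eq_zero_of_mem v h1
    rw [map_sub, sub_eq_zero] at h2
    rw [← h2, hx, ← coord_sub, coord_centroid_face]
    linarith [hK.coord_centroid_pos v]
  have hne : Vᗮ.starProjection x ≠ 0 := fun h => by rw [h, map_zero] at hg; exact lt_irrefl _ hg
  have hnorm : 0 < ‖Vᗮ.starProjection x‖ := norm_pos_iff.2 hne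
  rw [hon]
  refine ⟨Submodule.smul_mem _ _ hmem, ?_, ?_⟩
  · rw [norm_smul, norm_inv, norm_norm, inv_mul_cancel₀ hnorm.ne']
  · rw [map_smul, smul_eq_mul]
    exact mul_neg_of_pos_of_neg (inv_pos.2 hnorm) hg

lemma norm_outwardNormal (hK : IsCell K) (v : K) :
    ‖outwardNormal K (K.erase (v : E (m + 1)))‖ = 1 := (hK.outwardNormal_spec v).2.1

lemma outwardNormal_orthogonal (hK : IsCell K) (v : K) {u w : E (m + 1)}
    (hu : u ∈ K.erase (v : E (m + 1))) (hw : w ∈ K.erase (v : E (m + 1))) :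
    ∑ j, (w - u) j * outwardNormal K (K.erase (v : E (m + 1))) j = 0 := by
  have h := (hK.outwardNormal_spec v).1
  rw [Submodule.mem_orthogonal] at h
  have h1 := h (w - u) (vsub_mem_vectorSpan ℝ (Finset.mem_coe.2 hw) (Finset.mem_coe.2 hu))
  rw [PiLp.inner_apply] at h1
  rw [← h1]
  refine Finset.sum_congr rfl fun j _ => ?_
  simp [mul_comm]

lemma finrank_orthogonal_face (hK : IsCell K) (v : K) : Module.finrank ℝ
    (vectorSpan ℝ ((K.erase (v : E (m + 1)) : Finset (E (m + 1))) : Set (E (m + 1))))ᗮ = 1 := by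
  have hind : AffineIndependent ℝ ((↑) : (K.erase (v : E (m + 1)) : Finset (E (m + 1))) → E (m + 1)) :=
    hK.indep.mono (Finset.coe_subset.2 (Finset.erase_subset _ _))
  have hc : Fintype.card (K.erase (v : E (m + 1)) : Finset (E (m + 1))) = m + 1 := by
    rw [Fintype.card_coe, Finset.card_erase_of_mem v.2, hK.card]; rfl
  have h1 := hind.finrank_vectorSpan hc
  have h2 : Set.range ((↑) : (K.erase (v : E (m + 1)) : Finset (E (m + 1))) → E (m + 1)) =
    ((K.erase (v : E (m + 1)) : Finset (E (m + 1))) : Set (E (m + 1))) := Subtype.range_coe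
  rw [h2] at h1
  have h3 := Submodule.finrank_add_finrank_orthogonal
    (vectorSpan ℝ ((K.erase (v : E (m + 1)) : Finset (E (m + 1))) : Set (E (m + 1))))
  rw [h1, finrank_euclideanSpace, Fintype.card_fin] at h3
  omega

/-- The normals on the two sides of a common face are opposite. -/
theorem outwardNormal_eq_neg (hK : IsCell K) (hL : IsCell L) (hKL : K ≠ L)
    (hconf : hull K ∩ hull L = convexHull ℝ ((K : Set (E (m + 1))) ∩ (L : Set (E (m + 1)))))
    {v : K} {w : L} (he : K.erase (v : E (m + 1)) = L.erase (w : E (m + 1))) :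
    outwardNormal L (L.erase (w : E (m + 1))) = -outwardNormal K (K.erase (v : E (m + 1))) := by
  obtain ⟨h1, h2, h3⟩ := hK.outwardNormal_spec v
  obtain ⟨h4, h5, h6⟩ := hL.outwardNormal_spec w
  have hneg := hK.coord_apex_neg hL hKL hconf he
  set ν := outwardNormal K (K.erase (v : E (m + 1)))
  set μ := outwardNormal L (L.erase (w : E (m + 1)))
  rw [← he] at h4
  have hν : ν ≠ 0 := fun h => by rw [h, norm_zero] at h2; exact zero_ne_one h2
  -- Both unit normals span the same line, so they differ by a factor `c` of modulus 1. Its sign is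
  -- read off the gradient of `coord v`, using that the two opposite coordinates are negative
  -- multiples of each other.
  obtain ⟨c, hc⟩ := (finrank_eq_one_iff_of_nonzero' (⟨ν, h1⟩ : _ᗮ)
    (fun h => hν (Subtype.ext_iff.1 h))).1 (hK.finrank_orthogonal_face v) ⟨μ, h4⟩
  have hc' : c • ν = μ := Subtype.ext_iff.1 hc
  have habs : |c| = 1 := by
    rw [← hc', norm_smul, h2, mul_one] at h5
    exact h5
  have hg : hK.grad v μ = hK.coord v w * hL.grad w μ := by
    have e1 := hK.coord_eq_mul_coord hL he μ
    have e2 := hK.coord_eq_mul_coord hL he 0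
    have e3 := hK.coord_sub v μ 0
    have e4 := hL.coord_sub w μ 0
    rw [sub_zero] at e3 e4
    rw [← e3, ← e4, e1, e2]; ring
  have hpos : 0 < hK.grad v μ := by
    rw [hg]; exact mul_pos_of_neg_of_neg hneg h6
  rw [← hc', map_smul, smul_eq_mul] at hpos
  have hcneg : c < 0 := by
    by_contra! h
    nlinarith
  rw [abs_of_neg hcneg] at habs
  rw [← hc', show c = -1 by linarith, neg_one_smul]

lemma affineSpan_erase_ne_top (hK : IsCell K) (v : K) :
    affineSpan ℝ ((K.erase (v : E (m + 1)) : Finset (E (m + 1))) : Set (E (m + 1))) ≠ ⊤ := by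
  intro h
  have h1 : affineSpan ℝ ((K.erase (v : E (m + 1)) : Finset (E (m + 1))) : Set (E (m + 1))) ≤
      AffineSubspace.mk' ((K.erase (v : E (m + 1))).centroid ℝ id) (LinearMap.ker (hK.grad v)) := by
    rw [affineSpan_le]
    intro x hx
    rw [SetLike.mem_coe, AffineSubspace.mem_mk', vsub_eq_sub, LinearMap.mem_ker, ← coord_sub,
      coord_centroid_face, hK.coord_eq_zero (Finset.erase_subset _ _) (Finset.notMem_erase _ _)
      (mem_hull_of_mem (Finset.mem_coe.1 hx)), sub_zero]
  have h2 : (v : E (m + 1)) ∈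
      AffineSubspace.mk' ((K.erase (v : E (m + 1))).centroid ℝ id) (LinearMap.ker (hK.grad v)) :=
    h1 (h ▸ AffineSubspace.mem_top ℝ _ _)
  rw [AffineSubspace.mem_mk', vsub_eq_sub, LinearMap.mem_ker, ← coord_sub,
      coord_centroid_face, coord_self] at h2
  norm_num at h2

lemma exists_notMem (hK : IsCell K) (hL : IsCell L) (hKL : K ≠ L) : ∃ v : K, (v : E (m + 1)) ∉ L := by
  by_contra! h
  exact hKL (Finset.eq_of_subset_of_card_le (fun u hu => h ⟨u, hu⟩) (by rw [hK.card, hL.card]))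

/-- Some vertex `v` of `K` is not shared, so the intersection lies in the hyperplane of the face
opposite `v`. -/
lemma volume_inter_eq_zero (hK : IsCell K) (hL : IsCell L) (hKL : K ≠ L)
    (hconf : hull K ∩ hull L = convexHull ℝ ((K : Set (E (m + 1))) ∩ (L : Set (E (m + 1))))) :
    volume (hull K ∩ hull L) = 0 := by
  obtain ⟨v, hv⟩ := hK.exists_notMem hL hKL
  refine measure_mono_null ?_ (Measure.addHaar_affineSubspace volume _
    (hK.affineSpan_erase_ne_top v))
  rw [hconf]
  refine (convexHull_mono ?_).trans (convexHull_subset_affineSpan _)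
  rintro u ⟨h1, h2⟩
  exact Finset.mem_coe.2 (Finset.mem_erase.2 ⟨fun h => hv (h ▸ h2), h1⟩)

lemma interior_hull_nonempty (hK : IsCell K) : (interior (hull K)).Nonempty := by
  have h := (hK.basis).interior_convexHull
  have hr : Set.range hK.basis = (K : Set (E (m + 1))) := Subtype.range_coe
  rw [hr] at h
  refine ⟨K.centroid ℝ id, ?_⟩
  rw [hull, h]
  exact fun v => hK.coord_centroid_pos v

end IsCell

/-! ### Trigonometric approximation on a cube -/

section Fourier

attribute [local instance] instMeasureSpaceUnitAddCircle

/-- The unit cube centred at the origin. -/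
def unitCube (d : Type*) : Set (d → ℝ) := {x | ∀ i, x i ∈ Set.Ioc (-(1 / 2) : ℝ) (-(1 / 2) + 1)}

variable {d : Type*} [Fintype d]

lemma isProbabilityMeasure_unitAddTorus :
    IsProbabilityMeasure (volume : Measure (UnitAddTorus d)) := by
  have : IsProbabilityMeasure (volume : Measure UnitAddCircle) :=
    inferInstanceAs (IsProbabilityMeasure AddCircle.haarAddCircle)
  infer_instance

attribute [local instance] isProbabilityMeasure_unitAddTorus

/-- The character of frequency `ξ`. -/
def character (ξ x : d → ℝ) : ℂ := Complex.exp ((2 * Real.pi * ∑ i, ξ i * x i : ℝ) * Complex.I)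

lemma norm_character (ξ x : d → ℝ) : ‖character ξ x‖ = 1 := Complex.norm_exp_ofReal_mul_I _

lemma character_add (ξ η x : d → ℝ) : character (ξ + η) x = character ξ x * character η x := by
  simp only [character, ← Complex.exp_add, Pi.add_apply, add_mul, Finset.sum_add_distrib, mul_add,
    Complex.ofReal_add]

lemma mFourier_coe (ξ : d → ℤ) (x : d → ℝ) :
    UnitAddTorus.mFourier ξ (fun i => (x i : UnitAddCircle)) = character (fun i => (ξ i : ℝ)) x := by
  simp only [UnitAddTorus.mFourier, ContinuousMap.coe_mk, fourier_coe_apply, character]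
  rw [← Complex.exp_sum]
  congr 1
  push_cast
  rw [Finset.mul_sum, Finset.sum_mul]
  refine Finset.sum_congr rfl fun i _ => ?_
  simp
  ring

lemma norm_sq_eq_integral {α : Type*} [MeasurableSpace α] {μ : Measure α} (f : Lp ℂ 2 μ) :
    ‖f‖ ^ 2 = ∫ t, ‖f t‖ ^ 2 ∂μ := by
  rw [← inner_self_eq_norm_sq (𝕜 := ℂ), L2.inner_def, ← integral_re (L2.integrable_inner f f)]
  simp only [inner_self_eq_norm_sq]

/-- **Parseval's identity** for trigonometric polynomials. -/
lemma integral_trigPoly (F : Finset (d → ℤ)) (a : (d → ℤ) → ℂ) :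
    ∫ x in unitCube d, ‖∑ ξ ∈ F, a ξ * character (fun i => (ξ i : ℝ)) x‖ ^ 2 =
      ∑ ξ ∈ F, ‖a ξ‖ ^ 2 := by
  have h1 := UnitAddTorus.integral_preimage
    (fun t : UnitAddTorus d => ‖∑ ξ ∈ F, a ξ * UnitAddTorus.mFourier ξ t‖ ^ 2)
    (fun _ => (-(1 / 2) : ℝ))
  simp only [mFourier_coe] at h1
  rw [unitCube, ← h1]
  set f : Lp ℂ 2 (volume : Measure (UnitAddTorus d)) :=
    ∑ ξ ∈ F, a ξ • UnitAddTorus.mFourierLp 2 ξ with hf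
  have h2 : f =ᵐ[volume] fun t => ∑ ξ ∈ F, a ξ * UnitAddTorus.mFourier ξ t := by
    have : f = ContinuousMap.toLp (E := ℂ) 2 volume ℂ (∑ ξ ∈ F, a ξ • UnitAddTorus.mFourier ξ) := by
      simp [hf, UnitAddTorus.mFourierLp, map_sum]
    rw [this]
    filter_upwards [ContinuousMap.coeFn_toLp (𝕜 := ℂ) (p := 2) (volume : Measure (UnitAddTorus d))
      (∑ ξ ∈ F, a ξ • UnitAddTorus.mFourier ξ)] with t ht
    rw [ht]
    simp [ContinuousMap.sum_apply]
  have h3 : ∫ t : UnitAddTorus d, ‖∑ ξ ∈ F, a ξ * UnitAddTorus.mFourier ξ t‖ ^ 2 = ‖f‖ ^ 2 := by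
    rw [norm_sq_eq_integral]
    refine integral_congr_ae ?_
    filter_upwards [h2] with t ht
    rw [ht]
  rw [h3, ← inner_self_eq_norm_sq (𝕜 := ℂ), hf, UnitAddTorus.orthonormal_mFourier.inner_sum,
    map_sum]
  refine Finset.sum_congr rfl fun ξ _ => ?_
  rw [RCLike.conj_mul, ← RCLike.ofReal_pow, RCLike.ofReal_re]

/-- Bounded measurable functions on the unit cube are approximated by their Fourier sums. -/
lemma exists_trigPoly {G : (d → ℝ) → ℂ} (hG : Measurable G) {B : ℝ} (hB : ∀ x, ‖G x‖ ≤ B)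
    {ε : ℝ} (hε : 0 < ε) : ∃ (F : Finset (d → ℤ)) (c : (d → ℤ) → ℂ),
      ∑ ξ ∈ F, ‖c ξ‖ ^ 2 ≤ ∫ x in unitCube d, ‖G x‖ ^ 2 ∧
      ∫ x in unitCube d, ‖∑ ξ ∈ F, c ξ * character (fun i => (ξ i : ℝ)) x - G x‖ ^ 2 ≤ ε := by
  set a : d → ℝ := fun _ => -(1 / 2)
  set h : UnitAddTorus d → ℂ := fun t => G (UnitAddTorus.measurableEquivPiIoc a t).1 with hh
  have hm : Measurable h :=
    hG.comp (measurable_subtype_coe.comp (UnitAddTorus.measurableEquivPiIoc a).measurable)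
  have hmem : MemLp h 2 (volume : Measure (UnitAddTorus d)) :=
    MemLp.of_bound hm.aestronglyMeasurable B (Filter.Eventually.of_forall fun t => hB _)
  have hval : ∀ x ∈ unitCube d, h (fun i => (x i : UnitAddCircle)) = G x := by
    intro x hx
    have := (UnitAddTorus.measurableEquivPiIoc a).apply_symm_apply ⟨x, hx⟩
    simp only [hh]
    rw [UnitAddTorus.coe_symm_measurableEquivPiIoc_apply] at this
    rw [this]
  have hcube : MeasurableSet (unitCube d) := by
    have : unitCube d = Set.pi Set.univ fun _ => Set.Ioc (-(1 / 2) : ℝ) (-(1 / 2) + 1) := by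
      ext x; simp [unitCube]
    rw [this]
    exact MeasurableSet.univ_pi fun _ => measurableSet_Ioc
  set f : Lp ℂ 2 (volume : Measure (UnitAddTorus d)) := hmem.toLp h
  have hfh : f =ᵐ[volume] h := hmem.coeFn_toLp
  set c := UnitAddTorus.mFourierCoeff f
  have hlim := UnitAddTorus.hasSum_mFourier_series_L2 f
  obtain ⟨F, hF⟩ := (Metric.tendsto_atTop.1 hlim (Real.sqrt ε) (Real.sqrt_pos.2 hε))
  have hF := hF F le_rfl
  refine ⟨F, c, ?_, ?_⟩
  · have h1 := sum_le_hasSum F (fun _ _ => by positivity) (UnitAddTorus.hasSum_sq_mFourierCoeff f)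
    refine h1.trans (le_of_eq ?_)
    have h2 : ∫ t, ‖f t‖ ^ 2 = ∫ t, ‖h t‖ ^ 2 := by
      refine integral_congr_ae ?_
      filter_upwards [hfh] with t ht
      rw [ht]
    rw [h2, UnitAddTorus.integral_preimage _ a]
    exact setIntegral_congr_fun hcube fun x hx => by simp only [hval x hx]
  · have h1 := UnitAddTorus.integral_preimage
      (fun t : UnitAddTorus d => ‖∑ ξ ∈ F, c ξ * UnitAddTorus.mFourier ξ t - h t‖ ^ 2) a
    simp only [mFourier_coe] at h1
    have h2 : ∫ x in unitCube d, ‖∑ ξ ∈ F, c ξ * character (fun i => (ξ i : ℝ)) x - G x‖ ^ 2 =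
        ∫ x in unitCube d, ‖∑ ξ ∈ F, c ξ * character (fun i => (ξ i : ℝ)) x -
          h (fun i => (x i : UnitAddCircle))‖ ^ 2 :=
      setIntegral_congr_fun hcube fun x hx => by simp only [hval x hx]
    rw [h2]
    refine (le_of_eq h1.symm).trans ?_
    have h3 : ((∑ ξ ∈ F, c ξ • UnitAddTorus.mFourierLp 2 ξ : Lp ℂ 2 volume) - f : Lp ℂ 2 volume)
        =ᵐ[volume] fun t => ∑ ξ ∈ F, c ξ * UnitAddTorus.mFourier ξ t - h t := by
      have : (∑ ξ ∈ F, c ξ • UnitAddTorus.mFourierLp 2 ξ : Lp ℂ 2 volume) =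
          ContinuousMap.toLp (E := ℂ) 2 (volume : Measure (UnitAddTorus d)) ℂ
            (∑ ξ ∈ F, c ξ • UnitAddTorus.mFourier ξ) := by
        simp [UnitAddTorus.mFourierLp, map_sum]
      filter_upwards [ContinuousMap.coeFn_toLp (𝕜 := ℂ) (p := 2)
        (volume : Measure (UnitAddTorus d)) (∑ ξ ∈ F, c ξ • UnitAddTorus.mFourier ξ), hfh,
        Lp.coeFn_sub (∑ ξ ∈ F, c ξ • UnitAddTorus.mFourierLp 2 ξ : Lp ℂ 2 volume) f]
        with t ht1 ht2 ht3
      rw [ht3, Pi.sub_apply, ht2, this, ht1]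
      simp [ContinuousMap.sum_apply]
    have h4 : ∫ t : UnitAddTorus d, ‖∑ ξ ∈ F, c ξ * UnitAddTorus.mFourier ξ t - h t‖ ^ 2 =
        ‖(∑ ξ ∈ F, c ξ • UnitAddTorus.mFourierLp 2 ξ : Lp ℂ 2 volume) - f‖ ^ 2 := by
      rw [norm_sq_eq_integral]
      refine integral_congr_ae ?_
      filter_upwards [h3] with t ht
      rw [ht]
    rw [h4, ← Real.sq_sqrt hε.le]
    rw [dist_eq_norm] at hF
    exact pow_le_pow_left₀ (norm_nonneg _) hF.le 2

end Fourier

/-! ### Approximate solutions of the Poisson equation -/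

section Poisson

variable {m : ℕ}

/-- The unit cube of Euclidean space. -/
def unitBox (n : ℕ) : Set (E n) := {x | x.ofLp ∈ unitCube (Fin n)}

lemma measurableSet_unitBox (n : ℕ) : MeasurableSet (unitBox n) := by
  have : unitCube (Fin n) = Set.pi Set.univ fun _ => Set.Ioc (-(1 / 2) : ℝ) (-(1 / 2) + 1) := by
    ext x; simp [unitCube]
  have h : MeasurableSet (unitCube (Fin n)) := by
    rw [this]
    exact MeasurableSet.univ_pi fun _ => measurableSet_Ioc
  exact (PiLp.volume_preserving_ofLp (Fin n)).measurable h

lemma isBounded_unitBox (n : ℕ) : Bornology.IsBounded (unitBox n) := by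
  refine (Metric.isBounded_iff_subset_closedBall 0).2 ⟨n, fun x hx => ?_⟩
  rw [mem_closedBall_zero_iff, EuclideanSpace.norm_eq]
  refine Real.sqrt_le_iff.2 ⟨by positivity, ?_⟩
  have : ∀ i, ‖x.ofLp i‖ ^ 2 ≤ 1 := fun i => by
    have := hx i
    rw [Real.norm_eq_abs, sq_abs]
    nlinarith [this.1, this.2]
  calc ∑ i, ‖x.ofLp i‖ ^ 2 ≤ ∑ _i : Fin n, (1 : ℝ) := Finset.sum_le_sum fun i _ => this i
    _ = n := by simp
    _ ≤ (n : ℝ) ^ 2 := by exact_mod_cast Nat.le_self_pow two_ne_zero n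

lemma integral_unitBox {n : ℕ} (f : (Fin n → ℝ) → ℝ) :
    ∫ x in unitBox n, f x.ofLp = ∫ x in unitCube (Fin n), f x :=
  (PiLp.volume_preserving_ofLp (Fin n)).setIntegral_preimage_emb
    (MeasurableEquiv.toLp 2 (Fin n → ℝ)).symm.measurableEmbedding f _

/-- A real trigonometric polynomial. -/
def trig {n : ℕ} {ι : Type*} (F : Finset ι) (η : ι → Fin n → ℝ) (a : ι → ℂ) (x : E n) : ℝ :=
  (∑ ξ ∈ F, a ξ * character (η ξ) x.ofLp).re

lemma contDiff_character {n : ℕ} (ξ : Fin n → ℝ) :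
    ContDiff ℝ ⊤ fun x : E n => character ξ x.ofLp := by
  unfold character
  refine ContDiff.cexp (ContDiff.mul ?_ contDiff_const)
  refine Complex.ofRealCLM.contDiff.comp (contDiff_const.mul (ContDiff.sum fun i _ =>
    contDiff_const.mul ?_))
  exact (EuclideanSpace.proj (𝕜 := ℝ) i : E n →L[ℝ] ℝ).contDiff

lemma contDiff_trig {n : ℕ} {ι : Type*} (F : Finset ι) (η : ι → Fin n → ℝ) (a : ι → ℂ) :
    ContDiff ℝ 1 (trig F η a) := by
  refine Complex.reCLM.contDiff.comp (ContDiff.sum fun i _ => contDiff_const.mul ?_)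
  exact (contDiff_character _).of_le le_top

lemma hasFDerivAt_character {n : ℕ} (ξ : Fin n → ℝ) (x : E n) :
    HasFDerivAt (fun x : E n => character ξ x.ofLp)
      (∑ i, (EuclideanSpace.proj (𝕜 := ℝ) i : E n →L[ℝ] ℝ).smulRight
        (2 * Real.pi * ξ i * Complex.I * character ξ x.ofLp)) x := by
  have h1 : HasFDerivAt (fun x : E n => 2 * Real.pi * ∑ i, ξ i * x.ofLp i)
      ((2 * Real.pi) • ∑ i, ξ i • (EuclideanSpace.proj (𝕜 := ℝ) i : E n →L[ℝ] ℝ)) x :=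
    (HasFDerivAt.fun_sum fun i _ =>
      ((EuclideanSpace.proj (𝕜 := ℝ) i : E n →L[ℝ] ℝ).hasFDerivAt.const_mul (ξ i))).const_mul _
  have h2 := ((Complex.ofRealCLM.hasFDerivAt.comp x h1).mul_const Complex.I).cexp
  refine h2.congr_fderiv ?_
  ext t
  simp [character, Finset.mul_sum, Finset.sum_mul]
  refine Finset.sum_congr rfl fun i _ => ?_
  ring

lemma fderiv_trig {n : ℕ} {ι : Type*} (F : Finset ι) (η : ι → Fin n → ℝ) (a : ι → ℂ)
    (x t : E n) : fderiv ℝ (trig F η a) x t =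
      ∑ j, trig F η (fun ξ => 2 * Real.pi * η ξ j * Complex.I * a ξ) x * t j := by
  have h : HasFDerivAt (trig F η a) _ x := Complex.reCLM.hasFDerivAt.comp x
    (HasFDerivAt.fun_sum (u := F) fun ξ _ => (hasFDerivAt_character (η ξ) x).const_mul (a ξ))
  rw [h.fderiv]
  simp only [trig, ContinuousLinearMap.comp_apply, sum_apply, smul_apply,
    Finset.smul_sum, Complex.reCLM_apply, Complex.re_sum, Finset.sum_mul]
  rw [Finset.sum_comm]
  refine Finset.sum_congr rfl fun j _ => Finset.sum_congr rfl fun ξ _ => ?_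
  rw [ContinuousLinearMap.smulRight_apply, PiLp.proj_apply, smul_comm, Complex.smul_re,
    smul_eq_mul, smul_eq_mul, mul_comm]
  congr 2
  ring

/-- The integer frequency `ξ`, shifted by half a unit in the first coordinate. -/
def shifted (ξ : Fin (m + 1) → ℤ) : Fin (m + 1) → ℝ := (fun i => (ξ i : ℝ)) + Pi.single 0 (1 / 2)

/-- The first component is a half-integer, so there is no zero frequency and the Laplacian can be
inverted without any condition on the mean of the data. -/
lemma quarter_le_sum_shifted (ξ : Fin (m + 1) → ℤ) : 1 / 4 ≤ ∑ i, shifted ξ i ^ 2 := by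
  have h0 : 1 / 4 ≤ shifted ξ 0 ^ 2 := by
    simp only [shifted, Pi.add_apply, Pi.single_eq_same]
    rcases le_or_gt 0 (ξ 0) with h | h
    · have : (0 : ℝ) ≤ ξ 0 := by exact_mod_cast h
      nlinarith
    · have : (ξ 0 : ℝ) ≤ -1 := by exact_mod_cast Int.le_sub_one_of_lt h
      nlinarith
  exact h0.trans (Finset.single_le_sum (f := fun i => shifted ξ i ^ 2)
    (fun i _ => sq_nonneg _) (Finset.mem_univ 0))

/-- The shift is multiplication by one unimodular function, so Parseval's identity for integer
frequencies carries over to the shifted ones. -/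
lemma sum_character_shifted (F : Finset (Fin (m + 1) → ℤ)) (a : (Fin (m + 1) → ℤ) → ℂ)
    (x : Fin (m + 1) → ℝ) : ∑ ξ ∈ F, a ξ * character (shifted ξ) x =
      (∑ ξ ∈ F, a ξ * character (fun i => (ξ i : ℝ)) x) * character (Pi.single 0 (1 / 2)) x := by
  rw [Finset.sum_mul]
  refine Finset.sum_congr rfl fun ξ _ => ?_
  rw [shifted, character_add, mul_assoc]

lemma sq_re_le (z : ℂ) : z.re ^ 2 ≤ ‖z‖ ^ 2 := by
  rw [← sq_abs]
  exact pow_le_pow_left₀ (abs_nonneg _) (Complex.abs_re_le_norm z) 2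

lemma continuous_character {d : Type*} [Fintype d] (ξ : d → ℝ) : Continuous (character ξ) := by
  unfold character
  fun_prop

lemma integrableOn_unitBox {n : ℕ} {f : E n → ℝ} (hf : Measurable f) {B : ℝ}
    (hB : ∀ x ∈ unitBox n, ‖f x‖ ≤ B) : IntegrableOn f (unitBox n) :=
  Measure.integrableOn_of_bounded (isBounded_unitBox n).measure_lt_top.ne hf.aestronglyMeasurable
    ((ae_restrict_iff' (measurableSet_unitBox n)).2 (Filter.Eventually.of_forall hB))

lemma continuous_integrableOn_unitBox {n : ℕ} {f : E n → ℝ} (hf : Continuous f) :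
    IntegrableOn f (unitBox n) :=
  (hf.continuousOn.integrableOn_compact (isBounded_unitBox n).isCompact_closure).mono_set
    subset_closure

lemma integral_sq_trig_le (F : Finset (Fin (m + 1) → ℤ)) (a : (Fin (m + 1) → ℤ) → ℂ) :
    ∫ x in unitBox (m + 1), trig F shifted a x ^ 2 ≤ ∑ ξ ∈ F, ‖a ξ‖ ^ 2 := by
  rw [← integral_trigPoly, ← integral_unitBox]
  refine setIntegral_mono ?_ ?_ fun x => ?_
  · exact continuous_integrableOn_unitBox ((contDiff_trig F shifted a).continuous.pow 2)
  · refine continuous_integrableOn_unitBox ?_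
    refine ((continuous_finsetSum _ fun ξ _ => continuous_const.mul
      ((continuous_character _).comp (PiLp.continuous_ofLp 2 _))).norm.pow 2)
  · refine (sq_re_le _).trans ?_
    rw [sum_character_shifted, norm_mul, norm_character, mul_one]

/-- Remove the half-unit shift from `g`, truncate the Fourier series and put the shift back. With
`c` the Fourier coefficients, the potential would have the coefficients −c/(4π²|ξ|²) at the shifted
frequencies ξ. Only its gradient `P` and Hessian `Q` are formed, with multipliers −iξ_i/(2π|ξ|²) and
ξ_iξ_j/|ξ|²; both are at most 1 in modulus, the first because |ξ|² ≥ 1/4. -/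
lemma exists_poisson_unitBox {g : E (m + 1) → ℝ} (hg : Measurable g) {B : ℝ}
    (hB : ∀ x, |g x| ≤ B) {ε : ℝ} (hε : 0 < ε) :
    ∃ (P : Fin (m + 1) → E (m + 1) → ℝ) (Q : Fin (m + 1) → Fin (m + 1) → E (m + 1) → ℝ),
      (∀ i j x, Q i j x = Q j i x) ∧ (∀ i, ContDiff ℝ 1 (P i)) ∧
      (∀ i x t, fderiv ℝ (P i) x t = ∑ j, Q i j x * t j) ∧ (∀ i j, Continuous (Q i j)) ∧
      ∫ x in unitBox (m + 1), (∑ i, Q i i x - g x) ^ 2 ≤ ε ∧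
      (∀ i, ∫ x in unitBox (m + 1), P i x ^ 2 ≤ ∫ x in unitBox (m + 1), g x ^ 2) ∧
      ∀ i j, ∫ x in unitBox (m + 1), Q i j x ^ 2 ≤ ∫ x in unitBox (m + 1), g x ^ 2 := by
  set e : Fin (m + 1) → ℝ := Pi.single 0 (1 / 2) with he
  set G : (Fin (m + 1) → ℝ) → ℂ := fun x => character (-e) x * (g (WithLp.toLp 2 x) : ℂ) with hG
  have hGm : Measurable G := (continuous_character _).measurable.mul
    (Complex.measurable_ofReal.comp (hg.comp (PiLp.continuous_toLp 2 _).measurable))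
  have hGn : ∀ x, ‖G x‖ = |g (WithLp.toLp 2 x)| := fun x => by
    rw [hG, norm_mul, norm_character, one_mul, Complex.norm_real, Real.norm_eq_abs]
  obtain ⟨F, c, hc, happ⟩ := exists_trigPoly hGm (fun x => (hGn x).trans_le (hB _)) hε
  have hcg : ∑ ξ ∈ F, ‖c ξ‖ ^ 2 ≤ ∫ x in unitBox (m + 1), g x ^ 2 := by
    refine hc.trans (le_of_eq ?_)
    rw [← integral_unitBox]
    simp only [hGn, sq_abs]
  set N : (Fin (m + 1) → ℤ) → ℝ := fun ξ => ∑ i, shifted ξ i ^ 2 with hN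
  have hN4 : ∀ ξ, 1 / 4 ≤ N ξ := quarter_le_sum_shifted
  have hN0 : ∀ ξ, 0 < N ξ := fun ξ => lt_of_lt_of_le (by norm_num) (hN4 ξ)
  have hNc : ∀ ξ, (N ξ : ℂ) ≠ 0 := fun ξ => Complex.ofReal_ne_zero.2 (hN0 ξ).ne'
  have hsq : ∀ ξ i, shifted ξ i ^ 2 ≤ N ξ := fun ξ i =>
    Finset.single_le_sum (f := fun i => shifted ξ i ^ 2) (fun i _ => sq_nonneg _)
      (Finset.mem_univ i)
  set a : Fin (m + 1) → (Fin (m + 1) → ℤ) → ℂ := fun i ξ =>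
    ((shifted ξ i / (2 * Real.pi * N ξ) : ℝ) : ℂ) * (-Complex.I * c ξ) with ha
  set q : Fin (m + 1) → Fin (m + 1) → (Fin (m + 1) → ℤ) → ℂ := fun i j ξ =>
    ((shifted ξ i * shifted ξ j / N ξ : ℝ) : ℂ) * c ξ with hq
  have haq : ∀ i j, (fun ξ => 2 * Real.pi * shifted ξ j * Complex.I * a i ξ) = q i j := by
    intro i j
    funext ξ
    have h1 : (Real.pi : ℂ) ≠ 0 := Complex.ofReal_ne_zero.2 Real.pi_ne_zero
    have h2 := hNc ξ
    simp only [ha, hq]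
    push_cast
    field_simp
    rw [Complex.I_sq]
    ring
  refine ⟨fun i => trig F shifted (a i), fun i j => trig F shifted (q i j), ?_, ?_, ?_, ?_, ?_,
    ?_, ?_⟩
  · intro i j x
    simp only [hq, mul_comm]
  · exact fun i => contDiff_trig F shifted (a i)
  · intro i x t
    simp only [fderiv_trig, haq]
  · exact fun i j => (contDiff_trig F shifted (q i j)).continuous
  · refine le_trans ?_ happ
    have hsum : ∀ x, ∑ i, trig F shifted (q i i) x = trig F shifted c x := by
      intro x
      simp only [trig]
      rw [← Complex.re_sum, Finset.sum_comm]
      congr 1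
      refine Finset.sum_congr rfl fun ξ _ => ?_
      rw [← Finset.sum_mul]
      congr 1
      simp only [hq]
      rw [← Finset.sum_mul, ← Complex.ofReal_sum, ← Finset.sum_div]
      simp only [← sq]
      rw [div_self (hN0 ξ).ne', Complex.ofReal_one, one_mul]
    rw [← integral_unitBox]
    simp only [hsum]
    -- `g` is real, so taking real parts after restoring the unimodular factor cannot increase the
    -- error.
    have hpt : ∀ x : E (m + 1), (trig F shifted c x - g x) ^ 2 ≤
        ‖∑ ξ ∈ F, c ξ * character (fun i => (ξ i : ℝ)) x.ofLp - G x.ofLp‖ ^ 2 := by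
      intro x
      have h1 : trig F shifted c x - g x =
          ((∑ ξ ∈ F, c ξ * character (fun i => (ξ i : ℝ)) x.ofLp - G x.ofLp) *
            character e x.ofLp).re := by
        rw [sub_mul, ← sum_character_shifted, Complex.sub_re, hG]
        have h2 : character (-e) x.ofLp * (g (WithLp.toLp 2 x.ofLp) : ℂ) * character e x.ofLp =
            g x := by
          rw [mul_right_comm, ← character_add, neg_add_cancel]
          simp [character]
        simp only [h2, Complex.ofReal_re, trig]
      rw [h1]
      refine (sq_re_le _).trans ?_
      rw [norm_mul, norm_character, mul_one]
    refine setIntegral_mono ?_ ?_ hpt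
    · obtain ⟨D, hD⟩ := (isBounded_unitBox (m + 1)).isCompact_closure.exists_bound_of_continuousOn
        (contDiff_trig F shifted c).continuous.continuousOn
      refine integrableOn_unitBox (B := (D + B) ^ 2) (((contDiff_trig F shifted c).continuous.measurable.sub hg).pow_const 2) ?_
      intro x hx
      rw [norm_pow]
      refine pow_le_pow_left₀ (norm_nonneg _) ((norm_sub_le _ _).trans ?_) 2
      exact add_le_add (hD x (subset_closure hx)) (hB x)
    · have hcont : Continuous fun x : E (m + 1) =>
          ∑ ξ ∈ F, c ξ * character (fun i => (ξ i : ℝ)) x.ofLp :=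
        continuous_finsetSum _ fun ξ _ => continuous_const.mul
          ((continuous_character _).comp (PiLp.continuous_ofLp 2 _))
      obtain ⟨D, hD⟩ := (isBounded_unitBox (m + 1)).isCompact_closure.exists_bound_of_continuousOn
        hcont.continuousOn
      refine integrableOn_unitBox (B := (D + B) ^ 2) ((hcont.measurable.sub
        (hGm.comp (PiLp.continuous_ofLp 2 _).measurable)).norm.pow_const 2) ?_
      intro x hx
      rw [norm_pow, norm_norm]
      refine pow_le_pow_left₀ (norm_nonneg _) ((norm_sub_le _ _).trans ?_) 2
      exact add_le_add (hD x (subset_closure hx)) ((hGn _).trans_le (hB _))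
  · intro i
    refine (integral_sq_trig_le F _).trans (le_trans (Finset.sum_le_sum fun ξ _ => ?_) hcg)
    refine pow_le_pow_left₀ (norm_nonneg _) ?_ 2
    simp only [ha]
    rw [norm_mul, norm_mul, norm_neg, Complex.norm_I, one_mul, Complex.norm_real, Real.norm_eq_abs]
    refine mul_le_of_le_one_left (norm_nonneg _) ?_
    have hpi := Real.pi_gt_three
    rw [abs_div, abs_of_pos (by have := hN0 ξ; positivity : 0 < 2 * Real.pi * N ξ),
      div_le_one (by have := hN0 ξ; positivity)]
    refine abs_le_of_sq_le_sq (le_trans (hsq ξ i) ?_) (by have := hN0 ξ; positivity)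
    have h1 := hN4 ξ
    have h2 : 1 ≤ (2 * Real.pi) ^ 2 * N ξ := by nlinarith
    calc N ξ ≤ ((2 * Real.pi) ^ 2 * N ξ) * N ξ := le_mul_of_one_le_left (hN0 ξ).le h2
      _ = _ := by ring
  · intro i j
    refine (integral_sq_trig_le F _).trans (le_trans (Finset.sum_le_sum fun ξ _ => ?_) hcg)
    refine pow_le_pow_left₀ (norm_nonneg _) ?_ 2
    simp only [hq]
    rw [norm_mul, Complex.norm_real, Real.norm_eq_abs]
    refine mul_le_of_le_one_left (norm_nonneg _) ?_
    rw [abs_div, abs_of_pos (hN0 ξ), div_le_one (hN0 ξ), abs_le]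
    have h1 := hsq ξ i
    have h2 := hsq ξ j
    constructor <;> nlinarith [sq_nonneg (shifted ξ i + shifted ξ j),
      sq_nonneg (shifted ξ i - shifted ξ j)]

/-- The cube of side length `R`. -/
def box (n : ℕ) (R : ℝ) : Set (E n) := (fun x => R • x) '' unitBox n

/-- Approximate solutions of the Poisson equation on a cube: `P` and `Q` are the first and second
derivatives of a function whose Laplacian is close to `g`. -/
theorem exists_poisson {R : ℝ} (hR : 0 < R) {g : E (m + 1) → ℝ} (hg : Measurable g) {B : ℝ}
    (hB : ∀ x, |g x| ≤ B) {ε : ℝ} (hε : 0 < ε) :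
    ∃ (P : Fin (m + 1) → E (m + 1) → ℝ) (Q : Fin (m + 1) → Fin (m + 1) → E (m + 1) → ℝ),
      (∀ i j x, Q i j x = Q j i x) ∧ (∀ i, ContDiff ℝ 1 (P i)) ∧
      (∀ i x t, fderiv ℝ (P i) x t = ∑ j, Q i j x * t j) ∧ (∀ i j, Continuous (Q i j)) ∧
      ∫ x in box (m + 1) R, (∑ i, Q i i x - g x) ^ 2 ≤ ε ∧
      (∀ i, ∫ x in box (m + 1) R, P i x ^ 2 ≤ R ^ 2 * ∫ x in box (m + 1) R, g x ^ 2) ∧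
      ∀ i j, ∫ x in box (m + 1) R, Q i j x ^ 2 ≤ ∫ x in box (m + 1) R, g x ^ 2 := by
  have hR' := hR.ne'
  have key : ∀ f : E (m + 1) → ℝ, ∫ x in box (m + 1) R, f x =
      R ^ (m + 1) * ∫ x in unitBox (m + 1), f (R • x) := by
    intro f
    rw [Measure.setIntegral_comp_smul_of_pos volume f _ hR, finrank_euclideanSpace_fin, smul_eq_mul,
      mul_inv_cancel_left₀ (pow_ne_zero _ hR')]
    rfl
  obtain ⟨P, Q, hsymm, hP, hPQ, hQ, happ, hPn, hQn⟩ := exists_poisson_unitBox (m := m)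
    (g := fun x => g (R • x)) (hg.comp (measurable_const_smul R)) (fun x => hB _)
    (ε := ε / R ^ (m + 1)) (by positivity)
  have hinv : ∀ x : E (m + 1), R⁻¹ • R • x = x := fun x => inv_smul_smul₀ hR' x
  -- The rescaled potential is R² φ(x / R): its gradient keeps one factor `R` and its Hessian none.
  refine ⟨fun i x => R * P i (R⁻¹ • x), fun i j x => Q i j (R⁻¹ • x), fun i j x => hsymm i j _,
    fun i => contDiff_const.mul ((hP i).comp (contDiff_const_smul R⁻¹)), ?_,
    fun i j => (hQ i j).comp (continuous_const_smul R⁻¹), ?_, ?_, ?_⟩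
  · intro i x t
    have h1 : HasFDerivAt (fun x : E (m + 1) => R⁻¹ • x)
      (R⁻¹ • ContinuousLinearMap.id ℝ (E (m + 1))) x := (hasFDerivAt_id x).const_smul R⁻¹
    have h2 : HasFDerivAt (fun x => R * P i (R⁻¹ • x)) _ x :=
      ((((hP i).differentiable one_ne_zero) (R⁻¹ • x)).hasFDerivAt.comp x h1).const_mul R
    rw [h2.fderiv]
    simp only [smul_apply, ContinuousLinearMap.comp_apply, ContinuousLinearMap.id_apply, hPQ,
      smul_eq_mul, PiLp.smul_apply]
    rw [Finset.mul_sum]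
    refine Finset.sum_congr rfl fun j _ => ?_
    field_simp
  · rw [key]
    simp only [hinv]
    rw [le_div_iff₀' (by positivity)] at happ
    exact happ
  · intro i
    rw [key, key]
    simp only [hinv, mul_pow]
    rw [integral_const_mul, mul_left_comm]
    have := hPn i
    gcongr
  · intro i j
    rw [key, key]
    simp only [hinv]
    have := hQn i j
    gcongr

end Poisson

/-! ### Symmetric tensor fields with prescribed divergence -/

section Divergence

variable {m : ℕ}

lemma isBounded_box (n : ℕ) (R : ℝ) : Bornology.IsBounded (box n R) :=
  (isBounded_unitBox n).smul₀ R

lemma measurableSet_box (n : ℕ) {R : ℝ} (hR : 0 < R) : MeasurableSet (box n R) :=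
  (measurableSet_unitBox n).const_smul_of_ne_zero hR.ne'

lemma continuous_integrableOn_box {n : ℕ} {R : ℝ} {f : E n → ℝ} (hf : Continuous f) :
    IntegrableOn f (box n R) :=
  (hf.continuousOn.integrableOn_compact (isBounded_box n R).isCompact_closure).mono_set
    subset_closure

lemma mem_box {n : ℕ} {R : ℝ} (hR : 0 < R) {x : E n} (hx : 2 * ‖x‖ < R) : x ∈ box n R := by
  refine ⟨R⁻¹ • x, fun i => ?_, smul_inv_smul₀ hR.ne' x⟩
  have h1 : |x.ofLp i| ≤ ‖x‖ := PiLp.norm_apply_le x i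
  have h2 : |R⁻¹ * x.ofLp i| < 1 / 2 := by
    rw [abs_mul, abs_of_pos (inv_pos.2 hR), ← div_eq_inv_mul, div_lt_iff₀ hR]
    linarith
  have h3 := abs_lt.1 h2
  simp only [PiLp.smul_apply, smul_eq_mul]
  exact ⟨h3.1, by linarith [h3.2]⟩

lemma integral_sq_combination_le {n : ℕ} {R : ℝ} {a b : E n → ℝ} {c : Fin n → E n → ℝ}
    (ha : Continuous a) (hb : Continuous b) (hc : ∀ k, Continuous (c k)) {δ S : ℝ}
    (hδ : δ ^ 2 ≤ 1) (haS : ∫ x in box n R, a x ^ 2 ≤ S)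
    (hbS : ∫ x in box n R, b x ^ 2 ≤ S) (hcS : ∀ k, ∫ x in box n R, c k x ^ 2 ≤ S) :
    ∫ x in box n R, (a x + b x - δ * ∑ k, c k x) ^ 2 ≤ 3 * (2 + (n : ℝ) ^ 2) * S := by
  have hpt : ∀ x, (a x + b x - δ * ∑ k, c k x) ^ 2 ≤
      3 * (a x ^ 2 + b x ^ 2 + n * ∑ k, c k x ^ 2) := by
    intro x
    have h1 : (∑ k, c k x) ^ 2 ≤ n * ∑ k, c k x ^ 2 := by
      have := sq_sum_le_card_mul_sum_sq (s := Finset.univ) (f := fun k => c k x)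
      simpa using this
    have h2 : δ ^ 2 * (∑ k, c k x) ^ 2 ≤ (∑ k, c k x) ^ 2 :=
      mul_le_of_le_one_left (sq_nonneg _) hδ
    nlinarith [sq_nonneg (a x - b x), sq_nonneg (a x + δ * ∑ k, c k x),
      sq_nonneg (b x + δ * ∑ k, c k x)]
  have hca : Continuous fun x => ∑ k, c k x := continuous_finsetSum _ fun k _ => hc k
  have hcb : Continuous fun x => ∑ k, c k x ^ 2 := continuous_finsetSum _ fun k _ => (hc k).pow 2
  refine (setIntegral_mono (g := fun x => 3 * (a x ^ 2 + b x ^ 2 + n * ∑ k, c k x ^ 2))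
    (continuous_integrableOn_box (by fun_prop))
    (continuous_integrableOn_box (by fun_prop)) hpt).trans ?_
  rw [integral_const_mul, integral_add (continuous_integrableOn_box (by fun_prop))
    (continuous_integrableOn_box (by fun_prop)), integral_add
    (continuous_integrableOn_box (by fun_prop)) (continuous_integrableOn_box (by fun_prop)),
    integral_const_mul, integral_finsetSum (f := fun k x => c k x ^ 2) _
      fun k _ => continuous_integrableOn_box (f := fun x => c k x ^ 2) ((hc k).pow 2)]
  have : ∑ k, ∫ x in box n R, c k x ^ 2 ≤ ∑ _k : Fin n, S := Finset.sum_le_sum fun k _ => hcS k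
  rw [Finset.sum_const, Finset.card_univ, Fintype.card_fin, nsmul_eq_mul] at this
  have h2 := mul_le_mul_of_nonneg_left this (Nat.cast_nonneg (α := ℝ) n)
  nlinarith

lemma opNorm_sq_le {n : ℕ} (L : E n →L[ℝ] ℝ) (a : Fin n → ℝ) (h : ∀ t, L t = ∑ j, a j * t j) :
    ‖L‖ ^ 2 ≤ ∑ j, a j ^ 2 := by
  have h0 : 0 ≤ ∑ j, a j ^ 2 := Finset.sum_nonneg fun _ _ => sq_nonneg _
  rw [← Real.sq_sqrt h0]
  refine pow_le_pow_left₀ (norm_nonneg _) (L.opNorm_le_bound (Real.sqrt_nonneg _) fun t => ?_) 2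
  rw [h, EuclideanSpace.norm_eq, ← Real.sqrt_mul h0, Real.norm_eq_abs]
  refine Real.abs_le_sqrt ?_
  simp only [Real.norm_eq_abs, sq_abs]
  exact Finset.sum_mul_sq_le_sq_mul_sq _ _ _

/-- Every bounded vector field is, up to a small error in `L²`, the divergence of a symmetric
tensor field which is bounded in `H¹`. -/
theorem exists_symmetric_divergence {R : ℝ} (hR : 0 < R) {f : Fin (m + 1) → E (m + 1) → ℝ}
    (hf : ∀ i, Measurable (f i)) {B : ℝ} (hB : ∀ i x, |f i x| ≤ B) {ε : ℝ} (hε : 0 < ε) :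
    ∃ τ : Fin (m + 1) → Fin (m + 1) → E (m + 1) → ℝ,
      (∀ i j, τ i j = τ j i) ∧ (∀ i j, ContDiff ℝ 1 (τ i j)) ∧
      (∀ i, ∫ x in box (m + 1) R,
        (∑ j, fderiv ℝ (τ i j) x (EuclideanSpace.single j 1) - f i x) ^ 2 ≤ ε) ∧
      (∀ i j, ∫ x in box (m + 1) R, τ i j x ^ 2 ≤
        3 * (2 + ((m + 1 : ℕ) : ℝ) ^ 2) * (R ^ 2 * ∑ k, ∫ x in box (m + 1) R, f k x ^ 2)) ∧
      ∀ i j, ∫ x in box (m + 1) R, ‖fderiv ℝ (τ i j) x‖ ^ 2 ≤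
        (m + 1 : ℕ) * (3 * (2 + ((m + 1 : ℕ) : ℝ) ^ 2) *
          ∑ k, ∫ x in box (m + 1) R, f k x ^ 2) := by
  -- `P i j` and `Q i j l` stand for ∂_j φ_i and ∂_l ∂_j φ_i, where Δφ_i is close to `f i`.
  choose P Q hsymm hP hPQ hQ happ hPn hQn using fun i =>
    exists_poisson (m := m) hR (hf i) (hB i) hε
  have hnn : ∀ k, 0 ≤ ∫ x in box (m + 1) R, f k x ^ 2 := fun k =>
    integral_nonneg fun x => sq_nonneg _
  have hle : ∀ k, ∫ x in box (m + 1) R, f k x ^ 2 ≤ ∑ k, ∫ x in box (m + 1) R, f k x ^ 2 :=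
    fun k => Finset.single_le_sum (f := fun k => ∫ x in box (m + 1) R, f k x ^ 2)
      (fun k _ => hnn k) (Finset.mem_univ k)
  have hδ : ∀ i j : Fin (m + 1), (if i = j then (1 : ℝ) else 0) ^ 2 ≤ 1 := fun i j => by
    split_ifs <;> norm_num
  have hder : ∀ i j x t, fderiv ℝ (fun x => P i j x + P j i x -
      (if i = j then 1 else 0) * ∑ k, P k k x) x t = ∑ l, (Q i j l x + Q j i l x -
        (if i = j then 1 else 0) * ∑ k, Q k k l x) * t l := by
    intro i j x t
    have hd : ∀ a b, DifferentiableAt ℝ (P a b) x := fun a b =>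
      (hP a b).differentiable one_ne_zero x
    have hsum : DifferentiableAt ℝ (fun x => ∑ k, P k k x) x :=
      DifferentiableAt.fun_sum fun k _ => hd k k
    rw [fderiv_fun_sub ((hd i j).fun_add (hd j i)) (hsum.const_mul _),
      fderiv_fun_add (hd i j) (hd j i), fderiv_const_mul hsum,
      fderiv_fun_sum fun k _ => hd k k]
    simp only [sub_apply, add_apply, smul_apply, sum_apply, hPQ, smul_eq_mul]
    rw [Finset.sum_comm]
    simp only [sub_mul, add_mul, Finset.sum_sub_distrib, Finset.sum_add_distrib, Finset.mul_sum,
      Finset.sum_mul, mul_assoc]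
  -- This is ∇φ + (∇φ)ᵀ − (div φ) I. By symmetry of second derivatives the last two terms have
  -- divergence ∇ div φ and −∇ div φ, so what is left is Δφ.
  refine ⟨fun i j x => P i j x + P j i x - (if i = j then 1 else 0) * ∑ k, P k k x, ?_, ?_, ?_,
    ?_, ?_⟩
  · intro i j
    funext x
    by_cases h : i = j
    · rw [h]
    · simp only [if_neg h, if_neg (Ne.symm h), add_comm]
  · exact fun i j => ((hP i j).add (hP j i)).sub
      (contDiff_const.mul (ContDiff.sum fun k _ => hP k k))
  · intro i
    refine le_trans (le_of_eq ?_) (happ i)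
    congr 1
    funext x
    congr 2
    simp only [hder]
    have h1 : ∀ j, ∑ l, (Q i j l x + Q j i l x - (if i = j then 1 else 0) * ∑ k, Q k k l x) *
        (EuclideanSpace.single j (1 : ℝ) : E (m + 1)) l =
        Q i j j x + Q j i j x - (if i = j then 1 else 0) * ∑ k, Q k k j x := by
      intro j
      rw [Finset.sum_eq_single j]
      · simp
      · intro l _ hl
        simp [hl]
      · simp
    simp only [h1]
    simp only [Finset.sum_sub_distrib, Finset.sum_add_distrib, ite_mul, one_mul, zero_mul,
      Finset.sum_ite_eq, Finset.mem_univ, if_true]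
    have h2 : ∑ j, Q j i j x = ∑ k, Q k k i x := Finset.sum_congr rfl fun j _ => hsymm j i j x
    rw [h2]
    ring
  · intro i j
    refine integral_sq_combination_le (hP i j).continuous (hP j i).continuous
      (fun k => (hP k k).continuous) (hδ i j) ?_ ?_ fun k => ?_
    all_goals refine (hPn _ _).trans ?_
    all_goals exact mul_le_mul_of_nonneg_left (hle _) (sq_nonneg R)
  · intro i j
    have hc : ∀ l, Continuous fun x => (Q i j l x + Q j i l x -
        (if i = j then 1 else 0) * ∑ k, Q k k l x) ^ 2 := fun l =>
      (((hQ i j l).add (hQ j i l)).sub (continuous_const.mul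
        (continuous_finsetSum _ fun k _ => hQ k k l))).pow 2
    refine (setIntegral_mono (g := fun x => ∑ l, (Q i j l x + Q j i l x -
        (if i = j then 1 else 0) * ∑ k, Q k k l x) ^ 2) ?_ ?_
        fun x => opNorm_sq_le _ _ (hder i j x)).trans ?_
    · refine continuous_integrableOn_box (Continuous.pow (Continuous.norm ?_) 2)
      exact ContDiff.continuous_fderiv (((hP i j).add (hP j i)).sub
        (contDiff_const.mul (ContDiff.sum fun k _ => hP k k))) one_ne_zero
    · exact continuous_integrableOn_box (continuous_finsetSum _ fun l _ => hc l)
    · rw [integral_finsetSum _ fun l _ => continuous_integrableOn_box (hc l)]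
      refine (Finset.sum_le_card_nsmul _ _ _ fun l _ => integral_sq_combination_le (hQ i j l)
        (hQ j i l) (fun k => hQ k k l) (hδ i j) ((hQn _ _ _).trans (hle _))
        ((hQn _ _ _).trans (hle _)) fun k => (hQn _ _ _).trans (hle _)).trans ?_
      rw [Finset.card_univ, Fintype.card_fin, nsmul_eq_mul]

end Divergence

/-! ### Interior faces and connectivity of triangulations -/

namespace Triangulation

variable {m : ℕ} {Ω : Set (E (m + 1))} (T : Triangulation Ω)

lemma isCell (K : T.cells) : IsCell K.1 := ⟨T.card_cell K K.2, T.indep K K.2⟩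

lemma mem_adjacent {e : Finset (E (m + 1))} {K : T.cells} : K ∈ T.adjacent e ↔ e ⊆ K.1 := by
  simp [adjacent]

lemma exists_eq_erase {e : Finset (E (m + 1))} (he : e.card = m + 1) {K : T.cells}
    (hK : e ⊆ K.1) : ∃ v : K.1, e = K.1.erase (v : E (m + 1)) := by
  obtain ⟨v, hvK, hve⟩ : ∃ v ∈ K.1, v ∉ e := by
    by_contra! h
    have := Finset.card_le_card (fun u hu => h u hu : K.1 ⊆ e)
    rw [he, T.card_cell K K.2] at this
    omega
  refine ⟨⟨v, hvK⟩, Finset.eq_of_subset_of_card_le (fun u hu => Finset.mem_erase.2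
    ⟨fun h => hve ((show u = v from h) ▸ hu), hK hu⟩) ?_⟩
  rw [he, Finset.card_erase_of_mem hvK, T.card_cell K K.2]
  omega

lemma card_of_mem_interiorFaces {e : Finset (E (m + 1))} (he : e ∈ T.interiorFaces) :
    e.card = m + 1 := by
  simp only [interiorFaces, Finset.mem_filter, Finset.mem_biUnion, Finset.mem_powersetCard] at he
  obtain ⟨⟨K, _, _, h⟩, _⟩ := he
  exact h

/-- The two elements sharing an interior face. -/
lemma exists_adjacent_eq {e : Finset (E (m + 1))} (he : e ∈ T.interiorFaces) :
    ∃ K L : T.cells, K.1 ≠ L.1 ∧ T.adjacent e = {K, L} ∧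
      ∃ (v : K.1) (w : L.1), e = K.1.erase (v : E (m + 1)) ∧ e = L.1.erase (w : E (m + 1)) := by
  have hc := T.card_of_mem_interiorFaces he
  simp only [interiorFaces, Finset.mem_filter] at he
  obtain ⟨K, L, hKL, h⟩ := Finset.card_eq_two.1 he.2
  have hK : e ⊆ K.1 := T.mem_adjacent.1 (by rw [h]; simp)
  have hL : e ⊆ L.1 := T.mem_adjacent.1 (by rw [h]; simp)
  obtain ⟨v, hv⟩ := T.exists_eq_erase hc hK
  obtain ⟨w, hw⟩ := T.exists_eq_erase hc hL
  exact ⟨K, L, fun h => hKL (Subtype.ext h), h, v, w, hv, hw⟩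

/-- No third element contains the face: each of the three apexes would be on the opposite side of
its hyperplane from both others, contradicting the sign of the product of two negative coordinates.
So two elements suffice for the count in `interiorFaces` to be exactly 2. -/
lemma mem_interiorFaces {e : Finset (E (m + 1))} (hc : e.card = m + 1) {K L : T.cells}
    (hKL : K ≠ L) (hK : e ⊆ K.1) (hL : e ⊆ L.1) : e ∈ T.interiorFaces := by
  simp only [interiorFaces, Finset.mem_filter, Finset.mem_biUnion, Finset.mem_powersetCard]
  refine ⟨⟨K, K.2, hK, hc⟩, ?_⟩
  have h : T.adjacent e = {K, L} := by
    ext M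
    rw [T.mem_adjacent, Finset.mem_insert, Finset.mem_singleton]
    refine ⟨fun hM => ?_, ?_⟩
    · by_contra! hne
      obtain ⟨v, hv⟩ := T.exists_eq_erase hc hK
      obtain ⟨w, hw⟩ := T.exists_eq_erase hc hL
      obtain ⟨z, hz⟩ := T.exists_eq_erase hc hM
      have h1 := (T.isCell K).coord_apex_neg (T.isCell L) (fun h => hKL (Subtype.ext h))
        (T.conforming K K.2 L L.2) (hv.symm.trans hw)
      have h2 := (T.isCell K).coord_apex_neg (T.isCell M) (fun h => hne.1 (Subtype.ext h.symm))
        (T.conforming K K.2 M M.2) (hv.symm.trans hz)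
      have h3 := (T.isCell L).coord_apex_neg (T.isCell M) (fun h => hne.2 (Subtype.ext h.symm))
        (T.conforming L L.2 M M.2) (hw.symm.trans hz)
      have h4 := (T.isCell K).coord_eq_mul_coord (T.isCell L) (hv.symm.trans hw) (z : E (m + 1))
      linarith [mul_pos_of_neg_of_neg h1 h3]
    · rintro (rfl | rfl)
      · exact hK
      · exact hL
  rw [h, Finset.card_pair hKL]

lemma affineSpan_ne_top {s : Finset (E (m + 1))} (hs : s.card ≤ m + 1) :
    affineSpan ℝ (s : Set (E (m + 1))) ≠ ⊤ := by
  intro h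
  rcases s.eq_empty_or_nonempty with rfl | hne
  · simp only [Finset.coe_empty, AffineSubspace.span_empty] at h
    exact bot_ne_top h
  · obtain ⟨k, hk⟩ := Nat.exists_eq_succ_of_ne_zero (Finset.card_pos.2 hne).ne'
    have h1 := finrank_vectorSpan_image_finset_le ℝ (id : E (m + 1) → E (m + 1)) s hk
    rw [Finset.image_id, ← direction_affineSpan, h, AffineSubspace.direction_top, finrank_top,
      finrank_euclideanSpace_fin] at h1
    omega

/-- Finitely many proper affine subspaces form a null set, which cannot contain a nonempty open set.
-/
lemma exists_mem_notMem_affineSpan {U : Set (E (m + 1))} (hU : IsOpen U) (hne : U.Nonempty)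
    (S : Finset (Finset (E (m + 1)))) (hS : ∀ s ∈ S, s.card ≤ m + 1) :
    ∃ p ∈ U, ∀ s ∈ S, p ∉ affineSpan ℝ (s : Set (E (m + 1))) := by
  by_contra! h
  have h1 : volume (⋃ s ∈ S, (affineSpan ℝ (s : Set (E (m + 1))) : Set (E (m + 1)))) = 0 :=
    (measure_biUnion_null_iff S.countable_toSet).2 fun s hs =>
      Measure.addHaar_affineSubspace volume _ (affineSpan_ne_top (hS s hs))
  have h2 : U ⊆ ⋃ s ∈ S, (affineSpan ℝ (s : Set (E (m + 1))) : Set (E (m + 1))) := fun p hp => by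
    obtain ⟨s, hs, hps⟩ := h p hp
    exact Set.mem_biUnion hs hps
  exact (hU.measure_pos volume hne).ne' (measure_mono_null h2 h1)

lemma closure_interior_hull (K : T.cells) : closure (interior (hull K.1)) = hull K.1 := by
  rw [(convex_convexHull ℝ _).closure_interior_eq_closure_of_nonempty_interior
    (T.isCell K).interior_hull_nonempty, (IsCell.isCompact_hull K.1).isClosed.closure_eq]

lemma hull_subset_closure (K : T.cells) : hull K.1 ⊆ closure Ω := by
  rw [← T.cover]
  exact Set.subset_biUnion_of_mem (u := fun K => hull K) K.2

/-- A function on the elements of a triangulation of a domain which takes the same value on any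
two elements with a common face is constant. -/
theorem eq_of_forall_interiorFaces (hΩ : IsOpen Ω) (hΩc : IsConnected Ω) {c : T.cells → ℝ}
    (hc : ∀ e ∈ T.interiorFaces, ∀ K ∈ T.adjacent e, ∀ L ∈ T.adjacent e, c K = c L)
    (K L : T.cells) : c K = c L := by
  by_contra hKL
  -- The elements with the value `c K` and the others fill two closed sets covering Ω. By
  -- connectedness they meet at a point of Ω, and the argument is continued in a ball around it.
  obtain ⟨UA, hUA⟩ : ∃ U : Set (E (m + 1)), U = ⋃ M ∈ {M : T.cells | c M = c K}, hull M.1 :=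
    ⟨_, rfl⟩
  obtain ⟨UB, hUB⟩ : ∃ U : Set (E (m + 1)), U = ⋃ M ∈ {M : T.cells | c M ≠ c K}, hull M.1 :=
    ⟨_, rfl⟩
  have hclA : IsClosed UA := hUA ▸ (Set.toFinite _).isClosed_biUnion fun M _ =>
    (IsCell.isCompact_hull M.1).isClosed
  have hclB : IsClosed UB := hUB ▸ (Set.toFinite _).isClosed_biUnion fun M _ =>
    (IsCell.isCompact_hull M.1).isClosed
  have hcov : Ω ⊆ UA ∪ UB := by
    intro x hx
    have h1 := subset_closure hx
    rw [← T.cover] at h1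
    obtain ⟨M, hM, hx⟩ := Set.mem_iUnion₂.1 h1
    by_cases h : c ⟨M, hM⟩ = c K
    · left; rw [hUA]; exact Set.mem_biUnion (x := (⟨M, hM⟩ : T.cells)) h hx
    · right; rw [hUB]; exact Set.mem_biUnion (x := (⟨M, hM⟩ : T.cells)) h hx
  have hmeet : ∀ M : T.cells, (Ω ∩ hull M.1).Nonempty := by
    intro M
    obtain ⟨x, hx⟩ := (T.isCell M).interior_hull_nonempty
    obtain ⟨y, hy1, hy2⟩ := mem_closure_iff.1 (T.hull_subset_closure M (interior_subset hx)) _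
      isOpen_interior hx
    exact ⟨y, hy2, interior_subset hy1⟩
  have hA : (Ω ∩ UA).Nonempty := (hmeet K).mono (Set.inter_subset_inter_right _
    (hUA ▸ Set.subset_biUnion_of_mem (u := fun M : T.cells => hull M.1) (rfl : c K = c K)))
  have hB : (Ω ∩ UB).Nonempty := (hmeet L).mono (Set.inter_subset_inter_right _
    (hUB ▸ Set.subset_biUnion_of_mem (u := fun M : T.cells => hull M.1) (Ne.symm hKL)))
  obtain ⟨x, hxΩ, hxA, hxB⟩ := isPreconnected_closed_iff.1 hΩc.isPreconnected UA UB hclA hclB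
    hcov hA hB
  obtain ⟨r, hr, hball⟩ := Metric.isOpen_iff.1 hΩ x hxΩ
  have hopen : ∀ M : T.cells, x ∈ hull M.1 →
      IsOpen (Metric.ball x r ∩ interior (hull M.1)) ∧
        (Metric.ball x r ∩ interior (hull M.1)).Nonempty := by
    intro M hM
    rw [← T.closure_interior_hull M] at hM
    exact ⟨Metric.isOpen_ball.inter isOpen_interior,
      mem_closure_iff.1 hM _ Metric.isOpen_ball (Metric.mem_ball_self hr)⟩
  rw [hUA] at hxA
  rw [hUB] at hxB
  obtain ⟨M, hM, hxM⟩ := Set.mem_iUnion₂.1 hxA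
  obtain ⟨N, hN, hxN⟩ := Set.mem_iUnion₂.1 hxB
  -- `S` holds the intersections of two elements that are smaller than a full face. `p` avoids their
  -- spans, and `q` avoids their spans joined with `p`, which are still proper since they are
  -- spanned by at most `m + 1` points. The segment from `p` to `q` then misses all the small
  -- intersections.
  set S : Finset (Finset (E (m + 1))) :=
    (((Finset.univ : Finset T.cells) ×ˢ (Finset.univ : Finset T.cells)).image
      fun q => q.1.1 ∩ q.2.1).filter fun s => s.card ≤ m with hS
  obtain ⟨p, ⟨hpb, hpM⟩, hpS⟩ := exists_mem_notMem_affineSpan (hopen M hxM).1 (hopen M hxM).2 S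
    fun s hs => (Finset.mem_filter.1 hs).2.trans (Nat.le_succ m)
  obtain ⟨q, ⟨hqb, hqN⟩, hqS⟩ := exists_mem_notMem_affineSpan (hopen N hxN).1 (hopen N hxN).2
    (S.image fun s => insert p s) fun t ht => by
      obtain ⟨s, hs, rfl⟩ := Finset.mem_image.1 ht
      exact (Finset.card_insert_le _ _).trans (Nat.succ_le_succ (Finset.mem_filter.1 hs).2)
  have hseg : segment ℝ p q ⊆ Ω := ((convex_ball x r).segment_subset hpb hqb).trans hball
  have hpA : p ∈ UA := hUA ▸ Set.mem_biUnion hM (interior_subset hpM)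
  have hqB : q ∈ UB := hUB ▸ Set.mem_biUnion hN (interior_subset hqN)
  -- The segment runs from one closed set to the other inside Ω, so it has a point `y` in both. The
  -- two elements meeting there share a full face, across which `c` is constant by assumption.
  obtain ⟨y, hy, hyA, hyB⟩ := isPreconnected_closed_iff.1 (convex_segment p q).isPreconnected UA UB
    hclA hclB (hseg.trans hcov) ⟨p, left_mem_segment ℝ p q, hpA⟩ ⟨q, right_mem_segment ℝ p q, hqB⟩
  rw [hUA] at hyA
  rw [hUB] at hyB
  obtain ⟨M', hM', hyM⟩ := Set.mem_iUnion₂.1 hyA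
  obtain ⟨N', hN', hyN⟩ := Set.mem_iUnion₂.1 hyB
  have hne : M' ≠ N' := fun h => hN' (h ▸ hM')
  have hy' : y ∈ hull (M'.1 ∩ N'.1) := by
    have h1 : y ∈ hull M'.1 ∩ hull N'.1 := ⟨hyM, hyN⟩
    rw [T.conforming _ M'.2 _ N'.2, ← Finset.coe_inter] at h1
    exact h1
  have hcard : (M'.1 ∩ N'.1).card ≤ m + 1 := by
    obtain ⟨v, hv⟩ := (T.isCell M').exists_notMem (T.isCell N') fun h => hne (Subtype.ext h)
    have h1 : M'.1 ∩ N'.1 ⊆ M'.1.erase (v : E (m + 1)) := fun u hu =>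
      Finset.mem_erase.2 ⟨fun h => hv (h ▸ (Finset.mem_inter.1 hu).2), (Finset.mem_inter.1 hu).1⟩
    have h2 := Finset.card_le_card h1
    rwa [Finset.card_erase_of_mem v.2, T.card_cell _ M'.2] at h2
  rcases hcard.eq_or_lt with h | h
  · have := hc _ (T.mem_interiorFaces h hne Finset.inter_subset_left Finset.inter_subset_right)
      M' (T.mem_adjacent.2 Finset.inter_subset_left) N' (T.mem_adjacent.2 Finset.inter_subset_right)
    exact hN' (this.symm.trans hM')
  · have hsS : M'.1 ∩ N'.1 ∈ S := Finset.mem_filter.2 ⟨Finset.mem_image.2 ⟨(M', N'), by simp, rfl⟩,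
      Nat.le_of_lt_succ h⟩
    have hys : y ∈ affineSpan ℝ ((M'.1 ∩ N'.1 : Finset (E (m + 1))) : Set (E (m + 1))) :=
      convexHull_subset_affineSpan _ hy'
    -- In the remaining case `q` would be on the line through `p` and `y`, hence in a span that was
    -- excluded.
    have hpy : p ≠ y := fun h => hpS _ hsS (h ▸ hys)
    refine hqS _ (Finset.mem_image_of_mem _ hsS) ?_
    have hpI : p ∈ affineSpan ℝ ((insert p (M'.1 ∩ N'.1) : Finset (E (m + 1))) :
        Set (E (m + 1))) := subset_affineSpan ℝ _ (by simp)
    have hyI : y ∈ affineSpan ℝ ((insert p (M'.1 ∩ N'.1) : Finset (E (m + 1))) :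
        Set (E (m + 1))) := affineSpan_mono ℝ (by simp) hys
    obtain ⟨a, b, ha, hb, hab, rfl⟩ := hy
    have hb0 : b ≠ 0 := by
      rintro rfl
      apply hpy
      rw [add_zero] at hab
      rw [hab, one_smul, zero_smul, add_zero]
    have := AffineMap.lineMap_mem b⁻¹ hpI hyI
    convert this using 1
    have ha' : a = 1 - b := by linarith
    rw [AffineMap.lineMap_apply, vsub_eq_sub, vadd_eq_add, ha']
    have : (1 - b) • p + b • q - p = b • (q - p) := by module
    rw [this, inv_smul_smul₀ hb0]
    abel

end Triangulation

/-! ### Interpolation of symmetric tensor fields on a simplex -/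

section EdgeDecomposition

variable {V ι : Type*} [Fintype V] [Fintype ι]

lemma sum_gram_mul (G : V → ι → ℝ) (M : ι → ι → ℝ) (α β : V → ℝ) :
    ∑ v, ∑ w, (∑ a, ∑ b, G v a * G w b * M a b) * (α v * β w) =
      ∑ a, ∑ b, M a b * ((∑ v, G v a * α v) * ∑ w, G w b * β w) := by
  have h : ∀ a b, M a b * ((∑ v, G v a * α v) * ∑ w, G w b * β w) =
      ∑ v, ∑ w, G v a * G w b * M a b * (α v * β w) := by
    intro a b
    rw [Finset.sum_mul_sum, Finset.mul_sum]
    refine Finset.sum_congr rfl fun v _ => ?_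
    rw [Finset.mul_sum]
    exact Finset.sum_congr rfl fun w _ => by ring
  simp only [h]
  simp only [Finset.sum_mul]
  calc ∑ v, ∑ w, ∑ a, ∑ b, G v a * G w b * M a b * (α v * β w)
      = ∑ v, ∑ a, ∑ w, ∑ b, G v a * G w b * M a b * (α v * β w) :=
        Finset.sum_congr rfl fun v _ => Finset.sum_comm
    _ = ∑ a, ∑ v, ∑ b, ∑ w, G v a * G w b * M a b * (α v * β w) := by
        rw [Finset.sum_comm]
        exact Finset.sum_congr rfl fun a _ => Finset.sum_congr rfl fun v _ => Finset.sum_comm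
    _ = _ := Finset.sum_congr rfl fun a _ => Finset.sum_comm

/-- A symmetric matrix is a combination of the squares of the edge vectors of a simplex. -/
lemma edge_decomposition {G y : V → ι → ℝ} (h0 : ∀ a, ∑ v, G v a = 0)
    (h1 : ∀ a i, ∑ v, G v a * y v i = if a = i then 1 else 0) {M : ι → ι → ℝ}
    (hM : ∀ i j, M i j = M j i) (i j : ι) :
    ∑ v, ∑ w, (-(1 / 2) * ∑ a, ∑ b, G v a * G w b * M a b) *
      ((y w i - y v i) * (y w j - y v j)) = M i j := by
  -- The product of differences is expanded. Terms in which one of `v`, `w` does not occur vanish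
  -- because the gradients sum to zero; the two cross terms give `M i j / 2` and `M j i / 2`. The
  -- factor 1/2 is there because ordered pairs are summed.
  have e1 := sum_gram_mul G M (fun _ => 1) (fun w => y w i * y w j)
  have e2 := sum_gram_mul G M (fun v => y v i) (fun w => y w j)
  have e3 := sum_gram_mul G M (fun v => y v j) (fun w => y w i)
  have e4 := sum_gram_mul G M (fun v => y v i * y v j) (fun _ => 1)
  simp only [mul_one, one_mul, h0, zero_mul, mul_zero, Finset.sum_const_zero] at e1 e4
  simp only [h1, mul_ite, mul_zero, mul_one, Finset.sum_ite_eq', Finset.mem_univ, if_true] at e2 e3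
  have : ∀ v w, (-(1 / 2) * ∑ a, ∑ b, G v a * G w b * M a b) *
      ((y w i - y v i) * (y w j - y v j)) =
      -(1 / 2) * ((∑ a, ∑ b, G v a * G w b * M a b) * (1 * (y w i * y w j)))
      + 1 / 2 * ((∑ a, ∑ b, G v a * G w b * M a b) * (y v i * y w j))
      + 1 / 2 * ((∑ a, ∑ b, G v a * G w b * M a b) * (y v j * y w i))
      - 1 / 2 * ((∑ a, ∑ b, G v a * G w b * M a b) * ((y v i * y v j) * 1)) := fun v w => by ring
  simp only [this, Finset.sum_add_distrib, Finset.sum_sub_distrib, ← Finset.mul_sum]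
  simp only [mul_one, one_mul]
  rw [e1, e2, e3, e4, hM j i]
  ring

end EdgeDecomposition

/-! ### Coefficients along the edges of a simplex -/

section LocalInterpolation

variable {m : ℕ} {K : Finset (E (m + 1))}

namespace IsCell

/-- The coefficients of a tensor field with respect to the squares of the edge vectors. -/
def edgeCoeff (hK : IsCell K) (τ : Fin (m + 1) → Fin (m + 1) → E (m + 1) → ℝ) (v w : K)
    (x : E (m + 1)) : ℝ :=
  -(1 / 2) * ∑ a, ∑ b, hK.grad v (EuclideanSpace.single a 1) *
    hK.grad w (EuclideanSpace.single b 1) * τ a b x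

lemma sum_edgeCoeff (hK : IsCell K) {τ : Fin (m + 1) → Fin (m + 1) → E (m + 1) → ℝ}
    (hτ : ∀ i j, τ i j = τ j i) (i j : Fin (m + 1)) (x : E (m + 1)) :
    ∑ v, ∑ w, hK.edgeCoeff τ v w x *
      (((w : E (m + 1)) - v) i * ((w : E (m + 1)) - v) j) = τ i j x := by
  refine edge_decomposition (G := fun (v : K) a => hK.grad v (EuclideanSpace.single a 1))
    (y := fun (v : K) i => (v : E (m + 1)) i) (fun a => hK.sum_grad _) (fun a i => ?_)
    (M := fun i j => τ i j x) (fun i j => by rw [hτ]) i j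
  have h := congrArg (fun z : E (m + 1) => z i) (hK.sum_grad_smul (EuclideanSpace.single a 1))
  simp only [PiLp.single_apply] at h
  rw [← PiLp.proj_apply (𝕜 := ℝ) 2 (fun _ : Fin (m + 1) => ℝ) i, map_sum] at h
  simp only [map_smul, PiLp.proj_apply, smul_eq_mul] at h
  rw [h]
  by_cases hai : a = i
  · rw [if_pos hai, if_pos hai.symm]
  · rw [if_neg hai, if_neg (Ne.symm hai)]

lemma contDiff_edgeCoeff (hK : IsCell K) {τ : Fin (m + 1) → Fin (m + 1) → E (m + 1) → ℝ}
    (hτ : ∀ i j, ContDiff ℝ 1 (τ i j)) (v w : K) : ContDiff ℝ 1 (hK.edgeCoeff τ v w) :=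
  contDiff_const.mul (ContDiff.sum fun a _ => ContDiff.sum fun b _ =>
    contDiff_const.mul (hτ a b))

/-- Each coefficient contains two gradients of barycentric coordinates, each of size at most `r⁻¹`.
The resulting `r⁻²` is compensated later by the two edge vectors of length at most `diam K ≤ γ * r`.
-/
lemma norm_fderiv_edgeCoeff_le (hK : IsCell K)
    {τ : Fin (m + 1) → Fin (m + 1) → E (m + 1) → ℝ} (hτ : ∀ i j, ContDiff ℝ 1 (τ i j))
    {c : E (m + 1)} {r : ℝ} (hr : 0 < r) (hball : Metric.ball c r ⊆ hull K) (v w : K)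
    (x : E (m + 1)) : ‖fderiv ℝ (hK.edgeCoeff τ v w) x‖ ≤
      (r⁻¹) ^ 2 * ∑ a, ∑ b, ‖fderiv ℝ (τ a b) x‖ := by
  have hd : ∀ a b, DifferentiableAt ℝ (τ a b) x := fun a b => (hτ a b).differentiable one_ne_zero x
  have h1 : HasFDerivAt (hK.edgeCoeff τ v w) (-(1 / 2 : ℝ) • ∑ a, ∑ b,
      (hK.grad v (EuclideanSpace.single a 1) * hK.grad w (EuclideanSpace.single b 1)) •
        fderiv ℝ (τ a b) x) x :=
    (HasFDerivAt.fun_sum fun a _ => HasFDerivAt.fun_sum fun b _ =>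
      (hd a b).hasFDerivAt.const_mul _).const_mul _
  rw [h1.fderiv, norm_smul, Finset.mul_sum]
  have h2 : ‖(-(1 / 2 : ℝ))‖ ≤ 1 := by norm_num
  refine (mul_le_of_le_one_left (norm_nonneg _) h2).trans ((norm_sum_le _ _).trans
    (Finset.sum_le_sum fun a _ => ?_))
  rw [Finset.mul_sum]
  refine (norm_sum_le _ _).trans (Finset.sum_le_sum fun b _ => ?_)
  rw [norm_smul, Real.norm_eq_abs, abs_mul, sq]
  have h3 : ∀ (u : K) (a : Fin (m + 1)), |hK.grad u (EuclideanSpace.single a 1)| ≤ r⁻¹ :=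
    fun u a => by simpa using hK.abs_grad_le hr hball u (EuclideanSpace.single a 1)
  gcongr
  · exact h3 v a
  · exact h3 w b

end IsCell

lemma abs_coord_mul_le {n : ℕ} {h : ℝ} {z : E n} (hz : ‖z‖ ≤ h) (i j : Fin n) :
    |z i * z j| ≤ h ^ 2 := by
  rw [abs_mul, sq]
  exact mul_le_mul ((PiLp.norm_apply_le z i).trans hz) ((PiLp.norm_apply_le z j).trans hz)
    (abs_nonneg _) ((norm_nonneg z).trans hz)

/-- The sum of the elementwise squared `L²` norms of the gradients. -/
def gradSq (K : Finset (E (m + 1))) (τ : Fin (m + 1) → Fin (m + 1) → E (m + 1) → ℝ) : ℝ :=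
  ∑ a, ∑ b, ∫ x in hull K, ‖fderiv ℝ (τ a b) x‖ ^ 2

lemma continuous_integrableOn_hull {n : ℕ} {f : E n → ℝ} (hf : Continuous f) (s : Finset (E n)) :
    IntegrableOn f (hull s) :=
  hf.continuousOn.integrableOn_compact (IsCell.isCompact_hull s)

lemma IsCell.integral_fderiv_edgeCoeff_le (hK : IsCell K)
    {τ : Fin (m + 1) → Fin (m + 1) → E (m + 1) → ℝ} (hτ : ∀ i j, ContDiff ℝ 1 (τ i j))
    {c : E (m + 1)} {r : ℝ} (hr : 0 < r) (hball : Metric.ball c r ⊆ hull K) (v w : K) :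
    ∫ x in hull K, ‖fderiv ℝ (hK.edgeCoeff τ v w) x‖ ^ 2 ≤
      (r⁻¹) ^ 4 * (((m + 1 : ℕ) : ℝ) ^ 2 * gradSq K τ) := by
  have hcd : ∀ a b, Continuous fun x => ‖fderiv ℝ (τ a b) x‖ ^ 2 := fun a b =>
    continuous_sq_fun ((hτ a b).continuous_fderiv one_ne_zero).norm
  have hpt : ∀ x, ‖fderiv ℝ (hK.edgeCoeff τ v w) x‖ ^ 2 ≤
      (r⁻¹) ^ 4 * (((m + 1 : ℕ) : ℝ) ^ 2 * ∑ a, ∑ b, ‖fderiv ℝ (τ a b) x‖ ^ 2) := by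
    intro x
    refine (pow_le_pow_left₀ (norm_nonneg _) (hK.norm_fderiv_edgeCoeff_le hτ hr hball v w x)
      2).trans ?_
    rw [mul_pow, ← pow_mul]
    refine mul_le_mul_of_nonneg_left ?_ (by positivity)
    have := sq_sum_le_card_mul_sum_sq (s := (Finset.univ : Finset (Fin (m + 1) × Fin (m + 1))))
      (f := fun q => ‖fderiv ℝ (τ q.1 q.2) x‖)
    rw [Fintype.sum_prod_type, Fintype.sum_prod_type, Finset.card_univ, Fintype.card_prod,
      Fintype.card_fin] at this
    refine this.trans (le_of_eq ?_)
    push_cast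
    ring
  refine (setIntegral_mono (g := fun x => (r⁻¹) ^ 4 * (((m + 1 : ℕ) : ℝ) ^ 2 *
    ∑ a, ∑ b, ‖fderiv ℝ (τ a b) x‖ ^ 2)) (continuous_integrableOn_hull (continuous_sq_fun
    ((hK.contDiff_edgeCoeff hτ v w).continuous_fderiv one_ne_zero).norm) K)
    (continuous_integrableOn_hull (continuous_const.mul (continuous_const.mul
      (continuous_finsetSum _ fun a _ => continuous_finsetSum _ fun b _ => hcd a b))) K)
      hpt).trans (le_of_eq ?_)
  rw [integral_const_mul, integral_const_mul, integral_finsetSum _ fun a _ =>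
    continuous_integrableOn_hull (continuous_finsetSum _ fun b _ => hcd a b) K, gradSq]
  congr 3
  funext a
  rw [integral_finsetSum _ fun b _ => continuous_integrableOn_hull (hcd a b) K]

end LocalInterpolation

/-! ### The tensor interpolant, assembled edge by edge -/

section TensorInterpolation

variable {m : ℕ} {K : Finset (E (m + 1))}

lemma IsCell.integrableOn_face (hK : IsCell K) (v : K) {f : E (m + 1) → ℝ} (hf : Continuous f) :
    IntegrableOn f (hull (K.erase (v : E (m + 1)))) μHE[m] := by
  have hc : (K.erase (v : E (m + 1))).card = m + 1 := by
    rw [Finset.card_erase_of_mem v.2, hK.card]; omega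
  have hind : AffineIndependent ℝ ((↑) : (K.erase (v : E (m + 1)) : Finset _) → E (m + 1)) :=
    hK.indep.mono (Finset.coe_subset.2 (Finset.erase_subset _ _))
  obtain ⟨b, hb, hs⟩ := exists_vertexList' hc hind
  exact integrableOn_hull hb hs hf

lemma integral_sq_sum_le {X V : Type*} [TopologicalSpace X] [MeasurableSpace X] [Fintype V]
    {μ : Measure X} (hμ : ∀ f : X → ℝ, Continuous f → Integrable f μ) {f : V → X → ℝ}
    (hf : ∀ v, Continuous (f v)) {S : ℝ} (hS : ∀ v, ∫ x, f v x ^ 2 ∂μ ≤ S) :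
    ∫ x, (∑ v, f v x) ^ 2 ∂μ ≤ (Fintype.card V : ℝ) ^ 2 * S := by
  refine (integral_mono (g := fun x => (Fintype.card V : ℝ) * ∑ v, f v x ^ 2)
    (hμ _ (continuous_sq_fun (continuous_finsetSum _ fun v _ => hf v)))
    (hμ _ (continuous_const.mul (continuous_finsetSum _ fun v _ => continuous_sq_fun (hf v))))
    fun x => ?_).trans ?_
  · have := sq_sum_le_card_mul_sum_sq (s := Finset.univ) (f := fun v => f v x)
    rwa [Finset.card_univ] at this
  · rw [integral_const_mul, integral_finsetSum _ fun v _ => hμ _ (continuous_sq_fun (hf v)), sq,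
      mul_assoc]
    refine mul_le_mul_of_nonneg_left ?_ (Nat.cast_nonneg _)
    refine (Finset.sum_le_card_nsmul _ _ _ fun v _ => hS v).trans (le_of_eq ?_)
    rw [Finset.card_univ, nsmul_eq_mul]

lemma gradSq_nonneg (K : Finset (E (m + 1)))
    (τ : Fin (m + 1) → Fin (m + 1) → E (m + 1) → ℝ) : 0 ≤ gradSq K τ :=
  Finset.sum_nonneg fun _ _ => Finset.sum_nonneg fun _ _ => integral_nonneg fun _ => sq_nonneg _

/-- Interpolation of `H¹` symmetric tensor fields by polynomials on a simplex: it preserves the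
moments of the divergence and of the normal components on the faces. -/
theorem exists_tensorInterp (m k : ℕ) (γ : ℝ) : ∃ C : ℝ, 0 ≤ C ∧
    ∀ {K : Finset (E (m + 1))}, IsCell K → ∀ (c : E (m + 1)) (r : ℝ), 0 < r →
      Metric.ball c r ⊆ hull K → diam K ≤ γ * r →
      ∀ τ : Fin (m + 1) → Fin (m + 1) → E (m + 1) → ℝ,
      (∀ i j, τ i j = τ j i) → (∀ i j, ContDiff ℝ 1 (τ i j)) →
      ∃ σ : Matrix (Fin (m + 1)) (Fin (m + 1)) (Poly (m + 1)), σ.IsSymm ∧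
        (∀ i j, σ i j ∈ PolyLE (m + 1) (k + 1)) ∧
        (∀ v : K, ∀ i, ∀ q ∈ PolyLE (m + 1) k, ∫ x in hull (K.erase (v : E (m + 1))),
          (∑ j, (MvPolynomial.eval x.ofLp (σ i j) - τ i j x) *
            outwardNormal K (K.erase (v : E (m + 1))) j) * MvPolynomial.eval x.ofLp q ∂μHE[m] = 0) ∧
        (∀ i, ∀ q ∈ PolyLE (m + 1) k, ∫ x in hull K,
          (∑ j, fderiv ℝ (fun x => MvPolynomial.eval x.ofLp (σ i j) - τ i j x) x
            (EuclideanSpace.single j 1)) * MvPolynomial.eval x.ofLp q = 0) ∧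
        (∀ i j, (scale K)⁻¹ * ∫ x in hull K, (MvPolynomial.eval x.ofLp (σ i j) - τ i j x) ^ 2 ≤
          C * (diam K ^ 2 * ((scale K)⁻¹ * gradSq K τ))) ∧
        ∀ v : K, ∀ i, (scale (K.erase (v : E (m + 1))))⁻¹ *
          ∫ x in hull (K.erase (v : E (m + 1))),
            (∑ j, (MvPolynomial.eval x.ofLp (σ i j) - τ i j x) *
              outwardNormal K (K.erase (v : E (m + 1))) j) ^ 2 ∂μHE[m] ≤
          C * (diam K ^ 2 * ((scale K)⁻¹ * gradSq K τ)) := by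
  obtain ⟨C, hC0, hC⟩ := exists_interp m k
  -- `(m + 2) ^ 4` is the square of the number of ordered pairs of vertices, `γ ^ 4` bounds the
  -- ratio of edge lengths to inscribed radii, and `(m + 1) ^ 2` is the number of matrix entries.
  refine ⟨((m + 2 : ℕ) : ℝ) ^ 4 * (C * γ ^ 4 * ((m + 1 : ℕ) : ℝ) ^ 2), by positivity, ?_⟩
  intro K hK c r hr hball hγ τ hτs hτ
  -- On the diagonal the edge vector is zero, so any polynomial of the right degree will do there.
  have hex : ∀ v w : K, ∃ p ∈ PolyLE (m + 1) (k + 1), v ≠ w →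
      (∀ q ∈ PolyLE (m + 1) k, ∫ x in hull (K.erase (v : E (m + 1))),
        (MvPolynomial.eval x.ofLp p - hK.edgeCoeff τ v w x) *
          MvPolynomial.eval x.ofLp q ∂μHE[m] = 0) ∧
      (∀ q ∈ PolyLE (m + 1) k, ∫ x in hull (K.erase (w : E (m + 1))),
        (MvPolynomial.eval x.ofLp p - hK.edgeCoeff τ v w x) *
          MvPolynomial.eval x.ofLp q ∂μHE[m] = 0) ∧
      (∀ q ∈ PolyLE (m + 1) k, ∫ x in hull K,
        fderiv ℝ (fun x => MvPolynomial.eval x.ofLp p - hK.edgeCoeff τ v w x) x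
          ((w : E (m + 1)) - v) * MvPolynomial.eval x.ofLp q = 0) ∧
      (scale K)⁻¹ * (∫ x in hull K, (MvPolynomial.eval x.ofLp p - hK.edgeCoeff τ v w x) ^ 2) +
        (scale (K.erase (v : E (m + 1))))⁻¹ * (∫ x in hull (K.erase (v : E (m + 1))),
          (MvPolynomial.eval x.ofLp p - hK.edgeCoeff τ v w x) ^ 2 ∂μHE[m]) +
        (scale (K.erase (w : E (m + 1))))⁻¹ * (∫ x in hull (K.erase (w : E (m + 1))),
          (MvPolynomial.eval x.ofLp p - hK.edgeCoeff τ v w x) ^ 2 ∂μHE[m]) ≤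
        C * (diam K ^ 2 * ((scale K)⁻¹ *
          ∫ x in hull K, ‖fderiv ℝ (hK.edgeCoeff τ v w) x‖ ^ 2)) := by
    intro v w
    by_cases hvw : v = w
    · exact ⟨0, Submodule.zero_mem _, fun h => absurd hvw h⟩
    · obtain ⟨p, hp, h⟩ := hC hK v w hvw _ (hK.contDiff_edgeCoeff hτ v w)
      exact ⟨p, hp, fun _ => h⟩
  choose p hp hspec using hex
  obtain ⟨err, herr⟩ : ∃ err : K × K → E (m + 1) → ℝ, ∀ q, err q = fun x =>
    MvPolynomial.eval x.ofLp (p q.1 q.2) - hK.edgeCoeff τ q.1 q.2 x := ⟨_, fun _ => rfl⟩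
  obtain ⟨y, hy⟩ : ∃ y : K × K → E (m + 1), ∀ q, y q = (q.2 : E (m + 1)) - q.1 :=
    ⟨_, fun _ => rfl⟩
  have hy0 : ∀ q : K × K, q.1 = q.2 → y q = 0 := fun q h => by rw [hy, h, sub_self]
  have hspec' : ∀ q : K × K, q.1 ≠ q.2 →
      (∀ s ∈ PolyLE (m + 1) k, ∫ x in hull (K.erase (q.1 : E (m + 1))),
        err q x * MvPolynomial.eval x.ofLp s ∂μHE[m] = 0) ∧
      (∀ s ∈ PolyLE (m + 1) k, ∫ x in hull (K.erase (q.2 : E (m + 1))),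
        err q x * MvPolynomial.eval x.ofLp s ∂μHE[m] = 0) ∧
      (∀ s ∈ PolyLE (m + 1) k, ∫ x in hull K,
        fderiv ℝ (err q) x (y q) * MvPolynomial.eval x.ofLp s = 0) ∧
      (scale K)⁻¹ * (∫ x in hull K, err q x ^ 2) +
        (scale (K.erase (q.1 : E (m + 1))))⁻¹ * (∫ x in hull (K.erase (q.1 : E (m + 1))),
          err q x ^ 2 ∂μHE[m]) +
        (scale (K.erase (q.2 : E (m + 1))))⁻¹ * (∫ x in hull (K.erase (q.2 : E (m + 1))),
          err q x ^ 2 ∂μHE[m]) ≤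
        C * (diam K ^ 2 * ((scale K)⁻¹ *
          ∫ x in hull K, ‖fderiv ℝ (hK.edgeCoeff τ q.1 q.2) x‖ ^ 2)) := by
    intro q hq
    have := hspec q.1 q.2 hq
    simp only [herr, hy]
    exact this
  have herrC : ∀ q, ContDiff ℝ 1 (err q) := fun q => by
    rw [herr]
    exact (contDiff_eval _).sub (hK.contDiff_edgeCoeff hτ _ _)
  have herrc : ∀ q, Continuous (err q) := fun q => (herrC q).continuous
  clear hspec
  obtain ⟨σ, hσ⟩ : ∃ σ : Matrix (Fin (m + 1)) (Fin (m + 1)) (Poly (m + 1)), ∀ i j, σ i j =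
    ∑ q : K × K, MvPolynomial.C (y q i * y q j) * p q.1 q.2 := ⟨Matrix.of fun i j => _, fun i j => rfl⟩
  have key : ∀ i j x, MvPolynomial.eval x.ofLp (σ i j) - τ i j x =
      ∑ q, err q x * (y q i * y q j) := by
    intro i j x
    have h1 := hK.sum_edgeCoeff hτs i j x
    rw [← Fintype.sum_prod_type'] at h1
    rw [← h1, hσ, map_sum, ← Finset.sum_sub_distrib]
    refine Finset.sum_congr rfl fun q _ => ?_
    rw [map_mul, MvPolynomial.eval_C, herr, hy]
    ring
  have hsK := hK.scale_pos
  have hd0 : 0 ≤ diam K := Metric.diam_nonneg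
  have hyd : ∀ q, ‖y q‖ ≤ diam K := fun q => by
    rw [hy]
    exact IsCell.norm_sub_le_diam (IsCell.mem_hull_of_mem q.1.2) (IsCell.mem_hull_of_mem q.2.2)
  have hcard : (Fintype.card (K × K) : ℝ) ^ 2 = ((m + 2 : ℕ) : ℝ) ^ 4 := by
    rw [Fintype.card_prod, Fintype.card_coe, hK.card]
    push_cast
    ring
  have hG := gradSq_nonneg K τ
  have hratio : diam K ^ 4 * (r⁻¹) ^ 4 ≤ γ ^ 4 := by
    rw [← mul_pow]
    refine pow_le_pow_left₀ (by positivity) ?_ 4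
    rwa [← div_eq_mul_inv, div_le_iff₀ hr]
  have hbound : ∀ q : K × K, q.1 ≠ q.2 → diam K ^ 4 * (C * (diam K ^ 2 * ((scale K)⁻¹ *
      ∫ x in hull K, ‖fderiv ℝ (hK.edgeCoeff τ q.1 q.2) x‖ ^ 2))) ≤
      C * γ ^ 4 * ((m + 1 : ℕ) : ℝ) ^ 2 * (diam K ^ 2 * ((scale K)⁻¹ * gradSq K τ)) := by
    intro q hq
    calc diam K ^ 4 * (C * (diam K ^ 2 * ((scale K)⁻¹ *
          ∫ x in hull K, ‖fderiv ℝ (hK.edgeCoeff τ q.1 q.2) x‖ ^ 2)))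
        ≤ diam K ^ 4 * (C * (diam K ^ 2 * ((scale K)⁻¹ *
          ((r⁻¹) ^ 4 * (((m + 1 : ℕ) : ℝ) ^ 2 * gradSq K τ))))) := by
          have := hK.integral_fderiv_edgeCoeff_le hτ hr hball q.1 q.2
          gcongr
      _ = (diam K ^ 4 * (r⁻¹) ^ 4) * (C * ((m + 1 : ℕ) : ℝ) ^ 2 *
          (diam K ^ 2 * ((scale K)⁻¹ * gradSq K τ))) := by ring
      _ ≤ γ ^ 4 * (C * ((m + 1 : ℕ) : ℝ) ^ 2 *
          (diam K ^ 2 * ((scale K)⁻¹ * gradSq K τ))) := by gcongr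
      _ = _ := by ring
  have hS0 : 0 ≤ C * γ ^ 4 * ((m + 1 : ℕ) : ℝ) ^ 2 *
    (diam K ^ 2 * ((scale K)⁻¹ * gradSq K τ)) := by positivity
  have hnn : ∀ q (s : Finset (E (m + 1))) (d : ℕ),
      0 ≤ (scale s)⁻¹ * ∫ x in hull s, err q x ^ 2 ∂μHE[d] := by
    intro q s d
    have : 0 ≤ scale s := div_nonneg ENNReal.toReal_nonneg ENNReal.toReal_nonneg
    exact mul_nonneg (inv_nonneg.2 this) (integral_nonneg fun x => sq_nonneg _)
  have hnnK : ∀ q, 0 ≤ (scale K)⁻¹ * ∫ x in hull K, err q x ^ 2 := fun q =>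
    mul_nonneg (inv_nonneg.2 hsK.le) (integral_nonneg fun x => sq_nonneg _)
  have hcoef : ∀ (z : K) q i, ∑ j, y q i * y q j * outwardNormal K (K.erase (z : E (m + 1))) j =
      y q i * ∑ j, y q j * outwardNormal K (K.erase (z : E (m + 1))) j := fun z q i => by
    rw [Finset.mul_sum]
    exact Finset.sum_congr rfl fun j _ => by ring
  have hface : ∀ (z : K) i x, ∑ j, (MvPolynomial.eval x.ofLp (σ i j) - τ i j x) *
      outwardNormal K (K.erase (z : E (m + 1))) j = ∑ q, err q x *
        (y q i * ∑ j, y q j * outwardNormal K (K.erase (z : E (m + 1))) j) := by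
    intro z i x
    simp only [key, ← hcoef, Finset.mul_sum, Finset.sum_mul]
    rw [Finset.sum_comm]
    exact Finset.sum_congr rfl fun q _ => Finset.sum_congr rfl fun j _ => by ring
  -- An edge without the endpoint `z` lies in the face opposite `z` and is orthogonal to its normal.
  -- The edges that do contribute on this face end at `z`, and for those the scalar interpolant
  -- preserves the face moments.
  have horth : ∀ (z : K) (q : K × K), q.1 ≠ z → q.2 ≠ z →
      ∑ j, y q j * outwardNormal K (K.erase (z : E (m + 1))) j = 0 := by
    intro z q h1 h2
    rw [hy]
    exact hK.outwardNormal_orthogonal z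
      (Finset.mem_erase.2 ⟨fun h => h1 (Subtype.ext h), q.1.2⟩)
      (Finset.mem_erase.2 ⟨fun h => h2 (Subtype.ext h), q.2.2⟩)
  refine ⟨σ, ?_, ?_, ?_, ?_, ?_, ?_⟩
  · ext1 i j
    rw [Matrix.transpose_apply, hσ, hσ]
    simp only [mul_comm (y _ i)]
  · intro i j
    rw [hσ]
    refine Submodule.sum_mem _ fun q _ => ?_
    have := mul_mem_polyLE (C_mem_polyLE (n := m + 1) (k := 0) (y q i * y q j)) (hp q.1 q.2)
    rwa [zero_add] at this
  · intro z i s hs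
    simp only [hface, Finset.sum_mul]
    rw [integral_finsetSum _ fun q _ => hK.integrableOn_face z
      (continuous_mul_fun (continuous_mul_fun (herrc q) continuous_const) (continuous_evalE s))]
    refine Finset.sum_eq_zero fun q _ => ?_
    have hint : ∀ a : ℝ, ∫ x in hull (K.erase (z : E (m + 1))), err q x * a *
        MvPolynomial.eval x.ofLp s ∂μHE[m] = a * ∫ x in hull (K.erase (z : E (m + 1))), err q x *
        MvPolynomial.eval x.ofLp s ∂μHE[m] := fun a => by
      rw [← integral_const_mul]
      congr 1
      funext x
      ring
    rw [hint]
    by_cases hq : q.1 = q.2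
    · rw [hy0 q hq]; simp
    by_cases h1 : q.1 = z
    · rw [← h1, (hspec' q hq).1 s hs, mul_zero]
    by_cases h2 : q.2 = z
    · rw [← h2, (hspec' q hq).2.1 s hs, mul_zero]
    · rw [horth z q h1 h2, mul_zero, zero_mul]
  · intro i s hs
    -- The divergence of `err • y yᵀ` is the derivative of `err` along `y`, times `y`; its moments
    -- vanish by the scalar interpolation along the edge.
    have hder : ∀ x, ∑ j, fderiv ℝ (fun x => MvPolynomial.eval x.ofLp (σ i j) - τ i j x) x
        (EuclideanSpace.single j 1) = ∑ q, fderiv ℝ (err q) x (y q) * y q i := by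
      intro x
      have hd : ∀ q, DifferentiableAt ℝ (err q) x := fun q =>
        (herrC q).differentiable one_ne_zero x
      have h1 : ∀ j, fderiv ℝ (fun x => MvPolynomial.eval x.ofLp (σ i j) - τ i j x) x =
          ∑ q, (y q i * y q j) • fderiv ℝ (err q) x := by
        intro j
        have : (fun x : E (m + 1) => MvPolynomial.eval x.ofLp (σ i j) - τ i j x) =
          fun x => ∑ q, err q x * (y q i * y q j) := funext fun x => key i j x
        rw [this]
        exact (HasFDerivAt.fun_sum fun q _ => (hd q).hasFDerivAt.mul_const _).fderiv
      simp only [h1, sum_apply, smul_apply, smul_eq_mul]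
      rw [Finset.sum_comm]
      refine Finset.sum_congr rfl fun q _ => ?_
      have h2 : y q = ∑ j, y q j • EuclideanSpace.single j (1 : ℝ) := by
        ext l
        simp [Finset.sum_apply, Pi.single_apply]
      have h3 : fderiv ℝ (err q) x (y q) =
          ∑ j, y q j * fderiv ℝ (err q) x (EuclideanSpace.single j 1) := by
        conv_lhs => rw [h2]
        simp only [map_sum, map_smul, smul_eq_mul]
      rw [h3, Finset.sum_mul]
      exact Finset.sum_congr rfl fun j _ => by ring
    simp only [hder, Finset.sum_mul]
    have hcd : ∀ q, Continuous fun x => fderiv ℝ (err q) x (y q) := fun q =>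
      ((herrC q).continuous_fderiv one_ne_zero).clm_apply continuous_const
    rw [integral_finsetSum _ fun q _ => continuous_integrableOn_hull
      (continuous_mul_fun (continuous_mul_fun (hcd q) continuous_const) (continuous_evalE s)) K]
    refine Finset.sum_eq_zero fun q _ => ?_
    have hint : ∀ a : ℝ, ∫ x in hull K, fderiv ℝ (err q) x (y q) * a *
        MvPolynomial.eval x.ofLp s = a * ∫ x in hull K, fderiv ℝ (err q) x (y q) *
        MvPolynomial.eval x.ofLp s := fun a => by
      rw [← integral_const_mul]
      congr 1
      funext x
      ring
    rw [hint]
    by_cases hq : q.1 = q.2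
    · rw [hy0 q hq]; simp
    · rw [(hspec' q hq).2.2.1 s hs, mul_zero]
  · intro i j
    simp only [key]
    have hterm : ∀ q, ∫ x in hull K, (err q x * (y q i * y q j)) ^ 2 ≤ scale K *
        (C * γ ^ 4 * ((m + 1 : ℕ) : ℝ) ^ 2 * (diam K ^ 2 * ((scale K)⁻¹ * gradSq K τ))) := by
      intro q
      by_cases hq : q.1 = q.2
      · rw [hy0 q hq]
        simpa using mul_nonneg hsK.le hS0
      rw [← div_le_iff₀' hsK, div_eq_inv_mul]
      simp only [mul_pow (err q _)]
      rw [integral_mul_const, ← mul_assoc, mul_comm]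
      refine le_trans ?_ (hbound q hq)
      refine mul_le_mul ?_ (le_trans ?_ (hspec' q hq).2.2.2) (hnnK q) (by positivity)
      · have := pow_le_pow_left₀ (abs_nonneg _) (abs_coord_mul_le (hyd q) i j) 2
        rw [sq_abs, ← pow_mul] at this
        exact this
      · have h1 := hnn q (K.erase (q.1 : E (m + 1))) m
        have h2 := hnn q (K.erase (q.2 : E (m + 1))) m
        linarith
    have := integral_sq_sum_le (μ := volume.restrict (hull K))
      (fun f hf => continuous_integrableOn_hull hf K)
      (fun q => continuous_mul_fun (herrc q) continuous_const) hterm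
    rw [inv_mul_le_iff₀ hsK]
    refine this.trans (le_of_eq ?_)
    rw [hcard]
    ring
  · intro z i
    simp only [hface]
    have hsz := hK.scale_erase_pos z
    have hterm : ∀ q, ∫ x in hull (K.erase (z : E (m + 1))), (err q x * (y q i *
        ∑ j, y q j * outwardNormal K (K.erase (z : E (m + 1))) j)) ^ 2 ∂μHE[m] ≤
        scale (K.erase (z : E (m + 1))) *
        (C * γ ^ 4 * ((m + 1 : ℕ) : ℝ) ^ 2 * (diam K ^ 2 * ((scale K)⁻¹ * gradSq K τ))) := by
      intro q
      by_cases hq : q.1 = q.2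
      · rw [hy0 q hq]
        simpa using mul_nonneg hsz.le hS0
      by_cases hz : q.1 ≠ z ∧ q.2 ≠ z
      · rw [horth z q hz.1 hz.2]
        simpa using mul_nonneg hsz.le hS0
      rw [← div_le_iff₀' hsz, div_eq_inv_mul]
      simp only [mul_pow (err q _)]
      rw [integral_mul_const, ← mul_assoc, mul_comm]
      refine le_trans ?_ (hbound q hq)
      refine mul_le_mul ?_ (le_trans ?_ (hspec' q hq).2.2.2) (hnn q _ m) (by positivity)
      · have h1 : |y q i| ≤ diam K := (PiLp.norm_apply_le (y q) i).trans (hyd q)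
        have h2 : |∑ j, y q j * outwardNormal K (K.erase (z : E (m + 1))) j| ≤ diam K := by
          have := abs_real_inner_le_norm (y q) (outwardNormal K (K.erase (z : E (m + 1))))
          rw [hK.norm_outwardNormal z, mul_one] at this
          refine le_trans (le_of_eq ?_) (this.trans (hyd q))
          rw [PiLp.inner_apply]
          simp [mul_comm]
        have h3 := pow_le_pow_left₀ (abs_nonneg _) h1 2
        have h4 := pow_le_pow_left₀ (abs_nonneg _) h2 2
        rw [sq_abs] at h3 h4
        rw [mul_pow]
        calc _ ≤ diam K ^ 2 * diam K ^ 2 := mul_le_mul h3 h4 (sq_nonneg _) (by positivity)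
          _ = _ := by ring
      · have h0 := hnnK q
        have h1 := hnn q (K.erase (q.1 : E (m + 1))) m
        have h2 := hnn q (K.erase (q.2 : E (m + 1))) m
        by_cases hz1 : q.1 = z
        · rw [hz1] at h1 ⊢
          linarith
        · have hz2 : q.2 = z := by
            by_contra h
            exact hz ⟨hz1, h⟩
          rw [hz2] at h2 ⊢
          linarith
    have := integral_sq_sum_le (μ := (μHE[m]).restrict (hull (K.erase (z : E (m + 1)))))
      (fun f hf => hK.integrableOn_face z hf)
      (fun q => continuous_mul_fun (herrc q) continuous_const) hterm
    rw [inv_mul_le_iff₀ hsz]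
    refine this.trans (le_of_eq ?_)
    rw [hcard]
    ring

end TensorInterpolation

/-! ### The forms of the method as bilinear maps -/

section Forms

/-- All the forms of the method are weighted sums of integrals of products of pointwise evaluations,
so this single statement makes `innerV`, `innerDev`, `jumpForm` and `couplingForm` bilinear. -/
lemma exists_bilin {X Y ι J Z : Type*} [AddCommGroup X] [Module ℝ X] [AddCommGroup Y] [Module ℝ Y]
    [Fintype J] [TopologicalSpace Z] [MeasurableSpace Z] (S : Finset ι) (c : ι → ℝ)
    {μ : ι → Measure Z} (hμ : ∀ s ∈ S, ∀ f : Z → ℝ, Continuous f → Integrable f (μ s))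
    (A : ι → J → Z → X →ₗ[ℝ] ℝ) (hA : ∀ s j x, Continuous fun z => A s j z x)
    (B : ι → J → Z → Y →ₗ[ℝ] ℝ) (hB : ∀ s j y, Continuous fun z => B s j z y) :
    ∃ b : X →ₗ[ℝ] Y →ₗ[ℝ] ℝ, ∀ x y,
      b x y = ∑ s ∈ S, c s * ∫ z, ∑ j, A s j z x * B s j z y ∂μ s := by
  have hint : ∀ s ∈ S, ∀ x y, Integrable (fun z => ∑ j, A s j z x * B s j z y) (μ s) :=
    fun s hs x y => hμ s hs _ (continuous_finsetSum _ fun j _ => (hA s j x).mul (hB s j y))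
  refine ⟨LinearMap.mk₂ ℝ (fun x y => ∑ s ∈ S, c s * ∫ z, ∑ j, A s j z x * B s j z y ∂μ s)
    ?_ ?_ ?_ ?_, fun x y => rfl⟩
  · intro x x' y
    rw [← Finset.sum_add_distrib]
    refine Finset.sum_congr rfl fun s hs => ?_
    rw [← mul_add, ← integral_add (hint s hs x y) (hint s hs x' y)]
    simp only [map_add, add_mul, Finset.sum_add_distrib]
  · intro t x y
    rw [smul_eq_mul, Finset.mul_sum]
    refine Finset.sum_congr rfl fun s hs => ?_
    rw [mul_left_comm, ← integral_const_mul t]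
    simp only [map_smul, smul_eq_mul, mul_assoc, ← Finset.mul_sum]
  · intro x y y'
    rw [← Finset.sum_add_distrib]
    refine Finset.sum_congr rfl fun s hs => ?_
    rw [← mul_add, ← integral_add (hint s hs x y) (hint s hs x y')]
    simp only [map_add, mul_add, Finset.sum_add_distrib]
  · intro t x y
    rw [smul_eq_mul, Finset.mul_sum]
    refine Finset.sum_congr rfl fun s hs => ?_
    rw [mul_left_comm, ← integral_const_mul t]
    simp only [map_smul, smul_eq_mul, mul_left_comm _ t, ← Finset.mul_sum]

variable {m : ℕ} {Ω : Set (E (m + 1))} (T : Triangulation Ω)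

lemma jump_apply (τ : BrokenTensor T) (e : Finset (E (m + 1))) (x : E (m + 1))
    (i : Fin (m + 1)) : jump T τ e x i = 1 / 2 * ∑ K ∈ T.adjacent e,
      ∑ j, MvPolynomial.eval x.ofLp (τ K i j) * outwardNormal K.1 e j := by
  simp [jump, Matrix.mulVec, dotProduct, evalM, Finset.sum_apply]

lemma average_apply (v : BrokenVec T) (e : Finset (E (m + 1))) (x : E (m + 1))
    (i : Fin (m + 1)) : average T v e x i =
      1 / 2 * ∑ K ∈ T.adjacent e, MvPolynomial.eval x.ofLp (v K i) := by
  simp [average, evalV, Finset.sum_apply]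

lemma continuous_jump (τ : BrokenTensor T) (e : Finset (E (m + 1))) (i : Fin (m + 1)) :
    Continuous fun x => jump T τ e x i := by
  simp only [jump_apply]
  exact continuous_const.mul (continuous_finsetSum _ fun K _ => continuous_finsetSum _ fun j _ =>
    (continuous_evalE _).mul continuous_const)

lemma continuous_average (v : BrokenVec T) (e : Finset (E (m + 1))) (i : Fin (m + 1)) :
    Continuous fun x => average T v e x i := by
  simp only [average_apply]
  exact continuous_const.mul (continuous_finsetSum _ fun K _ => continuous_evalE _)

lemma integrableOn_interiorFace {e : Finset (E (m + 1))} (he : e ∈ T.interiorFaces)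
    {f : E (m + 1) → ℝ} (hf : Continuous f) : IntegrableOn f (hull e) μHE[m] := by
  obtain ⟨K, L, _, _, v, w, hv, _⟩ := T.exists_adjacent_eq he
  rw [hv]
  exact (T.isCell K).integrableOn_face v hf

/-- Evaluation of a component of a piecewise polynomial vector field. -/
def evalComp (K : T.cells) (i : Fin (m + 1)) (x : E (m + 1)) : BrokenVec T →ₗ[ℝ] ℝ where
  toFun v := MvPolynomial.eval x.ofLp (v K i)
  map_add' v w := by simp
  map_smul' c v := by simp [MvPolynomial.smul_eval]

lemma exists_bilin_innerV : ∃ b : BrokenVec T →ₗ[ℝ] BrokenVec T →ₗ[ℝ] ℝ,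
    ∀ u v, b u v = innerV T u v := by
  obtain ⟨b, hb⟩ := exists_bilin (X := BrokenVec T) (Y := BrokenVec T)
    (Finset.univ : Finset T.cells) (fun _ => 1) (μ := fun K => volume.restrict (hull K.1))
    (fun K _ f hf => continuous_integrableOn_hull hf K.1)
    (fun K i x => evalComp T K i x) (fun K i v => continuous_evalE _)
    (fun K i x => evalComp T K i x) (fun K i v => continuous_evalE _)
  refine ⟨b, fun u v => ?_⟩
  rw [hb]
  simp only [one_mul]
  rfl

/-- Evaluation of a component of the deviator of a piecewise polynomial tensor field. -/
def evalDev (K : T.cells) (q : Fin (m + 1) × Fin (m + 1)) (x : E (m + 1)) :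
    BrokenTensor T →ₗ[ℝ] ℝ where
  toFun τ := dev (evalM (τ K) x) q.1 q.2
  map_add' σ τ := by simp [dev, evalM, Matrix.trace, Finset.sum_add_distrib]; ring
  map_smul' c τ := by
    simp [dev, evalM, Matrix.trace, MvPolynomial.smul_eval, ← Finset.mul_sum]; ring

lemma continuous_evalDev (K : T.cells) (q : Fin (m + 1) × Fin (m + 1)) (τ : BrokenTensor T) :
    Continuous fun x => evalDev T K q x τ := by
  simp only [evalDev, LinearMap.coe_mk, AddHom.coe_mk, dev, evalM, Matrix.trace, Matrix.sub_apply,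
    Matrix.map_apply, Matrix.smul_apply, Matrix.diag_apply, smul_eq_mul]
  exact (continuous_evalE _).sub ((continuous_const.mul
    (continuous_finsetSum _ fun i _ => continuous_evalE _)).mul continuous_const)

lemma exists_bilin_innerDev : ∃ b : BrokenTensor T →ₗ[ℝ] BrokenTensor T →ₗ[ℝ] ℝ,
    ∀ σ τ, b σ τ = innerDev T σ τ := by
  obtain ⟨b, hb⟩ := exists_bilin (X := BrokenTensor T) (Y := BrokenTensor T)
    (Finset.univ : Finset T.cells) (fun _ => 1) (μ := fun K => volume.restrict (hull K.1))
    (fun K _ f hf => continuous_integrableOn_hull hf K.1)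
    (fun K q x => evalDev T K q x) (fun K q v => continuous_evalDev T K q v)
    (fun K q x => evalDev T K q x) (fun K q v => continuous_evalDev T K q v)
  refine ⟨b, fun u v => ?_⟩
  rw [hb]
  simp only [one_mul, Fintype.sum_prod_type]
  rfl

/-- Evaluation of a component of the jump. -/
def evalJump (e : Finset (E (m + 1))) (i : Fin (m + 1)) (x : E (m + 1)) :
    BrokenTensor T →ₗ[ℝ] ℝ where
  toFun τ := jump T τ e x i
  map_add' σ τ := by
    simp only [jump_apply, Pi.add_apply, Matrix.add_apply, map_add, add_mul,
      Finset.sum_add_distrib, mul_add]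
  map_smul' c τ := by
    simp only [jump_apply, Pi.smul_apply, Matrix.smul_apply, MvPolynomial.smul_eval, mul_assoc,
      ← Finset.mul_sum, RingHom.id_apply, smul_eq_mul, mul_left_comm (1 / 2 : ℝ) c]

/-- Evaluation of a component of the average. -/
def evalAverage (e : Finset (E (m + 1))) (i : Fin (m + 1)) (x : E (m + 1)) :
    BrokenVec T →ₗ[ℝ] ℝ where
  toFun v := average T v e x i
  map_add' σ τ := by
    simp only [average_apply, Pi.add_apply, map_add, Finset.sum_add_distrib, mul_add]
  map_smul' c τ := by
    simp only [average_apply, Pi.smul_apply, MvPolynomial.smul_eval,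
      ← Finset.mul_sum, RingHom.id_apply, smul_eq_mul, mul_left_comm c]

lemma exists_bilin_jumpForm : ∃ b : BrokenTensor T →ₗ[ℝ] BrokenTensor T →ₗ[ℝ] ℝ,
    ∀ σ τ, b σ τ = jumpForm T σ τ := by
  obtain ⟨b, hb⟩ := exists_bilin (X := BrokenTensor T) (Y := BrokenTensor T)
    T.interiorFaces (fun e => (diam e)⁻¹) (μ := fun e => μHE[m].restrict (hull e))
    (fun e he f hf => integrableOn_interiorFace T he hf)
    (fun e i x => evalJump T e i x) (fun e i v => continuous_jump T v e i)
    (fun e i x => evalJump T e i x) (fun e i v => continuous_jump T v e i)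
  exact ⟨b, fun u v => hb u v⟩

lemma exists_bilin_couplingForm : ∃ b : BrokenTensor T →ₗ[ℝ] BrokenVec T →ₗ[ℝ] ℝ,
    ∀ σ v, b σ v = couplingForm T σ v := by
  obtain ⟨b, hb⟩ := exists_bilin (X := BrokenTensor T) (Y := BrokenVec T)
    T.interiorFaces (fun _ => 1) (μ := fun e => μHE[m].restrict (hull e))
    (fun e he f hf => integrableOn_interiorFace T he hf)
    (fun e i x => evalJump T e i x) (fun e i v => continuous_jump T v e i)
    (fun e i x => evalAverage T e i x) (fun e i v => continuous_average T v e i)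
  refine ⟨b, fun u v => ?_⟩
  rw [hb]
  simp only [one_mul]
  rfl

/-- The broken divergence as a linear map. -/
def divL : BrokenTensor T →ₗ[ℝ] BrokenVec T where
  toFun := divh T
  map_add' σ τ := by
    funext K i
    simp [divh, divM, Finset.sum_add_distrib]
  map_smul' c τ := by
    funext K i
    simp [divh, divM, Finset.smul_sum]

lemma innerV_self (u : BrokenVec T) : innerV T u u =
    ∑ K : T.cells, ∑ i, ∫ x in hull K.1, MvPolynomial.eval x.ofLp (u K i) ^ 2 := by
  refine Finset.sum_congr rfl fun K _ => ?_
  rw [← integral_finsetSum _ fun i _ => continuous_integrableOn_hull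
    (continuous_sq_fun (continuous_evalE _)) K.1]
  simp only [dotProduct, evalV, sq]

lemma innerV_nonneg (u : BrokenVec T) : 0 ≤ innerV T u u := by
  rw [innerV_self]
  exact Finset.sum_nonneg fun K _ => Finset.sum_nonneg fun i _ =>
    integral_nonneg fun x => sq_nonneg _

lemma jumpForm_self (τ : BrokenTensor T) : jumpForm T τ τ = ∑ e ∈ T.interiorFaces, (diam e)⁻¹ *
    ∑ i, ∫ x in hull e, jump T τ e x i ^ 2 ∂μHE[m] := by
  refine Finset.sum_congr rfl fun e he => ?_
  rw [← integral_finsetSum _ fun i _ => integrableOn_interiorFace T he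
    (continuous_sq_fun (continuous_jump T τ e i))]
  simp only [dotProduct, sq, Nat.add_sub_cancel]

lemma diam_nonneg {n : ℕ} (s : Finset (E n)) : 0 ≤ diam s := Metric.diam_nonneg

lemma jumpForm_nonneg (τ : BrokenTensor T) : 0 ≤ jumpForm T τ τ := by
  rw [jumpForm_self]
  exact Finset.sum_nonneg fun e _ => mul_nonneg (inv_nonneg.2 (diam_nonneg e))
    (Finset.sum_nonneg fun i _ => integral_nonneg fun x => sq_nonneg _)

lemma innerDev_self (τ : BrokenTensor T) : innerDev T τ τ =
    ∑ K : T.cells, ∑ i, ∑ j, ∫ x in hull K.1, dev (evalM (τ K) x) i j ^ 2 := by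
  refine Finset.sum_congr rfl fun K _ => ?_
  have hc : ∀ i j, Continuous fun x => dev (evalM (τ K) x) i j := fun i j =>
    continuous_evalDev T K (i, j) τ
  have : ∀ i, ∑ j, ∫ x in hull K.1, dev (evalM (τ K) x) i j ^ 2 =
      ∫ x in hull K.1, ∑ j, dev (evalM (τ K) x) i j ^ 2 := fun i =>
    (integral_finsetSum _ fun j _ => continuous_integrableOn_hull
      (continuous_sq_fun (hc i j)) K.1).symm
  simp only [this]
  rw [← integral_finsetSum _ fun i _ => continuous_integrableOn_hull
    (continuous_finsetSum _ fun j _ => continuous_sq_fun (hc i j)) K.1]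
  simp only [ddot, sq]

lemma innerDev_nonneg (τ : BrokenTensor T) : 0 ≤ innerDev T τ τ := by
  rw [innerDev_self]
  exact Finset.sum_nonneg fun K _ => Finset.sum_nonneg fun i _ => Finset.sum_nonneg fun j _ =>
    integral_nonneg fun x => sq_nonneg _

end Forms

/-! ### Consequences of shape regularity -/

section ShapeRegularity

variable {m : ℕ}

lemma diam_mono {n : ℕ} {s t : Finset (E n)} (h : s ⊆ t) : diam s ≤ diam t :=
  Metric.diam_mono (convexHull_mono (Finset.coe_subset.2 h)) (IsCell.isCompact_hull t).isBounded

lemma exists_pow_le_scale (m : ℕ) : ∃ a : ℝ, 0 < a ∧ ∀ {K : Finset (E (m + 1))}, IsCell K →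
    ∀ (c : E (m + 1)) (r : ℝ), 0 < r → Metric.ball c r ⊆ hull K → a * r ^ (m + 1) ≤ scale K := by
  have hc : 0 < (volume (corner (m + 1))).toReal := corner_volume_toReal_pos _
  have hb : 0 < (volume (Metric.ball (0 : E (m + 1)) 1)).toReal :=
    ENNReal.toReal_pos (Metric.measure_ball_pos _ _ one_pos).ne' measure_ball_lt_top.ne
  refine ⟨(volume (Metric.ball (0 : E (m + 1)) 1)).toReal / (volume (corner (m + 1))).toReal,
    by positivity, fun {K} hK c r hr hball => ?_⟩
  rw [scale, hK.card, Nat.add_sub_cancel, measure_top, div_mul_eq_mul_div]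
  refine div_le_div_of_nonneg_right ?_ hc.le
  have h1 := ENNReal.toReal_mono (IsCell.isCompact_hull K).measure_lt_top.ne
    (measure_mono (μ := volume) hball)
  rw [Measure.addHaar_ball volume c hr.le, ENNReal.toReal_mul,
    ENNReal.toReal_ofReal (by positivity), finrank_euclideanSpace_fin] at h1
  rw [mul_comm]
  exact h1

/-- The face has measure at most a multiple of h_e^m, and the inscribed ball gives `K` at least a
multiple of h_K^(m+1). No lower bound for h_e is needed: in the second estimate h_e⁻¹ h_e^m =
h_e^(m−1) has a nonnegative exponent because `1 ≤ m`. -/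
lemma exists_scale_face_le (m : ℕ) (hm : 1 ≤ m) (γ : ℝ) : ∃ C : ℝ, 0 ≤ C ∧
    ∀ {K : Finset (E (m + 1))}, IsCell K → ∀ (c : E (m + 1)) (r : ℝ), 0 < r →
      Metric.ball c r ⊆ hull K → diam K ≤ γ * r → ∀ v : K,
      scale (K.erase (v : E (m + 1))) * diam (K.erase (v : E (m + 1))) ≤ C * scale K ∧
      (diam (K.erase (v : E (m + 1))))⁻¹ * scale (K.erase (v : E (m + 1))) * diam K ^ 2 ≤
        C * scale K := by
  obtain ⟨a, ha, hlow⟩ := exists_pow_le_scale m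
  obtain ⟨b, hb, hup⟩ := exists_scale_le_pow m
  refine ⟨b * |γ| ^ (m + 1) / a, by positivity, fun {K} hK c r hr hball hγ v => ?_⟩
  have hdK := diam_nonneg K
  have hde := diam_nonneg (K.erase (v : E (m + 1)))
  have hle : diam (K.erase (v : E (m + 1))) ≤ diam K := diam_mono (Finset.erase_subset _ _)
  have hs : scale (K.erase (v : E (m + 1))) ≤ b * diam (K.erase (v : E (m + 1))) ^ m := by
    have hc : (K.erase (v : E (m + 1))).card = m + 1 := by
      rw [Finset.card_erase_of_mem v.2, hK.card]; omega
    have hind : AffineIndependent ℝ ((↑) : (K.erase (v : E (m + 1)) : Finset _) → E (m + 1)) :=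
      hK.indep.mono (Finset.coe_subset.2 (Finset.erase_subset _ _))
    obtain ⟨l, hl, hls⟩ := exists_vertexList' hc hind
    have hmem : ∀ i, l i ∈ hull (K.erase (v : E (m + 1))) := fun i =>
      IsCell.mem_hull_of_mem (Finset.mem_coe.1 (hls ▸ Set.mem_range_self i))
    exact hup hl hls _ (fun i => IsCell.norm_sub_le_diam (hmem _) (hmem _)) hde
  have hpow : b * diam K ^ (m + 1) ≤ b * |γ| ^ (m + 1) / a * scale K := by
    have h1 : diam K ^ (m + 1) ≤ (|γ| * r) ^ (m + 1) :=
      pow_le_pow_left₀ hdK (hγ.trans (mul_le_mul_of_nonneg_right (le_abs_self γ) hr.le)) _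
    calc b * diam K ^ (m + 1) ≤ b * (|γ| * r) ^ (m + 1) := by gcongr
      _ = b * |γ| ^ (m + 1) / a * (a * r ^ (m + 1)) := by
        rw [mul_pow]; field_simp
      _ ≤ _ := by
        have := hlow hK c r hr hball
        gcongr
  obtain ⟨l, rfl⟩ := Nat.exists_eq_add_of_le' hm
  constructor
  · refine le_trans ?_ hpow
    calc _ ≤ b * diam (K.erase (v : E (l + 1 + 1))) ^ (l + 1) * diam (K.erase (v : E (l + 1 + 1))) :=
          by gcongr
      _ = b * diam (K.erase (v : E (l + 1 + 1))) ^ (l + 1 + 1) := by ring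
      _ ≤ _ := by gcongr
  · refine le_trans ?_ hpow
    rcases hde.eq_or_lt with h0 | h0
    · rw [← h0, inv_zero, zero_mul, zero_mul]
      positivity
    calc _ ≤ (diam (K.erase (v : E (l + 1 + 1))))⁻¹ *
          (b * diam (K.erase (v : E (l + 1 + 1))) ^ (l + 1)) * diam K ^ 2 := by gcongr
      _ = b * diam (K.erase (v : E (l + 1 + 1))) ^ l * diam K ^ 2 := by
        field_simp
        ring
      _ ≤ b * diam K ^ l * diam K ^ 2 := by gcongr
      _ = _ := by ring

variable {Ω : Set (E (m + 1))} (T : Triangulation Ω)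

/-- After exchanging the sums, each element is counted once for each of its interior faces, and it
has `m + 2` faces in all. -/
lemma sum_adjacent_le {F : T.cells → ℝ} (hF : ∀ K, 0 ≤ F K) :
    ∑ e ∈ T.interiorFaces, ∑ K ∈ T.adjacent e, F K ≤ (m + 2 : ℕ) * ∑ K, F K := by
  have h1 : ∀ e, ∑ K ∈ T.adjacent e, F K = ∑ K, if e ⊆ K.1 then F K else 0 := fun e => by
    rw [Triangulation.adjacent, Finset.sum_filter]
  simp only [h1]
  rw [Finset.sum_comm, Finset.mul_sum]
  refine Finset.sum_le_sum fun K _ => ?_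
  rw [← Finset.sum_filter, Finset.sum_const, nsmul_eq_mul]
  refine mul_le_mul_of_nonneg_right ?_ (hF K)
  have h2 : T.interiorFaces.filter (fun e => e ⊆ K.1) ⊆ K.1.powersetCard (m + 1) := by
    intro e he
    rw [Finset.mem_filter] at he
    exact Finset.mem_powersetCard.2 ⟨he.2, T.card_of_mem_interiorFaces he.1⟩
  have h3 := Finset.card_le_card h2
  rw [Finset.card_powersetCard, T.card_cell K K.2, Nat.choose_succ_self_right] at h3
  exact_mod_cast h3

lemma sq_half_sum_adjacent_le {e : Finset (E (m + 1))} (he : e ∈ T.interiorFaces)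
    (f : T.cells → ℝ) :
    (1 / 2 * ∑ K ∈ T.adjacent e, f K) ^ 2 ≤ ∑ K ∈ T.adjacent e, f K ^ 2 := by
  have hc : (T.adjacent e).card = 2 := by
    simp only [Triangulation.interiorFaces, Finset.mem_filter] at he
    exact he.2
  have h := sq_sum_le_card_mul_sum_sq (s := T.adjacent e) (f := f)
  rw [hc] at h
  have h0 : 0 ≤ ∑ K ∈ T.adjacent e, f K ^ 2 := Finset.sum_nonneg fun _ _ => sq_nonneg _
  rw [mul_pow]
  push_cast at h
  linarith

lemma diam_pos_of_card {n : ℕ} {s : Finset (E n)} (hs : 1 < s.card) : 0 < diam s := by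
  obtain ⟨x, hx, y, hy, hxy⟩ := Finset.one_lt_card.1 hs
  refine lt_of_lt_of_le (dist_pos.2 hxy) ?_
  rw [dist_eq_norm]
  exact IsCell.norm_sub_le_diam (IsCell.mem_hull_of_mem hy) (IsCell.mem_hull_of_mem hx)

/-- The coupling of jumps and averages is controlled by the jump seminorm and the `L²` norm. -/
theorem exists_coupling_bound (m : ℕ) (hm : 1 ≤ m) (k : ℕ) (γ : ℝ) : ∃ C : ℝ, 0 ≤ C ∧
    ∀ {Ω : Set (E (m + 1))} (T : Triangulation Ω), T.ShapeRegular γ → ∀ τ : BrokenTensor T,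
      ∀ v ∈ Vh T k, ∀ t : ℝ, 0 < t →
        |couplingForm T τ v| ≤ t * jumpForm T τ τ + C / t * innerV T v v := by
  obtain ⟨C₁, hC₁, hinv⟩ := exists_inverseTrace m k
  obtain ⟨C₂, hC₂, hsc⟩ := exists_scale_face_le m hm γ
  refine ⟨(m + 2 : ℕ) * (C₁ * C₂), by positivity, fun {Ω} T hT τ v hv t ht => ?_⟩
  -- The inverse trace inequality is used on both sides of the face; the factor `diam e` makes up
  -- for the ratio of the measures of face and element.
  have hav : ∀ e ∈ T.interiorFaces, diam e * ∑ i, ∫ x in hull e, average T v e x i ^ 2 ∂μHE[m] ≤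
      ∑ K ∈ T.adjacent e, C₁ * C₂ * ∑ i, ∫ x in hull K.1, MvPolynomial.eval x.ofLp (v K i) ^ 2 := by
    intro e he
    have hcell : ∀ K ∈ T.adjacent e, ∀ i, diam e * ∫ x in hull e,
        MvPolynomial.eval x.ofLp (v K i) ^ 2 ∂μHE[m] ≤
        C₁ * C₂ * ∫ x in hull K.1, MvPolynomial.eval x.ofLp (v K i) ^ 2 := by
      intro K hK i
      obtain ⟨z, rfl⟩ := T.exists_eq_erase (T.card_of_mem_interiorFaces he) (T.mem_adjacent.1 hK)
      obtain ⟨c, r, hr, hball, hγ⟩ := hT K.1 K.2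
      have h1 := hinv (T.isCell K) z _ (hv K i)
      have h2 := (hsc (T.isCell K) c r hr hball hγ z).1
      have hsz := (T.isCell K).scale_erase_pos z
      have hsK := (T.isCell K).scale_pos
      have h0 : 0 ≤ ∫ x in hull K.1, MvPolynomial.eval x.ofLp (v K i) ^ 2 :=
        integral_nonneg fun x => sq_nonneg _
      rw [inv_mul_le_iff₀ hsz] at h1
      calc _ ≤ diam (K.1.erase (z : E (m + 1))) * (scale (K.1.erase (z : E (m + 1))) *
            (C₁ * ((scale K.1)⁻¹ * ∫ x in hull K.1, MvPolynomial.eval x.ofLp (v K i) ^ 2))) :=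
            mul_le_mul_of_nonneg_left h1 (diam_nonneg _)
        _ = (scale (K.1.erase (z : E (m + 1))) * diam (K.1.erase (z : E (m + 1)))) *
            (C₁ * ((scale K.1)⁻¹ * ∫ x in hull K.1, MvPolynomial.eval x.ofLp (v K i) ^ 2)) := by
            ring
        _ ≤ (C₂ * scale K.1) *
            (C₁ * ((scale K.1)⁻¹ * ∫ x in hull K.1, MvPolynomial.eval x.ofLp (v K i) ^ 2)) := by
            gcongr
        _ = _ := by field_simp
    have hsq : ∀ i, ∫ x in hull e, average T v e x i ^ 2 ∂μHE[m] ≤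
        ∑ K ∈ T.adjacent e, ∫ x in hull e, MvPolynomial.eval x.ofLp (v K i) ^ 2 ∂μHE[m] := by
      intro i
      rw [← integral_finsetSum _ fun K _ => integrableOn_interiorFace T he
        (continuous_sq_fun (continuous_evalE _))]
      refine integral_mono (integrableOn_interiorFace T he
        (continuous_sq_fun (continuous_average T v e i))) (integrableOn_interiorFace T he
        (continuous_finsetSum _ fun K _ => continuous_sq_fun (continuous_evalE _))) fun x => ?_
      simp only [average_apply]
      exact sq_half_sum_adjacent_le T he fun K => MvPolynomial.eval x.ofLp (v K i)
    calc _ ≤ diam e * ∑ i, ∑ K ∈ T.adjacent e,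
          ∫ x in hull e, MvPolynomial.eval x.ofLp (v K i) ^ 2 ∂μHE[m] :=
          mul_le_mul_of_nonneg_left (Finset.sum_le_sum fun i _ => hsq i) (diam_nonneg e)
      _ = ∑ K ∈ T.adjacent e, ∑ i, diam e *
          ∫ x in hull e, MvPolynomial.eval x.ofLp (v K i) ^ 2 ∂μHE[m] := by
          rw [Finset.sum_comm, Finset.mul_sum]
          simp only [Finset.mul_sum]
      _ ≤ _ := by
          refine Finset.sum_le_sum fun K hK => ?_
          rw [Finset.mul_sum]
          exact Finset.sum_le_sum fun i _ => hcell K hK i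
  -- Young's inequality with weight `t / diam e` puts `(diam e)⁻¹` on the jump, as in `jumpForm`,
  -- and `diam e` on the average.
  have hface : ∀ e ∈ T.interiorFaces,
      |∫ x in hull e, jump T τ e x ⬝ᵥ average T v e x ∂μHE[m]| ≤
      t * ((diam e)⁻¹ * ∑ i, ∫ x in hull e, jump T τ e x i ^ 2 ∂μHE[m]) +
      t⁻¹ * (diam e * ∑ i, ∫ x in hull e, average T v e x i ^ 2 ∂μHE[m]) := by
    intro e he
    have hd : 0 < diam e := diam_pos_of_card (by rw [T.card_of_mem_interiorFaces he]; omega)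
    have hj := fun i => integrableOn_interiorFace T he (continuous_sq_fun (continuous_jump T τ e i))
    have ha := fun i =>
      integrableOn_interiorFace T he (continuous_sq_fun (continuous_average T v e i))
    have hcj := continuous_finsetSum (Finset.univ : Finset (Fin (m + 1)))
      fun i _ => continuous_sq_fun (continuous_jump T τ e i)
    have hca := continuous_finsetSum (Finset.univ : Finset (Fin (m + 1)))
      fun i _ => continuous_sq_fun (continuous_average T v e i)
    have hR : t * ((diam e)⁻¹ * ∑ i, ∫ x in hull e, jump T τ e x i ^ 2 ∂μHE[m]) +
        t⁻¹ * (diam e * ∑ i, ∫ x in hull e, average T v e x i ^ 2 ∂μHE[m]) =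
        ∫ x in hull e, (t * (diam e)⁻¹ * ∑ i, jump T τ e x i ^ 2 +
          t⁻¹ * diam e * ∑ i, average T v e x i ^ 2) ∂μHE[m] := by
      rw [integral_add (integrableOn_interiorFace T he (continuous_mul_fun continuous_const hcj))
        (integrableOn_interiorFace T he (continuous_mul_fun continuous_const hca)), integral_const_mul,
        integral_const_mul, integral_finsetSum _ fun i _ => hj i,
        integral_finsetSum _ fun i _ => ha i]
      ring
    rw [hR]
    have hpt : ∀ x, |jump T τ e x ⬝ᵥ average T v e x| ≤ t * (diam e)⁻¹ * ∑ i, jump T τ e x i ^ 2 +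
        t⁻¹ * diam e * ∑ i, average T v e x i ^ 2 := by
      intro x
      rw [dotProduct, Finset.mul_sum, Finset.mul_sum, ← Finset.sum_add_distrib]
      refine (Finset.abs_sum_le_sum_abs _ _).trans (Finset.sum_le_sum fun i _ => ?_)
      generalize jump T τ e x i = a
      generalize average T v e x i = b
      have h1 : t * (diam e)⁻¹ * a ^ 2 + t⁻¹ * diam e * b ^ 2 =
          (diam e * t)⁻¹ * ((t * a) ^ 2 + (diam e * b) ^ 2) := by field_simp
      rw [h1, ← div_eq_inv_mul, le_div_iff₀ (by positivity), abs_mul]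
      have h2 : |t * a| * |diam e * b| = |a| * |b| * (diam e * t) := by
        rw [abs_mul, abs_mul, abs_of_pos ht, abs_of_pos hd]; ring
      rw [← h2, ← sq_abs (t * a), ← sq_abs (diam e * b)]
      nlinarith [sq_nonneg (|t * a| - |diam e * b|), sq_nonneg (|t * a|), sq_nonneg (|diam e * b|)]
    have hcd : Continuous fun x => jump T τ e x ⬝ᵥ average T v e x := by
      simp only [dotProduct]
      exact continuous_finsetSum _ fun i _ =>
        (continuous_jump T τ e i).mul (continuous_average T v e i)
    refine (abs_integral_le_integral_abs).trans (integral_mono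
      (integrableOn_interiorFace T he hcd.abs) (integrableOn_interiorFace T he
        ((continuous_const.mul hcj).add (continuous_const.mul hca))) hpt)
  rw [couplingForm]
  calc _ ≤ ∑ e ∈ T.interiorFaces, |∫ x in hull e, jump T τ e x ⬝ᵥ average T v e x ∂μHE[m]| :=
        Finset.abs_sum_le_sum_abs _ _
    _ ≤ ∑ e ∈ T.interiorFaces,
        (t * ((diam e)⁻¹ * ∑ i, ∫ x in hull e, jump T τ e x i ^ 2 ∂μHE[m]) +
        t⁻¹ * ∑ K ∈ T.adjacent e, C₁ * C₂ *
          ∑ i, ∫ x in hull K.1, MvPolynomial.eval x.ofLp (v K i) ^ 2) := by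
        refine Finset.sum_le_sum fun e he => (hface e he).trans ?_
        have := hav e he
        gcongr
    _ ≤ _ := by
        rw [Finset.sum_add_distrib, ← Finset.mul_sum, ← Finset.mul_sum, jumpForm_self]
        refine add_le_add le_rfl ?_
        have h := sum_adjacent_le T (F := fun K => C₁ * C₂ *
          ∑ i, ∫ x in hull K.1, MvPolynomial.eval x.ofLp (v K i) ^ 2) fun K =>
            mul_nonneg (by positivity) (Finset.sum_nonneg fun i _ =>
              integral_nonneg fun x => sq_nonneg _)
        rw [← Finset.mul_sum, ← innerV_self] at h
        calc _ ≤ t⁻¹ * ((m + 2 : ℕ) * (C₁ * C₂ * innerV T v v)) := by gcongr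
          _ = _ := by ring

end ShapeRegularity

/-! ### Broken tensor fields with prescribed divergence -/

section MeanTrace

variable {m k : ℕ} {Ω : Set (E (m + 1))} (T : Triangulation Ω)

lemma sum_adjacent_outwardNormal {e : Finset (E (m + 1))} (he : e ∈ T.interiorFaces)
    (i : Fin (m + 1)) : ∑ K ∈ T.adjacent e, outwardNormal K.1 e i = 0 := by
  obtain ⟨K, L, hKL, h, v, w, hv, hw⟩ := T.exists_adjacent_eq he
  rw [h, Finset.sum_pair fun h => hKL (congrArg Subtype.val h)]
  have := (T.isCell K).outwardNormal_eq_neg (T.isCell L) hKL (T.conforming K K.2 L L.2)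
    (v := v) (w := w) (hv.symm.trans hw)
  rw [← hv, ← hw] at this
  rw [this]
  simp

lemma volume_hull_pos (K : T.cells) : 0 < (volume (hull K.1)).toReal :=
  ENNReal.toReal_pos (Measure.measure_pos_of_nonempty_interior _
    (T.isCell K).interior_hull_nonempty).ne' (IsCell.isCompact_hull K.1).measure_lt_top.ne

/-- Subtracting a multiple of the identity makes the mean trace vanish. -/
lemma exists_mem_Sigmah {σ : BrokenTensor T} (hs : ∀ K, (σ K).IsSymm)
    (hd : ∀ K i j, σ K i j ∈ PolyLE (m + 1) (k + 1)) : ∃ σ' ∈ Sigmah T k,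
      divh T σ' = divh T σ ∧ innerDev T σ' σ' = innerDev T σ σ ∧
      ∀ e ∈ T.interiorFaces, ∀ x, jump T σ' e x = jump T σ e x := by
  -- This `c` makes the mean trace zero. The field `c • I` has no divergence and no deviator, and no
  -- jump because the two normals cancel.
  obtain ⟨c, hc⟩ : ∃ c : ℝ, c = integralTrace T σ /
    ((m + 1 : ℕ) * ∑ K : T.cells, (volume (hull K.1)).toReal) := ⟨_, rfl⟩
  obtain ⟨σ', hσ'⟩ : ∃ σ' : BrokenTensor T, ∀ K, σ' K =
    σ K - Matrix.diagonal fun _ => MvPolynomial.C c := ⟨fun K => _, fun K => rfl⟩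
  have hev : ∀ K x, evalM (σ' K) x = evalM (σ K) x - Matrix.diagonal fun _ => c := by
    intro K x
    ext i j
    by_cases h : i = j
    · simp [hσ', evalM, h]
    · simp [hσ', evalM, Matrix.diagonal_apply_ne _ h]
  have htr : ∀ K x, (evalM (σ' K) x).trace = (evalM (σ K) x).trace - (m + 1 : ℕ) * c := by
    intro K x
    rw [hev, Matrix.trace_sub]
    simp [Matrix.trace]
  refine ⟨σ', ⟨fun K => ?_, fun K i j => ?_, ?_⟩, ?_, ?_, ?_⟩
  · rw [hσ']
    exact (hs K).sub (Matrix.isSymm_diagonal _)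
  · rw [hσ', Matrix.sub_apply]
    refine Submodule.sub_mem _ (hd K i j) ?_
    by_cases h : i = j
    · rw [h, Matrix.diagonal_apply_eq]
      exact C_mem_polyLE _
    · rw [Matrix.diagonal_apply_ne _ h]
      exact Submodule.zero_mem _
  · have h1 : integralTrace T σ' = integralTrace T σ -
        ((m + 1 : ℕ) * ∑ K : T.cells, (volume (hull K.1)).toReal) * c := by
      rw [integralTrace, integralTrace, Finset.mul_sum, Finset.sum_mul, ← Finset.sum_sub_distrib]
      refine Finset.sum_congr rfl fun K _ => ?_
      simp only [htr]
      rw [integral_sub (integrableOn_trace T σ K) (integrableOn_const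
        (IsCell.isCompact_hull K.1).measure_lt_top.ne)]
      rw [setIntegral_const, Measure.real, smul_eq_mul]
      ring
    rw [h1]
    by_cases hne : Nonempty T.cells
    · have hpos : 0 < ∑ K : T.cells, (volume (hull K.1)).toReal :=
        Finset.sum_pos (fun K _ => volume_hull_pos T K) Finset.univ_nonempty
      rw [hc, mul_div_cancel₀ _ (by positivity), sub_self]
    · rw [not_nonempty_iff] at hne
      simp [integralTrace]
  · funext K i
    simp only [divh, divM, hσ', Matrix.sub_apply, map_sub, Finset.sum_sub_distrib]
    rw [sub_eq_self]
    refine Finset.sum_eq_zero fun j _ => ?_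
    by_cases h : i = j
    · rw [h, Matrix.diagonal_apply_eq, MvPolynomial.pderiv_C]
    · rw [Matrix.diagonal_apply_ne _ h, map_zero]
  · refine Finset.sum_congr rfl fun K _ => ?_
    have : ∀ x, dev (evalM (σ' K) x) = dev (evalM (σ K) x) := by
      intro x
      have hm : ((m + 1 : ℕ) : ℝ) ≠ 0 := by positivity
      rw [dev, dev, htr, hev]
      ext i j
      simp only [Matrix.sub_apply, Matrix.smul_apply, smul_eq_mul]
      by_cases h : i = j
      · rw [h, Matrix.diagonal_apply_eq, Matrix.one_apply_eq]
        field_simp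
        ring
      · rw [Matrix.diagonal_apply_ne _ h, Matrix.one_apply_ne h]
        ring
    simp only [this]
  · intro e he x
    funext i
    rw [jump_apply, jump_apply]
    congr 1
    have h1 : ∀ K : T.cells, ∑ j, MvPolynomial.eval x.ofLp (σ' K i j) * outwardNormal K.1 e j =
        ∑ j, MvPolynomial.eval x.ofLp (σ K i j) * outwardNormal K.1 e j -
          c * outwardNormal K.1 e i := by
      intro K
      have h2 : ∀ j, MvPolynomial.eval x.ofLp (σ' K i j) =
          MvPolynomial.eval x.ofLp (σ K i j) - if i = j then c else 0 := by
        intro j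
        have := congrArg (fun M => M i j) (hev K x)
        simpa [evalM, Matrix.diagonal_apply] using this
      simp only [h2, sub_mul, Finset.sum_sub_distrib, ite_mul, zero_mul, Finset.sum_ite_eq,
        Finset.mem_univ, if_true]
    simp only [h1, Finset.sum_sub_distrib, ← Finset.mul_sum]
    rw [sum_adjacent_outwardNormal T he, mul_zero, sub_zero]

end MeanTrace

/-! ### Piecewise polynomials as functions on the whole space -/

section PiecewiseFields

variable {m k : ℕ} {Ω : Set (E (m + 1))} (T : Triangulation Ω)

lemma aedisjoint_hull {K L : T.cells} (hKL : K ≠ L) :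
    AEDisjoint volume (hull K.1) (hull L.1) :=
  (T.isCell K).volume_inter_eq_zero (T.isCell L) (fun h => hKL (Subtype.ext h))
    (T.conforming K K.2 L L.2)

lemma measurableSet_hull {n : ℕ} (s : Finset (E n)) : MeasurableSet (hull s) :=
  (IsCell.isCompact_hull s).measurableSet

lemma integral_iUnion_hull {f : E (m + 1) → ℝ}
    (hf : ∀ K : T.cells, IntegrableOn f (hull K.1)) :
    ∫ x in ⋃ K : T.cells, hull K.1, f x = ∑ K : T.cells, ∫ x in hull K.1, f x := by
  have h1 : IntegrableOn f (⋃ K : T.cells, hull K.1) := integrableOn_finite_iUnion.2 hf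
  have h2 := integral_iUnion_ae (μ := volume) (s := fun K : T.cells => hull K.1) (f := f)
    (fun K => (measurableSet_hull K.1).nullMeasurableSet)
    (fun K L h => aedisjoint_hull T h) h1
  rw [h2, tsum_fintype]

/-- A piecewise polynomial vector field as a function on the whole space. -/
def pieceFun (u : BrokenVec T) (i : Fin (m + 1)) (x : E (m + 1)) : ℝ :=
  ∑ K : T.cells, (hull K.1).indicator (fun x => MvPolynomial.eval x.ofLp (u K i)) x

lemma measurable_pieceFun (u : BrokenVec T) (i : Fin (m + 1)) : Measurable (pieceFun T u i) :=
  Finset.measurable_fun_sum _ fun K _ =>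
    (continuous_evalE _).measurable.indicator (measurableSet_hull K.1)

lemma exists_bound_pieceFun (u : BrokenVec T) : ∃ B, ∀ i x, |pieceFun T u i x| ≤ B := by
  have h : ∀ (K : T.cells) i, ∃ B, ∀ x, |(hull K.1).indicator
      (fun x => MvPolynomial.eval x.ofLp (u K i)) x| ≤ B := by
    intro K i
    obtain ⟨B, hB⟩ := (IsCell.isCompact_hull K.1).exists_bound_of_continuousOn
      (continuous_evalE (u K i)).continuousOn
    refine ⟨max B 0, fun x => ?_⟩
    by_cases hx : x ∈ hull K.1
    · rw [Set.indicator_of_mem hx]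
      exact (hB x hx).trans (le_max_left _ _)
    · rw [Set.indicator_of_notMem hx, abs_zero]
      exact le_max_right _ _
  choose B hB using h
  refine ⟨∑ i, ∑ K, |B K i|, fun i x => ?_⟩
  refine (Finset.abs_sum_le_sum_abs _ _).trans ?_
  refine (Finset.sum_le_sum fun K _ => (hB K i x).trans (le_abs_self _)).trans ?_
  exact Finset.single_le_sum (f := fun i => ∑ K, |B K i|)
    (fun i _ => Finset.sum_nonneg fun K _ => abs_nonneg _) (Finset.mem_univ i)

/-- Different elements overlap in null sets, so almost everywhere only one indicator contributes to
the sum. -/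
lemma ae_pieceFun_eq (u : BrokenVec T) (K : T.cells) : ∀ᵐ x ∂volume.restrict (hull K.1),
    ∀ i, pieceFun T u i x = MvPolynomial.eval x.ofLp (u K i) := by
  have h1 : ∀ᵐ x ∂volume.restrict (hull K.1), ∀ L : T.cells, L ≠ K → x ∉ hull L.1 := by
    rw [ae_all_iff]
    intro L
    by_cases hL : L = K
    · exact Filter.Eventually.of_forall fun x h => absurd hL h
    · rw [ae_restrict_iff' (measurableSet_hull K.1)]
      have : volume (hull K.1 ∩ hull L.1) = 0 := aedisjoint_hull T (Ne.symm hL)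
      filter_upwards [measure_eq_zero_iff_ae_notMem.1 this] with x hx hxK _ hxL
      exact hx ⟨hxK, hxL⟩
  filter_upwards [h1, ae_restrict_mem (measurableSet_hull K.1)] with x hx hxK i
  rw [pieceFun, Finset.sum_eq_single K]
  · rw [Set.indicator_of_mem hxK]
  · intro L _ hL
    exact Set.indicator_of_notMem (hx L hL) _
  · exact fun h => absurd (Finset.mem_univ K) h

lemma integral_pieceFun_sq {S : Set (E (m + 1))} (hS : MeasurableSet S)
    (hsub : ∀ K : T.cells, hull K.1 ⊆ S) (u : BrokenVec T) (i : Fin (m + 1)) :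
    ∫ x in S, pieceFun T u i x ^ 2 =
      ∑ K : T.cells, ∫ x in hull K.1, MvPolynomial.eval x.ofLp (u K i) ^ 2 := by
  have h1 : ∀ K : T.cells, (fun x => pieceFun T u i x ^ 2) =ᵐ[volume.restrict (hull K.1)]
      fun x => MvPolynomial.eval x.ofLp (u K i) ^ 2 := fun K => by
    filter_upwards [ae_pieceFun_eq T u K] with x hx
    rw [hx]
  have h2 : ∫ x in S, pieceFun T u i x ^ 2 =
      ∫ x in ⋃ K : T.cells, hull K.1, pieceFun T u i x ^ 2 := by
    refine (setIntegral_eq_of_subset_of_forall_sdiff_eq_zero hS (Set.iUnion_subset hsub)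
      fun x hx => ?_)
    rw [pieceFun, Finset.sum_eq_zero, zero_pow two_ne_zero]
    intro K _
    exact Set.indicator_of_notMem (fun h => hx.2 (Set.mem_iUnion_of_mem K h)) _
  rw [h2, integral_iUnion_hull T fun K => (continuous_integrableOn_hull
    (continuous_sq_fun (continuous_evalE _)) K.1).congr (h1 K).symm]
  exact Finset.sum_congr rfl fun K _ => integral_congr_ae (h1 K)

lemma sum_integral_hull_le {S : Set (E (m + 1))}
    (hsub : ∀ K : T.cells, hull K.1 ⊆ S) {f : E (m + 1) → ℝ} (hf : IntegrableOn f S)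
    (h0 : ∀ x, 0 ≤ f x) : ∑ K : T.cells, ∫ x in hull K.1, f x ≤ ∫ x in S, f x := by
  rw [← integral_iUnion_hull T fun K => hf.mono_set (hsub K)]
  exact setIntegral_mono_set hf (Filter.Eventually.of_forall h0)
    (Set.iUnion_subset hsub).eventuallyLE

end PiecewiseFields

/-! ### Jumps and divergence of the interpolant -/

section BrokenInterpolation

variable {m k : ℕ} {Ω : Set (E (m + 1))} (T : Triangulation Ω)

/-- The normal component on the face `e` of the difference of a polynomial tensor field on `K` and
a tensor field. -/
def normalError (σ : BrokenTensor T) (τ : Fin (m + 1) → Fin (m + 1) → E (m + 1) → ℝ)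
    (e : Finset (E (m + 1))) (i : Fin (m + 1)) (K : T.cells) (x : E (m + 1)) : ℝ :=
  ∑ j, (MvPolynomial.eval x.ofLp (σ K i j) - τ i j x) * outwardNormal K.1 e j

variable {T} {σ : BrokenTensor T} {τ : Fin (m + 1) → Fin (m + 1) → E (m + 1) → ℝ}

lemma continuous_normalError (hτ : ∀ i j, Continuous (τ i j)) (e : Finset (E (m + 1)))
    (i : Fin (m + 1)) (K : T.cells) : Continuous (normalError T σ τ e i K) :=
  continuous_finsetSum _ fun j _ => ((continuous_evalE _).sub (hτ i j)).mul continuous_const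

/-- The normal traces of the single-valued field `τ` from the two sides cancel, so the jump of the
interpolant is the jump of the error. -/
lemma jump_eq_normalError {e : Finset (E (m + 1))} (he : e ∈ T.interiorFaces) (x : E (m + 1))
    (i : Fin (m + 1)) :
    jump T σ e x i = 1 / 2 * ∑ K ∈ T.adjacent e, normalError T σ τ e i K x := by
  rw [jump_apply]
  congr 1
  simp only [normalError, sub_mul, Finset.sum_sub_distrib]
  have h : ∑ K ∈ T.adjacent e, ∑ j, τ i j x * outwardNormal K.1 e j = 0 := by
    rw [Finset.sum_comm]
    refine Finset.sum_eq_zero fun j _ => ?_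
    rw [← Finset.mul_sum, sum_adjacent_outwardNormal T he, mul_zero]
  rw [h, sub_zero]

/-- On a face the average of `u` is the restriction of one polynomial of degree `k`, and the normal
errors from both sides have zero moments against it. -/
lemma couplingForm_eq_zero (hτ : ∀ i j, Continuous (τ i j))
    (h : ∀ (K : T.cells) (v : K.1) i, ∀ q ∈ PolyLE (m + 1) k,
      ∫ x in hull (K.1.erase (v : E (m + 1))), normalError T σ τ (K.1.erase (v : E (m + 1))) i K x *
        MvPolynomial.eval x.ofLp q ∂μHE[m] = 0) {u : BrokenVec T} (hu : u ∈ Vh T k) :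
    couplingForm T σ u = 0 := by
  refine Finset.sum_eq_zero fun e he => ?_
  obtain ⟨q, hq⟩ : ∃ q : Fin (m + 1) → Poly (m + 1), ∀ i, q i =
    MvPolynomial.C (1 / 2) * ∑ K ∈ T.adjacent e, u K i := ⟨fun i => _, fun i => rfl⟩
  have hqm : ∀ i, q i ∈ PolyLE (m + 1) k := fun i => by
    rw [hq]
    have := mul_mem_polyLE (C_mem_polyLE (n := m + 1) (k := 0) (1 / 2))
      (Submodule.sum_mem (PolyLE (m + 1) k) fun K (_ : K ∈ T.adjacent e) => hu K i)
    rwa [zero_add] at this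
  have hav : ∀ x i, average T u e x i = MvPolynomial.eval x.ofLp (q i) := fun x i => by
    rw [average_apply, hq, map_mul, MvPolynomial.eval_C, map_sum]
  have hpt : ∀ x, jump T σ e x ⬝ᵥ average T u e x = ∑ i, 1 / 2 * ∑ K ∈ T.adjacent e,
      normalError T σ τ e i K x * MvPolynomial.eval x.ofLp (q i) := by
    intro x
    rw [dotProduct]
    refine Finset.sum_congr rfl fun i _ => ?_
    rw [jump_eq_normalError (τ := τ) he, hav, mul_assoc, Finset.sum_mul]
  simp only [hpt, Nat.add_sub_cancel]
  have hc : ∀ i K, Continuous fun x => normalError T σ τ e i K x *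
      MvPolynomial.eval x.ofLp (q i) := fun i K =>
    continuous_mul_fun (continuous_normalError hτ e i K) (continuous_evalE _)
  rw [integral_finsetSum _ fun i _ => integrableOn_interiorFace T he
    (continuous_mul_fun continuous_const (continuous_finsetSum _ fun K _ => hc i K))]
  refine Finset.sum_eq_zero fun i _ => ?_
  rw [integral_const_mul, integral_finsetSum _ fun K _ => integrableOn_interiorFace T he (hc i K),
    Finset.sum_eq_zero, mul_zero]
  intro K hK
  obtain ⟨v, rfl⟩ := T.exists_eq_erase (T.card_of_mem_interiorFaces he) (T.mem_adjacent.1 hK)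
  exact h K v i _ (hqm i)

/-- The weight `(diam e)⁻¹` costs one power of the mesh size and the ratio of the measures of face
and element another; the factor `diam K ^ 2` of the interpolation error pays for both. -/
lemma jumpForm_le_gradSq (hτ : ∀ i j, Continuous (τ i j)) {C₁ C₂ : ℝ} (hC₁ : 0 ≤ C₁) (hC₂ : 0 ≤ C₂)
    (h : ∀ (K : T.cells) (v : K.1) i, (scale (K.1.erase (v : E (m + 1))))⁻¹ *
      ∫ x in hull (K.1.erase (v : E (m + 1))),
        normalError T σ τ (K.1.erase (v : E (m + 1))) i K x ^ 2 ∂μHE[m] ≤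
      C₁ * (diam K.1 ^ 2 * ((scale K.1)⁻¹ * gradSq K.1 τ)))
    (hsc : ∀ (K : T.cells) (v : K.1), (diam (K.1.erase (v : E (m + 1))))⁻¹ *
      scale (K.1.erase (v : E (m + 1))) * diam K.1 ^ 2 ≤ C₂ * scale K.1) :
    jumpForm T σ σ ≤ (m + 2 : ℕ) * ((m + 1 : ℕ) * (C₁ * C₂)) * ∑ K : T.cells, gradSq K.1 τ := by
  rw [jumpForm_self]
  have hcell : ∀ e ∈ T.interiorFaces, ∀ K ∈ T.adjacent e, ∀ i, (diam e)⁻¹ * ∫ x in hull e,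
      normalError T σ τ e i K x ^ 2 ∂μHE[m] ≤ C₁ * C₂ * gradSq K.1 τ := by
    intro e he K hK i
    obtain ⟨v, rfl⟩ := T.exists_eq_erase (T.card_of_mem_interiorFaces he) (T.mem_adjacent.1 hK)
    have h1 := h K v i
    have h2 := hsc K v
    have hsv := (T.isCell K).scale_erase_pos v
    have hsK := (T.isCell K).scale_pos
    have hg := gradSq_nonneg K.1 τ
    rw [inv_mul_le_iff₀ hsv] at h1
    calc _ ≤ (diam (K.1.erase (v : E (m + 1))))⁻¹ * (scale (K.1.erase (v : E (m + 1))) *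
          (C₁ * (diam K.1 ^ 2 * ((scale K.1)⁻¹ * gradSq K.1 τ)))) :=
          mul_le_mul_of_nonneg_left h1 (inv_nonneg.2 (diam_nonneg _))
      _ = ((diam (K.1.erase (v : E (m + 1))))⁻¹ * scale (K.1.erase (v : E (m + 1))) *
          diam K.1 ^ 2) * (C₁ * ((scale K.1)⁻¹ * gradSq K.1 τ)) := by ring
      _ ≤ (C₂ * scale K.1) * (C₁ * ((scale K.1)⁻¹ * gradSq K.1 τ)) := by gcongr
      _ = _ := by field_simp
  have hface : ∀ e ∈ T.interiorFaces, (diam e)⁻¹ * ∑ i, ∫ x in hull e, jump T σ e x i ^ 2 ∂μHE[m] ≤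
      ∑ K ∈ T.adjacent e, (m + 1 : ℕ) * (C₁ * C₂) * gradSq K.1 τ := by
    intro e he
    have hsq : ∀ i, ∫ x in hull e, jump T σ e x i ^ 2 ∂μHE[m] ≤
        ∑ K ∈ T.adjacent e, ∫ x in hull e, normalError T σ τ e i K x ^ 2 ∂μHE[m] := by
      intro i
      rw [← integral_finsetSum _ fun K _ => integrableOn_interiorFace T he
        (continuous_sq_fun (continuous_normalError hτ e i K))]
      refine integral_mono (integrableOn_interiorFace T he
        (continuous_sq_fun (continuous_jump T σ e i))) (integrableOn_interiorFace T he
        (continuous_finsetSum _ fun K _ => continuous_sq_fun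
          (continuous_normalError hτ e i K))) fun x => ?_
      simp only [jump_eq_normalError (τ := τ) he]
      exact sq_half_sum_adjacent_le T he fun K => normalError T σ τ e i K x
    calc _ ≤ (diam e)⁻¹ * ∑ i, ∑ K ∈ T.adjacent e,
          ∫ x in hull e, normalError T σ τ e i K x ^ 2 ∂μHE[m] :=
          mul_le_mul_of_nonneg_left (Finset.sum_le_sum fun i _ => hsq i)
            (inv_nonneg.2 (diam_nonneg e))
      _ = ∑ K ∈ T.adjacent e, ∑ i, (diam e)⁻¹ *
          ∫ x in hull e, normalError T σ τ e i K x ^ 2 ∂μHE[m] := by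
          rw [Finset.sum_comm, Finset.mul_sum]
          simp only [Finset.mul_sum]
      _ ≤ ∑ K ∈ T.adjacent e, ∑ _i : Fin (m + 1), C₁ * C₂ * gradSq K.1 τ :=
          Finset.sum_le_sum fun K hK => Finset.sum_le_sum fun i _ => hcell e he K hK i
      _ = _ := by
          simp only [Finset.sum_const, Finset.card_univ, Fintype.card_fin, nsmul_eq_mul, mul_assoc]
  refine (Finset.sum_le_sum hface).trans ((sum_adjacent_le T fun K =>
    mul_nonneg (by positivity) (gradSq_nonneg K.1 τ)).trans (le_of_eq ?_))
  rw [← Finset.mul_sum]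
  ring

/-- The row-wise divergence of a differentiable tensor field. -/
def divF (τ : Fin (m + 1) → Fin (m + 1) → E (m + 1) → ℝ) (i : Fin (m + 1)) (x : E (m + 1)) : ℝ :=
  ∑ j, fderiv ℝ (τ i j) x (EuclideanSpace.single j 1)

lemma continuous_divF (hτ : ∀ i j, ContDiff ℝ 1 (τ i j)) (i : Fin (m + 1)) :
    Continuous (divF τ i) :=
  continuous_finsetSum _ fun j _ =>
    ((hτ i j).continuous_fderiv one_ne_zero).clm_apply continuous_const

lemma integral_divh_mul (hτ : ∀ i j, ContDiff ℝ 1 (τ i j)) {K : T.cells} {i : Fin (m + 1)}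
    {q : Poly (m + 1)} (h : ∫ x in hull K.1,
      (∑ j, fderiv ℝ (fun x => MvPolynomial.eval x.ofLp (σ K i j) - τ i j x) x
        (EuclideanSpace.single j 1)) * MvPolynomial.eval x.ofLp q = 0) :
    ∫ x in hull K.1, MvPolynomial.eval x.ofLp (divh T σ K i) * MvPolynomial.eval x.ofLp q =
      ∫ x in hull K.1, divF τ i x * MvPolynomial.eval x.ofLp q := by
  rw [← sub_eq_zero, ← integral_sub
    (continuous_integrableOn_hull (continuous_mul_fun (continuous_evalE _) (continuous_evalE q)) K.1)
    (continuous_integrableOn_hull (continuous_mul_fun (continuous_divF hτ i)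
      (continuous_evalE q)) K.1), ← h]
  congr 1
  funext x
  rw [← sub_mul]
  congr 1
  have hd : ∀ j, fderiv ℝ (fun x => MvPolynomial.eval x.ofLp (σ K i j) - τ i j x) x
      (EuclideanSpace.single j 1) = MvPolynomial.eval x.ofLp (MvPolynomial.pderiv j (σ K i j)) -
        fderiv ℝ (τ i j) x (EuclideanSpace.single j 1) := by
    intro j
    rw [fderiv_fun_sub ((contDiff_eval (l := 1) _).differentiable one_ne_zero x)
      ((hτ i j).differentiable one_ne_zero x), sub_apply, fderiv_eval, Finset.sum_eq_single j]
    · simp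
    · intro l _ hl
      simp [hl]
    · simp
  simp only [hd, Finset.sum_sub_distrib, divh, divM, divF, map_sum]

/-- The deviator is the orthogonal projection onto trace-free matrices, so it does not increase the
pointwise norm. -/
lemma integral_sq_dev_le (K : T.cells) :
    ∑ i, ∑ j, ∫ x in hull K.1, dev (evalM (σ K) x) i j ^ 2 ≤
      ∑ i, ∑ j, ∫ x in hull K.1, MvPolynomial.eval x.ofLp (σ K i j) ^ 2 := by
  have hpt : ∀ M : Matrix (Fin (m + 1)) (Fin (m + 1)) ℝ,
      ∑ i, ∑ j, dev M i j ^ 2 ≤ ∑ i, ∑ j, M i j ^ 2 := by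
    intro M
    have hm : (0 : ℝ) < (m + 1 : ℕ) := by positivity
    obtain ⟨t, ht⟩ : ∃ t, t = 1 / ((m + 1 : ℕ) : ℝ) * M.trace := ⟨_, rfl⟩
    have h1 : ∀ i j, dev M i j ^ 2 = M i j ^ 2 - if i = j then 2 * t * M i j - t ^ 2 else 0 := by
      intro i j
      simp only [dev, Matrix.sub_apply, Matrix.smul_apply, ← ht, smul_eq_mul]
      by_cases h : i = j
      · rw [h, Matrix.one_apply_eq, if_pos rfl]; ring
      · rw [Matrix.one_apply_ne h, if_neg h]; ring
    have h2 : ∑ i, ∑ j, dev M i j ^ 2 = ∑ i, ∑ j, M i j ^ 2 - (m + 1 : ℕ) * t ^ 2 := by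
      simp only [h1, Finset.sum_sub_distrib, Finset.sum_ite_eq, Finset.mem_univ, if_true,
        ← Finset.mul_sum, Finset.sum_const, Finset.card_univ, Fintype.card_fin, nsmul_eq_mul]
      have h3 : ∑ i, M i i = M.trace := rfl
      have h4 : M.trace = (m + 1 : ℕ) * t := by rw [ht]; field_simp
      rw [h3, h4]
      ring
    rw [h2]
    have : 0 ≤ ((m + 1 : ℕ) : ℝ) * t ^ 2 := by positivity
    linarith
  have hc : ∀ i j, Continuous fun x => dev (evalM (σ K) x) i j := fun i j =>
    continuous_evalDev T K (i, j) σ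
  have e1 : ∀ F : Fin (m + 1) → Fin (m + 1) → E (m + 1) → ℝ, (∀ i j, Continuous (F i j)) →
      ∑ i, ∑ j, ∫ x in hull K.1, F i j x ^ 2 = ∫ x in hull K.1, ∑ i, ∑ j, F i j x ^ 2 := by
    intro F hF
    rw [integral_finsetSum _ fun i _ => continuous_integrableOn_hull
      (continuous_finsetSum _ fun j _ => continuous_sq_fun (hF i j)) K.1]
    exact Finset.sum_congr rfl fun i _ => (integral_finsetSum _ fun j _ =>
      continuous_integrableOn_hull (continuous_sq_fun (hF i j)) K.1).symm
  rw [e1 (fun i j x => dev (evalM (σ K) x) i j) hc,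
    e1 (fun i j x => MvPolynomial.eval x.ofLp (σ K i j)) fun i j => continuous_evalE _]
  refine integral_mono (continuous_integrableOn_hull (continuous_finsetSum _ fun i _ =>
    continuous_finsetSum _ fun j _ => continuous_sq_fun (hc i j)) K.1)
    (continuous_integrableOn_hull (continuous_finsetSum _ fun i _ =>
    continuous_finsetSum _ fun j _ => continuous_sq_fun (continuous_evalE _)) K.1) fun x => ?_
  exact hpt (evalM (σ K) x)

end BrokenInterpolation

/-! ### The inf-sup condition for `bh` -/

section StableTensor

variable {m k : ℕ} {Ω : Set (E (m + 1))} {T : Triangulation Ω}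

lemma bh_zero_left (u : BrokenVec T) : bh T 0 u = 0 := by
  obtain ⟨bV, hbV⟩ := exists_bilin_innerV T
  obtain ⟨bC, hbC⟩ := exists_bilin_couplingForm T
  have h : divh T 0 = 0 := (divL T).map_zero
  rw [bh, h, ← hbV, ← hbC, LinearMap.map_zero₂, LinearMap.map_zero₂, sub_zero]

lemma innerDev_zero : innerDev T 0 0 = 0 := by
  obtain ⟨b, hb⟩ := exists_bilin_innerDev T
  rw [← hb, LinearMap.map_zero₂]

lemma jumpForm_zero : jumpForm T 0 0 = 0 := by
  obtain ⟨b, hb⟩ := exists_bilin_jumpForm T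
  rw [← hb, LinearMap.map_zero₂]

lemma innerV_divh_zero : innerV T (divh T 0) (divh T 0) = 0 := by
  obtain ⟨b, hb⟩ := exists_bilin_innerV T
  have h : divh T 0 = 0 := (divL T).map_zero
  rw [← hb, h, LinearMap.map_zero₂]

lemma integrableOn_bounded {R : ℝ} (hR : 0 < R) {f : E (m + 1) → ℝ} (hf : Measurable f) {B : ℝ}
    (hB : ∀ x ∈ box (m + 1) R, ‖f x‖ ≤ B) : IntegrableOn f (box (m + 1) R) :=
  Measure.integrableOn_of_bounded (isBounded_box _ R).measure_lt_top.ne hf.aestronglyMeasurable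
    ((ae_restrict_iff' (measurableSet_box _ hR)).2 (Filter.Eventually.of_forall hB))

/-- A smooth symmetric tensor field whose divergence is close to a given piecewise polynomial
vector field. -/
lemma exists_smooth_tensor (m : ℕ) {R : ℝ} (hR : 0 < R) : ∃ C : ℝ, 0 ≤ C ∧
    ∀ {Ω : Set (E (m + 1))} (T : Triangulation Ω), (∀ K : T.cells, hull K.1 ⊆ box (m + 1) R) →
      ∀ u : BrokenVec T, 0 < innerV T u u →
      ∃ τ : Fin (m + 1) → Fin (m + 1) → E (m + 1) → ℝ,
        (∀ i j, τ i j = τ j i) ∧ (∀ i j, ContDiff ℝ 1 (τ i j)) ∧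
        ∑ K : T.cells, ∑ i, ∫ x in hull K.1,
          (divF τ i x - MvPolynomial.eval x.ofLp (u K i)) ^ 2 ≤ 1 / 4 * innerV T u u ∧
        ∑ K : T.cells, ∑ i, ∑ j, ∫ x in hull K.1, τ i j x ^ 2 ≤ C * innerV T u u ∧
        ∑ K : T.cells, gradSq K.1 τ ≤ C * innerV T u u := by
  obtain ⟨A, hA⟩ : ∃ A : ℝ, A = 3 * (2 + ((m + 1 : ℕ) : ℝ) ^ 2) := ⟨_, rfl⟩
  have hA0 : 0 ≤ A := by rw [hA]; positivity
  refine ⟨((m + 1 : ℕ) : ℝ) ^ 2 * (A * R ^ 2 + (m + 1 : ℕ) * A), by positivity, ?_⟩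
  intro Ω T hbox u hu
  obtain ⟨B, hB⟩ := exists_bound_pieceFun T u
  have hsum : ∑ i, ∫ x in box (m + 1) R, pieceFun T u i x ^ 2 = innerV T u u := by
    rw [innerV_self, Finset.sum_comm]
    exact Finset.sum_congr rfl fun i _ => integral_pieceFun_sq T (measurableSet_box _ hR) hbox u i
  -- The tolerance is chosen so that the `m + 1` components of the error add up to `1 / 4 * innerV T
  -- u u`.
  obtain ⟨τ, hsymm, hC1, hdiv, hL2, hH1⟩ := exists_symmetric_divergence hR
    (f := pieceFun T u) (measurable_pieceFun T u) hB (ε := innerV T u u / (4 * (m + 1 : ℕ)))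
    (by positivity)
  rw [hsum, ← hA] at hL2 hH1
  have hm0 : (0 : ℝ) < (m + 1 : ℕ) := by positivity
  have hS := hu.le
  have swap : ∀ F : Fin (m + 1) → Fin (m + 1) → E (m + 1) → ℝ, (∀ i j, Continuous (F i j)) →
      (∀ i j x, 0 ≤ F i j x) → ∀ D : ℝ, (∀ i j, ∫ x in box (m + 1) R, F i j x ≤ D) →
      ∑ K : T.cells, ∑ i, ∑ j, ∫ x in hull K.1, F i j x ≤ ((m + 1 : ℕ) : ℝ) ^ 2 * D := by
    intro F hF hF0 D hD
    have h1 : ∑ K : T.cells, ∑ i, ∑ j, ∫ x in hull K.1, F i j x =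
        ∑ i, ∑ j, ∑ K : T.cells, ∫ x in hull K.1, F i j x := by
      rw [Finset.sum_comm]
      exact Finset.sum_congr rfl fun i _ => Finset.sum_comm
    rw [h1]
    calc _ ≤ ∑ _i : Fin (m + 1), ∑ _j : Fin (m + 1), D :=
          Finset.sum_le_sum fun i _ => Finset.sum_le_sum fun j _ =>
            (sum_integral_hull_le T hbox (continuous_integrableOn_box (hF i j))
              (hF0 i j)).trans (hD i j)
      _ = _ := by
          simp only [Finset.sum_const, Finset.card_univ, Fintype.card_fin, nsmul_eq_mul]
          ring
  refine ⟨τ, hsymm, hC1, ?_, ?_, ?_⟩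
  · rw [Finset.sum_comm]
    have hi : ∀ i, ∑ K : T.cells, ∫ x in hull K.1,
        (divF τ i x - MvPolynomial.eval x.ofLp (u K i)) ^ 2 ≤
        innerV T u u / (4 * (m + 1 : ℕ)) := by
      intro i
      obtain ⟨D, hD⟩ := (isBounded_box (m + 1) R).isCompact_closure.exists_bound_of_continuousOn
        (continuous_divF hC1 i).continuousOn
      have hint : IntegrableOn (fun x => (divF τ i x - pieceFun T u i x) ^ 2)
          (box (m + 1) R) := by
        refine integrableOn_bounded hR (B := (D + B) ^ 2)
          (((continuous_divF hC1 i).measurable.sub (measurable_pieceFun T u i)).pow_const 2) ?_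
        intro x hx
        rw [norm_pow]
        refine pow_le_pow_left₀ (norm_nonneg _) ((norm_sub_le _ _).trans ?_) 2
        exact add_le_add (hD x (subset_closure hx)) (hB i x)
      have h1 : ∀ K : T.cells, ∫ x in hull K.1,
          (divF τ i x - MvPolynomial.eval x.ofLp (u K i)) ^ 2 =
          ∫ x in hull K.1, (divF τ i x - pieceFun T u i x) ^ 2 := fun K => by
        refine integral_congr_ae ?_
        filter_upwards [ae_pieceFun_eq T u K] with x hx
        rw [hx]
      simp only [h1]
      exact (sum_integral_hull_le T hbox hint fun x => sq_nonneg _).trans (hdiv i)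
    refine (Finset.sum_le_sum fun i _ => hi i).trans (le_of_eq ?_)
    simp only [Finset.sum_const, Finset.card_univ, Fintype.card_fin, nsmul_eq_mul]
    field_simp
  · refine (swap (fun i j x => τ i j x ^ 2) (fun i j => continuous_sq_fun (hC1 i j).continuous)
      (fun i j x => sq_nonneg _) _ hL2).trans ?_
    have : 0 ≤ ((m + 1 : ℕ) : ℝ) ^ 2 * ((m + 1 : ℕ) * A) * innerV T u u := by positivity
    linarith
  · refine (swap (fun i j x => ‖fderiv ℝ (τ i j) x‖ ^ 2)
      (fun i j => continuous_sq_fun ((hC1 i j).continuous_fderiv one_ne_zero).norm)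
      (fun i j x => sq_nonneg _) _ hH1).trans ?_
    have : 0 ≤ ((m + 1 : ℕ) : ℝ) ^ 2 * (A * R ^ 2) * innerV T u u := by positivity
    linarith

/-- The discrete inf-sup condition for `b_h`. -/
theorem exists_stable_tensor (m : ℕ) (hm : 1 ≤ m) (k : ℕ) (γ : ℝ) {R : ℝ} (hR : 0 < R) :
    ∃ C : ℝ, 0 ≤ C ∧ ∀ {Ω : Set (E (m + 1))} (T : Triangulation Ω),
      (∀ K : T.cells, hull K.1 ⊆ box (m + 1) R) → T.ShapeRegular γ → ∀ u ∈ Vh T k,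
      ∃ σ ∈ Sigmah T k, 1 / 4 * innerV T u u ≤ bh T σ u ∧
        innerDev T σ σ ≤ C * innerV T u u ∧
        innerV T (divh T σ) (divh T σ) ≤ C * innerV T u u ∧
        jumpForm T σ σ ≤ C * innerV T u u := by
  obtain ⟨C₁, hC₁, hsm⟩ := exists_smooth_tensor m hR
  obtain ⟨C₂, hC₂, hint⟩ := exists_tensorInterp m k γ
  obtain ⟨C₃, hC₃, hsc⟩ := exists_scale_face_le m hm γ
  obtain ⟨d, hd⟩ : ∃ d, d = Metric.diam (box (m + 1) R) := ⟨_, rfl⟩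
  have hd0 : 0 ≤ d := hd ▸ Metric.diam_nonneg
  refine ⟨(2 * C₁ + 2 * (((m + 1 : ℕ) : ℝ) ^ 2 * (C₂ * d ^ 2)) * C₁) + 5 / 2 +
    (m + 2 : ℕ) * ((m + 1 : ℕ) * (C₂ * C₃)) * C₁, by positivity, ?_⟩
  intro Ω T hbox hT u hu
  obtain ⟨S, hSdef⟩ : ∃ S, S = innerV T u u := ⟨_, rfl⟩
  have hS : 0 ≤ S := hSdef ▸ innerV_nonneg T u
  -- The case of zero norm is separate because the tolerance for the smooth field is a fraction of
  -- this norm and has to be positive.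
  rcases hS.eq_or_lt with h0 | hpos
  · refine ⟨0, Submodule.zero_mem _, ?_, ?_, ?_, ?_⟩
    · rw [bh_zero_left, ← hSdef, ← h0, mul_zero]
    · rw [innerDev_zero, ← hSdef, ← h0, mul_zero]
    · rw [innerV_divh_zero, ← hSdef, ← h0, mul_zero]
    · rw [jumpForm_zero, ← hSdef, ← h0, mul_zero]
  obtain ⟨τ, hsymm, hC1, hdiv, hL2, hH1⟩ := hsm T hbox u (hSdef ▸ hpos)
  rw [← hSdef] at hdiv hL2 hH1 ⊢
  have hτc : ∀ i j, Continuous (τ i j) := fun i j => (hC1 i j).continuous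
  choose c r hr hball hγ using fun K : T.cells => hT K.1 K.2
  choose σ₀ h1 h2 h3 h4 h5 h6 using fun K : T.cells =>
    hint (T.isCell K) (c K) (r K) (hr K) (hball K) (hγ K) τ hsymm hC1
  obtain ⟨σ, hσ, hσdiv, hσdev, hσjump⟩ := exists_mem_Sigmah T h1 h2
  have hcoup : couplingForm T σ u = 0 := by
    have e1 : couplingForm T σ u = couplingForm T σ₀ u := by
      refine Finset.sum_congr rfl fun e he => ?_
      simp only [hσjump e he]
    rw [e1]
    exact couplingForm_eq_zero hτc (fun K v i q hq => h3 K v i q hq) hu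
  have hjump : jumpForm T σ σ ≤ (m + 2 : ℕ) * ((m + 1 : ℕ) * (C₂ * C₃)) * (C₁ * S) := by
    have e1 : jumpForm T σ σ = jumpForm T σ₀ σ₀ := by
      refine Finset.sum_congr rfl fun e he => ?_
      simp only [hσjump e he]
    rw [e1]
    refine (jumpForm_le_gradSq hτc hC₂ hC₃ (fun K v i => h6 K v i)
      (fun K v => (hsc (T.isCell K) (c K) (r K) (hr K) (hball K) (hγ K) v).2)).trans ?_
    gcongr
  have hdeg : ∀ K i, divh T σ₀ K i ∈ PolyLE (m + 1) k := fun K i =>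
    Submodule.sum_mem _ fun j _ => pderiv_mem_polyLE _ (h2 K i j)
  have hmom : ∀ K i, ∀ q ∈ PolyLE (m + 1) k, ∫ x in hull K.1,
      MvPolynomial.eval x.ofLp (divh T σ₀ K i) * MvPolynomial.eval x.ofLp q =
      ∫ x in hull K.1, divF τ i x * MvPolynomial.eval x.ofLp q := fun K i q hq =>
    integral_divh_mul hC1 (h4 K i q hq)
  have cD := continuous_divF hC1
  have cE : ∀ q : Poly (m + 1), Continuous fun x : E (m + 1) => MvPolynomial.eval x.ofLp q :=
    fun q => continuous_evalE q
  have csub : ∀ {f g : E (m + 1) → ℝ}, Continuous f → Continuous g →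
      Continuous fun x => f x - g x := fun hf hg => hf.sub hg
  have cadd : ∀ {f g : E (m + 1) → ℝ}, Continuous f → Continuous g →
      Continuous fun x => f x + g x := fun hf hg => hf.add hg
  have iK : ∀ (K : T.cells) {f : E (m + 1) → ℝ}, Continuous f → IntegrableOn f (hull K.1) :=
    fun K f hf => continuous_integrableOn_hull hf K.1
  have hV : ∀ v w : BrokenVec T, innerV T v w = ∑ K : T.cells, ∑ i, ∫ x in hull K.1,
      MvPolynomial.eval x.ofLp (v K i) * MvPolynomial.eval x.ofLp (w K i) := by
    intro v w
    refine Finset.sum_congr rfl fun K _ => ?_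
    rw [← integral_finsetSum _ fun i _ => iK K (continuous_mul_fun (cE _) (cE _))]
    rfl
  refine ⟨σ, hσ, ?_, ?_, ?_, ?_⟩
  · rw [bh, hcoup, sub_zero, hσdiv, hV]
    -- Pointwise f u ≥ ½ u² − ½ (f − u)². With f = div τ and an error of at most a quarter this
    -- leaves 3/8 of the norm, more than the required quarter.
    have hcell : ∀ (K : T.cells) i, 1 / 2 * (∫ x in hull K.1, MvPolynomial.eval x.ofLp (u K i) ^ 2) -
        1 / 2 * (∫ x in hull K.1, (divF τ i x - MvPolynomial.eval x.ofLp (u K i)) ^ 2) ≤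
        ∫ x in hull K.1, MvPolynomial.eval x.ofLp (divh T σ₀ K i) *
          MvPolynomial.eval x.ofLp (u K i) := by
      intro K i
      rw [hmom K i _ (hu K i), ← integral_const_mul, ← integral_const_mul, ← integral_sub
        (iK K (continuous_mul_fun continuous_const (continuous_sq_fun (cE _))))
        (iK K (continuous_mul_fun continuous_const (continuous_sq_fun (csub (cD i) (cE _)))))]
      refine integral_mono (iK K ((continuous_mul_fun continuous_const
        (continuous_sq_fun (cE _))).sub (continuous_mul_fun continuous_const
          (continuous_sq_fun (csub (cD i) (cE _)))))) (iK K (continuous_mul_fun (cD i) (cE _)))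
        fun x => ?_
      simp only
      nlinarith [sq_nonneg (divF τ i x)]
    have hsum := Finset.sum_le_sum fun (K : T.cells) (_ : K ∈ Finset.univ) =>
      Finset.sum_le_sum fun (i : Fin (m + 1)) (_ : i ∈ Finset.univ) => hcell K i
    refine le_trans ?_ hsum
    simp only [Finset.sum_sub_distrib, ← Finset.mul_sum]
    rw [← innerV_self, ← hSdef]
    linarith
  · rw [hσdev, innerDev_self]
    have hcell : ∀ K : T.cells, ∑ i, ∑ j, ∫ x in hull K.1, dev (evalM (σ₀ K) x) i j ^ 2 ≤
        2 * (∑ i, ∑ j, ∫ x in hull K.1, τ i j x ^ 2) +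
          2 * (((m + 1 : ℕ) : ℝ) ^ 2 * (C₂ * d ^ 2)) * gradSq K.1 τ := by
      intro K
      refine (integral_sq_dev_le K).trans ?_
      have hij : ∀ i j, ∫ x in hull K.1, MvPolynomial.eval x.ofLp (σ₀ K i j) ^ 2 ≤
          2 * (∫ x in hull K.1, τ i j x ^ 2) + 2 * (C₂ * d ^ 2 * gradSq K.1 τ) := by
        intro i j
        have hsK := (T.isCell K).scale_pos
        have hg := gradSq_nonneg K.1 τ
        have e1 := h5 K i j
        rw [inv_mul_le_iff₀ hsK] at e1
        have e2 : scale K.1 * (C₂ * (diam K.1 ^ 2 * ((scale K.1)⁻¹ * gradSq K.1 τ))) =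
            C₂ * diam K.1 ^ 2 * gradSq K.1 τ := by field_simp
        have e3 : diam K.1 ≤ d := hd ▸ Metric.diam_mono (hbox K) (isBounded_box _ R)
        have e4 : C₂ * diam K.1 ^ 2 * gradSq K.1 τ ≤ C₂ * d ^ 2 * gradSq K.1 τ := by
          have := diam_nonneg K.1
          gcongr
        have e5 : ∫ x in hull K.1, MvPolynomial.eval x.ofLp (σ₀ K i j) ^ 2 ≤
            2 * (∫ x in hull K.1, τ i j x ^ 2) +
            2 * ∫ x in hull K.1, (MvPolynomial.eval x.ofLp (σ₀ K i j) - τ i j x) ^ 2 := by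
          rw [← integral_const_mul, ← integral_const_mul, ← integral_add
            (iK K (continuous_mul_fun continuous_const (continuous_sq_fun (hτc i j))))
            (iK K (continuous_mul_fun continuous_const
              (continuous_sq_fun (csub (cE _) (hτc i j)))))]
          refine integral_mono (iK K (continuous_sq_fun (cE _))) (iK K
            ((continuous_mul_fun continuous_const (continuous_sq_fun (hτc i j))).add
            (continuous_mul_fun continuous_const
              (continuous_sq_fun (csub (cE _) (hτc i j)))))) fun x => ?_
          simp only
          nlinarith [sq_nonneg (MvPolynomial.eval x.ofLp (σ₀ K i j) - 2 * τ i j x)]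
        linarith
      refine (Finset.sum_le_sum fun i _ => Finset.sum_le_sum fun j _ => hij i j).trans
        (le_of_eq ?_)
      simp only [Finset.sum_add_distrib, ← Finset.mul_sum, Finset.sum_const, Finset.card_univ,
        Fintype.card_fin, nsmul_eq_mul]
      ring
    refine (Finset.sum_le_sum fun K _ => hcell K).trans ?_
    rw [Finset.sum_add_distrib, ← Finset.mul_sum, ← Finset.mul_sum]
    have e1 := mul_le_mul_of_nonneg_left hH1
      (by positivity : 0 ≤ 2 * (((m + 1 : ℕ) : ℝ) ^ 2 * (C₂ * d ^ 2)))
    have e2 : 0 ≤ (m + 2 : ℕ) * ((m + 1 : ℕ) * (C₂ * C₃)) * C₁ * S := by positivity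
    linarith
  · rw [hσdiv, innerV_self]
    have hcell : ∀ (K : T.cells) i, ∫ x in hull K.1,
        MvPolynomial.eval x.ofLp (divh T σ₀ K i) ^ 2 ≤
        2 * (∫ x in hull K.1, MvPolynomial.eval x.ofLp (u K i) ^ 2) +
        2 * (∫ x in hull K.1, (divF τ i x - MvPolynomial.eval x.ofLp (u K i)) ^ 2) := by
      intro K i
      -- The discrete divergence has degree `k`, so it is itself an admissible test polynomial, and
      -- its squared norm equals its inner product with div τ.
      have e1 := hmom K i _ (hdeg K i)
      simp only [← sq] at e1
      have e2 : ∫ x in hull K.1, divF τ i x * MvPolynomial.eval x.ofLp (divh T σ₀ K i) ≤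
          1 / 2 * (∫ x in hull K.1, MvPolynomial.eval x.ofLp (divh T σ₀ K i) ^ 2) +
          ((∫ x in hull K.1, MvPolynomial.eval x.ofLp (u K i) ^ 2) +
          (∫ x in hull K.1, (divF τ i x - MvPolynomial.eval x.ofLp (u K i)) ^ 2)) := by
        rw [← integral_const_mul, ← integral_add (iK K (continuous_sq_fun (cE _)))
          (iK K (continuous_sq_fun (csub (cD i) (cE _)))), ← integral_add
          (iK K (continuous_mul_fun continuous_const (continuous_sq_fun (cE _))))
          (iK K (cadd (continuous_sq_fun (cE _)) (continuous_sq_fun (csub (cD i) (cE _)))))]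
        refine integral_mono (iK K (continuous_mul_fun (cD i) (cE _))) (iK K
          ((continuous_mul_fun continuous_const (continuous_sq_fun (cE _))).add
          ((continuous_sq_fun (cE _)).add (continuous_sq_fun (csub (cD i) (cE _)))))) fun x => ?_
        simp only
        nlinarith [sq_nonneg (divF τ i x - MvPolynomial.eval x.ofLp (divh T σ₀ K i)),
          sq_nonneg (divF τ i x - 2 * MvPolynomial.eval x.ofLp (u K i))]
      linarith
    refine (Finset.sum_le_sum fun K _ => Finset.sum_le_sum fun i _ => hcell K i).trans ?_
    simp only [Finset.sum_add_distrib, ← Finset.mul_sum]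
    rw [← innerV_self, ← hSdef]
    have e1 : 0 ≤ (m + 2 : ℕ) * ((m + 1 : ℕ) * (C₂ * C₃)) * C₁ * S := by positivity
    have e2 : 0 ≤ (2 * C₁ + 2 * (((m + 1 : ℕ) : ℝ) ^ 2 * (C₂ * d ^ 2)) * C₁) * S := by positivity
    linarith
  · have e1 : 0 ≤ ((2 * C₁ + 2 * (((m + 1 : ℕ) : ℝ) ^ 2 * (C₂ * d ^ 2)) * C₁) + 5 / 2) * S := by
      positivity
    linarith

end StableTensor

/-! ### The norms are definite -/

section Definite

/-- An open set contains a box, that is a product of infinite sets, and such a product determines a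
polynomial. -/
lemma eq_zero_of_eval_eq_zero {n : ℕ} {U : Set (E n)} (hU : IsOpen U) (hne : U.Nonempty)
    {p : Poly n} (h : ∀ x ∈ U, MvPolynomial.eval x.ofLp p = 0) : p = 0 := by
  obtain ⟨x, hx⟩ := hne
  have hV : IsOpen ((WithLp.toLp 2 : (Fin n → ℝ) → E n) ⁻¹' U) :=
    hU.preimage (PiLp.continuous_toLp 2 _)
  obtain ⟨r, hr, hball⟩ := Metric.isOpen_iff.1 hV x.ofLp hx
  rw [ball_pi _ hr] at hball
  refine MvPolynomial.funext_set (fun i => Metric.ball (x.ofLp i) r) (fun i => ?_) fun y hy => ?_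
  · rw [Real.ball_eq_Ioo]
    exact Set.Ioo_infinite (by linarith)
  · rw [map_zero]
    exact h _ (hball hy)

variable {m k : ℕ} {Ω : Set (E (m + 1))} {T : Triangulation Ω}

lemma eq_zero_of_integral_sq {K : T.cells} {p : Poly (m + 1)}
    (h : ∫ x in hull K.1, MvPolynomial.eval x.ofLp p ^ 2 = 0) : p = 0 := by
  have hc : Continuous fun x : E (m + 1) => MvPolynomial.eval x.ofLp p ^ 2 :=
    continuous_sq_fun (continuous_evalE p)
  have h1 := (setIntegral_eq_zero_iff_of_nonneg_ae (μ := volume) (s := hull K.1)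
    (f := fun x => MvPolynomial.eval x.ofLp p ^ 2)
    (Filter.Eventually.of_forall fun x => sq_nonneg _)
    (continuous_integrableOn_hull hc K.1)).1 h
  have h2 : Set.EqOn (fun x : E (m + 1) => MvPolynomial.eval x.ofLp p ^ 2) 0
      (interior (hull K.1)) :=
    Measure.eqOn_open_of_ae_eq (μ := volume)
      (ae_restrict_of_ae_restrict_of_subset interior_subset h1) isOpen_interior
      hc.continuousOn continuousOn_const
  exact eq_zero_of_eval_eq_zero isOpen_interior (T.isCell K).interior_hull_nonempty
    fun x hx => pow_eq_zero_iff two_ne_zero |>.1 (h2 hx)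

lemma eq_zero_of_innerV {u : BrokenVec T} (h : innerV T u u = 0) : u = 0 := by
  rw [innerV_self] at h
  have hnn : ∀ K i, 0 ≤ ∫ x in hull K.1, MvPolynomial.eval x.ofLp (u K i) ^ 2 := fun K i =>
    integral_nonneg fun x => sq_nonneg _
  funext K i
  have h1 := (Finset.sum_eq_zero_iff_of_nonneg fun K _ =>
    Finset.sum_nonneg fun i _ => hnn K i).1 h K (Finset.mem_univ K)
  exact eq_zero_of_integral_sq ((Finset.sum_eq_zero_iff_of_nonneg fun i _ => hnn K i).1 h1 i
    (Finset.mem_univ i))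

/-- The polynomial deviator. -/
def devPoly {n : ℕ} (σ : Matrix (Fin n) (Fin n) (Poly n)) : Matrix (Fin n) (Fin n) (Poly n) :=
  σ - Matrix.diagonal fun _ => MvPolynomial.C (1 / (n : ℝ)) * σ.trace

lemma dev_evalM {n : ℕ} (σ : Matrix (Fin n) (Fin n) (Poly n)) (x : E n) (i j : Fin n) :
    dev (evalM σ x) i j = MvPolynomial.eval x.ofLp (devPoly σ i j) := by
  by_cases h : i = j
  · simp [h, dev, devPoly, evalM, Matrix.trace]
  · simp [dev, devPoly, evalM, Matrix.diagonal_apply_ne _ h, Matrix.one_apply_ne h]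

lemma devPoly_eq_zero {σ : BrokenTensor T} (h : innerDev T σ σ = 0) (K : T.cells) :
    devPoly (σ K) = 0 := by
  rw [innerDev_self] at h
  simp only [dev_evalM] at h
  have hnn : ∀ K i j, 0 ≤ ∫ x in hull K.1, MvPolynomial.eval x.ofLp (devPoly (σ K) i j) ^ 2 :=
    fun K i j => integral_nonneg fun x => sq_nonneg _
  ext1 i j
  have h1 := (Finset.sum_eq_zero_iff_of_nonneg fun K _ => Finset.sum_nonneg fun i _ =>
    Finset.sum_nonneg fun j _ => hnn K i j).1 h K (Finset.mem_univ K)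
  have h2 := (Finset.sum_eq_zero_iff_of_nonneg fun i _ => Finset.sum_nonneg fun j _ =>
    hnn K i j).1 h1 i (Finset.mem_univ i)
  exact eq_zero_of_integral_sq ((Finset.sum_eq_zero_iff_of_nonneg fun j _ => hnn K i j).1 h2 j
    (Finset.mem_univ j))

lemma exists_eq_C_of_pderiv {n : ℕ} {p : Poly n} (h : ∀ i, MvPolynomial.pderiv i p = 0) :
    ∃ c, p = MvPolynomial.C c := by
  have h1 : ∀ x : E n, fderiv ℝ (fun x : E n => MvPolynomial.eval x.ofLp p) x = 0 := by
    intro x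
    ext t
    rw [fderiv_eval]
    simp [h]
  have h2 := is_const_of_fderiv_eq_zero (𝕜 := ℝ) ((contDiff_eval (l := 1) p).differentiable one_ne_zero) h1
  refine ⟨MvPolynomial.eval (0 : E n).ofLp p, ?_⟩
  rw [← sub_eq_zero]
  refine eq_zero_of_eval_eq_zero isOpen_univ Set.univ_nonempty fun x _ => ?_
  rw [map_sub, MvPolynomial.eval_C, h2 x 0, sub_self]

/-- A broken tensor field with vanishing norm is zero. -/
theorem eq_zero_of_Sigmah (hm : 1 ≤ m) (hΩ : IsOpen Ω) (hΩc : IsConnected Ω) {σ : BrokenTensor T}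
    (hσ : σ ∈ Sigmah T k) (hdev : innerDev T σ σ = 0)
    (hdiv : innerV T (divh T σ) (divh T σ) = 0) (hjump : jumpForm T σ σ = 0) : σ = 0 := by
  -- Zero deviator makes `σ` a scalar multiple of the identity on each element, zero divergence
  -- makes the scalar constant, and zero jumps make the constants of neighbours equal. Connectedness
  -- of Ω leaves a single constant, which the mean trace condition kills.
  have hd := devPoly_eq_zero hdev
  have hv := eq_zero_of_innerV hdiv
  have hdiag : ∀ K, ∃ p : Poly (m + 1), σ K = Matrix.diagonal fun _ => p := fun K =>
    ⟨_, sub_eq_zero.1 (hd K)⟩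
  choose p hp using hdiag
  have hconst : ∀ K, ∃ c, p K = MvPolynomial.C c := by
    intro K
    refine exists_eq_C_of_pderiv fun i => ?_
    have h1 := congrFun (congrFun hv K) i
    simp only [divh, divM, hp, Pi.zero_apply] at h1
    rw [Finset.sum_eq_single i, Matrix.diagonal_apply_eq] at h1
    · exact h1
    · intro j _ hj
      rw [Matrix.diagonal_apply_ne _ (Ne.symm hj), map_zero]
    · exact fun h => absurd (Finset.mem_univ i) h
  choose c hc using hconst
  have hσc : ∀ K i j, σ K i j = if i = j then MvPolynomial.C (c K) else 0 := by
    intro K i j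
    rw [hp, hc, Matrix.diagonal_apply]
  have hadj : ∀ e ∈ T.interiorFaces, ∀ K ∈ T.adjacent e, ∀ L ∈ T.adjacent e, c K = c L := by
    intro e he
    obtain ⟨K, L, hKL, hadj, v, w, hv, hw⟩ := T.exists_adjacent_eq he
    suffices h : c K = c L by
      intro K' hK' L' hL'
      rw [hadj, Finset.mem_insert, Finset.mem_singleton] at hK' hL'
      rcases hK' with rfl | rfl <;> rcases hL' with rfl | rfl <;> simp [h]
    have hneg := (T.isCell K).outwardNormal_eq_neg (T.isCell L) hKL (T.conforming K K.2 L L.2)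
      (v := v) (w := w) (hv.symm.trans hw)
    have hnorm := (T.isCell K).norm_outwardNormal v
    have hsc := (T.isCell K).scale_erase_pos v
    rw [← hv] at hneg hnorm hsc
    rw [← hw] at hneg
    have hcard := T.card_of_mem_interiorFaces he
    have hdiam : 0 < diam e := diam_pos_of_card (by rw [hcard]; omega)
    have hj : ∀ x i, jump T σ e x i = 1 / 2 * ((c K - c L) * outwardNormal K.1 e i) := by
      intro x i
      rw [jump_apply, hadj, Finset.sum_pair fun h => hKL (congrArg Subtype.val h), hneg]
      have h1 : ∀ M : T.cells, ∀ j, MvPolynomial.eval x.ofLp (σ M i j) =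
          if i = j then c M else 0 := by
        intro M j
        rw [hσc]
        split_ifs <;> simp
      simp only [h1, ite_mul, zero_mul, Finset.sum_ite_eq, Finset.mem_univ, if_true,
        PiLp.neg_apply]
      ring
    rw [jumpForm_self] at hjump
    have hnn : ∀ e i, 0 ≤ ∫ x in hull e, jump T σ e x i ^ 2 ∂μHE[m] := fun e i =>
      integral_nonneg fun x => sq_nonneg _
    have h1 := (Finset.sum_eq_zero_iff_of_nonneg fun e _ => mul_nonneg
      (inv_nonneg.2 (diam_nonneg e)) (Finset.sum_nonneg fun i _ => hnn e i)).1 hjump e he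
    have h2 := (mul_eq_zero.1 h1).resolve_left (inv_pos.2 hdiam).ne'
    have h3 : ∀ i, ∫ x in hull e, jump T σ e x i ^ 2 ∂μHE[m] = 0 := fun i =>
      (Finset.sum_eq_zero_iff_of_nonneg fun i _ => hnn e i).1 h2 i (Finset.mem_univ i)
    have hmeas : (μHE[m] (hull e)).toReal ≠ 0 := by
      intro h0
      rw [scale, hcard, Nat.add_sub_cancel, h0, zero_div] at hsc
      exact lt_irrefl _ hsc
    by_contra hne
    have h4 : ∀ i, outwardNormal K.1 e i = 0 := by
      intro i
      have h5 := h3 i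
      simp only [hj, setIntegral_const, smul_eq_mul, Measure.real] at h5
      have h6 := (mul_eq_zero.1 h5).resolve_left hmeas
      have h7 := pow_eq_zero_iff two_ne_zero |>.1 h6
      have h8 := (mul_eq_zero.1 h7).resolve_left (by norm_num)
      exact (mul_eq_zero.1 h8).resolve_left (sub_ne_zero.2 hne)
    have h9 : outwardNormal K.1 e = 0 := by
      ext i
      exact h4 i
    rw [h9, norm_zero] at hnorm
    exact zero_ne_one hnorm
  have heq := T.eq_of_forall_interiorFaces hΩ hΩc hadj
  have htr : integralTrace T σ = ∑ K : T.cells, (m + 1 : ℕ) * c K * (volume (hull K.1)).toReal := by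
    refine Finset.sum_congr rfl fun K _ => ?_
    have h1 : ∀ x, (evalM (σ K) x).trace = (m + 1 : ℕ) * c K := by
      intro x
      simp [Matrix.trace, evalM, hσc]
    simp only [h1, setIntegral_const, smul_eq_mul, Measure.real]
    ring
  have hc0 : ∀ K, c K = 0 := by
    intro K
    have h0 := hσ.2.2
    rw [htr] at h0
    simp only [heq _ K] at h0
    rw [← Finset.mul_sum] at h0
    have hpos : 0 < ∑ K : T.cells, (volume (hull K.1)).toReal :=
      Finset.sum_pos (fun K _ => volume_hull_pos T K) ⟨K, Finset.mem_univ K⟩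
    have h1 := (mul_eq_zero.1 h0).resolve_right hpos.ne'
    exact (mul_eq_zero.1 h1).resolve_left (by positivity)
  funext K
  ext1 i j
  rw [hσc, hc0]
  simp

end Definite

/-! ### The inf-sup condition -/

section InfSup

/-- Young's inequality with a free weight, from the nonnegativity of `b` at `(2 * s) • x + y` and
`(2 * s) • x - y`. -/
lemma abs_bilin_le {X : Type*} [AddCommGroup X] [Module ℝ X] (b : X →ₗ[ℝ] X →ₗ[ℝ] ℝ)
    (hs : ∀ x y, b x y = b y x) (h0 : ∀ x, 0 ≤ b x x) {s : ℝ} (hpos : 0 < s) (x y : X) :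
    |b x y| ≤ s * b x x + b y y / (4 * s) := by
  have h1 := h0 ((2 * s) • x + y)
  have h2 := h0 ((2 * s) • x - y)
  simp only [map_add, map_sub, map_smul, LinearMap.add_apply, LinearMap.sub_apply,
    LinearMap.smul_apply, smul_eq_mul, hs y x] at h1 h2
  have h3 : s * b x x + b y y / (4 * s) = (4 * s ^ 2 * b x x + b y y) / (4 * s) := by
    field_simp
  have h4 : |b x y| * (4 * s) = |b x y * (4 * s)| := by
    rw [abs_mul, abs_of_pos (by positivity : 0 < 4 * s)]
  rw [h3, le_div_iff₀ (by positivity), h4]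
  refine abs_le.2 ⟨?_, ?_⟩ <;> linarith

lemma bilin_add_self_le {X : Type*} [AddCommGroup X] [Module ℝ X] (b : X →ₗ[ℝ] X →ₗ[ℝ] ℝ)
    (h0 : ∀ x, 0 ≤ b x x) (x y : X) : b (x + y) (x + y) ≤ 2 * b x x + 2 * b y y := by
  have h1 := h0 (x - y)
  simp only [map_add, map_sub, LinearMap.add_apply, LinearMap.sub_apply] at h1 ⊢
  linarith

lemma sqrt_add_sqrt_le {p q : ℝ} (hp : 0 ≤ p) (hq : 0 ≤ q) :
    Real.sqrt p + Real.sqrt q ≤ Real.sqrt (2 * (p + q)) := by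
  refine Real.le_sqrt_of_sq_le ?_
  nlinarith [Real.sq_sqrt hp, Real.sq_sqrt hq, sq_nonneg (Real.sqrt p - Real.sqrt q)]

/-- Here `μ⁻¹ = max κ⁻¹ 1`. This is what allows the norm of `u`, weighted by `κ̃⁻¹`, to be
controlled uniformly in `κ`. -/
lemma inv_mul_le_of_eq_min {κ μ U : ℝ} (hκ : 0 < κ) (hμ : μ = min κ 1) (hU : 0 ≤ U) :
    U ≤ μ⁻¹ * U ∧ μ⁻¹ * U ≤ κ⁻¹ * U + U := by
  have h := mul_nonneg (inv_pos.2 hκ).le hU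
  rcases min_cases κ 1 with ⟨h1, h2⟩ | ⟨h1, _⟩
  · rw [hμ, h1]
    exact ⟨le_mul_of_one_le_left hU ((one_le_inv₀ hκ).2 h2), by linarith⟩
  · rw [hμ, h1, inv_one]
    exact ⟨by linarith, by linarith⟩

/-- The coercivity estimate behind the inf-sup condition, in terms of the values of the forms. -/
lemma coercivity_of_form_bounds {a j d U Dστ Jστ Vud Cσ Bτ aτ jτ κ μ C₁ C₂ t s c : ℝ}
    (hC₁ : 0 ≤ C₁) (hC₂ : 0 ≤ C₂) (hκ : 0 < κ) (hμ : μ = min κ 1)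
    (ha : 0 ≤ a) (hj : 0 ≤ j) (hd : 0 ≤ d) (hU : 0 ≤ U)
    (ht : t = 1 / (12 * (C₂ + 1))) (hs : s = 1 / (8 * (C₁ + 1)))
    (hc0 : 0 ≤ c) (hct : c ≤ t / 8) (hcs : c ≤ s / 4)
    (hDστ : |Dστ| ≤ 3 * (C₂ + 1) * a + aτ / (4 * (3 * (C₂ + 1))))
    (hJστ : |Jστ| ≤ 3 * (C₂ + 1) * j + jτ / (4 * (3 * (C₂ + 1))))
    (hVud : |Vud| ≤ κ⁻¹ * U + d / (4 * κ⁻¹))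
    (hcp : |Cσ| ≤ 2 * (C₁ + 1) * j + C₁ / (2 * (C₁ + 1)) * d)
    (hτu : 1 / 4 * U ≤ Bτ) (hτD : aτ ≤ C₂ * U) (hτJ : jτ ≤ C₂ * U) :
    c * (a + μ * d + j + μ⁻¹ * U) ≤ 1 / 2 * a + j + κ⁻¹ * U +
      t * (1 / 2 * Dστ + Jστ + Bτ) + s * μ * (d - Cσ) - s * (μ * κ⁻¹ * Vud) := by
  -- Dictionary: `a`, `j`, `d`, `U` are the squared deviator, jump seminorm, divergence and L² norm
  -- of `(σ, u)`; `Dστ` and `Jστ` are the parts of a_h(σ, τ); `Vud` is (u, div_h σ); `Cσ` is the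
  -- coupling of `σ` with its own divergence; `Bτ` is b_h(τ, u).
  have ht0 : 0 < t := by rw [ht]; positivity
  have hs0 : 0 < s := by rw [hs]; positivity
  have ht1 : t ≤ 1 := by rw [ht, div_le_one (by positivity)]; linarith
  have hs1 : s ≤ 1 / 8 := by
    rw [hs]
    exact div_le_div_of_nonneg_left one_pos.le (by norm_num) (by linarith)
  have hμ0 : 0 < μ := hμ ▸ lt_min hκ one_pos
  have hμ1 : μ ≤ 1 := hμ ▸ min_le_right _ _
  have hμκ : μ ≤ κ := hμ ▸ min_le_left _ _
  have hQle := (inv_mul_le_of_eq_min hκ hμ hU).2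
  have hκU : 0 ≤ κ⁻¹ * U := mul_nonneg (inv_pos.2 hκ).le hU
  obtain ⟨Q, hQ⟩ : ∃ Q, Q = μ⁻¹ * U := ⟨_, rfl⟩
  obtain ⟨z, hz⟩ : ∃ z, z = μ * d := ⟨_, rfl⟩
  have hz0 : 0 ≤ z := hz ▸ mul_nonneg hμ0.le hd
  rw [← hQ] at hQle
  rw [← hQ, ← hz]
  have e1 : aτ / (4 * (3 * (C₂ + 1))) ≤ U / 12 := by
    rw [div_le_iff₀ (by positivity)]; nlinarith
  have e2 : jτ / (4 * (3 * (C₂ + 1))) ≤ U / 12 := by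
    rw [div_le_iff₀ (by positivity)]; nlinarith
  have e3 : C₁ / (2 * (C₁ + 1)) * d ≤ 1 / 2 * d := by
    refine mul_le_mul_of_nonneg_right ?_ hd
    rw [div_le_iff₀ (by positivity)]; linarith
  -- The choices of `t` and `s` turn the Young weights into 1/4. The perturbation by `τ` then costs
  -- `a / 8 + j / 4` and the one by the divergence costs `j / 4`, which `1 / 2 * a + j` can afford.
  have e4 : t * (3 * (C₂ + 1)) = 1 / 4 := by rw [ht]; field_simp; norm_num
  have e5 : s * (2 * (C₁ + 1)) = 1 / 4 := by rw [hs]; field_simp; norm_num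
  have f1 : -(3 * (C₂ + 1)) * (1 / 2 * a + j) + 1 / 8 * U ≤
      1 / 2 * Dστ + Jστ + Bτ := by
    have := (abs_le.1 hDστ).1
    have := (abs_le.1 hJστ).1
    linarith
  have f2 : -(1 / 8 * a) - 1 / 4 * j + t / 8 * U ≤ t * (1 / 2 * Dστ + Jστ + Bτ) := by
    have := mul_le_mul_of_nonneg_left f1 ht0.le
    have e : t * (-(3 * (C₂ + 1)) * (1 / 2 * a + j) + 1 / 8 * U) =
      -(t * (3 * (C₂ + 1))) * (1 / 2 * a + j) + t / 8 * U := by ring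
    rw [e, e4] at this
    linarith
  have g1 : 1 / 2 * d - 2 * (C₁ + 1) * j ≤ d - Cσ := by
    have := (abs_le.1 hcp).2
    linarith
  have g2 : 1 / 2 * (s * z) - 1 / 4 * j ≤ s * μ * (d - Cσ) := by
    have h1 := mul_le_mul_of_nonneg_left g1 (by positivity : 0 ≤ s * μ)
    have e : s * μ * (1 / 2 * d - 2 * (C₁ + 1) * j) =
      1 / 2 * (s * z) - μ * ((s * (2 * (C₁ + 1))) * j) := by rw [hz]; ring
    rw [e, e5] at h1
    have h2 : μ * (1 / 4 * j) ≤ 1 * (1 / 4 * j) :=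
      mul_le_mul_of_nonneg_right hμ1 (by positivity)
    linarith
  -- Young's inequality with weight `κ⁻¹` and `μ ≤ κ` bound the mixed term by quantities that are
  -- already present, with constants free of `κ`.
  have k1 : μ * κ⁻¹ * Vud ≤ κ⁻¹ * U + 1 / 4 * z := by
    have h1 := (abs_le.1 hVud).2
    have h2 : μ * κ⁻¹ ≤ 1 := by
      rw [← div_eq_mul_inv]; exact (div_le_one hκ).2 hμκ
    have h3 := mul_le_mul_of_nonneg_left h1 (by positivity : 0 ≤ μ * κ⁻¹)
    have h4 : μ * κ⁻¹ * (κ⁻¹ * U + d / (4 * κ⁻¹)) = μ * κ⁻¹ * (κ⁻¹ * U) + 1 / 4 * z := by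
      rw [hz]; field_simp
    rw [h4] at h3
    have h5 := mul_le_mul_of_nonneg_right h2 hκU
    linarith
  have k2 := mul_le_mul_of_nonneg_left k1 hs0.le
  have k3 : s * (κ⁻¹ * U) ≤ 1 / 8 * (κ⁻¹ * U) := mul_le_mul_of_nonneg_right hs1 hκU
  have l1 : c * a ≤ 1 / 4 * a := mul_le_mul_of_nonneg_right (by linarith) ha
  have l2 : c * j ≤ 1 / 4 * j := mul_le_mul_of_nonneg_right (by linarith) hj
  have l3 : c * z ≤ s / 4 * z := mul_le_mul_of_nonneg_right hcs hz0
  have l4 : c * U ≤ t / 8 * U := mul_le_mul_of_nonneg_right hct hU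
  have l5 : c * (κ⁻¹ * U) ≤ 1 / 2 * (κ⁻¹ * U) := mul_le_mul_of_nonneg_right (by linarith) hκU
  have l6 : c * Q ≤ c * (κ⁻¹ * U) + c * U := by
    rw [← mul_add]; exact mul_le_mul_of_nonneg_left hQle hc0
  linarith

/-- The boundedness estimate behind the inf-sup condition, in terms of the values of the forms. -/
lemma boundedness_of_form_bounds {a j d U aτ jτ dτ aw jw dw Uw κ μ C₂ t s : ℝ}
    (hC₂ : 0 ≤ C₂) (hκ : 0 < κ) (hμ : μ = min κ 1)
    (ha : 0 ≤ a) (hj : 0 ≤ j) (hd : 0 ≤ d) (hU : 0 ≤ U)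
    (haτ : 0 ≤ aτ) (hjτ : 0 ≤ jτ) (hdτ : 0 ≤ dτ)
    (ht0 : 0 ≤ t) (ht1 : t ≤ 1) (hs0 : 0 ≤ s) (hs1 : s ≤ 1)
    (hτD : aτ ≤ C₂ * U) (hτJ : jτ ≤ C₂ * U) (hτV : dτ ≤ C₂ * U)
    (hDadd : aw ≤ 2 * a + 2 * (t * (t * aτ))) (hJadd : jw ≤ 2 * j + 2 * (t * (t * jτ)))
    (hdadd : dw ≤ 2 * d + 2 * (t * (t * dτ)))
    (hUadd : Uw ≤ 2 * U + 2 * (-(s * μ) * (-(s * μ) * d))) :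
    2 * (aw + μ * dw + jw + μ⁻¹ * Uw) ≤
      (8 + 12 * C₂) * (a + μ * d + j + μ⁻¹ * U) := by
  have hμ0 : 0 < μ := hμ ▸ lt_min hκ one_pos
  have hμ1 : μ ≤ 1 := hμ ▸ min_le_right _ _
  have hUQ := (inv_mul_le_of_eq_min hκ hμ hU).1
  obtain ⟨Q, hQ⟩ : ∃ Q, Q = μ⁻¹ * U := ⟨_, rfl⟩
  obtain ⟨z, hz⟩ : ∃ z, z = μ * d := ⟨_, rfl⟩
  have hz0 : 0 ≤ z := hz ▸ mul_nonneg hμ0.le hd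
  rw [← hQ] at hUQ
  rw [← hQ, ← hz]
  -- In the final constant, 8 arises because the divergence of `σ` occurs in both components of the
  -- test pair, and `12 * C₂` collects the three norms of `τ`.
  have htt : t * t ≤ 1 := by nlinarith
  have m1 : t * (t * aτ) ≤ C₂ * U := by
    rw [← mul_assoc]; exact (mul_le_of_le_one_left haτ htt).trans hτD
  have m2 : t * (t * jτ) ≤ C₂ * U := by
    rw [← mul_assoc]; exact (mul_le_of_le_one_left hjτ htt).trans hτJ
  have m3 : t * (t * dτ) ≤ C₂ * U := by
    rw [← mul_assoc]; exact (mul_le_of_le_one_left hdτ htt).trans hτV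
  have m4 : μ * dw ≤ 2 * z + 2 * (C₂ * U) := by
    have h1 := mul_le_mul_of_nonneg_left hdadd hμ0.le
    have h2 : μ * (t * (t * dτ)) ≤ 1 * (t * (t * dτ)) :=
      mul_le_mul_of_nonneg_right hμ1 (by positivity)
    rw [hz]
    linarith
  have m5 : μ⁻¹ * Uw ≤ 2 * Q + 2 * z := by
    have h1 := mul_le_mul_of_nonneg_left hUadd (inv_pos.2 hμ0).le
    have h2 : μ⁻¹ * (2 * U + 2 * (-(s * μ) * (-(s * μ) * d))) = 2 * Q + 2 * (s * s * z) := by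
      rw [hQ, hz]; field_simp
    rw [h2] at h1
    have h3 : s * s * z ≤ z := mul_le_of_le_one_left hz0 (by nlinarith)
    linarith
  have m6 : C₂ * U ≤ C₂ * Q := mul_le_mul_of_nonneg_left hUQ hC₂
  have m7 : 0 ≤ C₂ * a := by positivity
  have m8 : 0 ≤ C₂ * j := by positivity
  have m9 : 0 ≤ C₂ * z := by positivity
  linarith

variable {m k : ℕ} {Ω : Set (E (m + 1))}

lemma innerV_comm (T : Triangulation Ω) (u v : BrokenVec T) : innerV T u v = innerV T v u := by
  simp only [innerV, dotProduct_comm]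

lemma innerDev_comm (T : Triangulation Ω) (σ τ : BrokenTensor T) :
    innerDev T σ τ = innerDev T τ σ := by
  simp only [innerDev, ddot, mul_comm]

lemma jumpForm_comm (T : Triangulation Ω) (σ τ : BrokenTensor T) :
    jumpForm T σ τ = jumpForm T τ σ := by
  simp only [jumpForm, dotProduct_comm]

lemma kappaTilde_pos {κ : ℝ} (hκ : 0 < κ) : 0 < kappaTilde κ := lt_min hκ one_pos

/-- Definiteness matters for the quotient itself: if a nonzero pair had norm zero, all its quotients
would be divisions by zero, hence 0, and no positive lower bound could hold. -/
lemma normProd_pos (hm : 1 ≤ m) (hΩ : IsOpen Ω) (hΩc : IsConnected Ω) {T : Triangulation Ω} {κ : ℝ}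
    (hκ : 0 < κ) {y : Sigmah T k × Vh T k} (hy : y ≠ 0) : 0 < normProd T κ k y := by
  have hk := kappaTilde_pos hκ
  have hD := innerDev_nonneg T (y.1 : BrokenTensor T)
  have hJ := jumpForm_nonneg T (y.1 : BrokenTensor T)
  have hV := innerV_nonneg T (divh T (y.1 : BrokenTensor T))
  have hU := innerV_nonneg T (y.2 : BrokenVec T)
  have hkV := mul_nonneg hk.le hV
  refine lt_of_le_of_ne (add_nonneg (Real.sqrt_nonneg _) (Real.sqrt_nonneg _)) fun h => hy ?_
  have h1 : normSigma T κ y.1 = 0 := le_antisymm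
    (by rw [h]; exact le_add_of_nonneg_right (Real.sqrt_nonneg _)) (Real.sqrt_nonneg _)
  have h2 : normV T κ y.2 = 0 := le_antisymm
    (by rw [h]; exact le_add_of_nonneg_left (Real.sqrt_nonneg _)) (Real.sqrt_nonneg _)
  rw [normSigma, Real.sqrt_eq_zero (by positivity)] at h1
  rw [normV, Real.sqrt_eq_zero (by positivity)] at h2
  have h3 : innerV T (y.2 : BrokenVec T) y.2 = 0 :=
    (mul_eq_zero.1 h2).resolve_left (inv_pos.2 hk).ne'
  have h4 : kappaTilde κ * innerV T (divh T (y.1 : BrokenTensor T)) (divh T y.1) = 0 := by linarith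
  refine Prod.ext (Subtype.ext ?_) (Subtype.ext (eq_zero_of_innerV h3))
  exact eq_zero_of_Sigmah hm hΩ hΩc y.1.2 (by linarith)
    ((mul_eq_zero.1 h4).resolve_left hk.ne') (by linarith)

/-- Finitely many simplices have a bounded union, so if the closure of Ω is unbounded there is no
triangulation and any cube will do. -/
lemma exists_box (Ω : Set (E (m + 1))) : ∃ R : ℝ, 0 < R ∧ ∀ (T : Triangulation Ω) (K : T.cells),
    hull K.1 ⊆ box (m + 1) R := by
  by_cases hb : Bornology.IsBounded (closure Ω)
  · obtain ⟨r, hr, hsub⟩ := hb.subset_closedBall_lt 0 0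
    refine ⟨2 * r + 1, by positivity, fun T K x hx => mem_box (by positivity) ?_⟩
    have := hsub (T.hull_subset_closure K hx)
    rw [mem_closedBall_zero_iff] at this
    linarith
  · refine ⟨1, one_pos, fun T => absurd ?_ hb⟩
    rw [← T.cover]
    exact (Bornology.isBounded_biUnion T.cells.finite_toSet).2 fun K _ =>
      (IsCell.isCompact_hull K).isBounded

/-- The inf-sup condition for `A_h` in any dimension `n ≥ 2`. -/
theorem exists_le_infSup (m : ℕ) (hm : 1 ≤ m) (Ω : Set (E (m + 1))) (hΩ : IsOpen Ω)
    (hΩc : IsConnected Ω) (k : ℕ) (γ : ℝ) :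
    ∃ C : ℝ, 0 < C ∧ ∀ T : Triangulation Ω, T.ShapeRegular γ → ∀ κ : ℝ, 0 < κ →
      (C : EReal) ≤ infSup (Ah T κ k) (normProd T κ k) := by
  obtain ⟨R, hR, hbox⟩ := exists_box Ω
  obtain ⟨C₁, hC₁, hcoup⟩ := exists_coupling_bound m hm k γ
  obtain ⟨C₂, hC₂, hstab⟩ := exists_stable_tensor m hm k γ hR
  obtain ⟨t, ht⟩ : ∃ t, t = 1 / (12 * (C₂ + 1)) := ⟨_, rfl⟩
  obtain ⟨s, hs⟩ : ∃ s, s = 1 / (8 * (C₁ + 1)) := ⟨_, rfl⟩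
  have ht0 : 0 < t := by rw [ht]; positivity
  have hs0 : 0 < s := by rw [hs]; positivity
  have ht1 : t ≤ 1 := by
    rw [ht, div_le_one (by positivity)]; linarith
  have hs1 : s ≤ 1 / 8 := by
    rw [hs]
    exact div_le_div_of_nonneg_left one_pos.le (by norm_num) (by linarith)
  obtain ⟨c, hc⟩ : ∃ c, c = min (t / 8) (s / 4) := ⟨_, rfl⟩
  have hc0 : 0 < c := by rw [hc]; exact lt_min (by positivity) (by positivity)
  have hct : c ≤ t / 8 := hc ▸ min_le_left _ _
  have hcs : c ≤ s / 4 := hc ▸ min_le_right _ _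
  obtain ⟨D, hD⟩ : ∃ D, D = 8 + 12 * C₂ := ⟨_, rfl⟩
  have hD0 : 0 < D := by rw [hD]; positivity
  -- With `S` the sum of the squared norms of the trial pair, the form is at least `c * S`, while
  -- the trial and test norms are at most `√(2 S)` and `√(D S)`.
  refine ⟨c / Real.sqrt (2 * D), by positivity, fun T hT κ hκ => le_iInf fun x => ?_⟩
  obtain ⟨⟨⟨σ, hσ⟩, ⟨u, hu⟩⟩, hx⟩ := x
  obtain ⟨bV, hbV⟩ := exists_bilin_innerV T
  obtain ⟨bD, hbD⟩ := exists_bilin_innerDev T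
  obtain ⟨bJ, hbJ⟩ := exists_bilin_jumpForm T
  obtain ⟨bC, hbC⟩ := exists_bilin_couplingForm T
  have hVs : ∀ v w, bV v w = bV w v := fun v w => by rw [hbV, hbV, innerV_comm]
  have hDs : ∀ v w, bD v w = bD w v := fun v w => by rw [hbD, hbD, innerDev_comm]
  have hJs : ∀ v w, bJ v w = bJ w v := fun v w => by rw [hbJ, hbJ, jumpForm_comm]
  have hV0 : ∀ v, 0 ≤ bV v v := fun v => by rw [hbV]; exact innerV_nonneg T v
  have hD0' : ∀ v, 0 ≤ bD v v := fun v => by rw [hbD]; exact innerDev_nonneg T v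
  have hJ0 : ∀ v, 0 ≤ bJ v v := fun v => by rw [hbJ]; exact jumpForm_nonneg T v
  have hdv : ∀ v, divh T v = divL T v := fun v => rfl
  -- Degree `k + 1` for tensors and `k` for vectors make the divergence an admissible perturbation
  -- of `u`.
  have hdivk : divL T σ ∈ Vh T k := fun K i =>
    Submodule.sum_mem _ fun j _ => pderiv_mem_polyLE _ (hσ.2.1 K i j)
  obtain ⟨τ, hτ, hτu, hτD, hτV, hτJ⟩ := hstab T (hbox T) hT u hu
  obtain ⟨μ, hμ⟩ : ∃ μ, μ = kappaTilde κ := ⟨_, rfl⟩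
  have hμ0 : 0 < μ := hμ ▸ kappaTilde_pos hκ
  have hμ1 : μ ≤ 1 := hμ ▸ min_le_right _ _
  have hμκ : μ ≤ κ := hμ ▸ min_le_left _ _
  have hcp := hcoup T hT σ _ hdivk (2 * (C₁ + 1)) (by positivity)
  rw [bh] at hτu
  simp only [hdv] at hτu hτV
  rw [← hbC, ← hbJ, ← hbV] at hcp
  rw [← hbV, ← hbV, ← hbC] at hτu
  rw [← hbV, ← hbV] at hτV
  rw [← hbD, ← hbV] at hτD
  rw [← hbJ, ← hbV] at hτJ
  have hDστ := abs_bilin_le bD hDs hD0' (by positivity : 0 < 3 * (C₂ + 1)) σ τ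
  have hJστ := abs_bilin_le bJ hJs hJ0 (by positivity : 0 < 3 * (C₂ + 1)) σ τ
  have hVud := abs_bilin_le bV hVs hV0 (inv_pos.2 hκ) u (divL T σ)
  have hDadd := bilin_add_self_le bD hD0' σ (t • τ)
  have hJadd := bilin_add_self_le bJ hJ0 σ (t • τ)
  have hdadd := bilin_add_self_le bV hV0 (divL T σ) (t • divL T τ)
  have hUadd := bilin_add_self_le bV hV0 u (-(s * μ) • divL T σ)
  -- The minus sign in the second component makes the term −b_h(σ, v) of the form contribute `+ s μ`
  -- times the squared divergence.
  obtain ⟨w, hw⟩ : ∃ w : Sigmah T k × Vh T k, w =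
      (⟨σ + t • τ, Submodule.add_mem _ hσ (Submodule.smul_mem _ t hτ)⟩,
       ⟨u + -(s * μ) • divL T σ, Submodule.add_mem _ hu (Submodule.smul_mem _ _ hdivk)⟩) :=
    ⟨_, rfl⟩
  have hAw : Ah T κ k (⟨σ, hσ⟩, ⟨u, hu⟩) w = 1 / 2 * bD σ σ + bJ σ σ + κ⁻¹ * bV u u +
      t * (1 / 2 * bD σ τ + bJ σ τ + (bV (divL T τ) u - bC τ u)) +
      s * μ * (bV (divL T σ) (divL T σ) - bC σ (divL T σ)) -
      s * (μ * κ⁻¹ * bV u (divL T σ)) := by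
    simp only [Ah, ah, bh, sForm, hw, hdv, ← hbV, ← hbD, ← hbJ, ← hbC, map_add, map_smul,
      LinearMap.add_apply, LinearMap.smul_apply, smul_eq_mul]
    ring
  have hNx : normProd T κ k (⟨σ, hσ⟩, ⟨u, hu⟩) =
      Real.sqrt (bD σ σ + μ * bV (divL T σ) (divL T σ) + bJ σ σ) +
        Real.sqrt (μ⁻¹ * bV u u) := by
    simp only [normProd, normSigma, normV, hdv, ← hbV, ← hbD, ← hbJ, hμ]
  have hNw : normProd T κ k w = Real.sqrt (bD (σ + t • τ) (σ + t • τ) +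
      μ * bV (divL T σ + t • divL T τ) (divL T σ + t • divL T τ) +
      bJ (σ + t • τ) (σ + t • τ)) + Real.sqrt (μ⁻¹ *
        bV (u + -(s * μ) • divL T σ) (u + -(s * μ) • divL T σ)) := by
    simp only [normProd, normSigma, normV, hw, hdv, ← hbV, ← hbD, ← hbJ, hμ, map_add, map_smul]
  have hxpos := normProd_pos hm hΩ hΩc hκ hx
  simp only [map_smul, LinearMap.smul_apply, smul_eq_mul] at hDadd hJadd hdadd hUadd
  have ha := hD0' σ
  have hj := hJ0 σ
  have hd := hV0 (divL T σ)
  have hU := hV0 u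
  have hDw0 := hD0' (σ + t • τ)
  have hJw0 := hJ0 (σ + t • τ)
  have hdw0 := hV0 (divL T σ + t • divL T τ)
  have hUw0 := hV0 (u + -(s * μ) • divL T σ)
  have hDτ0 := hD0' τ
  have hJτ0 := hJ0 τ
  have hdτ0 := hV0 (divL T τ)
  obtain ⟨S, hS⟩ : ∃ S, S = bD σ σ + μ * bV (divL T σ) (divL T σ) + bJ σ σ + μ⁻¹ * bV u u :=
    ⟨_, rfl⟩
  have hS0 : 0 ≤ S := by rw [hS]; positivity
  have hlow : c * S ≤ Ah T κ k (⟨σ, hσ⟩, ⟨u, hu⟩) w := by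
    rw [hAw, hS]
    exact coercivity_of_form_bounds hC₁ hC₂ hκ hμ ha hj hd hU ht hs hc0.le hct hcs
      hDστ hJστ hVud hcp hτu hτD hτJ
  have hS1 : normProd T κ k (⟨σ, hσ⟩, ⟨u, hu⟩) ≤ Real.sqrt (2 * S) := by
    rw [hNx, hS]
    exact sqrt_add_sqrt_le (by positivity) (by positivity)
  have hSpos : 0 < S := by
    have := hxpos.trans_le hS1
    rw [Real.sqrt_pos] at this
    linarith
  have hS2 : normProd T κ k w ≤ Real.sqrt (D * S) := by
    rw [hNw, hD, hS]
    refine (sqrt_add_sqrt_le (by positivity) (by positivity)).trans (Real.sqrt_le_sqrt ?_)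
    exact boundedness_of_form_bounds hC₂ hκ hμ ha hj hd hU hDτ0 hJτ0 hdτ0 ht0.le ht1 hs0.le
      (hs1.trans (by norm_num)) hτD hτJ hτV hDadd hJadd hdadd hUadd
  have hApos : 0 < Ah T κ k (⟨σ, hσ⟩, ⟨u, hu⟩) w := (mul_pos hc0 hSpos).trans_le hlow
  -- The supremum runs over nonzero test pairs; positivity of the form rules out `w = 0`.
  have hwne : w ≠ 0 := by
    intro h
    rw [h] at hApos
    have h0 : Ah T κ k (⟨σ, hσ⟩, ⟨u, hu⟩) 0 = 0 := by
      have e1 : ((0 : Sigmah T k × Vh T k).1 : BrokenTensor T) = 0 := rfl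
      have e2 : ((0 : Sigmah T k × Vh T k).2 : BrokenVec T) = 0 := rfl
      simp only [Ah, ah, bh, sForm, hdv, ← hbV, ← hbD, ← hbJ, ← hbC, e1, e2, map_zero,
        LinearMap.zero_apply]
      ring
    exact lt_irrefl _ (h0 ▸ hApos)
  have hwpos := normProd_pos hm hΩ hΩc hκ hwne
  refine le_trans ?_ (le_iSup (fun y : {y : Sigmah T k × Vh T k // y ≠ 0} =>
    ((Ah T κ k (⟨σ, hσ⟩, ⟨u, hu⟩) y.1 / (normProd T κ k (⟨σ, hσ⟩, ⟨u, hu⟩) *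
      normProd T κ k y.1) : ℝ) : EReal)) ⟨w, hwne⟩)
  refine EReal.coe_le_coe_iff.2 ?_
  rw [div_le_div_iff₀ (by positivity) (mul_pos hxpos hwpos)]
  have hprod : normProd T κ k (⟨σ, hσ⟩, ⟨u, hu⟩) * normProd T κ k w ≤ Real.sqrt (2 * D) * S := by
    calc _ ≤ Real.sqrt (2 * S) * Real.sqrt (D * S) :=
          mul_le_mul hS1 hS2 hwpos.le (Real.sqrt_nonneg _)
      _ = Real.sqrt (2 * D) * S := by
        rw [← Real.sqrt_mul (by positivity), show 2 * S * (D * S) = 2 * D * S ^ 2 by ring,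
          Real.sqrt_mul (by positivity), Real.sqrt_sq hS0]
  calc _ ≤ c * (Real.sqrt (2 * D) * S) := mul_le_mul_of_nonneg_left hprod hc0.le
    _ = (c * S) * Real.sqrt (2 * D) := by ring
    _ ≤ _ := mul_le_mul_of_nonneg_right hlow (Real.sqrt_nonneg _)

end InfSup

end MDG

end

theorem mainTheorem1 (n : ℕ) (hn : n = 2 ∨ n = 3) (Ω : Set (MDG.E n)) (hΩ : IsOpen Ω)
    (hΩc : IsConnected Ω) (k : ℕ) (γ : ℝ) :
    ∃ C : ℝ, 0 < C ∧ ∀ T : MDG.Triangulation Ω, T.ShapeRegular γ → ∀ κ : ℝ, 0 < κ →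
      (C : EReal) ≤ MDG.infSup (MDG.Ah T κ k) (MDG.normProd T κ k) := by
  rcases hn with rfl | rfl
  · exact MDG.exists_le_infSup 1 le_rfl Ω hΩ hΩc k γ
  · exact MDG.exists_le_infSup 2 one_le_two Ω hΩ hΩc k γ
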